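/- Fix constants $\theta,\mathsf N>0$, real $\mathbf l,\mathbf r$, an open set $\Lambda\subset\mathbb C$ containing $[\mathbf l,\mathbf r]$, a constant $C>0$, and a constant $c(S)>0$ for every compact $S\subset\Lambda\setminus[\mathbf l,\mathbf r]$. For $n\ge 1$ put $\varepsilon=\mathsf N/n$. Let $x=(x_1,\dots,x_n)$ satisfy $x_1\in\mathbb Z$, $x_i-x_{i+1}\in\theta+\mathbb Z_{\ge0}$, $\mathbf l\le\varepsilon x_n$, $\varepsilon x_1\le\mathbf r-\varepsilon$ and $\varepsilon x_1+\varepsilon\theta\le\mathbf r$. Let $\mathsf b,\varphi^+,\varphi^-$ be holomorphic on $\Lambda$, with $\mathsf b$ injective, $|\mathsf b|\le C$, $|\mathsf b'|\ge 1/C$, $|\varphi^\pm|\le C$ on $\Lambda$, with $\mathsf b(\bar z)=\overline{\mathsf b(z)}$, $\varphi^\pm(\bar z)=\overline{\varphi^\pm(z)}$, and with $\varphi^\pm>0$ on $(\mathbf l,\mathbf r)$. (All of $x,\mathsf b,\varphi^\pm$ may depend on $n$.) Let $e\in\{0,1\}^n$ be random with $$\mathbb P(e)=\frac1{Z(x)}\prod_{1\le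 i<j\le n}\frac{\mathsf b(\varepsilon x_i+\varepsilon\theta e_i)-\mathsf b(\varepsilon x_j+\varepsilon\theta e_j)}{\mathsf b(\varepsilon x_i)-\mathsf b(\varepsilon x_j)}\prod_{i=1}^n\varphi^+(\varepsilon x_i)^{e_i}\varphi^-(\varepsilon x_i)^{1-e_i},$$ where it is assumed that the normalization $Z(x)\neq0$ exists, and let $y=x+e$. Put $\rho(s;x)=\frac1\theta\sum_{i}\mathbf 1(\varepsilon x_i\le s\le\varepsilon x_i+\varepsilon\theta)$, and $$\mathcal G(z)=\exp\Big[\theta\int_{\mathbf l}^{\mathbf r}\frac{\mathsf b'(z)\rho(s;x)}{\mathsf b(z)-\mathsf b(s)}ds\Big],\qquad \mathcal B(z)=\mathcal G(z)\varphi^+(z)+\varphi^-(z),\qquad z\in\Lambda\setminus[\mathbf l,\mathbf r].$$ Assume that $c(S)<|\mathcal B(z)|<c(S)^{-1}$ for every compact $S\subset\Lambda\setminus[\mathbf l,\mathbf r]$ and every $z\in S$, and that $\frac1{2\pi\mathrm i}\oint_\omega\frac{\mathcal B'(z)}{\mathcal B(z)}dz=0$ for every closed contour $\omega\subset\Lambda\setminus[\mathbf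 l,\mathbf r]$, so that a single-valued branch of $\ln\mathcal B$ exists on $\Lambda\setminus[\mathbf l,\mathbf r]$; the formulas below hold for any such branch. All contours below are positively oriented, lie in $\Lambda\setminus[\mathbf l,\mathbf r]$, enclose $[\mathbf l,\mathbf r]$ once, and have their inside contained in $\Lambda$. Define $\Delta\mathcal M(z)=X(z)-\mathbb E[X(z)]$, where $X(z)=\frac1\varepsilon\int_{\mathbb R}\frac{\mathsf b'(z)(\rho(s;y)-\rho(s;x))}{\mathsf b(z)-\mathsf b(s)}ds$; these are random variables of mean $0$. Then as $\varepsilon\to0$, for $z\in\Lambda\setminus[\mathbf l,\mathbf r]$, $$X(z)=\frac1{2\pi\mathrm i\theta}\oint_{\omega}\frac{\ln\mathcal B(w)\,\mathsf b'(w)\mathsf b'(z)}{(\mathsf b(w)-\mathsf b(z))^2}dw+\frac{\varepsilon}{2\pi\mathrm i\theta}\oint_{\omega}\mathcal E^{(2)}(w,z)\frac{\mathsf b'(w)\mathsf b'(z)}{(\mathsf b(w)-\mathsf b(z))^2}dw+\Delta\mathcal M(z)+O(\varepsilon^2),$$ where $\omega$ does not enclose $z$, and $$\mathcal E^{(2)}(w,z)=\frac{\varphi^+(w)\mathcal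 G(w)}{\mathcal B(w)}\Big(\frac{\theta\mathsf b'(w)}{\mathsf b(z)-\mathsf b(w)}+\frac{\theta}{2\pi\mathrm i}\oint_{\omega'}\frac{\ln\mathcal B(u)\mathsf b'(w)\mathsf b'(u)}{(\mathsf b(u)-\mathsf b(w))^2}du+\frac{\theta^2}2\int_{\mathbf l}^{\mathbf r}\frac{\mathsf b''(w)(\mathsf b(w)-\mathsf b(s))-\mathsf b'(w)^2-\mathsf b'(w)\mathsf b'(s)}{(\mathsf b(w)-\mathsf b(s))^2}\rho(s;x)ds\Big)-\frac{\mathcal B'(w)}{2\mathcal B(w)},$$ with $\omega'$ not enclosing $w$. Moreover $\{\varepsilon^{-1/2}\Delta\mathcal M(z)\}$ is asymptotically a centred Gaussian field in the sense of moments: $$\mathbb E\Big[\frac{\Delta\mathcal M(z_1)}{\varepsilon^{1/2}}\frac{\Delta\mathcal M(z_2)}{\varepsilon^{1/2}}\Big]=\mathcal K(z_1,z_2)+o(1),\qquad \mathcal K(z_1,z_2)=\frac1{2\pi\mathrm i\theta}\oint_\omega\frac{\mathcal G(w)\varphi^+(w)}{\mathcal B(w)}\frac{\mathsf b'(w)\mathsf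 b'(z_1)}{(\mathsf b(w)-\mathsf b(z_1))^2}\frac{\mathsf b'(w)\mathsf b'(z_2)}{(\mathsf b(w)-\mathsf b(z_2))^2}dw,$$ with $\omega$ not enclosing $z_1,z_2$, and for every $p$ the joint moment $\mathbb E\big[\prod_{k=1}^p\varepsilon^{-1/2}\Delta\mathcal M(z_k)\big]$ equals, up to $o(1)$, the sum over all pairings of $\{1,\dots,p\}$ of the products of the covariances $\mathcal K(z_i,z_j)$ over the pairs $\{i,j\}$. The constants and rates in $O(\varepsilon^2)$ and in the $o(1)$ terms are uniform over $e$, over all $x,\mathsf b,\varphi^\pm$ as above and over $z,z_1,z_2,\dots$ in a compact $F\subset\Lambda\setminus[\mathbf l,\mathbf r]$; they depend only on $\theta,\mathsf N,\mathbf l,\mathbf r,\Lambda,C,c(\cdot),F$ (and on $p$). -/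

import Mathlib

open scoped BigOperators

noncomputable section

namespace DynLoop

/-! ### Contours in the complex plane -/

/-- A closed piecewise continuously differentiable curve `γ : [0,1] → ℂ`. -/
def IsLoop (γ : ℝ → ℂ) : Prop :=
  ContinuousOn γ (Set.Icc 0 1) ∧ γ 0 = γ 1 ∧
    ∃ P : Finset ℝ, ∀ s t : ℝ, 0 ≤ s → s < t → t ≤ 1 → (∀ p ∈ P, p ∉ Set.Ioo s t) →
      ContDiffOn ℝ 1 γ (Set.Icc s t)

/-- The set of points of the curve. -/
def trace (γ : ℝ → ℂ) : Set ℂ := γ '' Set.Icc 0 1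

/-- The contour integral `∮_γ f(w) dw`. -/
def contourInt (γ : ℝ → ℂ) (f : ℂ → ℂ) : ℂ :=
  ∫ t in (0 : ℝ)..1, f (γ t) * deriv γ t

/-- The winding number of `γ` around `a` (a point off the curve). -/
def winding (γ : ℝ → ℂ) (a : ℂ) : ℂ :=
  (2 * Real.pi * Complex.I)⁻¹ * contourInt γ (fun w => (w - a)⁻¹)

/-- The real segment `[l, r]` as a subset of `ℂ`. -/
def seg (l r : ℝ) : Set ℂ := (fun t : ℝ => (t : ℂ)) '' Set.Icc l r

/-- `γ` is a positively oriented contour in `Λ` which encloses `[l, r]` but no point of `E`: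
it runs in `Λ`, off `[l, r]` and `E`, winds once around every point of `[l, r]`, and does not wind
around the points of `E`, nor around the points outside `Λ` (its inside lies in `Λ`). -/
structure Encloses (Λ : Set ℂ) (l r : ℝ) (E : Set ℂ) (γ : ℝ → ℂ) : Prop where
  isLoop : IsLoop γ
  trace_subset : trace γ ⊆ Λ \ seg l r
  disjoint : Disjoint (trace γ) E
  winding_seg : ∀ a ∈ seg l r, winding γ a = 1
  winding_excluded : ∀ a ∈ E, winding γ a = 0
  winding_outside : ∀ a, a ∉ Λ → winding γ a = 0

/-! ### Particle configurations and the transition probability -/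

/-- The `θ`-shifted lattice: `x₁ ∈ ℤ` and `xᵢ - xᵢ₊₁ ∈ θ + ℤ_{≥ 0}` (indices start at `0` here). -/
def IsShiftedConfig (θ : ℝ) {n : ℕ} (x : Fin n → ℝ) : Prop :=
  (∀ h : 0 < n, ∃ m : ℤ, x ⟨0, h⟩ = m) ∧
    ∀ (i : ℕ) (h : i + 1 < n), ∃ k : ℕ, x ⟨i, Nat.lt_of_succ_lt h⟩ - x ⟨i + 1, h⟩ = θ + k

/-- The configuration `y = x + e`. -/
def jump {n : ℕ} (x : Fin n → ℝ) (e : Fin n → Fin 2) : Fin n → ℝ :=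
  fun i => x i + ((e i : ℕ) : ℝ)

/-- The unnormalized weight of the jump `e ∈ {0,1}ⁿ` from `x`:
`∏_{i<j} (b(xᵢ + θeᵢ) - b(xⱼ + θeⱼ)) / (b(xᵢ) - b(xⱼ)) · ∏ᵢ φ⁺(xᵢ)^{eᵢ} φ⁻(xᵢ)^{1-eᵢ}`. -/
def weight (θ : ℝ) (b φp φm : ℂ → ℂ) {n : ℕ} (x : Fin n → ℝ) (e : Fin n → Fin 2) : ℂ :=
  (∏ i, ∏ j ∈ Finset.Ioi i,
      (b (x i + θ * (e i : ℕ)) - b (x j + θ * (e j : ℕ))) / (b (x i) - b (x j))) *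
    ∏ i, φp (x i) ^ (e i : ℕ) * φm (x i) ^ (1 - (e i : ℕ))

/-- The normalization constant `Z(x)`. -/
def partitionZ (θ : ℝ) (b φp φm : ℂ → ℂ) {n : ℕ} (x : Fin n → ℝ) : ℂ :=
  ∑ e : Fin n → Fin 2, weight θ b φp φm x e

/-- The transition probability `a_e = ℙ(x + e | x)`. -/
def transProb (θ : ℝ) (b φp φm : ℂ → ℂ) {n : ℕ} (x : Fin n → ℝ) (e : Fin n → Fin 2) : ℂ :=
  weight θ b φp φm x e / partitionZ θ b φp φm x

/-- The transition probability for functions `b, φ⁺, φ⁻` given in the macroscopic variable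
`z = ε ξ`, that is, `b(ξ) = bs(εξ)` and `φ^±(ξ) = φs^±(εξ)`. -/
def prob (θ ε : ℝ) (b φp φm : ℂ → ℂ) {n : ℕ} (x : Fin n → ℝ) (e : Fin n → Fin 2) : ℂ :=
  transProb θ (fun ξ => b (ε * ξ)) (fun ξ => φp (ε * ξ)) (fun ξ => φm (ε * ξ)) x e

/-- Expectation of a function of `e` with respect to the transition probability. -/
def expect (θ ε : ℝ) (b φp φm : ℂ → ℂ) {n : ℕ} (x : Fin n → ℝ)
    (f : (Fin n → Fin 2) → ℂ) : ℂ :=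
  ∑ e : Fin n → Fin 2, prob θ ε b φp φm x e * f e

/-- The smoothed empirical density `ρ(s; x) = θ⁻¹ ∑ᵢ 1(εxᵢ ≤ s ≤ εxᵢ + εθ)`. -/
def rho (θ ε : ℝ) {n : ℕ} (x : Fin n → ℝ) (s : ℝ) : ℝ :=
  θ⁻¹ * ∑ i, (Set.Icc (ε * x i) (ε * x i + ε * θ)).indicator (fun _ => (1 : ℝ)) s

/-- `𝒢(z) = exp (θ ∫_l^r b'(z) ρ(s; x) / (b(z) - b(s)) ds)`. -/
def G (θ ε l r : ℝ) (b : ℂ → ℂ) {n : ℕ} (x : Fin n → ℝ) (z : ℂ) : ℂ :=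
  Complex.exp (θ * ∫ s in l..r, deriv b z * (rho θ ε x s : ℂ) / (b z - b s))

/-- `𝓑(z) = 𝒢(z) φ⁺(z) + φ⁻(z)`. -/
def B (θ ε l r : ℝ) (b φp φm : ℂ → ℂ) {n : ℕ} (x : Fin n → ℝ) (z : ℂ) : ℂ :=
  G θ ε l r b x z * φp z + φm z

/-! ### Assumptions -/

/-- The asymptotic assumption, with `ε = N / n`. The condition `ε xᵢ + ε θ ≤ r` says that
`ρ(·; x)` is supported in `[l, r]`; for `θ ≤ 1` it follows from `ε xᵢ ≤ r - ε`. -/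
structure AsympAssumption (θ N l r C : ℝ) (Λ : Set ℂ) (n : ℕ) (x : Fin n → ℝ)
    (b φp φm : ℂ → ℂ) : Prop where
  n_pos : 0 < n
  config : IsShiftedConfig θ x
  lower : ∀ i, l ≤ N / n * x i
  upper : ∀ i, N / n * x i ≤ r - N / n
  support : ∀ i, N / n * x i + N / n * θ ≤ r
  b_holo : DifferentiableOn ℂ b Λ
  b_inj : Set.InjOn b Λ
  b_real : ∀ z ∈ Λ, b (starRingEnd ℂ z) = starRingEnd ℂ (b z)
  φp_holo : DifferentiableOn ℂ φp Λ
  φm_holo : DifferentiableOn ℂ φm Λ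
  b_bound : ∀ z ∈ Λ, ‖b z‖ ≤ C
  deriv_b_bound : ∀ z ∈ Λ, 1 / C ≤ ‖deriv b z‖
  φp_bound : ∀ z ∈ Λ, ‖φp z‖ ≤ C
  φm_bound : ∀ z ∈ Λ, ‖φm z‖ ≤ C

/-- A function is real on the real line (conjugation-symmetric) and positive on `(l, r)`. -/
def RealPositive (Λ : Set ℂ) (l r : ℝ) (φ : ℂ → ℂ) : Prop :=
  (∀ z ∈ Λ, φ (starRingEnd ℂ z) = starRingEnd ℂ (φ z)) ∧
    ∀ t ∈ Set.Ioo l r, 0 < (φ t).re ∧ (φ t).im = 0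

/-- The non-criticality assumption: on every compact `S ⊆ Λ \ [l, r]` one has
`c(S) < |𝓑| < c(S)⁻¹`, and `(2πi)⁻¹ ∮ 𝓑'/𝓑 = 0` along every closed contour in `Λ \ [l, r]`. -/
structure StableAssumption (θ N l r : ℝ) (Λ : Set ℂ) (c : Set ℂ → ℝ) (n : ℕ) (x : Fin n → ℝ)
    (b φp φm : ℂ → ℂ) : Prop where
  bounds : ∀ S : Set ℂ, IsCompact S → S ⊆ Λ \ seg l r → ∀ z ∈ S,
    c S < ‖B θ (N / n) l r b φp φm x z‖ ∧ ‖B θ (N / n) l r b φp φm x z‖ < (c S)⁻¹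
  no_winding : ∀ γ : ℝ → ℂ, IsLoop γ → trace γ ⊆ Λ \ seg l r →
    (2 * Real.pi * Complex.I)⁻¹ * contourInt γ (fun w =>
      deriv (B θ (N / n) l r b φp φm x) w / B θ (N / n) l r b φp φm x w) = 0

/-- All the hypotheses on the data `(n, x, b, φ⁺, φ⁻)` of one step, in the probabilistic case,
with the given constants. The last field says that the normalization constant exists. -/
structure Admissible (θ N l r C : ℝ) (Λ : Set ℂ) (c : Set ℂ → ℝ) (n : ℕ) (x : Fin n → ℝ)
    (b φp φm : ℂ → ℂ) : Prop where
  asymp : AsympAssumption θ N l r C Λ n x b φp φm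
  φp_pos : RealPositive Λ l r φp
  φm_pos : RealPositive Λ l r φm
  stable : StableAssumption θ N l r Λ c n x b φp φm
  normalizable : partitionZ θ (fun ξ => b ((N / n : ℝ) * ξ)) (fun ξ => φp ((N / n : ℝ) * ξ))
    (fun ξ => φm ((N / n : ℝ) * ξ)) x ≠ 0

/-! ### The terms of the expansion -/

/-- `L` is a single-valued holomorphic branch of `ln f` on `U`. -/
def IsLogBranch (U : Set ℂ) (f L : ℂ → ℂ) : Prop :=
  DifferentiableOn ℂ L U ∧ ∀ z ∈ U, Complex.exp (L z) = f z

/-- The kernel `b'(w) b'(z) / (b(w) - b(z))²`. -/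
def ker (b : ℂ → ℂ) (w z : ℂ) : ℂ := deriv b w * deriv b z / (b w - b z) ^ 2

/-- `ε⁻¹ ∫ b'(z) (ρ(s; x + e) - ρ(s; x)) / (b(z) - b(s)) ds`. The integral extends over the whole
support of the two densities (`ρ(·; x + e)` may reach beyond `r`, by at most `ε`). -/
def increment (θ ε : ℝ) (b : ℂ → ℂ) {n : ℕ} (x : Fin n → ℝ) (e : Fin n → Fin 2) (z : ℂ) : ℂ :=
  (ε : ℂ)⁻¹ * ∫ s : ℝ, deriv b z * ((rho θ ε (jump x e) s - rho θ ε x s : ℝ) : ℂ) / (b z - b s)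

/-- The random field `Δℳ(z)`: the centred increment
`ε⁻¹ ∫ b'(z) (ρ(s; x + e) - 𝔼 ρ(s; x + e)) / (b(z) - b(s)) ds`. -/
def deltaM (θ ε : ℝ) (b φp φm : ℂ → ℂ) {n : ℕ} (x : Fin n → ℝ) (e : Fin n → Fin 2) (z : ℂ) : ℂ :=
  increment θ ε b x e z - expect θ ε b φp φm x (fun e' => increment θ ε b x e' z)

/-- The leading term `(2πiθ)⁻¹ ∮_ω ln 𝓑(w) b'(w) b'(z) / (b(w) - b(z))² dw`; here `L = ln 𝓑`. -/
def leading (θ : ℝ) (b L : ℂ → ℂ) (ω : ℝ → ℂ) (z : ℂ) : ℂ :=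
  (2 * Real.pi * Complex.I * θ)⁻¹ * contourInt ω (fun w => L w * ker b w z)

/-- The function `ℰ⁽²⁾(w, z)`; here `L = ln 𝓑` and `ω'` is the contour of the inner integral. -/
def E2 (θ ε l r : ℝ) (b φp φm : ℂ → ℂ) {n : ℕ} (x : Fin n → ℝ) (L : ℂ → ℂ) (ω' : ℝ → ℂ)
    (w z : ℂ) : ℂ :=
  φp w * G θ ε l r b x w / B θ ε l r b φp φm x w *
      (θ * deriv b w / (b z - b w)
        + θ / (2 * Real.pi * Complex.I) * contourInt ω' (fun u => L u * ker b u w)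
        + (θ : ℂ) ^ 2 / 2 * ∫ s in l..r,
            (deriv (deriv b) w * (b w - b s) - deriv b w ^ 2 - deriv b w * deriv b s)
              / (b w - b s) ^ 2 * (rho θ ε x s : ℂ))
    - deriv (B θ ε l r b φp φm x) w / (2 * B θ ε l r b φp φm x w)

/-- The correction `ε (2πiθ)⁻¹ ∮_ω ℰ⁽²⁾(w, z) b'(w) b'(z) / (b(w) - b(z))² dw`. The contour
`ω' w` of the inner integral may depend on `w`. -/
def correction (θ ε l r : ℝ) (b φp φm : ℂ → ℂ) {n : ℕ} (x : Fin n → ℝ) (L : ℂ → ℂ)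
    (ω : ℝ → ℂ) (ω' : ℂ → ℝ → ℂ) (z : ℂ) : ℂ :=
  ε * (2 * Real.pi * Complex.I * θ)⁻¹ *
    contourInt ω (fun w => E2 θ ε l r b φp φm x L (ω' w) w z * ker b w z)

/-- The limiting covariance
`(2πiθ)⁻¹ ∮_ω 𝒢(w) φ⁺(w) / 𝓑(w) · b'(w)b'(z₁)/(b(w)-b(z₁))² · b'(w)b'(z₂)/(b(w)-b(z₂))² dw`. -/
def cov (θ ε l r : ℝ) (b φp φm : ℂ → ℂ) {n : ℕ} (x : Fin n → ℝ) (ω : ℝ → ℂ) (z₁ z₂ : ℂ) : ℂ :=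
  (2 * Real.pi * Complex.I * θ)⁻¹ * contourInt ω (fun w =>
    G θ ε l r b x w * φp w / B θ ε l r b φp φm x w * ker b w z₁ * ker b w z₂)

/-- The joint moment `𝔼[ξ₁ ⋯ ξ_p]` of a centred Gaussian vector with `𝔼[ξᵢ ξⱼ] = K i j`: the sum
over the pairings of the index set (fixed-point-free involutions) of the products of covariances. -/
def gaussianMoment {p : ℕ} (K : Fin p → Fin p → ℂ) : ℂ :=
  ∑ σ ∈ (Finset.univ : Finset (Equiv.Perm (Fin p))).filter (fun σ => ∀ i, σ (σ i) = i ∧ σ i ≠ i),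
    ∏ i ∈ Finset.univ.filter (fun i => i < σ i), K i (σ i)

end DynLoop

end

open scoped BigOperators Topology Interval
open Set MeasureTheory Filter

namespace DynLoop

section

/-- A piecewise continuously differentiable curve `[0,1] → ℂ`. -/
def PwC1 (γ : ℝ → ℂ) : Prop :=
  ContinuousOn γ (Icc 0 1) ∧
    ∃ P : Finset ℝ, ∀ s t : ℝ, 0 ≤ s → s < t → t ≤ 1 → (∀ p ∈ P, p ∉ Ioo s t) →
      ContDiffOn ℝ 1 γ (Icc s t)

theorem IsLoop.pwC1 {γ : ℝ → ℂ} (h : IsLoop γ) : PwC1 γ := ⟨h.1, h.2.2⟩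

theorem PwC1.isLoop {γ : ℝ → ℂ} (h : PwC1 γ) (h' : γ 0 = γ 1) : IsLoop γ := ⟨h.1, h', h.2⟩

theorem intervalIntegrable_deriv_of_contDiffOn {γ : ℝ → ℂ} {s t : ℝ} (hst : s ≤ t)
    (h : ContDiffOn ℝ 1 γ (Icc s t)) : IntervalIntegrable (deriv γ) volume s t := by
  rcases hst.eq_or_lt with rfl | hlt
  · simp
  have h1 : IntervalIntegrable (derivWithin γ (Icc s t)) volume s t := by
    apply ContinuousOn.intervalIntegrable
    rw [uIcc_of_le hst]
    exact h.continuousOn_derivWithin (uniqueDiffOn_Icc hlt) le_rfl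
  rw [intervalIntegrable_iff_integrableOn_Ioo_of_le hst] at h1 ⊢
  refine h1.congr_fun (fun x hx => ?_) measurableSet_Ioo
  exact derivWithin_of_mem_nhds (Icc_mem_nhds hx.1 hx.2)

theorem PwC1.intervalIntegrable_deriv {γ : ℝ → ℂ} (h : PwC1 γ) :
    IntervalIntegrable (deriv γ) volume 0 1 := by
  obtain ⟨-, P, hP⟩ := h
  have key : ∀ k : ℕ, ∀ s t : ℝ, 0 ≤ s → s ≤ t → t ≤ 1 →
      (P.filter (fun p => p ∈ Ioo s t)).card = k → IntervalIntegrable (deriv γ) volume s t := by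
    intro k
    induction k using Nat.strong_induction_on with
    | _ k ih =>
      intro s t hs hst ht hk
      rcases hst.eq_or_lt with rfl | hlt
      · simp
      by_cases hp : ∃ p ∈ P, p ∈ Ioo s t
      · obtain ⟨p, hpP, hpI⟩ := hp
        have h1 : (P.filter (fun q => q ∈ Ioo s p)).card < k := by
          rw [← hk]
          apply Finset.card_lt_card
          refine ⟨fun q hq => ?_, fun hh => ?_⟩
          · simp only [Finset.mem_filter, mem_Ioo] at hq ⊢
            exact ⟨hq.1, hq.2.1, hq.2.2.trans hpI.2⟩
          · have := hh (Finset.mem_filter.2 ⟨hpP, hpI⟩)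
            simp at this
        have h2 : (P.filter (fun q => q ∈ Ioo p t)).card < k := by
          rw [← hk]
          apply Finset.card_lt_card
          refine ⟨fun q hq => ?_, fun hh => ?_⟩
          · simp only [Finset.mem_filter, mem_Ioo] at hq ⊢
            exact ⟨hq.1, hpI.1.trans hq.2.1, hq.2.2⟩
          · have := hh (Finset.mem_filter.2 ⟨hpP, hpI⟩)
            simp at this
        exact (ih _ h1 s p hs hpI.1.le (hpI.2.le.trans ht) rfl).trans
          (ih _ h2 p t (hs.trans hpI.1.le) hpI.2.le ht rfl)
      · push Not at hp
        exact intervalIntegrable_deriv_of_contDiffOn hst (hP s t hs hlt ht hp)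
  exact key _ 0 1 le_rfl zero_le_one le_rfl rfl

theorem PwC1.exists_finset_hasDerivAt {γ : ℝ → ℂ} (h : PwC1 γ) :
    ∃ P : Finset ℝ, ∀ t ∈ Ioo (0 : ℝ) 1, t ∉ P → HasDerivAt γ (deriv γ t) t := by
  obtain ⟨-, P, hP⟩ := h
  refine ⟨P, fun t ht htP => ?_⟩
  have hU : Ioo (0 : ℝ) 1 ∩ (P : Set ℝ)ᶜ ∈ 𝓝 t :=
    (isOpen_Ioo.inter P.finite_toSet.isClosed.isOpen_compl).mem_nhds ⟨ht, htP⟩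
  obtain ⟨δ, hδ, hb⟩ := Metric.mem_nhds_iff.1 hU
  have hin : ∀ x, |x - t| < δ → x ∈ Ioo (0 : ℝ) 1 ∩ (P : Set ℝ)ᶜ := fun x hx =>
    hb (by simpa [Real.dist_eq] using hx)
  have h1 : t - δ / 2 ∈ Ioo (0 : ℝ) 1 :=
    (hin _ (by rw [abs_lt]; constructor <;> linarith)).1
  have h2 : t + δ / 2 ∈ Ioo (0 : ℝ) 1 :=
    (hin _ (by rw [abs_lt]; constructor <;> linarith)).1
  have := hP (t - δ / 2) (t + δ / 2) h1.1.le (by linarith) h2.2.le (fun p hp hpI =>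
    (hin p (by rw [abs_lt]; constructor <;> linarith [hpI.1, hpI.2])).2 hp)
  exact ((this.differentiableOn one_ne_zero).differentiableAt
    (Icc_mem_nhds (by linarith) (by linarith))).hasDerivAt

theorem isCompact_trace {γ : ℝ → ℂ} (h : ContinuousOn γ (Icc 0 1)) : IsCompact (trace γ) :=
  isCompact_Icc.image_of_continuousOn h

theorem mem_trace {γ : ℝ → ℂ} {t : ℝ} (ht : t ∈ Icc (0 : ℝ) 1) : γ t ∈ trace γ :=
  mem_image_of_mem _ ht

theorem mem_trace' {γ : ℝ → ℂ} {t : ℝ} (ht : t ∈ uIcc (0 : ℝ) 1) : γ t ∈ trace γ :=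
  mem_trace (by rwa [uIcc_of_le zero_le_one] at ht)

theorem continuousOn_comp_trace {γ : ℝ → ℂ} (h : ContinuousOn γ (Icc 0 1)) {f : ℂ → ℂ}
    (hf : ContinuousOn f (trace γ)) : ContinuousOn (fun t => f (γ t)) (Icc 0 1) :=
  hf.comp h (fun _ ht => mem_trace ht)

theorem PwC1.integrable {γ : ℝ → ℂ} (h : PwC1 γ) {f : ℂ → ℂ} (hf : ContinuousOn f (trace γ)) :
    IntervalIntegrable (fun t => f (γ t) * deriv γ t) volume 0 1 := by
  have := (continuousOn_comp_trace h.1 hf)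
  rw [← uIcc_of_le (zero_le_one' ℝ)] at this
  exact h.intervalIntegrable_deriv.continuousOn_mul this

theorem PwC1.contourInt_deriv {γ : ℝ → ℂ} (h : PwC1 γ) {V : Set ℂ} (hV : IsOpen V)
    (hγ : trace γ ⊆ V) {F : ℂ → ℂ} (hF : DifferentiableOn ℂ F V) :
    contourInt γ (deriv F) = F (γ 1) - F (γ 0) := by
  obtain ⟨P, hP⟩ := h.exists_finset_hasDerivAt
  have hc : ContinuousOn (deriv F) V := (hF.deriv hV).continuousOn
  refine integral_eq_of_hasDerivAt_off_countable_of_le (fun t => F (γ t)) _ zero_le_one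
    P.countable_toSet (continuousOn_comp_trace h.1 (hF.continuousOn.mono hγ)) (fun t ht => ?_)
    (h.integrable (hc.mono hγ))
  have h1 := hP t ht.1 ht.2
  have h2 := (hF.differentiableAt
    (hV.mem_nhds (hγ (mem_trace (Ioo_subset_Icc_self ht.1))))).hasDerivAt
  exact h2.comp_of_eq t h1 rfl

theorem IsLoop.contourInt_deriv {γ : ℝ → ℂ} (h : IsLoop γ) {V : Set ℂ} (hV : IsOpen V)
    (hγ : trace γ ⊆ V) {F : ℂ → ℂ} (hF : DifferentiableOn ℂ F V) :
    contourInt γ (deriv F) = 0 := by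
  rw [h.pwC1.contourInt_deriv hV hγ hF, h.2.1, sub_self]

theorem contourInt_congr {γ : ℝ → ℂ} {f g : ℂ → ℂ} (h : ∀ w ∈ trace γ, f w = g w) :
    contourInt γ f = contourInt γ g :=
  intervalIntegral.integral_congr fun t ht => by simp only [h _ (mem_trace' ht)]

theorem contourInt_add {γ : ℝ → ℂ} (h : PwC1 γ) {f g : ℂ → ℂ} (hf : ContinuousOn f (trace γ))
    (hg : ContinuousOn g (trace γ)) :
    contourInt γ (fun w => f w + g w) = contourInt γ f + contourInt γ g := by
  unfold contourInt
  rw [← intervalIntegral.integral_add (h.integrable hf) (h.integrable hg)]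
  simp only [add_mul]

theorem contourInt_sub {γ : ℝ → ℂ} (h : PwC1 γ) {f g : ℂ → ℂ} (hf : ContinuousOn f (trace γ))
    (hg : ContinuousOn g (trace γ)) :
    contourInt γ (fun w => f w - g w) = contourInt γ f - contourInt γ g := by
  unfold contourInt
  rw [← intervalIntegral.integral_sub (h.integrable hf) (h.integrable hg)]
  simp only [sub_mul]

theorem contourInt_const_mul (γ : ℝ → ℂ) (c : ℂ) (f : ℂ → ℂ) :
    contourInt γ (fun w => c * f w) = c * contourInt γ f := by
  unfold contourInt
  rw [← intervalIntegral.integral_const_mul]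
  simp only [mul_assoc]

theorem contourInt_mul_const (γ : ℝ → ℂ) (c : ℂ) (f : ℂ → ℂ) :
    contourInt γ (fun w => f w * c) = contourInt γ f * c := by
  simp only [mul_comm _ c, contourInt_const_mul]

theorem contourInt_finset_sum {γ : ℝ → ℂ} (h : PwC1 γ) {ι : Type*} (s : Finset ι)
    {f : ι → ℂ → ℂ} (hf : ∀ i ∈ s, ContinuousOn (f i) (trace γ)) :
    contourInt γ (fun w => ∑ i ∈ s, f i w) = ∑ i ∈ s, contourInt γ (f i) := by
  unfold contourInt
  rw [← intervalIntegral.integral_finsetSum (fun i hi => h.integrable (hf i hi))]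
  simp only [Finset.sum_mul]

/-- The length of a curve. -/
noncomputable def curveLength (γ : ℝ → ℂ) : ℝ := ∫ t in (0 : ℝ)..1, ‖deriv γ t‖

theorem curveLength_nonneg (γ : ℝ → ℂ) : 0 ≤ curveLength γ :=
  intervalIntegral.integral_nonneg zero_le_one fun _ _ => norm_nonneg _

theorem norm_contourInt_le {γ : ℝ → ℂ} (h : PwC1 γ) {f : ℂ → ℂ} {M : ℝ}
    (hf : ∀ w ∈ trace γ, ‖f w‖ ≤ M) : ‖contourInt γ f‖ ≤ M * curveLength γ := by
  unfold contourInt curveLength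
  rw [← intervalIntegral.integral_const_mul]
  refine intervalIntegral.norm_integral_le_of_norm_le zero_le_one ?_
    (h.intervalIntegrable_deriv.norm.const_mul M)
  refine Eventually.of_forall fun t ht => ?_
  rw [norm_mul]
  exact mul_le_mul_of_nonneg_right (hf _ (mem_trace ⟨ht.1.le, ht.2⟩)) (norm_nonneg _)

/-- Differentiation under the integral sign for a holomorphic parameter. -/
theorem hasDerivAt_intervalIntegral {V : Set ℂ} (hV : IsOpen V) {f : ℂ → ℝ → ℂ} {g : ℝ → ℂ}
    {a b : ℝ} (hab : a ≤ b) (hf : ContinuousOn (Function.uncurry f) (V ×ˢ Icc a b))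
    (hol : ∀ t ∈ Icc a b, DifferentiableOn ℂ (fun z => f z t) V)
    (hg : IntervalIntegrable g volume a b) {z₀ : ℂ} (hz : z₀ ∈ V) :
    HasDerivAt (fun z => ∫ t in a..b, f z t * g t)
      (∫ t in a..b, deriv (fun z => f z t) z₀ * g t) z₀ := by
  obtain ⟨R, hR, hRV⟩ := Metric.nhds_basis_closedBall.mem_iff.1 (hV.mem_nhds hz)
  have hK : IsCompact (Metric.closedBall z₀ R ×ˢ Icc a b) :=
    (isCompact_closedBall z₀ R).prod isCompact_Icc
  have hKsub : Metric.closedBall z₀ R ×ˢ Icc a b ⊆ V ×ˢ Icc a b := prod_mono hRV subset_rfl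
  obtain ⟨M, hM⟩ := hK.exists_bound_of_continuousOn (hf.mono hKsub)
  have hsub : ∀ z ∈ Metric.ball z₀ (R / 2), ∀ t ∈ Icc a b,
      ‖deriv (fun z => f z t) z‖ ≤ M / (R / 2) := by
    intro z hz t ht
    have hcb : Metric.closedBall z (R / 2) ⊆ Metric.closedBall z₀ R := by
      intro w hw
      rw [Metric.mem_ball] at hz
      rw [Metric.mem_closedBall] at hw ⊢
      linarith [dist_triangle w z z₀]
    refine Complex.norm_deriv_le_of_forall_mem_sphere_norm_le (by positivity) ?_ ?_
    · refine DifferentiableOn.diffContOnCl ?_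
      rw [closure_ball _ (by positivity)]
      exact (hol t ht).mono (hcb.trans hRV)
    · intro w hw
      exact hM (w, t) ⟨hcb (Metric.sphere_subset_closedBall hw), ht⟩
  have hcontt : ∀ z ∈ V, ContinuousOn (fun t => f z t) (Icc a b) := fun z hz =>
    hf.comp (f := fun t => (z, t)) (Continuous.continuousOn (by fun_prop)) (fun t ht => ⟨hz, ht⟩)
  have hgm : AEStronglyMeasurable g (volume.restrict (Ι a b)) := by
    rw [intervalIntegrable_iff] at hg
    exact hg.aestronglyMeasurable
  have hFm : ∀ z ∈ V, AEStronglyMeasurable (fun t => f z t) (volume.restrict (Ι a b)) := by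
    intro z hz
    rw [uIoc_of_le hab]
    exact ((hcontt z hz).mono Ioc_subset_Icc_self).aestronglyMeasurable measurableSet_Ioc
  have hmem : ∀ t ∈ Ι a b, t ∈ Icc a b := fun t ht => by
    rw [uIoc_of_le hab] at ht; exact Ioc_subset_Icc_self ht
  have hdm : AEStronglyMeasurable (fun t => deriv (fun z => f z t) z₀)
      (volume.restrict (Ι a b)) := by
    have hseq : Tendsto (fun k : ℕ => z₀ + (R / (k + 1) : ℝ)) atTop (𝓝[≠] z₀) := by
      refine tendsto_nhdsWithin_iff.2 ⟨?_, Eventually.of_forall fun k => ?_⟩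
      · have h1 : Tendsto (fun k : ℕ => (R / (k + 1) : ℝ)) atTop (𝓝 0) := by
          have := (tendsto_one_div_add_atTop_nhds_zero_nat (𝕜 := ℝ)).const_mul R
          simpa [div_eq_mul_inv] using this
        have h2 : Tendsto (fun k : ℕ => z₀ + ((R / (k + 1) : ℝ) : ℂ)) atTop (𝓝 (z₀ + (0 : ℝ))) :=
          tendsto_const_nhds.add ((Complex.continuous_ofReal.tendsto _).comp h1)
        simpa using h2
      · have : (R / (k + 1) : ℝ) ≠ 0 := by positivity
        simp only [mem_compl_iff, mem_singleton_iff, add_eq_left, Complex.ofReal_eq_zero]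
        exact this
    refine aestronglyMeasurable_of_tendsto_ae (atTop : Filter ℕ)
      (f := fun k t => slope (fun z => f z t) z₀ (z₀ + (R / (k + 1) : ℝ))) (fun k => ?_) ?_
    · have hk : z₀ + (R / (k + 1) : ℝ) ∈ V := by
        apply hRV
        rw [Metric.mem_closedBall, dist_eq_norm, add_sub_cancel_left, Complex.norm_real,
          Real.norm_of_nonneg (by positivity)]
        exact div_le_self hR.le (by linarith [Nat.cast_nonneg (α := ℝ) k])
      simp only [slope_def_field, div_eq_mul_inv]
      exact ((hFm _ hk).sub (hFm _ hz)).mul_const _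
    · refine (ae_restrict_iff' measurableSet_uIoc).2 (Eventually.of_forall fun t ht => ?_)
      have := ((hol t (hmem t ht)).differentiableAt (hV.mem_nhds hz)).hasDerivAt
      exact (hasDerivAt_iff_tendsto_slope.1 this).comp hseq
  refine (intervalIntegral.hasDerivAt_integral_of_dominated_loc_of_deriv_le
    (F' := fun z t => deriv (fun z => f z t) z * g t) (bound := fun t => M / (R / 2) * ‖g t‖)
    (Metric.ball_mem_nhds z₀ (half_pos hR)) ?_ ?_ (hdm.mul hgm) ?_ (hg.norm.const_mul _) ?_).2
  · filter_upwards [hV.mem_nhds hz] with z hz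
    exact (hFm z hz).mul hgm
  · have := hcontt z₀ hz
    rw [← uIcc_of_le hab] at this
    exact hg.continuousOn_mul this
  · refine Eventually.of_forall fun t ht z hz => ?_
    rw [norm_mul]
    exact mul_le_mul_of_nonneg_right (hsub z hz t (hmem t ht)) (norm_nonneg _)
  · refine Eventually.of_forall fun t ht z hz => ?_
    refine HasDerivAt.mul_const ?_ _
    refine ((hol t (hmem t ht)).differentiableAt (hV.mem_nhds (hRV ?_))).hasDerivAt
    exact Metric.ball_subset_closedBall (Metric.ball_subset_ball (by linarith) hz)

theorem hasDerivAt_contourInt {V : Set ℂ} (hV : IsOpen V) {γ : ℝ → ℂ} (hγ : PwC1 γ)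
    {f : ℂ → ℂ → ℂ} (hf : ContinuousOn (Function.uncurry f) (V ×ˢ trace γ))
    (hol : ∀ w ∈ trace γ, DifferentiableOn ℂ (fun z => f z w) V) {z₀ : ℂ} (hz : z₀ ∈ V) :
    HasDerivAt (fun z => contourInt γ (f z))
      (contourInt γ (fun w => deriv (fun z => f z w) z₀)) z₀ := by
  refine hasDerivAt_intervalIntegral hV (f := fun z t => f z (γ t)) zero_le_one ?_
    (fun t ht => hol _ (mem_trace ht)) hγ.intervalIntegrable_deriv hz
  refine hf.comp (f := fun p : ℂ × ℝ => (p.1, γ p.2)) ?_ (fun p hp => ⟨hp.1, mem_trace hp.2⟩)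
  exact continuousOn_fst.prodMk (hγ.1.comp continuousOn_snd fun p hp => hp.2)

theorem differentiableOn_contourInt {V : Set ℂ} (hV : IsOpen V) {γ : ℝ → ℂ} (hγ : PwC1 γ)
    {f : ℂ → ℂ → ℂ} (hf : ContinuousOn (Function.uncurry f) (V ×ˢ trace γ))
    (hol : ∀ w ∈ trace γ, DifferentiableOn ℂ (fun z => f z w) V) :
    DifferentiableOn ℂ (fun z => contourInt γ (f z)) V := fun _ hz =>
  (hasDerivAt_contourInt hV hγ hf hol hz).differentiableAt.differentiableWithinAt

/-- Fubini for products of a continuous function with integrable functions of one variable. -/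
theorem intervalIntegral_swap {f : ℝ → ℝ → ℂ} {u v : ℝ → ℂ} {a b c d : ℝ} (hab : a ≤ b)
    (hcd : c ≤ d) (hf : ContinuousOn (Function.uncurry f) (Icc a b ×ˢ Icc c d))
    (hu : IntervalIntegrable u volume a b) (hv : IntervalIntegrable v volume c d) :
    ∫ t in a..b, (∫ s in c..d, f t s * v s) * u t =
      ∫ s in c..d, (∫ t in a..b, f t s * u t) * v s := by
  simp only [← intervalIntegral.integral_mul_const]
  simp only [intervalIntegral.integral_of_le hab, intervalIntegral.integral_of_le hcd]
  rw [integral_integral_swap]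
  · simp only [mul_right_comm]
  rw [intervalIntegrable_iff_integrableOn_Ioc_of_le hab] at hu
  rw [intervalIntegrable_iff_integrableOn_Ioc_of_le hcd] at hv
  have huv := Integrable.mul_prod hu hv
  obtain ⟨M, hM⟩ := (isCompact_Icc.prod isCompact_Icc).exists_bound_of_continuousOn hf
  rw [Measure.prod_restrict] at huv ⊢
  have := Integrable.bdd_mul (c := M) huv
    (f := Function.uncurry f) ((hf.mono (prod_mono Ioc_subset_Icc_self
      Ioc_subset_Icc_self)).aestronglyMeasurable (measurableSet_Ioc.prod measurableSet_Ioc))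
    ((ae_restrict_iff' (measurableSet_Ioc.prod measurableSet_Ioc)).2
      (Eventually.of_forall fun p hp => hM p ⟨Ioc_subset_Icc_self hp.1,
        Ioc_subset_Icc_self hp.2⟩))
  refine this.congr (Eventually.of_forall fun p => ?_)
  simp only [Function.uncurry]
  ring

theorem contourInt_swap {γ₁ γ₂ : ℝ → ℂ} (h₁ : PwC1 γ₁) (h₂ : PwC1 γ₂) {f : ℂ → ℂ → ℂ}
    (hf : ContinuousOn (Function.uncurry f) (trace γ₁ ×ˢ trace γ₂)) :
    contourInt γ₁ (fun z => contourInt γ₂ (fun w => f z w)) =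
      contourInt γ₂ (fun w => contourInt γ₁ (fun z => f z w)) := by
  refine intervalIntegral_swap (f := fun t s => f (γ₁ t) (γ₂ s)) zero_le_one zero_le_one ?_
    h₁.intervalIntegrable_deriv h₂.intervalIntegrable_deriv
  refine hf.comp (f := fun p : ℝ × ℝ => (γ₁ p.1, γ₂ p.2)) ?_
    (fun p hp => ⟨mem_trace hp.1, mem_trace hp.2⟩)
  exact (h₁.1.comp continuousOn_fst fun p hp => hp.1).prodMk
    (h₂.1.comp continuousOn_snd fun p hp => hp.2)

theorem contourInt_intervalIntegral_swap {γ : ℝ → ℂ} (h : PwC1 γ) {f : ℂ → ℝ → ℂ} {c d : ℝ}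
    (hcd : c ≤ d) (hf : ContinuousOn (Function.uncurry f) (trace γ ×ˢ Icc c d)) :
    contourInt γ (fun z => ∫ s in c..d, f z s) = ∫ s in c..d, contourInt γ (fun z => f z s) := by
  have := intervalIntegral_swap (f := fun t s => f (γ t) s) (v := fun _ => 1) zero_le_one hcd
    (hf.comp (f := fun p : ℝ × ℝ => (γ p.1, p.2)) ((h.1.comp continuousOn_fst
      fun p hp => hp.1).prodMk continuousOn_snd) (fun p hp => ⟨mem_trace hp.1, hp.2⟩))
    h.intervalIntegrable_deriv intervalIntegrable_const
  simpa [contourInt] using this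

end

section

theorem two_pi_I_ne_zero : (2 * Real.pi * Complex.I : ℂ) ≠ 0 := Complex.two_pi_I_ne_zero

theorem continuousOn_sub_inv {γ : ℝ → ℂ} {a : ℂ} (ha : a ∉ trace γ) :
    ContinuousOn (fun w => (w - a)⁻¹) (trace γ) := by
  refine ContinuousOn.inv₀ (by fun_prop) fun w hw h => ha ?_
  rwa [← sub_eq_zero.1 h]

theorem contourInt_sub_inv (γ : ℝ → ℂ) (a : ℂ) :
    contourInt γ (fun w => (w - a)⁻¹) = 2 * Real.pi * Complex.I * winding γ a := by
  unfold winding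
  rw [mul_inv_cancel_left₀ two_pi_I_ne_zero]

/-- The winding number is locally constant off the curve. -/
theorem eventually_winding_eq {γ : ℝ → ℂ} (hγ : IsLoop γ) {a : ℂ} (ha : a ∉ trace γ) :
    ∀ᶠ z in 𝓝 a, z ∉ trace γ ∧ winding γ z = winding γ a := by
  obtain ⟨r, hr, hb⟩ := Metric.mem_nhds_iff.1
    ((isCompact_trace hγ.1).isClosed.isOpen_compl.mem_nhds ha)
  have hne : ∀ z ∈ Metric.ball a r, ∀ w ∈ trace γ, w - z ≠ 0 := fun z hz w hw h =>
    hb hz (by rwa [← sub_eq_zero.1 h])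
  have hd : ∀ z ∈ Metric.ball a r,
      HasDerivAt (fun z => contourInt γ (fun w => (w - z)⁻¹)) 0 z := by
    intro z hz
    have h1 := hasDerivAt_contourInt Metric.isOpen_ball hγ.pwC1 (f := fun z w => (w - z)⁻¹)
      (V := Metric.ball a r) (by
        refine ContinuousOn.inv₀ (Continuous.continuousOn (by fun_prop)) ?_
        exact fun p hp => hne _ hp.1 _ hp.2) (fun w hw => by
        refine DifferentiableOn.inv (by fun_prop) fun z hz => hne z hz w hw) hz
    convert h1 using 1
    have h2 : ∀ w ∈ trace γ, deriv (fun z => (w - z)⁻¹) z = deriv (fun w => -(w - z)⁻¹) w := by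
      intro w hw
      have e1 : HasDerivAt (fun z => (w - z)⁻¹) (-(-1) / (w - z) ^ 2) z :=
        ((hasDerivAt_id z).const_sub w).inv (hne z hz w hw)
      have e2 : HasDerivAt (fun w => -(w - z)⁻¹) (-(-(1) / (w - z) ^ 2)) w :=
        (((hasDerivAt_id w).sub_const z).inv (hne z hz w hw)).neg
      rw [e1.deriv, e2.deriv]
      ring
    rw [contourInt_congr h2, hγ.contourInt_deriv (V := {z}ᶜ) isOpen_compl_singleton]
    · exact fun w hw h => hne z hz w hw (sub_eq_zero.2 h)
    · exact (DifferentiableOn.inv (by fun_prop) fun w hw => sub_ne_zero.2 hw).neg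
  filter_upwards [Metric.ball_mem_nhds a hr] with z hz
  refine ⟨hb hz, ?_⟩
  unfold winding
  congr 1
  exact Metric.isOpen_ball.is_const_of_deriv_eq_zero
    (convex_ball a r).isPreconnected
    (fun z hz => (hd z hz).differentiableAt.differentiableWithinAt)
    (fun z hz => (hd z hz).deriv) hz (Metric.mem_ball_self hr)

/-- A loop inside a disk does not see functions holomorphic on the disk. -/
theorem contourInt_eq_zero_of_ball {γ : ℝ → ℂ} (hγ : IsLoop γ) {c : ℂ} {R : ℝ}
    (hR : trace γ ⊆ Metric.ball c R) {f : ℂ → ℂ}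
    (hf : DifferentiableOn ℂ f (Metric.ball c R)) : contourInt γ f = 0 := by
  obtain ⟨F, hF⟩ := hf.isExactOn_ball
  rw [← hγ.contourInt_deriv Metric.isOpen_ball hR (F := F)
    fun z hz => (hF z hz).differentiableAt.differentiableWithinAt]
  exact contourInt_congr fun w hw => (hF w (hR hw)).deriv.symm

theorem exists_winding_eq_zero {γ : ℝ → ℂ} (hγ : IsLoop γ) :
    ∃ R : ℝ, 0 < R ∧ trace γ ⊆ Metric.ball 0 R ∧ ∀ a, R ≤ ‖a‖ → winding γ a = 0 := by
  obtain ⟨R, hR, h⟩ := (isCompact_trace hγ.1).isBounded.subset_ball_lt 0 0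
  refine ⟨R, hR, h, fun a ha => ?_⟩
  unfold winding
  rw [contourInt_eq_zero_of_ball hγ h, mul_zero]
  refine DifferentiableOn.inv (by fun_prop) fun w hw h0 => ?_
  rw [mem_ball_zero_iff, sub_eq_zero.1 h0] at hw
  linarith

theorem continuousOn_dslope_uncurry {V : Set ℂ} (hV : IsOpen V) {f : ℂ → ℂ}
    (hf : DifferentiableOn ℂ f V) :
    ContinuousOn (Function.uncurry (dslope f)) (V ×ˢ V) := by
  rintro ⟨a, b⟩ ⟨ha, hb⟩
  simp only at ha hb
  refine ContinuousAt.continuousWithinAt ?_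
  by_cases hab : a = b
  · subst hab
    have hs : HasStrictDerivAt f (deriv f a) a :=
      (hf.analyticOnNhd hV a ha).hasStrictDerivAt
    have hdc : ContinuousAt (deriv f) a := ((hf.deriv hV).differentiableAt
      (hV.mem_nhds ha)).continuousAt
    have hlo := hs.hasStrictFDerivAt.isLittleO
    rw [Metric.continuousAt_iff]
    intro ε hε
    have h1 := hlo.def (half_pos hε)
    have h2 := Metric.continuousAt_iff.1 hdc ε hε
    obtain ⟨δ₂, hδ₂, h2⟩ := h2
    obtain ⟨δ₁, hδ₁, h1⟩ := Metric.eventually_nhds_iff.1 h1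
    refine ⟨min δ₁ δ₂, lt_min hδ₁ hδ₂, ?_⟩
    rintro ⟨z, w⟩ hzw
    have hz1 : dist (z, w) (a, a) < δ₁ := hzw.trans_le (min_le_left _ _)
    have hz2 : dist z a < δ₂ := (le_max_left _ _).trans_lt (hzw.trans_le (min_le_right _ _))
    simp only [Function.uncurry, dslope_same]
    by_cases hzw' : w = z
    · subst hzw'
      rw [dslope_same]
      exact h2 hz2
    · rw [dslope_of_ne _ hzw', slope_def_field, dist_eq_norm]
      have h3 := h1 hz1
      simp only [ContinuousLinearMap.toSpanSingleton_apply, smul_eq_mul] at h3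
      have h4 : z - w ≠ 0 := sub_ne_zero.2 (Ne.symm hzw')
      have h4' : w - z ≠ 0 := sub_ne_zero.2 hzw'
      have h5 : (f w - f z) / (w - z) - deriv f a = (f z - f w - (z - w) * deriv f a) / (z - w) := by
        field_simp
        ring
      rw [h5, norm_div, div_lt_iff₀ (norm_pos_iff.2 h4)]
      refine h3.trans_lt ?_
      have := norm_pos_iff.2 h4
      nlinarith
  · have h1 : (fun p : ℂ × ℂ => (f p.2 - f p.1) / (p.2 - p.1)) =ᶠ[𝓝 (a, b)]
        Function.uncurry (dslope f) := by
      have : ∀ᶠ p : ℂ × ℂ in 𝓝 (a, b), p.2 ≠ p.1 :=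
        (isOpen_ne_fun continuous_snd continuous_fst).mem_nhds (Ne.symm hab)
      filter_upwards [this] with p hp
      simp only [Function.uncurry]
      rw [dslope_of_ne _ hp, slope_def_field]
    refine ContinuousAt.congr ?_ h1
    have hfa : ContinuousAt f a := (hf.differentiableAt (hV.mem_nhds ha)).continuousAt
    have hfb : ContinuousAt f b := (hf.differentiableAt (hV.mem_nhds hb)).continuousAt
    refine ContinuousAt.div ?_ (by fun_prop) (sub_ne_zero.2 (Ne.symm hab))
    exact (ContinuousAt.comp (f := fun p : ℂ × ℂ => p.2) (x := (a, b)) hfb continuousAt_snd).sub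
      (ContinuousAt.comp (f := fun p : ℂ × ℂ => p.1) (x := (a, b)) hfa continuousAt_fst)

theorem dslope_comm' (f : ℂ → ℂ) (a b : ℂ) : dslope f a b = dslope f b a := by
  by_cases h : b = a
  · rw [h]
  · rw [dslope_of_ne _ h, dslope_of_ne _ (Ne.symm h), slope_comm]

/-- The difference of the two Cauchy transforms vanishes: for `f` holomorphic on `V` and loops
`γ₁, γ₂` in `V` with the same winding numbers off `V`, the integrals of all difference quotients
of `f` agree. -/
theorem contourInt_dslope_eq {V : Set ℂ} (hV : IsOpen V) {γ₁ γ₂ : ℝ → ℂ} (h₁ : IsLoop γ₁)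
    (h₂ : IsLoop γ₂) (t₁ : trace γ₁ ⊆ V) (t₂ : trace γ₂ ⊆ V)
    (hw : ∀ a, a ∉ V → winding γ₁ a = winding γ₂ a) {f : ℂ → ℂ} (hf : DifferentiableOn ℂ f V)
    {z : ℂ} (hz : z ∈ V) : contourInt γ₁ (dslope f z) = contourInt γ₂ (dslope f z) := by
  classical
  set E : Set ℂ := {a | a ∉ trace γ₁ ∧ a ∉ trace γ₂ ∧ winding γ₁ a = winding γ₂ a} with hE
  have hEo : IsOpen E := by
    rw [isOpen_iff_mem_nhds]
    rintro a ⟨ha1, ha2, ha⟩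
    filter_upwards [eventually_winding_eq h₁ ha1, eventually_winding_eq h₂ ha2] with z hz1 hz2
    exact ⟨hz1.1, hz2.1, by rw [hz1.2, hz2.2, ha]⟩
  have hVE : ∀ a, a ∉ V → a ∈ E := fun a ha =>
    ⟨fun h => ha (t₁ h), fun h => ha (t₂ h), hw a ha⟩
  let p : ℂ → ℂ := fun z => contourInt γ₁ (dslope f z) - contourInt γ₂ (dslope f z)
  let q : ℂ → ℂ := fun z => contourInt γ₁ (fun w => f w * (w - z)⁻¹) -
    contourInt γ₂ (fun w => f w * (w - z)⁻¹)
  have hpd : DifferentiableOn ℂ p V := by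
    have aux : ∀ γ, IsLoop γ → trace γ ⊆ V →
        DifferentiableOn ℂ (fun z => contourInt γ (dslope f z)) V := by
      intro γ hγ ht
      refine differentiableOn_contourInt hV hγ.pwC1 (f := dslope f)
        ((continuousOn_dslope_uncurry hV hf).mono (prod_mono subset_rfl ht)) fun w hw => ?_
      simp only [dslope_comm' f _ w]
      exact (Complex.differentiableOn_dslope (hV.mem_nhds (ht hw))).2 hf
    exact (aux _ h₁ t₁).sub (aux _ h₂ t₂)
  have hqd : DifferentiableOn ℂ q E := by
    have aux : ∀ γ, IsLoop γ → trace γ ⊆ V → (∀ a ∈ E, a ∉ trace γ) →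
        DifferentiableOn ℂ (fun z => contourInt γ (fun w => f w * (w - z)⁻¹)) E := by
      intro γ hγ ht hEγ
      have hne : ∀ z ∈ E, ∀ w ∈ trace γ, w - z ≠ 0 := fun z hz w hw h =>
        hEγ z hz (by rwa [← sub_eq_zero.1 h])
      refine differentiableOn_contourInt hEo hγ.pwC1 (f := fun z w => f w * (w - z)⁻¹) ?_ ?_
      · refine ContinuousOn.mul ?_ (ContinuousOn.inv₀ (Continuous.continuousOn (by fun_prop))
          fun p hp => hne _ hp.1 _ hp.2)
        exact (hf.continuousOn.mono ht).comp continuousOn_snd fun p hp => hp.2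
      · exact fun w hw => (differentiableOn_const _).mul
          (DifferentiableOn.inv (by fun_prop) fun z hz => hne z hz w hw)
    exact (aux _ h₁ t₁ fun a ha => ha.1).sub (aux _ h₂ t₂ fun a ha => ha.2.1)
  have hpq : ∀ z ∈ V, z ∈ E → p z = q z := by
    intro z hzV hzE
    have aux : ∀ γ, IsLoop γ → trace γ ⊆ V → z ∉ trace γ → contourInt γ (dslope f z) =
        contourInt γ (fun w => f w * (w - z)⁻¹) - f z * (2 * Real.pi * Complex.I * winding γ z) := by
      intro γ hγ ht hzγ
      rw [← contourInt_sub_inv, ← contourInt_const_mul, ← contourInt_sub hγ.pwC1]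
      · refine contourInt_congr fun w hw => ?_
        have : w ≠ z := fun h => hzγ (h ▸ hw)
        rw [dslope_of_ne _ this, slope_def_field]
        ring
      · exact (hf.continuousOn.mono ht).mul (continuousOn_sub_inv hzγ)
      · exact continuousOn_const.mul (continuousOn_sub_inv hzγ)
    simp only [p, q, aux _ h₁ t₁ hzE.1, aux _ h₂ t₂ hzE.2.1, hzE.2.2]
    ring
  let H : ℂ → ℂ := fun z => if z ∈ V then p z else q z
  have hHV : ∀ z ∈ V, H z = p z := fun z hz => if_pos hz
  have hHE : ∀ z ∈ E, H z = q z := fun z hz => by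
    by_cases h : z ∈ V
    · rw [hHV z h, hpq z h hz]
    · exact if_neg h
  have hHd : Differentiable ℂ H := by
    intro z
    by_cases h : z ∈ V
    · exact (hpd.differentiableAt (hV.mem_nhds h)).congr_of_eventuallyEq
        (eventually_of_mem (hV.mem_nhds h) hHV)
    · have h' := hVE z h
      exact (hqd.differentiableAt (hEo.mem_nhds h')).congr_of_eventuallyEq
        (eventually_of_mem (hEo.mem_nhds h') hHE)
  obtain ⟨R₁, hR₁, hb₁, hw₁⟩ := exists_winding_eq_zero h₁
  obtain ⟨R₂, hR₂, hb₂, hw₂⟩ := exists_winding_eq_zero h₂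
  have hlim : Tendsto H (cocompact ℂ) (𝓝 0) := by
    have aux : ∀ γ, IsLoop γ → trace γ ⊆ V → ∀ R, 0 < R → trace γ ⊆ Metric.ball 0 R →
        Tendsto (fun z => contourInt γ (fun w => f w * (w - z)⁻¹)) (cocompact ℂ) (𝓝 0) := by
      intro γ hγ ht R hR hb
      obtain ⟨M, hM⟩ := (isCompact_trace hγ.1).exists_bound_of_continuousOn (hf.continuousOn.mono ht)
      have hle : ∀ᶠ z in cocompact ℂ, ‖contourInt γ (fun w => f w * (w - z)⁻¹)‖ ≤
          (|M| * curveLength γ) * (‖z‖ - R)⁻¹ := by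
        filter_upwards [tendsto_norm_cocompact_atTop.eventually (eventually_gt_atTop R)] with z hz
        have := norm_contourInt_le hγ.pwC1 (f := fun w => f w * (w - z)⁻¹)
          (M := |M| * (‖z‖ - R)⁻¹) fun w hw => ?_
        · exact this.trans (le_of_eq (by ring))
        · rw [norm_mul, norm_inv]
          have hwR : ‖w‖ < R := by simpa using hb hw
          refine mul_le_mul ((hM w hw).trans (le_abs_self M)) ?_ (by positivity) (abs_nonneg _)
          refine inv_anti₀ (by linarith) ?_
          have := norm_sub_norm_le z w
          rw [norm_sub_rev] at this
          linarith
      refine squeeze_zero_norm' hle ?_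
      have h1 : Tendsto (fun z : ℂ => ‖z‖ - R) (cocompact ℂ) atTop :=
        tendsto_atTop_add_const_right _ _ tendsto_norm_cocompact_atTop
      simpa using h1.inv_tendsto_atTop.const_mul (|M| * curveLength γ)
    have h0 := (aux _ h₁ t₁ R₁ hR₁ hb₁).sub (aux _ h₂ t₂ R₂ hR₂ hb₂)
    rw [sub_zero] at h0
    refine h0.congr' ?_
    filter_upwards [tendsto_norm_cocompact_atTop.eventually (eventually_ge_atTop (max R₁ R₂))]
      with z hz
    refine (hHE z ⟨fun h => ?_, fun h => ?_, ?_⟩).symm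
    · have := hb₁ h
      rw [mem_ball_zero_iff] at this
      linarith [le_max_left R₁ R₂]
    · have := hb₂ h
      rw [mem_ball_zero_iff] at this
      linarith [le_max_right R₁ R₂]
    · rw [hw₁ z ((le_max_left _ _).trans hz), hw₂ z ((le_max_right _ _).trans hz)]
  have := hHd.apply_eq_of_tendsto_cocompact z hlim
  rw [hHV z hz] at this
  exact sub_eq_zero.1 this

/-- Cauchy's theorem, homology version, for two loops. -/
theorem contourInt_eq {V : Set ℂ} (hV : IsOpen V) {γ₁ γ₂ : ℝ → ℂ} (h₁ : IsLoop γ₁)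
    (h₂ : IsLoop γ₂) (t₁ : trace γ₁ ⊆ V) (t₂ : trace γ₂ ⊆ V)
    (hw : ∀ a, a ∉ V → winding γ₁ a = winding γ₂ a) {f : ℂ → ℂ} (hf : DifferentiableOn ℂ f V) :
    contourInt γ₁ f = contourInt γ₂ f := by
  obtain ⟨z, hz⟩ : V.Nonempty := ⟨γ₁ 0, t₁ (mem_trace (by simp))⟩
  have key := contourInt_dslope_eq hV h₁ h₂ t₁ t₂ hw (f := fun w => (w - z) * f w)
    (by fun_prop) hz
  have aux : ∀ w ∈ V, dslope (fun w => (w - z) * f w) z w = f w := by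
    intro w hwV
    by_cases h : w = z
    · subst h
      rw [dslope_same]
      have : HasDerivAt (fun x => (x - w) * f x) _ w := ((hasDerivAt_id w).sub_const w).mul
        (hf.differentiableAt (hV.mem_nhds hz)).hasDerivAt
      have h2 := this.deriv
      simpa using h2
    · rw [dslope_of_ne _ h, slope_def_field]
      have : w - z ≠ 0 := sub_ne_zero.2 h
      field_simp
      ring
  rwa [contourInt_congr fun w hw => aux w (t₁ hw), contourInt_congr fun w hw => aux w (t₂ hw)]
    at key

theorem isLoop_const (c : ℂ) : IsLoop (fun _ => c) :=
  ⟨continuousOn_const, rfl, ∅, fun _ _ _ _ _ _ => contDiffOn_const⟩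

theorem contourInt_const (c : ℂ) (f : ℂ → ℂ) : contourInt (fun _ => c) f = 0 := by
  simp [contourInt]

/-- Cauchy's theorem, homology version, for one loop. -/
theorem contourInt_eq_zero {V : Set ℂ} (hV : IsOpen V) {γ : ℝ → ℂ} (h : IsLoop γ)
    (t : trace γ ⊆ V) (hw : ∀ a, a ∉ V → winding γ a = 0) {f : ℂ → ℂ}
    (hf : DifferentiableOn ℂ f V) : contourInt γ f = 0 := by
  have := contourInt_eq hV h (isLoop_const (γ 0)) t (by
    rintro _ ⟨s, -, rfl⟩; exact t (mem_trace (by simp))) (fun a ha => by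
    rw [hw a ha]; simp [winding, contourInt_const]) hf
  rwa [contourInt_const] at this

/-- Cauchy's integral formula for two loops. -/
theorem contourInt_cauchy {V : Set ℂ} (hV : IsOpen V) {γ₁ γ₂ : ℝ → ℂ} (h₁ : IsLoop γ₁)
    (h₂ : IsLoop γ₂) (t₁ : trace γ₁ ⊆ V) (t₂ : trace γ₂ ⊆ V)
    (hw : ∀ a, a ∉ V → winding γ₁ a = winding γ₂ a) {f : ℂ → ℂ} (hf : DifferentiableOn ℂ f V)
    {z : ℂ} (hz : z ∈ V) (hz₁ : z ∉ trace γ₁) (hz₂ : z ∉ trace γ₂) :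
    contourInt γ₁ (fun w => f w * (w - z)⁻¹) - contourInt γ₂ (fun w => f w * (w - z)⁻¹) =
      2 * Real.pi * Complex.I * (winding γ₁ z - winding γ₂ z) * f z := by
  have key := contourInt_dslope_eq hV h₁ h₂ t₁ t₂ hw hf hz
  have aux : ∀ γ, IsLoop γ → trace γ ⊆ V → z ∉ trace γ → contourInt γ (dslope f z) =
      contourInt γ (fun w => f w * (w - z)⁻¹) - f z * (2 * Real.pi * Complex.I * winding γ z) := by
    intro γ hγ ht hzγ
    rw [← contourInt_sub_inv, ← contourInt_const_mul, ← contourInt_sub hγ.pwC1]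
    · refine contourInt_congr fun w hw => ?_
      have : w ≠ z := fun h => hzγ (h ▸ hw)
      rw [dslope_of_ne _ this, slope_def_field]
      ring
    · exact (hf.continuousOn.mono ht).mul (continuousOn_sub_inv hzγ)
    · exact continuousOn_const.mul (continuousOn_sub_inv hzγ)
  rw [aux _ h₁ t₁ hz₁, aux _ h₂ t₂ hz₂] at key
  linear_combination key

end

section

theorem PwC1.comp_holo {γ : ℝ → ℂ} (h : PwC1 γ) {V : Set ℂ} (hV : IsOpen V) (hγ : trace γ ⊆ V)
    {g : ℂ → ℂ} (hg : DifferentiableOn ℂ g V) : PwC1 (fun t => g (γ t)) := by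
  obtain ⟨hc, P, hP⟩ := h
  refine ⟨continuousOn_comp_trace hc (hg.continuousOn.mono hγ), P, fun s t hs hst ht hp => ?_⟩
  have h1 : ContDiffOn ℝ 1 g V := (hg.contDiffOn hV).restrict_scalars ℝ
  exact h1.comp (hP s t hs hst ht hp) fun u hu => hγ (mem_trace ⟨hs.trans hu.1, hu.2.trans ht⟩)

theorem IsLoop.comp_holo {γ : ℝ → ℂ} (h : IsLoop γ) {V : Set ℂ} (hV : IsOpen V)
    (hγ : trace γ ⊆ V) {g : ℂ → ℂ} (hg : DifferentiableOn ℂ g V) :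
    IsLoop (fun t => g (γ t)) :=
  (h.pwC1.comp_holo hV hγ hg).isLoop (by rw [h.2.1])

theorem contourInt_comp_holo {γ : ℝ → ℂ} (h : PwC1 γ) {V : Set ℂ} (hV : IsOpen V)
    (hγ : trace γ ⊆ V) {g : ℂ → ℂ} (hg : DifferentiableOn ℂ g V) (f : ℂ → ℂ) :
    contourInt (fun t => g (γ t)) f = contourInt γ (fun w => f (g w) * deriv g w) := by
  obtain ⟨P, hP⟩ := h.exists_finset_hasDerivAt
  unfold contourInt
  simp only [intervalIntegral.integral_of_le zero_le_one, integral_Ioc_eq_integral_Ioo]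
  refine integral_congr_ae ?_
  have h1 : ∀ᵐ t ∂(volume.restrict (Ioo (0 : ℝ) 1)), t ∉ (P : Set ℝ) :=
    ae_restrict_of_ae (P.countable_toSet.ae_notMem volume)
  filter_upwards [h1, ae_restrict_mem measurableSet_Ioo] with t htP ht
  have h2 := hP t ht htP
  have h3 := (hg.differentiableAt
    (hV.mem_nhds (hγ (mem_trace (Ioo_subset_Icc_self ht))))).hasDerivAt
  have h4 : HasDerivAt (fun t => g (γ t)) (deriv g (γ t) * deriv γ t) t :=
    h3.comp_of_eq t h2 rfl
  rw [h4.deriv, mul_assoc]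

/-! ### Circles and confocal ellipses -/

/-- The positively oriented circle of radius `ρ` around the origin. -/
noncomputable def circ (ρ : ℝ) : ℝ → ℂ := fun t => circleMap 0 ρ (2 * Real.pi * t)

theorem isLoop_circ (ρ : ℝ) : IsLoop (circ ρ) := by
  have h : ContDiff ℝ 1 (circ ρ) := (contDiff_circleMap 0 ρ).comp (by fun_prop)
  refine ⟨h.continuous.continuousOn, ?_, ∅, fun _ _ _ _ _ _ => h.contDiffOn⟩
  simp [circ, circleMap]

theorem contourInt_circ (ρ : ℝ) (f : ℂ → ℂ) :
    contourInt (circ ρ) f = ∮ z in C(0, ρ), f z := by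
  have h : ∀ t, deriv (circ ρ) t = (2 * Real.pi : ℝ) * deriv (circleMap 0 ρ) (2 * Real.pi * t) := by
    intro t
    have h1 : HasDerivAt (fun t : ℝ => 2 * Real.pi * t) (2 * Real.pi) t := by
      simpa using (hasDerivAt_id t).const_mul (2 * Real.pi)
    have h2 := (hasDerivAt_circleMap 0 ρ (2 * Real.pi * t)).scomp t h1
    rw [show circ ρ = circleMap 0 ρ ∘ fun t => 2 * Real.pi * t from rfl, h2.deriv,
      deriv_circleMap, Complex.real_smul]
  unfold contourInt circleIntegral
  simp only [h, smul_eq_mul]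
  have h2 := intervalIntegral.integral_comp_mul_left (a := (0 : ℝ)) (b := 1)
    (fun θ => deriv (circleMap 0 ρ) θ * f (circleMap 0 ρ θ))
    (c := 2 * Real.pi) (by positivity)
  rw [mul_zero, mul_one] at h2
  have h3 : (∫ θ in (0 : ℝ)..2 * Real.pi, deriv (circleMap 0 ρ) θ * f (circleMap 0 ρ θ)) =
      (2 * Real.pi : ℝ) • ∫ t in (0 : ℝ)..1, deriv (circleMap 0 ρ) (2 * Real.pi * t) *
        f (circleMap 0 ρ (2 * Real.pi * t)) := by
    rw [h2, smul_smul, mul_inv_cancel₀ (by positivity), one_smul]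
  rw [h3, ← intervalIntegral.integral_smul]
  refine intervalIntegral.integral_congr fun t _ => ?_
  simp only [circ, Complex.real_smul]
  ring

theorem norm_of_mem_trace_circ {ρ : ℝ} (hρ : 0 ≤ ρ) {w : ℂ} (hw : w ∈ trace (circ ρ)) :
    ‖w‖ = ρ := by
  obtain ⟨t, -, rfl⟩ := hw
  rw [circ, norm_circleMap_zero, abs_of_nonneg hρ]

theorem winding_circ_of_lt {ρ : ℝ} {a : ℂ} (h : ‖a‖ < ρ) : winding (circ ρ) a = 1 := by
  unfold winding
  rw [contourInt_circ, circleIntegral.integral_sub_inv_of_mem_ball (by simpa using h),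
    inv_mul_cancel₀ two_pi_I_ne_zero]

theorem winding_circ_of_gt {ρ : ℝ} (hρ : 0 ≤ ρ) {a : ℂ} (h : ρ < ‖a‖) :
    winding (circ ρ) a = 0 := by
  have hn : ∀ w ∈ Metric.ball (0 : ℂ) ‖a‖, w - a ≠ 0 := fun w hw h0 => by
    rw [mem_ball_zero_iff, sub_eq_zero.1 h0] at hw
    exact lt_irrefl _ hw
  unfold winding
  rw [contourInt_eq_zero_of_ball (isLoop_circ ρ) (c := 0) (R := ‖a‖) (f := fun w => (w - a)⁻¹)
    (fun w hw => by rw [mem_ball_zero_iff, norm_of_mem_trace_circ hρ hw]; exact h)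
    (DifferentiableOn.inv (by fun_prop) hn), mul_zero]

/-- The function whose level sets are the ellipses with foci `l` and `r`. -/
noncomputable def lvl (l r : ℝ) (z : ℂ) : ℝ := ‖z - l‖ + ‖z - r‖

theorem continuous_lvl (l r : ℝ) : Continuous (lvl l r) := by unfold lvl; fun_prop

theorem lvl_le_add (l r : ℝ) (z w : ℂ) : lvl l r z ≤ lvl l r w + 2 * ‖z - w‖ := by
  have h1 := norm_sub_le_norm_sub_add_norm_sub z w (l : ℂ)
  have h2 := norm_sub_le_norm_sub_add_norm_sub z w (r : ℂ)
  unfold lvl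
  linarith

theorem lvl_of_mem_seg {l r : ℝ} {z : ℂ} (h : z ∈ seg l r) : lvl l r z = r - l := by
  obtain ⟨t, ⟨h1, h2⟩, rfl⟩ := h
  simp only [lvl]
  rw [← Complex.ofReal_sub, ← Complex.ofReal_sub, Complex.norm_real, Complex.norm_real,
    Real.norm_of_nonneg (by linarith), Real.norm_of_nonpos (by linarith)]
  ring

theorem isCompact_lvl_le (l r s : ℝ) : IsCompact {z | lvl l r z ≤ s} := by
  refine Metric.isCompact_of_isClosed_isBounded
    (isClosed_le (continuous_lvl l r) continuous_const) ?_
  refine (Metric.isBounded_closedBall (x := (l : ℂ)) (r := s)).subset fun z hz => ?_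
  rw [Metric.mem_closedBall, dist_eq_norm]
  have : lvl l r z ≤ s := hz
  unfold lvl at this
  linarith [norm_nonneg (z - r)]

theorem isOpen_lvl_lt (l r s : ℝ) : IsOpen {z | lvl l r z < s} :=
  isOpen_lt (continuous_lvl l r) continuous_const

theorem isOpen_lt_lvl (l r s : ℝ) : IsOpen {z | s < lvl l r z} :=
  isOpen_lt continuous_const (continuous_lvl l r)

/-- The Joukowski map of the complement of the unit disk to the complement of `[l, r]`. -/
noncomputable def jouk (l r : ℝ) (ζ : ℂ) : ℂ := (l + r) / 2 + (r - l) / 4 * (ζ + ζ⁻¹)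

theorem lvl_jouk {l r : ℝ} (hlr : l < r) {ζ : ℂ} (hζ : ζ ≠ 0) :
    lvl l r (jouk l r ζ) = (r - l) / 2 * (‖ζ‖ + ‖ζ‖⁻¹) := by
  have hn : ‖ζ‖ ≠ 0 := norm_ne_zero_iff.2 hζ
  have h1 : jouk l r ζ - l = ((r - l) / 4 : ℝ) * (ζ + 1) ^ 2 / ζ := by
    unfold jouk; push_cast; field_simp; ring
  have h2 : jouk l r ζ - r = ((r - l) / 4 : ℝ) * (ζ - 1) ^ 2 / ζ := by
    unfold jouk; push_cast; field_simp; ring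
  have h3 := parallelogram_law_with_norm ℝ ζ 1
  rw [norm_one] at h3
  unfold lvl
  rw [h1, h2, norm_div, norm_div, norm_mul, norm_mul, norm_pow, norm_pow, Complex.norm_real,
    Real.norm_of_nonneg (by linarith)]
  field_simp
  linear_combination (2 * (r - l)) * h3

theorem exists_jouk {l r : ℝ} (hlr : l < r) (a : ℂ) : ∃ ζ : ℂ, 1 ≤ ‖ζ‖ ∧ jouk l r ζ = a := by
  have hk : ((r : ℂ) - l) ≠ 0 := by
    rw [← Complex.ofReal_sub]; exact_mod_cast (sub_pos.2 hlr).ne'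
  set u : ℂ := (a - (l + r) / 2) / ((r - l) / 4) with hu
  obtain ⟨v, hv⟩ := IsAlgClosed.exists_pow_nat_eq (u ^ 2 - 4) (n := 2) (by norm_num)
  have hq : ((u + v) / 2) * ((u - v) / 2) = 1 := by linear_combination (-1 / 4) * hv
  have key : ∀ x y : ℂ, x * y = 1 → x + y = u → jouk l r x = a := by
    intro x y hxy hs
    have : x⁻¹ = y := (eq_inv_of_mul_eq_one_right hxy).symm
    rw [jouk, this, hs, hu]
    field_simp
    ring
  rcases le_or_gt 1 ‖(u + v) / 2‖ with h | h
  · exact ⟨_, h, key _ _ hq (by ring)⟩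
  · refine ⟨(u - v) / 2, ?_, key _ _ (by rw [mul_comm, hq]) (by ring)⟩
    have := congrArg norm hq
    rw [norm_mul, norm_one] at this
    by_contra! h'
    nlinarith [norm_nonneg ((u + v) / 2), norm_nonneg ((u - v) / 2)]

/-- The parameter of the ellipse `lvl l r = s`. -/
noncomputable def ellRad (l r s : ℝ) : ℝ :=
  (2 * s / (r - l) + √((2 * s / (r - l)) ^ 2 - 4)) / 2

theorem ellRad_spec {l r s : ℝ} (hlr : l < r) (hs : r - l < s) :
    1 < ellRad l r s ∧ (r - l) / 2 * (ellRad l r s + (ellRad l r s)⁻¹) = s := by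
  have h0 : 0 < r - l := sub_pos.2 hlr
  set t := 2 * s / (r - l) with ht
  have h2 : 2 < t := by rw [ht, lt_div_iff₀ h0]; linarith
  have h3 : 0 ≤ t ^ 2 - 4 := by nlinarith
  have h4 := Real.sq_sqrt h3
  have h5 := Real.sqrt_nonneg (t ^ 2 - 4)
  have h1 : 1 < ellRad l r s := by unfold ellRad; rw [← ht]; linarith
  refine ⟨h1, ?_⟩
  have h6 : (ellRad l r s)⁻¹ = (t - √(t ^ 2 - 4)) / 2 := by
    refine (eq_inv_of_mul_eq_one_right ?_).symm
    unfold ellRad; rw [← ht]; linear_combination (-1 / 4) * h4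
  rw [h6]
  unfold ellRad
  rw [← ht, ht]
  field_simp
  ring

/-- The positively oriented ellipse `lvl l r = s`. -/
noncomputable def ell (l r s : ℝ) : ℝ → ℂ := fun t => jouk l r (circ (ellRad l r s) t)

theorem differentiableOn_jouk (l r : ℝ) : DifferentiableOn ℂ (jouk l r) {0}ᶜ := by
  unfold jouk
  exact (differentiableOn_const _).add
    ((differentiableOn_id.add (differentiableOn_inv)).const_mul _)

theorem trace_circ_subset {ρ : ℝ} (h : 1 < ρ) : trace (circ ρ) ⊆ {0}ᶜ := fun w hw h0 => by
  have := norm_of_mem_trace_circ (by linarith) hw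
  rw [h0, norm_zero] at this
  linarith

theorem isLoop_ell {l r s : ℝ} (hlr : l < r) (hs : r - l < s) : IsLoop (ell l r s) :=
  (isLoop_circ _).comp_holo isOpen_compl_singleton (trace_circ_subset (ellRad_spec hlr hs).1)
    (differentiableOn_jouk l r)

theorem lvl_of_mem_trace_ell {l r s : ℝ} (hlr : l < r) (hs : r - l < s) {w : ℂ}
    (hw : w ∈ trace (ell l r s)) : lvl l r w = s := by
  obtain ⟨h1, h2⟩ := ellRad_spec hlr hs
  obtain ⟨t, ht, rfl⟩ := hw
  have h3 := norm_of_mem_trace_circ (by linarith) (mem_trace (γ := circ (ellRad l r s)) ht)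
  simp only [ell]
  rw [lvl_jouk hlr (norm_ne_zero_iff.1 (by rw [h3]; linarith)), h3, h2]

theorem winding_ell {l r s : ℝ} (hlr : l < r) (hs : r - l < s) {ζ : ℂ} (hζ : 1 ≤ ‖ζ‖)
    (hne : ‖ζ‖ ≠ ellRad l r s) :
    winding (ell l r s) (jouk l r ζ) = winding (circ (ellRad l r s)) ζ := by
  obtain ⟨h1, -⟩ := ellRad_spec hlr hs
  set ρ := ellRad l r s
  have hk : ((r : ℂ) - l) ≠ 0 := by
    rw [← Complex.ofReal_sub]; exact_mod_cast (sub_pos.2 hlr).ne'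
  have hζ0 : ζ ≠ 0 := norm_ne_zero_iff.1 (by linarith)
  have hinv : ‖ζ⁻¹‖ < ρ := by
    rw [norm_inv]; exact (inv_le_one_of_one_le₀ hζ).trans_lt h1
  have hoff : ∀ a : ℂ, ‖a‖ ≠ ρ → a ∉ trace (circ ρ) := fun a ha h =>
    ha (norm_of_mem_trace_circ (by linarith) h)
  have w1 := winding_circ_of_lt hinv
  have w0 : winding (circ ρ) 0 = 1 := winding_circ_of_lt (by rw [norm_zero]; linarith)
  have hγ := (isLoop_circ ρ).pwC1
  have c1 := continuousOn_sub_inv (hoff ζ hne)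
  have c2 := continuousOn_sub_inv (hoff ζ⁻¹ hinv.ne)
  have c3 := continuousOn_sub_inv (hoff 0 (by rw [norm_zero]; linarith))
  have key : contourInt (ell l r s) (fun w => (w - jouk l r ζ)⁻¹) =
      contourInt (circ ρ) (fun w => (w - ζ)⁻¹) + contourInt (circ ρ) (fun w => (w - ζ⁻¹)⁻¹) -
        contourInt (circ ρ) (fun w => (w - 0)⁻¹) := by
    rw [← contourInt_add hγ c1 c2, ← contourInt_sub hγ (f := fun w => (w - ζ)⁻¹ + (w - ζ⁻¹)⁻¹) (c1.add c2) c3]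
    unfold ell
    rw [contourInt_comp_holo hγ isOpen_compl_singleton (trace_circ_subset h1)
      (differentiableOn_jouk l r)]
    refine contourInt_congr fun w hw => ?_
    have hw0 : w ≠ 0 := trace_circ_subset h1 hw
    have hwn := norm_of_mem_trace_circ (by linarith) hw
    have hw1 : w - ζ ≠ 0 := fun h => hne (by rw [← hwn, sub_eq_zero.1 h])
    have hw2 : w - ζ⁻¹ ≠ 0 := fun h => hinv.ne (by rw [← hwn, sub_eq_zero.1 h])
    have hw2' : w * ζ - 1 ≠ 0 := fun h => hw2 (by
      rw [sub_eq_zero] at h ⊢; exact (eq_inv_of_mul_eq_one_left h))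
    have hd : HasDerivAt (jouk l r) ((r - l) / 4 * (1 + -(w ^ 2)⁻¹)) w := by
      unfold jouk
      exact (((hasDerivAt_id w).add (hasDerivAt_inv hw0)).const_mul _).const_add _
    have e1 : jouk l r w - jouk l r ζ = (r - l) / 4 * ((w - ζ) * (w * ζ - 1) / (w * ζ)) := by
      unfold jouk; field_simp; ring
    have e2 : w - ζ⁻¹ = (w * ζ - 1) / ζ := by field_simp
    rw [hd.deriv, e1, e2, sub_zero]
    field_simp
    ring
  unfold winding at w1 w0 ⊢
  rw [key, mul_sub, mul_add, w1, w0]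
  ring

theorem winding_ell_of_lt {l r s : ℝ} (hlr : l < r) (hs : r - l < s) {a : ℂ}
    (ha : lvl l r a < s) : winding (ell l r s) a = 1 := by
  obtain ⟨h1, h2⟩ := ellRad_spec hlr hs
  obtain ⟨ζ, hζ, rfl⟩ := exists_jouk hlr a
  have h0 : 0 < r - l := sub_pos.2 hlr
  have hζ0 : 0 < ‖ζ‖ := by linarith
  rw [lvl_jouk hlr (norm_pos_iff.1 hζ0), ← h2] at ha
  have hlt : ‖ζ‖ < ellRad l r s := by
    by_contra! h
    have h3 : ‖ζ‖ + ‖ζ‖⁻¹ < ellRad l r s + (ellRad l r s)⁻¹ :=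
      lt_of_mul_lt_mul_left ha (by positivity)
    have h4 : ellRad l r s * ‖ζ‖ * (‖ζ‖ + ‖ζ‖⁻¹) <
        ellRad l r s * ‖ζ‖ * (ellRad l r s + (ellRad l r s)⁻¹) :=
      mul_lt_mul_of_pos_left h3 (by positivity)
    have h5 : ellRad l r s * ‖ζ‖ * (‖ζ‖ + ‖ζ‖⁻¹) = ellRad l r s * (‖ζ‖ * ‖ζ‖ + 1) := by
      field_simp
    have h6 : ellRad l r s * ‖ζ‖ * (ellRad l r s + (ellRad l r s)⁻¹) =
        ‖ζ‖ * (ellRad l r s * ellRad l r s + 1) := by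
      field_simp
    rw [h5, h6] at h4
    have h7 : 1 ≤ ellRad l r s * ‖ζ‖ := by nlinarith
    nlinarith [mul_nonneg (sub_nonneg.2 h) (sub_nonneg.2 h7)]
  rw [winding_ell hlr hs hζ hlt.ne, winding_circ_of_lt hlt]

theorem winding_ell_of_gt {l r s : ℝ} (hlr : l < r) (hs : r - l < s) {a : ℂ}
    (ha : s < lvl l r a) : winding (ell l r s) a = 0 := by
  obtain ⟨h1, h2⟩ := ellRad_spec hlr hs
  obtain ⟨ζ, hζ, rfl⟩ := exists_jouk hlr a
  have h0 : 0 < r - l := sub_pos.2 hlr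
  have hζ0 : 0 < ‖ζ‖ := by linarith
  rw [lvl_jouk hlr (norm_pos_iff.1 hζ0), ← h2] at ha
  have hlt : ellRad l r s < ‖ζ‖ := by
    by_contra! h
    have h3 : ellRad l r s + (ellRad l r s)⁻¹ < ‖ζ‖ + ‖ζ‖⁻¹ :=
      lt_of_mul_lt_mul_left ha (by positivity)
    have h4 : ellRad l r s * ‖ζ‖ * (ellRad l r s + (ellRad l r s)⁻¹) <
        ellRad l r s * ‖ζ‖ * (‖ζ‖ + ‖ζ‖⁻¹) :=
      mul_lt_mul_of_pos_left h3 (by positivity)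
    have h5 : ellRad l r s * ‖ζ‖ * (‖ζ‖ + ‖ζ‖⁻¹) = ellRad l r s * (‖ζ‖ * ‖ζ‖ + 1) := by
      field_simp
    have h6 : ellRad l r s * ‖ζ‖ * (ellRad l r s + (ellRad l r s)⁻¹) =
        ‖ζ‖ * (ellRad l r s * ellRad l r s + 1) := by
      field_simp
    rw [h5, h6] at h4
    have h7 : 1 ≤ ellRad l r s * ‖ζ‖ := by nlinarith
    nlinarith [mul_nonneg (sub_nonneg.2 h) (sub_nonneg.2 h7)]
  rw [winding_ell hlr hs hζ hlt.ne', winding_circ_of_gt (by linarith) hlt]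

theorem lt_lvl_of_notMem_seg {l r : ℝ} (hlr : l < r) {a : ℂ} (ha : a ∉ seg l r) :
    r - l < lvl l r a := by
  obtain ⟨ζ, hζ, rfl⟩ := exists_jouk hlr a
  have h0 : 0 < r - l := sub_pos.2 hlr
  have hζ0 : 0 < ‖ζ‖ := by linarith
  rw [lvl_jouk hlr (norm_pos_iff.1 hζ0)]
  by_contra! h
  have h3 : ‖ζ‖ + ‖ζ‖⁻¹ ≤ 2 := by
    by_contra! h'
    nlinarith
  have h4 : ‖ζ‖ * (‖ζ‖ + ‖ζ‖⁻¹) = ‖ζ‖ * ‖ζ‖ + 1 := by field_simp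
  have h5 : ‖ζ‖ = 1 := by
    have : (‖ζ‖ - 1) ^ 2 ≤ 0 := by nlinarith
    nlinarith [sq_nonneg (‖ζ‖ - 1)]
  apply ha
  have h6 : ζ⁻¹ = starRingEnd ℂ ζ := by
    rw [Complex.inv_def, Complex.normSq_eq_norm_sq, h5]; simp
  have h7 := Complex.abs_re_le_norm ζ
  rw [h5, abs_le] at h7
  refine ⟨(l + r) / 2 + (r - l) / 4 * (2 * ζ.re), ⟨by nlinarith, by nlinarith⟩, ?_⟩
  unfold jouk
  rw [h6, Complex.add_conj]
  push_cast
  ring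

end

section

/-- An injective holomorphic function with nowhere vanishing derivative on an open set. -/
structure Conformal (Λ : Set ℂ) (b : ℂ → ℂ) : Prop where
  isOpen : IsOpen Λ
  holo : DifferentiableOn ℂ b Λ
  inj : InjOn b Λ
  deriv_ne : ∀ z ∈ Λ, deriv b z ≠ 0

/-- The Cauchy kernel `b'(w) / (b(w) - b(a))`. -/
noncomputable def cauchyKer (b : ℂ → ℂ) (w a : ℂ) : ℂ := deriv b w / (b w - b a)

namespace Conformal

variable {Λ : Set ℂ} {b : ℂ → ℂ}

theorem differentiableAt (h : Conformal Λ b) {z : ℂ} (hz : z ∈ Λ) : DifferentiableAt ℂ b z :=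
  h.holo.differentiableAt (h.isOpen.mem_nhds hz)

theorem deriv_holo (h : Conformal Λ b) : DifferentiableOn ℂ (deriv b) Λ := h.holo.deriv h.isOpen

theorem sub_ne (h : Conformal Λ b) {w a : ℂ} (hw : w ∈ Λ) (ha : a ∈ Λ) (hwa : w ≠ a) :
    b w - b a ≠ 0 := fun h0 => hwa (h.inj hw ha (sub_eq_zero.1 h0))

theorem dslope_ne (h : Conformal Λ b) {w a : ℂ} (hw : w ∈ Λ) (ha : a ∈ Λ) :
    dslope b a w ≠ 0 := by
  by_cases hwa : w = a
  · rw [hwa, dslope_same]; exact h.deriv_ne a ha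
  · rw [dslope_of_ne _ hwa, slope_def_field]
    exact div_ne_zero (h.sub_ne hw ha hwa) (sub_ne_zero.2 hwa)

theorem dslope_holo (h : Conformal Λ b) {a : ℂ} (ha : a ∈ Λ) :
    DifferentiableOn ℂ (dslope b a) Λ :=
  (Complex.differentiableOn_dslope (h.isOpen.mem_nhds ha)).2 h.holo

theorem quot_holo (h : Conformal Λ b) {a : ℂ} (ha : a ∈ Λ) :
    DifferentiableOn ℂ (fun w => deriv b w / dslope b a w) Λ :=
  h.deriv_holo.div (h.dslope_holo ha) fun _ hw => h.dslope_ne hw ha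

theorem cauchyKer_eq (h : Conformal Λ b) {w a : ℂ} (hw : w ∈ Λ) (ha : a ∈ Λ) (hwa : w ≠ a) :
    cauchyKer b w a = deriv b w / dslope b a w * (w - a)⁻¹ := by
  have h1 := h.sub_ne hw ha hwa
  have h2 : w - a ≠ 0 := sub_ne_zero.2 hwa
  rw [cauchyKer, dslope_of_ne _ hwa, slope_def_field]
  field_simp

theorem cauchyKer_holo_left (h : Conformal Λ b) {a : ℂ} (ha : a ∈ Λ) :
    DifferentiableOn ℂ (fun w => cauchyKer b w a) (Λ \ {a}) :=
  (h.deriv_holo.mono sdiff_subset).div ((h.holo.mono sdiff_subset).sub_const _)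
    fun _ hw => h.sub_ne hw.1 ha hw.2

theorem cauchyKer_holo_right (h : Conformal Λ b) {w : ℂ} (hw : w ∈ Λ) :
    DifferentiableOn ℂ (fun a => cauchyKer b w a) (Λ \ {w}) :=
  (differentiableOn_const _).div ((h.holo.mono sdiff_subset).const_sub _)
    fun _ ha => h.sub_ne hw ha.1 (Ne.symm ha.2)

theorem continuousOn_cauchyKer (h : Conformal Λ b) {S T : Set ℂ} (hS : S ⊆ Λ) (hT : T ⊆ Λ)
    (hST : Disjoint S T) : ContinuousOn (Function.uncurry (cauchyKer b)) (S ×ˢ T) := by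
  have h1 : ContinuousOn b Λ := h.holo.continuousOn
  have h2 : ContinuousOn (deriv b) Λ := h.deriv_holo.continuousOn
  refine ContinuousOn.div (h2.comp continuousOn_fst fun p hp => hS hp.1)
    ((h1.comp continuousOn_fst fun p hp => hS hp.1).sub
      (h1.comp continuousOn_snd fun p hp => hT hp.2)) fun p hp => ?_
  exact h.sub_ne (hS hp.1) (hT hp.2) fun h0 => disjoint_left.1 hST hp.1 (h0 ▸ hp.2)

/-- Cauchy's integral formula with the kernel `b'(w) / (b(w) - b(a))`, for two loops. -/
theorem cauchy_pair (h : Conformal Λ b) {V : Set ℂ} (hV : IsOpen V) (hVΛ : V ⊆ Λ)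
    {γ₁ γ₂ : ℝ → ℂ} (h₁ : IsLoop γ₁) (h₂ : IsLoop γ₂) (t₁ : trace γ₁ ⊆ V) (t₂ : trace γ₂ ⊆ V)
    (hw : ∀ a, a ∉ V → winding γ₁ a = winding γ₂ a) {f : ℂ → ℂ} (hf : DifferentiableOn ℂ f V)
    {z : ℂ} (hz : z ∈ V) (hz₁ : z ∉ trace γ₁) (hz₂ : z ∉ trace γ₂) :
    contourInt γ₁ (fun w => f w * cauchyKer b w z) -
      contourInt γ₂ (fun w => f w * cauchyKer b w z) =
      2 * Real.pi * Complex.I * (winding γ₁ z - winding γ₂ z) * f z := by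
  have key := contourInt_cauchy hV h₁ h₂ t₁ t₂ hw
    (f := fun w => f w * (deriv b w / dslope b z w))
    (hf.mul ((h.quot_holo (hVΛ hz)).mono hVΛ)) hz hz₁ hz₂
  simp only [dslope_same, div_self (h.deriv_ne z (hVΛ hz)), mul_one] at key
  have aux : ∀ γ, trace γ ⊆ V → z ∉ trace γ →
      contourInt γ (fun w => f w * cauchyKer b w z) =
      contourInt γ (fun w => f w * (deriv b w / dslope b z w) * (w - z)⁻¹) := fun γ ht hzγ =>
    contourInt_congr fun w hw => by
      rw [h.cauchyKer_eq (hVΛ (ht hw)) (hVΛ hz) (fun h0 => hzγ (h0 ▸ hw)), mul_assoc]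
  rw [aux _ t₁ hz₁, aux _ t₂ hz₂]
  exact key

theorem cauchy (h : Conformal Λ b) {V : Set ℂ} (hV : IsOpen V) (hVΛ : V ⊆ Λ)
    {γ : ℝ → ℂ} (hγ : IsLoop γ) (t : trace γ ⊆ V) (hw : ∀ a, a ∉ V → winding γ a = 0)
    {f : ℂ → ℂ} (hf : DifferentiableOn ℂ f V) {z : ℂ} (hz : z ∈ V) (hzγ : z ∉ trace γ) :
    contourInt γ (fun w => f w * cauchyKer b w z) =
      2 * Real.pi * Complex.I * winding γ z * f z := by
  have h0 : ∀ a, winding (fun _ => γ 0) a = 0 := fun a => by simp [winding, contourInt_const]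
  have ht : trace (fun _ => γ 0) ⊆ trace γ := by
    rintro _ ⟨s, -, rfl⟩; exact mem_trace (by simp)
  have := h.cauchy_pair hV hVΛ hγ (isLoop_const (γ 0)) t (ht.trans t)
    (fun a ha => by rw [hw a ha, h0]) hf hz hzγ (fun h' => hzγ (ht h'))
  rw [contourInt_const, h0] at this
  simpa using this

theorem winding_comp (h : Conformal Λ b) {γ : ℝ → ℂ} (hγ : IsLoop γ) (t : trace γ ⊆ Λ)
    (hw : ∀ a, a ∉ Λ → winding γ a = 0) {z : ℂ} (hz : z ∈ Λ) (hzγ : z ∉ trace γ) :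
    winding (fun s => b (γ s)) (b z) = winding γ z := by
  have := h.cauchy h.isOpen subset_rfl hγ t hw (differentiableOn_const (c := (1 : ℂ))) hz hzγ
  rw [winding, contourInt_comp_holo hγ.pwC1 h.isOpen t h.holo]
  have e : contourInt γ (fun w => (b w - b z)⁻¹ * deriv b w) =
      contourInt γ (fun w => 1 * cauchyKer b w z) :=
    contourInt_congr fun w _ => by rw [cauchyKer]; ring
  rw [e, this, mul_one, ← mul_assoc, inv_mul_cancel₀ two_pi_I_ne_zero, one_mul]

end Conformal

/-- `f` is a function of `b`, holomorphic off `b(S)`, with limit `c` at infinity. -/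
def IsOuter (Λ : Set ℂ) (b : ℂ → ℂ) (S : Set ℂ) (f : ℂ → ℂ) (c : ℂ) : Prop :=
  ∃ F : ℂ → ℂ, DifferentiableOn ℂ F (b '' S)ᶜ ∧ Tendsto F (cocompact ℂ) (𝓝 c) ∧
    ∀ w ∈ Λ \ S, f w = F (b w)

theorem trace_comp (b : ℂ → ℂ) (γ : ℝ → ℂ) : trace (fun s => b (γ s)) = b '' trace γ := by
  unfold trace; rw [image_image]

theorem tendsto_contourInt_circ {F : ℂ → ℂ} {c : ℂ} (hF : Tendsto F (cocompact ℂ) (𝓝 c)) (β : ℂ)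
    {ρ₀ : ℝ} (hd : ∀ ρ, ρ₀ < ρ → ContinuousOn F (trace (circ ρ))) :
    Tendsto (fun ρ => contourInt (circ ρ) (fun w => F w * (w - β)⁻¹)) atTop
      (𝓝 (2 * Real.pi * Complex.I * c)) := by
  rw [tendsto_iff_norm_sub_tendsto_zero]
  have hsm : ∀ δ > 0, ∃ R, ∀ w : ℂ, R ≤ ‖w‖ → ‖F w - c‖ ≤ δ := by
    intro δ hδ
    have h1 := hF.eventually (Metric.closedBall_mem_nhds c hδ)
    rw [← Metric.cobounded_eq_cocompact, ← comap_norm_atTop, eventually_comap] at h1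
    obtain ⟨R, hR⟩ := eventually_atTop.1 h1
    exact ⟨R, fun w hw => by simpa [dist_eq_norm] using hR _ hw w rfl⟩
  rw [Metric.tendsto_atTop]
  intro ε hε
  obtain ⟨R, hR⟩ := hsm (ε / (8 * Real.pi)) (by positivity)
  refine ⟨max (max R (ρ₀ + 1)) (2 * ‖β‖ + 1), fun ρ hρ => ?_⟩
  have h1 : R ≤ ρ := ((le_max_left _ _).trans (le_max_left _ _)).trans hρ
  have h2 : ρ₀ + 1 ≤ ρ := ((le_max_right _ _).trans (le_max_left _ _)).trans hρ
  have h3 : 2 * ‖β‖ + 1 ≤ ρ := (le_max_right _ _).trans hρ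
  have hβ := norm_nonneg β
  have h0 : 0 < ρ := by linarith
  have hw : winding (circ ρ) β = 1 := winding_circ_of_lt (by linarith)
  have hβt : β ∉ trace (circ ρ) := fun h => by
    have := norm_of_mem_trace_circ h0.le h; linarith
  have hc := continuousOn_sub_inv hβt
  have e : contourInt (circ ρ) (fun w => F w * (w - β)⁻¹) - 2 * Real.pi * Complex.I * c =
      contourInt (circ ρ) (fun w => (F w - c) * (w - β)⁻¹) := by
    simp only [sub_mul]
    rw [contourInt_sub (isLoop_circ ρ).pwC1 (f := fun w => F w * (w - β)⁻¹)
      (g := fun w => c * (w - β)⁻¹) ((hd ρ (by linarith)).mul hc)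
      (continuousOn_const.mul hc), contourInt_const_mul, contourInt_sub_inv, hw]
    ring
  rw [e, Real.dist_eq, sub_zero, abs_norm, contourInt_circ]
  refine (circleIntegral.norm_integral_le_of_norm_le_const h0.le
    (C := ε / (8 * Real.pi) * (2 / ρ)) fun w hw => ?_).trans_lt ?_
  · have hwn : ‖w‖ = ρ := by simpa using hw
    rw [norm_mul, norm_inv]
    refine mul_le_mul (hR w (by rw [hwn]; exact h1)) ?_ (by positivity) (by positivity)
    rw [inv_le_comm₀ _ (by positivity), inv_div]
    · linarith [norm_sub_norm_le w β]
    · linarith [norm_sub_norm_le w β]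
  · have : 2 * Real.pi * ρ * (ε / (8 * Real.pi) * (2 / ρ)) = ε / 2 := by
      field_simp; ring
    rw [this]; linarith

theorem IsOuter.cauchy {Λ : Set ℂ} {b : ℂ → ℂ} (h : Conformal Λ b) {S : Set ℂ} (hS : IsCompact S)
    (hSΛ : S ⊆ Λ) {f : ℂ → ℂ} {c : ℂ} (hf : IsOuter Λ b S f c) {γ : ℝ → ℂ} (hγ : IsLoop γ)
    (t : trace γ ⊆ Λ \ S) (hw1 : ∀ a ∈ S, winding γ a = 1) (hw0 : ∀ a, a ∉ Λ → winding γ a = 0)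
    {z : ℂ} (hz : z ∈ Λ \ S) (hzγ : z ∉ trace γ) (hwz : winding γ z = 0) :
    contourInt γ (fun w => f w * cauchyKer b w z) = 2 * Real.pi * Complex.I * (c - f z) := by
  obtain ⟨F, hF, hFc, hfF⟩ := hf
  have tΛ : trace γ ⊆ Λ := t.trans sdiff_subset
  set Γ : ℝ → ℂ := fun s => b (γ s) with hΓ
  have hΓl : IsLoop Γ := hγ.comp_holo h.isOpen tΛ h.holo
  have hK : IsCompact (b '' S) := hS.image_of_continuousOn (h.holo.continuousOn.mono hSΛ)
  obtain ⟨R, hR0, hR⟩ := (hK.insert (b z)).isBounded.subset_ball_lt 0 0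
  have hoff : ∀ w ∈ Λ \ S, b w ∈ (b '' S)ᶜ := by
    rintro w hw ⟨s, hs, hsw⟩
    exact hw.2 (h.inj (hSΛ hs) hw.1 hsw ▸ hs)
  have hΓt : trace Γ ⊆ (b '' S)ᶜ := by
    rw [trace_comp]; rintro _ ⟨w, hw, rfl⟩; exact hoff w (t hw)
  have e1 : contourInt γ (fun w => f w * cauchyKer b w z) =
      contourInt Γ (fun w => F w * (w - b z)⁻¹) := by
    rw [hΓ, contourInt_comp_holo hγ.pwC1 h.isOpen tΛ h.holo]
    exact contourInt_congr fun w hw => by rw [hfF w (t hw), cauchyKer]; ring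
  have hct : ∀ ρ, R < ρ → trace (circ ρ) ⊆ (b '' S)ᶜ := fun ρ hρ w hw hwS => by
    have h1 := norm_of_mem_trace_circ (hR0.trans hρ).le hw
    have h2 := hR (mem_insert_of_mem _ hwS)
    rw [mem_ball_zero_iff] at h2; linarith
  have hzR : ‖b z‖ < R := by simpa using hR (mem_insert _ _)
  have e2 : ∀ ρ, R < ρ → contourInt (circ ρ) (fun w => F w * (w - b z)⁻¹) =
      contourInt Γ (fun w => F w * (w - b z)⁻¹) + 2 * Real.pi * Complex.I * F (b z) := by
    intro ρ hρ
    have := contourInt_cauchy hK.isClosed.isOpen_compl hΓl (isLoop_circ ρ) hΓt (hct ρ hρ)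
      (fun a ha => ?_) hF (hoff z hz) (fun hzt => ?_) (fun hzt => ?_)
    · rw [h.winding_comp hγ tΛ hw0 hz.1 hzγ, hwz, winding_circ_of_lt (hzR.trans hρ)] at this
      linear_combination -this
    · obtain ⟨s, hs, rfl⟩ := notMem_compl_iff.1 ha
      rw [h.winding_comp hγ tΛ hw0 (hSΛ hs) (fun h' => (t h').2 hs), hw1 s hs,
        winding_circ_of_lt]
      have := hR (mem_insert_of_mem _ (mem_image_of_mem b hs))
      rw [mem_ball_zero_iff] at this; linarith
    · rw [trace_comp] at hzt
      obtain ⟨w, hw, hwz'⟩ := hzt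
      exact hzγ (h.inj (tΛ hw) hz.1 hwz' ▸ hw)
    · have := norm_of_mem_trace_circ (hR0.trans hρ).le hzt
      linarith
  have h1 := tendsto_contourInt_circ hFc (b z) (ρ₀ := R) fun ρ hρ =>
    hF.continuousOn.mono (hct ρ hρ)
  have h2 : Tendsto (fun ρ => contourInt (circ ρ) (fun w => F w * (w - b z)⁻¹)) atTop
      (𝓝 (contourInt Γ (fun w => F w * (w - b z)⁻¹) + 2 * Real.pi * Complex.I * F (b z))) :=
    tendsto_const_nhds.congr' (by
      filter_upwards [eventually_gt_atTop R] with ρ hρ; exact (e2 ρ hρ).symm)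
  have h3 := tendsto_nhds_unique h1 h2
  rw [e1, hfF z hz]
  linear_combination -h3

namespace IsOuter

variable {Λ : Set ℂ} {b : ℂ → ℂ} {S : Set ℂ} {f g : ℂ → ℂ} {c d : ℂ}

theorem const (Λ : Set ℂ) (b : ℂ → ℂ) (S : Set ℂ) (c : ℂ) : IsOuter Λ b S (fun _ => c) c :=
  ⟨fun _ => c, differentiableOn_const _, tendsto_const_nhds, fun _ _ => rfl⟩

theorem add (hf : IsOuter Λ b S f c) (hg : IsOuter Λ b S g d) :
    IsOuter Λ b S (fun w => f w + g w) (c + d) := by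
  obtain ⟨F, h1, h2, h3⟩ := hf
  obtain ⟨G, h4, h5, h6⟩ := hg
  exact ⟨fun w => F w + G w, h1.add h4, h2.add h5, fun w hw => by simp only [h3 w hw, h6 w hw]⟩

theorem mul (hf : IsOuter Λ b S f c) (hg : IsOuter Λ b S g d) :
    IsOuter Λ b S (fun w => f w * g w) (c * d) := by
  obtain ⟨F, h1, h2, h3⟩ := hf
  obtain ⟨G, h4, h5, h6⟩ := hg
  exact ⟨fun w => F w * G w, h1.mul h4, h2.mul h5, fun w hw => by simp only [h3 w hw, h6 w hw]⟩

theorem exp (hf : IsOuter Λ b S f c) :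
    IsOuter Λ b S (fun w => Complex.exp (f w)) (Complex.exp c) := by
  obtain ⟨F, h1, h2, h3⟩ := hf
  exact ⟨fun w => Complex.exp (F w), h1.cexp, (Complex.continuous_exp.tendsto c).comp h2,
    fun w hw => by simp only [h3 w hw]⟩

theorem sum {ι : Type*} (s : Finset ι) {f : ι → ℂ → ℂ} {c : ι → ℂ}
    (hf : ∀ i ∈ s, IsOuter Λ b S (f i) (c i)) :
    IsOuter Λ b S (fun w => ∑ i ∈ s, f i w) (∑ i ∈ s, c i) := by
  classical
  induction s using Finset.induction_on with
  | empty => simpa using const Λ b S 0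
  | insert a s ha ih =>
    simp only [Finset.sum_insert ha]
    exact (hf a (Finset.mem_insert_self _ _)).add
      (ih fun i hi => hf i (Finset.mem_insert_of_mem hi))

theorem congr (hf : IsOuter Λ b S f c) (h : ∀ w ∈ Λ \ S, f w = g w) : IsOuter Λ b S g c := by
  obtain ⟨F, h1, h2, h3⟩ := hf
  exact ⟨F, h1, h2, fun w hw => by rw [← h w hw, h3 w hw]⟩

theorem neg (hf : IsOuter Λ b S f c) : IsOuter Λ b S (fun w => -f w) (-c) := by
  simpa using (const Λ b S (-1)).mul hf

theorem sub (hf : IsOuter Λ b S f c) (hg : IsOuter Λ b S g d) :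
    IsOuter Λ b S (fun w => f w - g w) (c - d) := by
  simpa [sub_eq_add_neg] using hf.add hg.neg

theorem differentiableOn (hf : IsOuter Λ b S f c) (h : Conformal Λ b)
    (hSΛ : S ⊆ Λ) : DifferentiableOn ℂ f (Λ \ S) := by
  obtain ⟨F, h1, -, h3⟩ := hf
  refine DifferentiableOn.congr (f := fun w => F (b w)) (h1.comp (h.holo.mono sdiff_subset) ?_) h3
  rintro w hw ⟨s, hs, hsw⟩
  exact hw.2 (h.inj (hSΛ hs) hw.1 hsw ▸ hs)

/-- Cauchy transforms of densities on a curve are outer functions. -/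
theorem intervalIntegral {y g : ℝ → ℂ} {α β : ℝ} (hαβ : α ≤ β) (hy : ContinuousOn y (Icc α β))
    (hyS : ∀ t ∈ Icc α β, y t ∈ b '' S) (hSc : IsCompact (b '' S))
    (hg : IntervalIntegrable g volume α β) :
    IsOuter Λ b S (fun w => ∫ t in α..β, (b w - y t)⁻¹ * g t) 0 := by
  have hne : ∀ p ∈ (b '' S)ᶜ, ∀ t ∈ Icc α β, p - y t ≠ 0 := fun p hp t ht h0 =>
    hp (by rw [sub_eq_zero.1 h0]; exact hyS t ht)
  refine ⟨fun p => ∫ t in α..β, (p - y t)⁻¹ * g t, fun p hp => ?_, ?_, fun _ _ => rfl⟩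
  · refine (hasDerivAt_intervalIntegral hSc.isClosed.isOpen_compl (f := fun p t => (p - y t)⁻¹)
      hαβ ?_ (fun t ht => ?_) hg hp).differentiableAt.differentiableWithinAt
    · refine ContinuousOn.inv₀ (continuousOn_fst.sub (hy.comp continuousOn_snd fun p hp => hp.2)) ?_
      exact fun q hq => hne _ hq.1 _ hq.2
    · exact DifferentiableOn.inv (by fun_prop) fun p hp => hne p hp t ht
  · obtain ⟨R, hR0, hR⟩ := hSc.isBounded.subset_ball_lt 0 0
    have hle : ∀ᶠ p : ℂ in cocompact ℂ, ‖∫ t in α..β, (p - y t)⁻¹ * g t‖ ≤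
        (∫ t in α..β, ‖g t‖) * (‖p‖ - R)⁻¹ := by
      filter_upwards [tendsto_norm_cocompact_atTop.eventually (eventually_gt_atTop R)] with p hp
      rw [← intervalIntegral.integral_mul_const]
      refine intervalIntegral.norm_integral_le_of_norm_le hαβ ?_ (hg.norm.mul_const _)
      refine Eventually.of_forall fun t ht => ?_
      rw [norm_mul, mul_comm, norm_inv]
      refine mul_le_mul_of_nonneg_left (inv_anti₀ (by linarith) ?_) (norm_nonneg _)
      have h1 := hR (hyS t (Ioc_subset_Icc_self ht))
      rw [mem_ball_zero_iff] at h1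
      linarith [norm_sub_norm_le p (y t)]
    refine squeeze_zero_norm' hle ?_
    have h1 : Tendsto (fun z : ℂ => ‖z‖ - R) (cocompact ℂ) atTop :=
      tendsto_atTop_add_const_right _ _ tendsto_norm_cocompact_atTop
    simpa using h1.inv_tendsto_atTop.const_mul (∫ t in α..β, ‖g t‖)

theorem inv_sub (hSc : IsCompact (b '' S)) {a : ℂ} (ha : a ∈ S) :
    IsOuter Λ b S (fun w => (b w - b a)⁻¹) 0 := by
  simpa using intervalIntegral (Λ := Λ) (y := fun _ => b a) (g := fun _ => 1) zero_le_one
    continuousOn_const (fun _ _ => mem_image_of_mem b ha) hSc intervalIntegrable_const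

end IsOuter

theorem Conformal.ker_holo {Λ : Set ℂ} {b : ℂ → ℂ} (h : Conformal Λ b) {z : ℂ} (hz : z ∈ Λ) :
    DifferentiableOn ℂ (fun w => ker b w z) (Λ \ {z}) := by
  unfold ker
  exact ((h.deriv_holo.mono sdiff_subset).mul_const _).fun_div
    (((h.holo.mono sdiff_subset).sub_const _).fun_pow 2) fun w hw =>
      pow_ne_zero _ (h.sub_ne hw.1 hz hw.2)

end

section

/-- The fixed constants of the theorem, with a margin `g` for the contours around `[l, r]`. -/
structure Setting where
  θ : ℝ
  N : ℝ
  l : ℝ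
  r : ℝ
  C : ℝ
  g : ℝ
  Λ : Set ℂ
  c : Set ℂ → ℝ
  F : Set ℂ
  θ_pos : 0 < θ
  N_pos : 0 < N
  C_pos : 0 < C
  lr : l < r
  g_pos : 0 < g
  isOpen : IsOpen Λ
  c_pos : ∀ S : Set ℂ, IsCompact S → S ⊆ Λ \ seg l r → 0 < c S
  region : {z | lvl l r z ≤ r - l + 10 * g} ⊆ Λ
  F_compact : IsCompact F
  F_sub : F ⊆ Λ
  F_far : ∀ z ∈ F, r - l + 10 * g < lvl l r z

/-- The levels of the ellipses which serve as contours. -/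
def Setting.s (P : Setting) (k : ℝ) : ℝ := P.r - P.l + k * P.g

/-- The data of one step of the dynamics. -/
structure Conf (P : Setting) where
  n : ℕ
  x : Fin n → ℝ
  b : ℂ → ℂ
  φp : ℂ → ℂ
  φm : ℂ → ℂ
  adm : Admissible P.θ P.N P.l P.r P.C P.Λ P.c n x b φp φm

/-- The data of one step of the dynamics, with `ε` small and a branch `L` of `ln 𝓑`. -/
structure Step (P : Setting) extends Conf P where
  L : ℂ → ℂ
  branch : IsLogBranch (P.Λ \ seg P.l P.r) (B P.θ (P.N / n) P.l P.r b φp φm x) L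
  small : (1 + P.θ) * (P.N / n) ≤ P.g / 8

theorem Setting.s_lt {P : Setting} {j k : ℝ} (h : j < k) : P.s j < P.s k := by
  unfold Setting.s; nlinarith [P.g_pos]

theorem Setting.s_le {P : Setting} {j k : ℝ} (h : j ≤ k) : P.s j ≤ P.s k := by
  unfold Setting.s; nlinarith [P.g_pos]

theorem Setting.lt_s {P : Setting} {k : ℝ} (h : 0 < k) : P.r - P.l < P.s k := by
  unfold Setting.s; nlinarith [P.g_pos]

theorem Setting.mem_Λ {P : Setting} {z : ℂ} {k : ℝ} (hk : k ≤ 10) (h : lvl P.l P.r z ≤ P.s k) :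
    z ∈ P.Λ :=
  P.region (h.trans (P.s_le hk))

theorem Setting.lvl_gt_of_notMem {P : Setting} {z : ℂ} (h : z ∉ P.Λ) :
    P.s 10 < lvl P.l P.r z := not_le.1 fun h' => h (P.mem_Λ le_rfl h')

theorem Setting.seg_sub (P : Setting) : seg P.l P.r ⊆ P.Λ := fun _ hz =>
  P.mem_Λ (k := 1) (by norm_num) (by rw [lvl_of_mem_seg hz]; exact (P.lt_s one_pos).le)

theorem Setting.notMem_seg {P : Setting} {z : ℂ} {k : ℝ} (hk : 0 ≤ k)
    (h : P.s k < lvl P.l P.r z) : z ∉ seg P.l P.r := fun hz => by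
  rw [lvl_of_mem_seg hz] at h
  have := P.s_le hk
  simp only [Setting.s] at this h
  linarith

/-- The contour at level `k`. -/
noncomputable def Setting.con (P : Setting) (k : ℝ) : ℝ → ℂ := ell P.l P.r (P.s k)

section con
variable {P : Setting} {k : ℝ}

theorem Setting.isLoop_con (hk : 0 < k) : IsLoop (P.con k) := isLoop_ell P.lr (P.lt_s hk)

theorem Setting.lvl_con (hk : 0 < k) {w : ℂ} (hw : w ∈ trace (P.con k)) :
    lvl P.l P.r w = P.s k := lvl_of_mem_trace_ell P.lr (P.lt_s hk) hw

theorem Setting.winding_con_in (hk : 0 < k) {a : ℂ} (ha : lvl P.l P.r a < P.s k) :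
    winding (P.con k) a = 1 := winding_ell_of_lt P.lr (P.lt_s hk) ha

theorem Setting.winding_con_out (hk : 0 < k) {a : ℂ} (ha : P.s k < lvl P.l P.r a) :
    winding (P.con k) a = 0 := winding_ell_of_gt P.lr (P.lt_s hk) ha

theorem Setting.con_sub (hk : 0 < k) (hk' : k ≤ 10) : trace (P.con k) ⊆ P.Λ := fun _ hw =>
  P.mem_Λ hk' (P.lvl_con hk hw).le

theorem Setting.winding_con_off (hk : 0 < k) (hk' : k ≤ 10) (a : ℂ) (ha : a ∉ P.Λ) :
    winding (P.con k) a = 0 :=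
  P.winding_con_out hk ((P.s_le hk').trans_lt (P.lvl_gt_of_notMem ha))

theorem Setting.lvl_seg_lt (hk : 0 < k) {a : ℂ} (ha : a ∈ seg P.l P.r) :
    lvl P.l P.r a < P.s k := by rw [lvl_of_mem_seg ha]; exact P.lt_s hk

end con

namespace Conf

variable {P : Setting} (D : Conf P)

/-- The mesh `ε`. -/
noncomputable def ε : ℝ := P.N / D.n
/-- The width `εθ` of a particle. -/
noncomputable def h : ℝ := D.ε * P.θ
/-- The rescaled particle positions. -/
noncomputable def a (j : Fin D.n) : ℝ := D.ε * D.x j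
/-- The rescaled, `θ`-shifted position of the particle `j` under the jump `e`. -/
noncomputable def pt (e : Fin D.n → Fin 2) (j : Fin D.n) : ℝ := D.a j + D.h * (e j : ℕ)

theorem n_pos : 0 < D.n := D.adm.asymp.n_pos
theorem ε_pos : 0 < D.ε := div_pos P.N_pos (Nat.cast_pos.2 D.n_pos)
theorem h_pos : 0 < D.h := mul_pos D.ε_pos P.θ_pos
theorem n_mul_ε : (D.n : ℝ) * D.ε = P.N := by
  have := D.n_pos
  unfold ε; field_simp

theorem l_le_a (j : Fin D.n) : P.l ≤ D.a j := D.adm.asymp.lower j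
theorem a_add_ε_le (j : Fin D.n) : D.a j + D.ε ≤ P.r := by
  have := D.adm.asymp.upper j; unfold a ε; linarith
theorem a_add_h_le (j : Fin D.n) : D.a j + D.h ≤ P.r := D.adm.asymp.support j

theorem x_sub_ge {i j : Fin D.n} (hij : i < j) : P.θ ≤ D.x i - D.x j := by
  obtain ⟨i, hi⟩ := i
  obtain ⟨j, hj⟩ := j
  have hij' : i < j := hij
  clear hij
  induction j, hij' using Nat.le_induction with
  | base =>
    obtain ⟨k, hk⟩ := D.adm.asymp.config.2 i hj
    rw [hk]; linarith [Nat.cast_nonneg (α := ℝ) k]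
  | succ j hj' ih =>
    obtain ⟨k, hk⟩ := D.adm.asymp.config.2 j hj
    have := ih (by omega)
    linarith [Nat.cast_nonneg (α := ℝ) k, P.θ_pos]

theorem a_sub_ge {i j : Fin D.n} (hij : i < j) : D.a j + D.h ≤ D.a i := by
  have := mul_le_mul_of_nonneg_left (D.x_sub_ge hij) D.ε_pos.le
  unfold a h
  linarith

theorem a_injective : Function.Injective D.a := by
  intro i j hij
  rcases lt_trichotomy i j with h | h | h
  · linarith [D.a_sub_ge h, D.h_pos]
  · exact h
  · linarith [D.a_sub_ge h, D.h_pos]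

theorem mem_seg {t : ℝ} (h1 : P.l ≤ t) (h2 : t ≤ P.r) : (t : ℂ) ∈ seg P.l P.r := ⟨t, ⟨h1, h2⟩, rfl⟩

theorem a_mem (j : Fin D.n) : (D.a j : ℂ) ∈ seg P.l P.r :=
  mem_seg (D.l_le_a j) (by linarith [D.a_add_ε_le j, D.ε_pos])

theorem pt_zero {e : Fin D.n → Fin 2} {j : Fin D.n} (h : e j = 0) : D.pt e j = D.a j := by
  simp [pt, h]

theorem pt_one {e : Fin D.n → Fin 2} {j : Fin D.n} (h : e j = 1) : D.pt e j = D.a j + D.h := by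
  simp [pt, h]

theorem fin_two (i : Fin 2) : i = 0 ∨ i = 1 := by omega

theorem pt_bounds (e : Fin D.n → Fin 2) (j : Fin D.n) :
    D.a j ≤ D.pt e j ∧ D.pt e j ≤ D.a j + D.h := by
  have := D.h_pos
  rcases fin_two (e j) with h | h
  · rw [D.pt_zero h]; constructor <;> linarith
  · rw [D.pt_one h]; constructor <;> linarith

theorem pt_mem (e : Fin D.n → Fin 2) (j : Fin D.n) : (D.pt e j : ℂ) ∈ seg P.l P.r :=
  mem_seg (by linarith [D.l_le_a j, (D.pt_bounds e j).1])
    (by linarith [D.a_add_h_le j, (D.pt_bounds e j).2])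

theorem conf : Conformal P.Λ D.b where
  isOpen := P.isOpen
  holo := D.adm.asymp.b_holo
  inj := D.adm.asymp.b_inj
  deriv_ne z hz h0 := by
    have := D.adm.asymp.deriv_b_bound z hz
    rw [h0, norm_zero] at this
    linarith [one_div_pos.2 P.C_pos]

/-! ### The transition probabilities -/

/-- The interaction of the particles `i` and `j`. -/
noncomputable def pairFactor (e : Fin D.n → Fin 2) (i j : Fin D.n) : ℂ :=
  (D.b (D.pt e i) - D.b (D.pt e j)) / (D.b (D.a i) - D.b (D.a j))

theorem pairFactor_symm (e : Fin D.n → Fin 2) (i j : Fin D.n) :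
    D.pairFactor e i j = D.pairFactor e j i := by
  unfold pairFactor
  rw [← neg_sub (D.b (D.pt e j)), ← neg_sub (D.b (D.a j)), neg_div_neg_eq]

/-- The unnormalized weight in macroscopic coordinates. -/
noncomputable def wt (e : Fin D.n → Fin 2) : ℂ :=
  (∏ i, ∏ j ∈ Finset.Ioi i, D.pairFactor e i j) *
    ∏ i, D.φp (D.a i) ^ (e i : ℕ) * D.φm (D.a i) ^ (1 - (e i : ℕ))

theorem weight_eq (e : Fin D.n → Fin 2) :
    weight P.θ (fun ξ => D.b ((D.ε : ℝ) * ξ)) (fun ξ => D.φp ((D.ε : ℝ) * ξ))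
      (fun ξ => D.φm ((D.ε : ℝ) * ξ)) D.x e = D.wt e := by
  have h1 : ∀ i, ((D.ε : ℂ)) * ((D.x i : ℂ) + (P.θ : ℂ) * ((e i : ℕ) : ℂ)) = (D.pt e i : ℂ) := by
    intro i; unfold pt a h; push_cast; ring
  have h2 : ∀ i, ((D.ε : ℂ)) * (D.x i : ℂ) = (D.a i : ℂ) := by
    intro i; unfold a; push_cast; ring
  unfold weight wt pairFactor
  simp only [h1, h2]

/-- The transition probability. -/
noncomputable def pr (e : Fin D.n → Fin 2) : ℂ := prob P.θ D.ε D.b D.φp D.φm D.x e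

/-- The sum of the weights. -/
noncomputable def Z : ℂ := ∑ e, D.wt e

theorem Z_ne : D.Z ≠ 0 := by
  have := D.adm.normalizable
  unfold partitionZ at this
  unfold Z
  simp only [← D.weight_eq]
  exact this

theorem pr_eq (e : Fin D.n → Fin 2) : D.pr e = D.wt e / D.Z := by
  unfold pr prob transProb partitionZ Z
  simp only [D.weight_eq]

theorem sum_pr : ∑ e, D.pr e = 1 := by
  simp only [D.pr_eq, ← Finset.sum_div]
  exact div_self D.Z_ne

theorem real_of_symm {f : ℂ → ℂ} (hf : ∀ z ∈ P.Λ, f (starRingEnd ℂ z) = starRingEnd ℂ (f z))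
    {t : ℝ} (ht : (t : ℂ) ∈ P.Λ) : ((f t).re : ℂ) = f t := by
  have := hf t ht
  rw [Complex.conj_ofReal] at this
  exact Complex.conj_eq_iff_re.1 this.symm

theorem nonneg_of_realPositive {f : ℂ → ℂ} (hf : RealPositive P.Λ P.l P.r f)
    (hd : DifferentiableOn ℂ f P.Λ) {t : ℝ} (h1 : P.l ≤ t) (h2 : t < P.r) : 0 ≤ (f t).re := by
  rcases h1.eq_or_lt with rfl | h1
  · have hc : ContinuousAt (fun s : ℝ => (f s).re) P.l := by
      have hm : ((P.l : ℝ) : ℂ) ∈ P.Λ := P.seg_sub (mem_seg le_rfl h2.le)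
      have := (hd.differentiableAt (P.isOpen.mem_nhds hm)).continuousAt
      exact Complex.continuous_re.continuousAt.comp (this.comp Complex.continuous_ofReal.continuousAt)
    have h3 : Tendsto (fun s : ℝ => (f s).re) (𝓝[>] P.l) (𝓝 (f P.l).re) :=
      hc.tendsto.mono_left nhdsWithin_le_nhds
    refine ge_of_tendsto h3 ?_
    filter_upwards [Ioo_mem_nhdsGT h2] with s hs
    exact (hf.2 s hs).1.le
  · exact (hf.2 t ⟨h1, h2⟩).1.le

theorem pairFactor_nonneg (e : Fin D.n → Fin 2) {i j : Fin D.n} (hij : i < j) :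
    ∃ p : ℝ, 0 ≤ p ∧ (p : ℂ) = D.pairFactor e i j := by
  have hreal : ∀ t ∈ Icc P.l P.r, (((D.b (t : ℝ)).re : ℝ) : ℂ) = D.b (t : ℝ) := fun t ht =>
    real_of_symm D.adm.asymp.b_real (P.seg_sub (mem_seg ht.1 ht.2))
  have hcont : ContinuousOn (fun t : ℝ => (D.b t).re) (Icc P.l P.r) :=
    Complex.continuous_re.comp_continuousOn (D.conf.holo.continuousOn.comp
      Complex.continuous_ofReal.continuousOn fun t ht => P.seg_sub (mem_seg ht.1 ht.2))
  have hinj : InjOn (fun t : ℝ => (D.b t).re) (Icc P.l P.r) := by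
    intro t ht u hu htu
    have h1 : D.b (t : ℝ) = D.b (u : ℝ) := by
      rw [← hreal t ht, ← hreal u hu]; exact congrArg _ htu
    exact_mod_cast D.conf.inj (P.seg_sub (mem_seg ht.1 ht.2)) (P.seg_sub (mem_seg hu.1 hu.2)) h1
  have mema : ∀ k, D.a k ∈ Icc P.l P.r := fun k =>
    ⟨D.l_le_a k, by linarith [D.a_add_ε_le k, D.ε_pos]⟩
  have memp : ∀ k, D.pt e k ∈ Icc P.l P.r := fun k =>
    ⟨by linarith [D.l_le_a k, (D.pt_bounds e k).1], by linarith [D.a_add_h_le k, (D.pt_bounds e k).2]⟩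
  refine ⟨((D.b (D.pt e i)).re - (D.b (D.pt e j)).re) / ((D.b (D.a i)).re - (D.b (D.a j)).re),
    ?_, ?_⟩
  · have h1 : D.a j ≤ D.a i := by linarith [D.a_sub_ge hij, D.h_pos]
    have h2 : D.pt e j ≤ D.pt e i := by
      linarith [D.a_sub_ge hij, (D.pt_bounds e j).2, (D.pt_bounds e i).1]
    rcases hcont.strictMonoOn_of_injOn_Icc' P.lr.le hinj with hm | hm
    · exact div_nonneg (sub_nonneg.2 (hm.monotoneOn (memp j) (memp i) h2))
        (sub_nonneg.2 (hm.monotoneOn (mema j) (mema i) h1))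
    · exact div_nonneg_of_nonpos (sub_nonpos.2 (hm.antitoneOn (memp j) (memp i) h2))
        (sub_nonpos.2 (hm.antitoneOn (mema j) (mema i) h1))
  · unfold pairFactor
    push_cast
    rw [hreal _ (mema i), hreal _ (mema j), hreal _ (memp i), hreal _ (memp j)]

theorem wt_nonneg (e : Fin D.n → Fin 2) : ∃ p : ℝ, 0 ≤ p ∧ (p : ℂ) = D.wt e := by
  have hφ : ∀ f : ℂ → ℂ, RealPositive P.Λ P.l P.r f → DifferentiableOn ℂ f P.Λ → ∀ i,
      ∃ p : ℝ, 0 ≤ p ∧ (p : ℂ) = f (D.a i) := fun f hf hd i =>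
    ⟨_, nonneg_of_realPositive hf hd (D.l_le_a i) (by linarith [D.a_add_ε_le i, D.ε_pos]),
      real_of_symm hf.1 (P.seg_sub (D.a_mem i))⟩
  choose p hp0 hp using hφ D.φp D.adm.φp_pos D.adm.asymp.φp_holo
  choose m hm0 hm using hφ D.φm D.adm.φm_pos D.adm.asymp.φm_holo
  have hpf : ∀ i j, ∃ q : ℝ, 0 ≤ q ∧ (i < j → (q : ℂ) = D.pairFactor e i j) := by
    intro i j
    by_cases hij : i < j
    · obtain ⟨q, h1, h2⟩ := D.pairFactor_nonneg e hij
      exact ⟨q, h1, fun _ => h2⟩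
    · exact ⟨0, le_rfl, fun h => absurd h hij⟩
  choose q hq0 hq using hpf
  refine ⟨(∏ i, ∏ j ∈ Finset.Ioi i, q i j) * ∏ i, p i ^ (e i : ℕ) * m i ^ (1 - (e i : ℕ)), ?_, ?_⟩
  · refine mul_nonneg (Finset.prod_nonneg fun i _ => Finset.prod_nonneg fun j _ => hq0 i j)
      (Finset.prod_nonneg fun i _ => mul_nonneg (pow_nonneg (hp0 i) _) (pow_nonneg (hm0 i) _))
  · unfold wt
    push_cast
    congr 1
    · exact Finset.prod_congr rfl fun i _ => Finset.prod_congr rfl fun j hj =>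
        hq i j (Finset.mem_Ioi.1 hj)
    · exact Finset.prod_congr rfl fun i _ => by rw [hp, hm]

theorem exists_pr (e : Fin D.n → Fin 2) : ∃ p : ℝ, 0 ≤ p ∧ (p : ℂ) = D.pr e := by
  choose p hp0 hp using D.wt_nonneg
  refine ⟨p e / ∑ e, p e, div_nonneg (hp0 e) (Finset.sum_nonneg fun e _ => hp0 e), ?_⟩
  rw [D.pr_eq, Z]
  push_cast
  simp only [hp]

/-- The transition probability as a real number. -/
noncomputable def p (e : Fin D.n → Fin 2) : ℝ := (D.pr e).re

theorem p_eq (e : Fin D.n → Fin 2) : (D.p e : ℂ) = D.pr e := by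
  obtain ⟨p, -, h⟩ := D.exists_pr e
  rw [Conf.p, ← h, Complex.ofReal_re]

theorem p_nonneg (e : Fin D.n → Fin 2) : 0 ≤ D.p e := by
  obtain ⟨p, h0, h⟩ := D.exists_pr e
  rw [Conf.p, ← h, Complex.ofReal_re]; exact h0

theorem sum_p : ∑ e, D.p e = 1 := by
  have := D.sum_pr
  simp only [← D.p_eq] at this
  exact_mod_cast this

/-- Expectation of complex random variables. -/
noncomputable def E (f : (Fin D.n → Fin 2) → ℂ) : ℂ := ∑ e, D.pr e * f e

/-- Expectation of real random variables. -/
noncomputable def ER (f : (Fin D.n → Fin 2) → ℝ) : ℝ := ∑ e, D.p e * f e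

theorem expect_eq (f : (Fin D.n → Fin 2) → ℂ) :
    expect P.θ D.ε D.b D.φp D.φm D.x f = D.E f := rfl

theorem E_const (k : ℂ) : D.E (fun _ => k) = k := by
  unfold E; rw [← Finset.sum_mul, D.sum_pr, one_mul]

theorem E_add (f g : (Fin D.n → Fin 2) → ℂ) : D.E (fun e => f e + g e) = D.E f + D.E g := by
  simp [E, mul_add, Finset.sum_add_distrib]

theorem E_sub (f g : (Fin D.n → Fin 2) → ℂ) : D.E (fun e => f e - g e) = D.E f - D.E g := by
  simp [E, mul_sub, Finset.sum_sub_distrib]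

theorem E_mul_left (k : ℂ) (f : (Fin D.n → Fin 2) → ℂ) :
    D.E (fun e => k * f e) = k * D.E f := by
  simp only [E, Finset.mul_sum]
  exact Finset.sum_congr rfl fun e _ => by ring

theorem E_mul_right (k : ℂ) (f : (Fin D.n → Fin 2) → ℂ) :
    D.E (fun e => f e * k) = D.E f * k := by
  simp only [mul_comm _ k, E_mul_left]

theorem E_sum {ι : Type*} (s : Finset ι) (f : ι → (Fin D.n → Fin 2) → ℂ) :
    D.E (fun e => ∑ i ∈ s, f i e) = ∑ i ∈ s, D.E (f i) := by
  simp only [E, Finset.mul_sum]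
  exact Finset.sum_comm

theorem ER_const (k : ℝ) : D.ER (fun _ => k) = k := by
  unfold ER; rw [← Finset.sum_mul, D.sum_p, one_mul]

theorem ER_mono {f g : (Fin D.n → Fin 2) → ℝ} (h : ∀ e, f e ≤ g e) : D.ER f ≤ D.ER g :=
  Finset.sum_le_sum fun e _ => mul_le_mul_of_nonneg_left (h e) (D.p_nonneg e)

theorem ER_mul_left (k : ℝ) (f : (Fin D.n → Fin 2) → ℝ) :
    D.ER (fun e => k * f e) = k * D.ER f := by
  simp only [ER, Finset.mul_sum]
  exact Finset.sum_congr rfl fun e _ => by ring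

theorem ER_add (f g : (Fin D.n → Fin 2) → ℝ) : D.ER (fun e => f e + g e) = D.ER f + D.ER g := by
  simp [ER, mul_add, Finset.sum_add_distrib]

theorem E_ofReal (f : (Fin D.n → Fin 2) → ℝ) : D.E (fun e => (f e : ℂ)) = (D.ER f : ℂ) := by
  unfold E ER; push_cast; simp only [D.p_eq]

theorem norm_E_le (f : (Fin D.n → Fin 2) → ℂ) : ‖D.E f‖ ≤ D.ER fun e => ‖f e‖ := by
  refine (norm_sum_le _ _).trans (le_of_eq (Finset.sum_congr rfl fun e _ => ?_))
  rw [norm_mul, ← D.p_eq, Complex.norm_real, Real.norm_of_nonneg (D.p_nonneg e)]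

theorem norm_E_le_of_le {f : (Fin D.n → Fin 2) → ℂ} {g : (Fin D.n → Fin 2) → ℝ}
    (h : ∀ e, ‖f e‖ ≤ g e) : ‖D.E f‖ ≤ D.ER g := (D.norm_E_le f).trans (D.ER_mono h)

end Conf

namespace Step

variable {P : Setting} (D : Step P)

theorem ε_add_h : D.ε + D.h ≤ P.g / 8 := by
  have := D.small
  unfold Conf.h Conf.ε
  linarith

theorem ε_le : D.ε ≤ P.g / 8 := by linarith [D.ε_add_h, D.h_pos]
theorem h_le : D.h ≤ P.g / 8 := by linarith [D.ε_add_h, D.ε_pos]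

end Step

end

section

open Conf

theorem prod_pairs_eq {n : ℕ} {s : Fin n → Fin n → ℂ} (hs : ∀ i j, s i j = s j i) (k : Fin n) :
    ∏ i, ∏ j ∈ Finset.Ioi i, s i j = (∏ j ∈ Finset.univ.erase k, s k j) *
      ∏ i ∈ Finset.univ.erase k, ∏ j ∈ Finset.univ.erase k, if i < j then s i j else 1 := by
  have h1 : ∀ i, ∏ j ∈ Finset.Ioi i, s i j = ∏ j, if i < j then s i j else 1 := fun i => by
    rw [← Finset.prod_filter]
    exact Finset.prod_congr (by ext j; simp) fun _ _ => rfl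
  simp only [h1]
  rw [← Finset.mul_prod_erase Finset.univ _ (Finset.mem_univ k)]
  have h2 : ∀ i, (∏ j, if i < j then s i j else 1) = (if i < k then s i k else 1) *
      ∏ j ∈ Finset.univ.erase k, if i < j then s i j else 1 := fun i =>
    (Finset.mul_prod_erase Finset.univ _ (Finset.mem_univ k)).symm
  simp only [h2, Finset.prod_mul_distrib, lt_irrefl, if_false, one_mul]
  rw [← mul_assoc, ← Finset.prod_mul_distrib]
  congr 1
  refine Finset.prod_congr rfl fun j hj => ?_
  have hjk := Finset.ne_of_mem_erase hj
  rcases lt_or_gt_of_ne hjk with h | h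
  · simp [h, h.not_gt, hs j k]
  · simp [h, h.not_gt]

/-- Division of a holomorphic function by its zeros, in terms of a conformal coordinate. -/
theorem Conformal.exists_quotient {Λ : Set ℂ} {b : ℂ → ℂ} (h : Conformal Λ b) {V : Set ℂ}
    (hV : IsOpen V) (hVΛ : V ⊆ Λ) {ι : Type*} (s : Finset ι) {y : ι → ℂ}
    (hy : Function.Injective y) (hyV : ∀ i, y i ∈ V) {f : ℂ → ℂ} (hf : DifferentiableOn ℂ f V)
    (h0 : ∀ i ∈ s, f (y i) = 0) :
    ∃ q : ℂ → ℂ, DifferentiableOn ℂ q V ∧ ∀ w ∈ V, f w = q w * ∏ i ∈ s, (b w - b (y i)) := by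
  classical
  induction s using Finset.induction_on with
  | empty => exact ⟨f, hf, fun w _ => by simp⟩
  | insert k s hk ih =>
    obtain ⟨q, hq, hqf⟩ := ih fun i hi => h0 i (Finset.mem_insert_of_mem hi)
    have hq0 : q (y k) = 0 := by
      have h1 := hqf (y k) (hyV k)
      rw [h0 k (Finset.mem_insert_self _ _)] at h1
      refine (mul_eq_zero.1 h1.symm).resolve_right (Finset.prod_ne_zero_iff.2 fun i hi => ?_)
      exact h.sub_ne (hVΛ (hyV k)) (hVΛ (hyV i)) fun e => hk (hy e ▸ hi)
    refine ⟨fun w => dslope q (y k) w / dslope b (y k) w, ?_, fun w hw => ?_⟩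
    · refine ((Complex.differentiableOn_dslope (hV.mem_nhds (hyV k))).2 hq).div
        ((h.dslope_holo (hVΛ (hyV k))).mono hVΛ) fun w hw => h.dslope_ne (hVΛ hw) (hVΛ (hyV k))
    · rw [hqf w hw, Finset.prod_insert hk, ← mul_assoc]
      congr 1
      have e1 := sub_smul_dslope q (y k) w
      have e2 := sub_smul_dslope b (y k) w
      rw [hq0, sub_zero] at e1
      have e3 := h.dslope_ne (hVΛ hw) (hVΛ (hyV k))
      rw [← e1, ← e2, smul_eq_mul, smul_eq_mul]
      field_simp

namespace Step

variable {P : Setting} (D : Step P)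

/-- The change of the particle `i` in a jump. -/
def flip {n : ℕ} (i : Fin n) (e : Fin n → Fin 2) : Fin n → Fin 2 :=
  Function.update e i (1 - e i)

theorem flip_flip {n : ℕ} (i : Fin n) (e : Fin n → Fin 2) : flip i (flip i e) = e := by
  unfold flip
  simp

theorem sum_eq_zero_of_flip (i : Fin D.n) {A A' : (Fin D.n → Fin 2) → ℂ}
    (hA : ∀ e, e i = 1 → A e = 0) (hA' : ∀ e, e i = 0 → A' e = 0)
    (h : ∀ e, e i = 0 → A e + A' (Function.update e i 1) = 0) : ∑ e, (A e + A' e) = 0 := by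
  have h1 : ∑ e, A' e = ∑ e, A' (flip i e) :=
    (Equiv.sum_comp (Function.Involutive.toPerm (flip i) (flip_flip i)) A').symm
  rw [Finset.sum_add_distrib, h1, ← Finset.sum_add_distrib]
  refine Finset.sum_eq_zero fun e _ => ?_
  rcases fin_two (e i) with h0 | h0
  · have := h e h0
    unfold flip
    rwa [h0, sub_zero]
  · rw [hA e h0, hA' _ (by simp [flip, h0]), add_zero]

theorem pt_update_ne (e : Fin D.n → Fin 2) {i j : Fin D.n} (hij : j ≠ i) (k : Fin 2) :
    D.pt (Function.update e i k) j = D.pt e j := by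
  unfold pt; rw [Function.update_of_ne hij]

/-- The ratio of the weights of two jumps which differ in one particle. -/
theorem wt_update (e : Fin D.n → Fin 2) (i : Fin D.n) (he : e i = 0) :
    D.wt (Function.update e i 1) * D.φm (D.a i) *
        ∏ j ∈ Finset.univ.erase i, (D.b (D.a i) - D.b (D.pt e j)) =
      D.wt e * D.φp (D.a i) *
        ∏ j ∈ Finset.univ.erase i, (D.b (D.a i + D.h) - D.b (D.pt e j)) := by
  set e' := Function.update e i 1 with he'
  have hi' : e' i = 1 := by simp [he']
  have h1 : ∀ f : Fin D.n → Fin 2, D.wt f =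
      (∏ j ∈ Finset.univ.erase i, (D.b (D.pt f i) - D.b (D.pt f j))) *
      (∏ j ∈ Finset.univ.erase i, (D.b (D.a i) - D.b (D.a j)))⁻¹ *
      (∏ k ∈ Finset.univ.erase i, ∏ j ∈ Finset.univ.erase i,
        if k < j then D.pairFactor f k j else 1) *
      ((D.φp (D.a i) ^ (f i : ℕ) * D.φm (D.a i) ^ (1 - (f i : ℕ))) *
      ∏ k ∈ Finset.univ.erase i, D.φp (D.a k) ^ (f k : ℕ) * D.φm (D.a k) ^ (1 - (f k : ℕ))) := by
    intro f
    unfold wt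
    rw [prod_pairs_eq (D.pairFactor_symm f) i, ← Finset.mul_prod_erase Finset.univ
      (fun k => D.φp (D.a k) ^ (f k : ℕ) * D.φm (D.a k) ^ (1 - (f k : ℕ))) (Finset.mem_univ i)]
    congr 2
    unfold pairFactor
    rw [Finset.prod_div_distrib, div_eq_mul_inv]
  have h2 : (∏ k ∈ Finset.univ.erase i, ∏ j ∈ Finset.univ.erase i,
        if k < j then D.pairFactor e' k j else 1) =
      ∏ k ∈ Finset.univ.erase i, ∏ j ∈ Finset.univ.erase i,
        if k < j then D.pairFactor e k j else 1 := by
    refine Finset.prod_congr rfl fun k hk => Finset.prod_congr rfl fun j hj => ?_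
    unfold pairFactor
    rw [he', D.pt_update_ne e (Finset.ne_of_mem_erase hk), D.pt_update_ne e (Finset.ne_of_mem_erase hj)]
  have h3 : (∏ k ∈ Finset.univ.erase i,
      D.φp (D.a k) ^ (e' k : ℕ) * D.φm (D.a k) ^ (1 - (e' k : ℕ))) =
      ∏ k ∈ Finset.univ.erase i, D.φp (D.a k) ^ (e k : ℕ) * D.φm (D.a k) ^ (1 - (e k : ℕ)) := by
    refine Finset.prod_congr rfl fun k hk => ?_
    rw [he', Function.update_of_ne (Finset.ne_of_mem_erase hk)]
  have h4 : (∏ j ∈ Finset.univ.erase i, (D.b (D.pt e' i) - D.b (D.pt e' j))) =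
      ∏ j ∈ Finset.univ.erase i, (D.b (D.a i + D.h) - D.b (D.pt e j)) := by
    refine Finset.prod_congr rfl fun j hj => ?_
    rw [D.pt_one hi', he', D.pt_update_ne e (Finset.ne_of_mem_erase hj)]
    push_cast; rfl
  rw [h1 e, h1 e', h2, h3, h4, hi', he, D.pt_zero he]
  simp only [Fin.val_one, Fin.val_zero, pow_one, pow_zero, Nat.sub_zero, Nat.sub_self]
  ring

theorem pr_update (e : Fin D.n → Fin 2) (i : Fin D.n) (he : e i = 0) :
    D.pr (Function.update e i 1) * D.φm (D.a i) *
        ∏ j ∈ Finset.univ.erase i, (D.b (D.a i) - D.b (D.pt e j)) =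
      D.pr e * D.φp (D.a i) *
        ∏ j ∈ Finset.univ.erase i, (D.b (D.a i + D.h) - D.b (D.pt e j)) := by
  simp only [D.pr_eq, div_mul_eq_mul_div, D.wt_update e i he]

/-- The observable `∏ⱼ (b(w) - b(aⱼ + h eⱼ)) / (b(w) - b(aⱼ))`. -/
noncomputable def obs (e : Fin D.n → Fin 2) (w : ℂ) : ℂ :=
  ∏ j, (D.b w - D.b (D.pt e j)) / (D.b w - D.b (D.a j))

/-- The shifted observable `∏ⱼ (b(w + h) - b(aⱼ + h eⱼ)) / (b(w) - b(aⱼ))`. -/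
noncomputable def sobs (e : Fin D.n → Fin 2) (w : ℂ) : ℂ :=
  ∏ j, (D.b (w + D.h) - D.b (D.pt e j)) / (D.b w - D.b (D.a j))

/-- The functions `P(e)` and `Q(e, w)` may be inserted in the loop equation. -/
def Insert (U : Set ℂ) (R : (Fin D.n → Fin 2) → ℂ) (Q : (Fin D.n → Fin 2) → ℂ → ℂ) : Prop :=
  (∀ e, DifferentiableOn ℂ (Q e) U) ∧
    ∀ e i, e i = 0 → Q e (D.a i) = R (Function.update e i 1)

/-- **The dynamical loop equation.** -/
theorem loop_equation {V : Set ℂ} (hV : IsOpen V) (hVΛ : V ⊆ P.Λ) (hVh : ∀ w ∈ V, w + D.h ∈ P.Λ)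
    (ha : ∀ j, (D.a j : ℂ) ∈ V) {R : (Fin D.n → Fin 2) → ℂ} {Q : (Fin D.n → Fin 2) → ℂ → ℂ}
    (hPQ : D.Insert V R Q) :
    ∃ q : ℂ → ℂ, DifferentiableOn ℂ q V ∧ ∀ w ∈ V, (∀ j, w ≠ D.a j) →
      q w = D.φp w * D.E (fun e => D.sobs e w * Q e w) +
        D.φm w * D.E (fun e => D.obs e w * R e) := by
  set f : ℂ → ℂ := fun w => ∑ e, (D.pr e * D.φp w *
    (∏ j, (D.b (w + D.h) - D.b (D.pt e j))) * Q e w + D.pr e * D.φm w *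
    (∏ j, (D.b w - D.b (D.pt e j))) * R e) with hf
  have hb := D.conf.holo.mono hVΛ
  have hbh : DifferentiableOn ℂ (fun w => D.b (w + D.h)) V :=
    D.conf.holo.comp (f := fun w => w + (D.h : ℂ)) (by fun_prop) hVh
  have hp := D.adm.asymp.φp_holo.mono hVΛ
  have hm := D.adm.asymp.φm_holo.mono hVΛ
  have hfd : DifferentiableOn ℂ f V := by
    refine DifferentiableOn.fun_sum fun e _ => DifferentiableOn.add ?_ ?_
    · exact (((differentiableOn_const _).mul hp).mul
        (DifferentiableOn.fun_finsetProd fun j _ => hbh.sub_const _)).mul (hPQ.1 e)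
    · exact (((differentiableOn_const _).mul hm).mul
        (DifferentiableOn.fun_finsetProd fun j _ => hb.sub_const _)).mul_const _
  have hf0 : ∀ i ∈ Finset.univ, f (D.a i) = 0 := by
    intro i _
    refine D.sum_eq_zero_of_flip i (fun e he => ?_) (fun e he => ?_) fun e he => ?_
    · have : ∏ j, (D.b (D.a i + D.h) - D.b (D.pt e j)) = 0 :=
        Finset.prod_eq_zero (Finset.mem_univ i) (by rw [D.pt_one he]; push_cast; ring)
      rw [this]; ring
    · have : ∏ j, (D.b (D.a i) - D.b (D.pt e j)) = 0 :=
        Finset.prod_eq_zero (Finset.mem_univ i) (by rw [D.pt_zero he]; ring)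
      rw [this]; ring
    · have h1 := D.pr_update e i he
      rw [hPQ.2 e i he, ← Finset.mul_prod_erase Finset.univ (fun j => D.b (D.a i + D.h) -
        D.b (D.pt e j)) (Finset.mem_univ i), ← Finset.mul_prod_erase Finset.univ
        (fun j => D.b (D.a i) - D.b (D.pt (Function.update e i 1) j)) (Finset.mem_univ i)]
      have h2 : ∏ j ∈ Finset.univ.erase i,
          (D.b (D.a i) - D.b (D.pt (Function.update e i 1) j)) =
          ∏ j ∈ Finset.univ.erase i, (D.b (D.a i) - D.b (D.pt e j)) :=
        Finset.prod_congr rfl fun j hj => by rw [D.pt_update_ne e (Finset.ne_of_mem_erase hj)]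
      rw [h2, D.pt_zero he, D.pt_one (e := Function.update e i 1) (j := i) (by simp)]
      push_cast
      linear_combination (R (Function.update e i 1) * (D.b (D.a i) - D.b (D.a i + D.h))) * h1
  obtain ⟨q, hq, hqf⟩ := D.conf.exists_quotient hV hVΛ Finset.univ (y := fun j => (D.a j : ℂ))
    (fun i j hij => D.a_injective (Complex.ofReal_injective hij)) ha hfd hf0
  refine ⟨q, hq, fun w hw hwa => ?_⟩
  have hne : ∏ j, (D.b w - D.b (D.a j)) ≠ 0 := Finset.prod_ne_zero_iff.2 fun j _ =>
    D.conf.sub_ne (hVΛ hw) (hVΛ (ha j)) (hwa j)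
  rw [eq_div_of_mul_eq hne (hqf w hw).symm, hf]
  unfold E obs sobs
  simp only [Finset.prod_div_distrib, Finset.mul_sum]
  rw [Finset.sum_div, ← Finset.sum_add_distrib]
  refine Finset.sum_congr rfl fun e _ => ?_
  field_simp

end Step

end

section

open Conf

theorem IsOuter.prod {Λ : Set ℂ} {b : ℂ → ℂ} {S : Set ℂ} {ι : Type*} (s : Finset ι)
    {f : ι → ℂ → ℂ} {c : ι → ℂ} (hf : ∀ i ∈ s, IsOuter Λ b S (f i) (c i)) :
    IsOuter Λ b S (fun w => ∏ i ∈ s, f i w) (∏ i ∈ s, c i) := by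
  classical
  induction s using Finset.induction_on with
  | empty => simpa using IsOuter.const Λ b S 1
  | insert a s ha ih =>
    simp only [Finset.prod_insert ha]
    exact (hf a (Finset.mem_insert_self _ _)).mul
      (ih fun i hi => hf i (Finset.mem_insert_of_mem hi))

/-- The closed region inside the first contour. -/
def Setting.core (P : Setting) : Set ℂ := {z | lvl P.l P.r z ≤ P.s 1}

section
variable {P : Setting}

theorem Setting.isCompact_core : IsCompact P.core := isCompact_lvl_le _ _ _

theorem Setting.core_sub : P.core ⊆ P.Λ := fun _ hz => P.mem_Λ (by norm_num) hz

theorem Setting.seg_sub_core : seg P.l P.r ⊆ P.core := fun _ hz => (P.lvl_seg_lt one_pos hz).le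

theorem Setting.notMem_core {k : ℝ} (hk : 1 ≤ k) {z : ℂ} (hz : P.s k < lvl P.l P.r z) :
    z ∉ P.core := fun h => absurd hz (not_lt.2 (h.trans (P.s_le hk)))

theorem Setting.con_sub_lt {j k : ℝ} (hj : 0 < j) (hjk : j < k) :
    trace (P.con j) ⊆ {z | lvl P.l P.r z < P.s k} := fun w hw => by
  rw [mem_ofPred_eq, P.lvl_con hj hw]; exact P.s_lt hjk

theorem Setting.lt_sub {k : ℝ} (hk : k ≤ 10) : {z | lvl P.l P.r z < P.s k} ⊆ P.Λ :=
  fun _ hz => P.mem_Λ hk (le_of_lt hz)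

end

namespace Step

variable {P : Setting} (D : Step P)

theorem isCompact_image_core : IsCompact (D.b '' P.core) :=
  P.isCompact_core.image_of_continuousOn (D.conf.holo.continuousOn.mono P.core_sub)

/-- The function `𝓑`. -/
noncomputable def Bf (w : ℂ) : ℂ := B P.θ D.ε P.l P.r D.b D.φp D.φm D.x w

/-- The function `𝒢`. -/
noncomputable def Gf (w : ℂ) : ℂ := G P.θ D.ε P.l P.r D.b D.x w

theorem Bf_eq (w : ℂ) : D.Bf w = D.Gf w * D.φp w + D.φm w := rfl

theorem exp_L {w : ℂ} (hw : w ∈ P.Λ \ seg P.l P.r) : Complex.exp (D.L w) = D.Bf w :=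
  D.branch.2 w hw

theorem Bf_ne {w : ℂ} (hw : w ∈ P.Λ \ seg P.l P.r) : D.Bf w ≠ 0 := by
  rw [← D.exp_L hw]; exact Complex.exp_ne_zero _

theorem L_continuousOn_con {k : ℝ} (hk : 0 < k) (hk' : k ≤ 10) :
    ContinuousOn D.L (trace (P.con k)) :=
  D.branch.1.continuousOn.mono fun w hw => ⟨P.con_sub hk hk' hw,
    P.notMem_seg (k := 0) le_rfl (by rw [P.lvl_con hk hw]; exact P.s_lt hk)⟩

/-- The exterior part of `-ln 𝓑`. -/
noncomputable def ld (w : ℂ) : ℂ :=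
  (2 * Real.pi * Complex.I)⁻¹ * contourInt (P.con 1) (fun u => D.L u * cauchyKer D.b u w)

/-- The interior part of `ln 𝓑`. -/
noncomputable def Lin (w : ℂ) : ℂ :=
  (2 * Real.pi * Complex.I)⁻¹ * contourInt (P.con 8) (fun u => D.L u * cauchyKer D.b u w)

theorem ld_outer : IsOuter P.Λ D.b P.core D.ld 0 := by
  have hp := (P.isLoop_con one_pos).pwC1
  have h1 : IsOuter P.Λ D.b P.core _ 0 := IsOuter.intervalIntegral (Λ := P.Λ) (b := D.b)
    (S := P.core) (y := fun t => D.b (P.con 1 t))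
    (g := fun t => -(D.L (P.con 1 t) * deriv D.b (P.con 1 t)) * deriv (P.con 1) t) zero_le_one
    (continuousOn_comp_trace hp.1 (D.conf.holo.continuousOn.mono (P.con_sub one_pos (by norm_num))))
    (fun t ht => mem_image_of_mem _ (P.lvl_con one_pos (mem_trace ht)).le)
    D.isCompact_image_core
    (hp.integrable (f := fun u => -(D.L u * deriv D.b u))
      ((D.L_continuousOn_con one_pos (by norm_num)).mul
        (D.conf.deriv_holo.continuousOn.mono (P.con_sub one_pos (by norm_num)))).neg)
  have h2 := (IsOuter.const P.Λ D.b P.core (2 * Real.pi * Complex.I)⁻¹).mul h1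
  rw [mul_zero] at h2
  refine h2.congr fun w hw => ?_
  unfold ld contourInt
  congr 1
  refine intervalIntegral.integral_congr fun t ht => ?_
  have ht' := mem_trace' (γ := P.con 1) ht
  have h3 : D.b (P.con 1 t) - D.b w ≠ 0 :=
    D.conf.sub_ne (P.con_sub one_pos (by norm_num) ht') hw.1
      fun h => hw.2 (h ▸ (P.lvl_con one_pos ht').le)
  have h4 : D.b w - D.b (P.con 1 t) ≠ 0 := by rw [← neg_sub]; exact neg_ne_zero.2 h3
  simp only [cauchyKer]
  rw [← neg_sub (D.b w)]
  field_simp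

theorem obs_outer (e : Fin D.n → Fin 2) : IsOuter P.Λ D.b P.core (D.obs e) 1 := by
  have h1 : ∀ j ∈ Finset.univ, IsOuter P.Λ D.b P.core
      (fun w => (D.b w - D.b (D.pt e j)) / (D.b w - D.b (D.a j))) 1 := by
    intro j _
    have h2 := (IsOuter.const P.Λ D.b P.core 1).add ((IsOuter.const P.Λ D.b P.core
      (D.b (D.a j) - D.b (D.pt e j))).mul (IsOuter.inv_sub (Λ := P.Λ) D.isCompact_image_core
        (P.seg_sub_core (D.a_mem j))))
    rw [mul_zero, add_zero] at h2
    refine h2.congr fun w hw => ?_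
    have h3 : D.b w - D.b (D.a j) ≠ 0 := D.conf.sub_ne hw.1 (P.seg_sub (D.a_mem j))
      fun h => hw.2 (h ▸ P.seg_sub_core (D.a_mem j))
    field_simp
    ring
  have h2 := IsOuter.prod Finset.univ h1
  rwa [Finset.prod_const_one] at h2

theorem Lin_holo : DifferentiableOn ℂ D.Lin {z | lvl P.l P.r z < P.s 8} := by
  have hdis : Disjoint (trace (P.con 8)) {z | lvl P.l P.r z < P.s 8} :=
    disjoint_left.2 fun u hu hu' => by
      rw [mem_ofPred_eq, P.lvl_con (by norm_num) hu] at hu'; exact lt_irrefl _ hu'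
  have hs : trace (P.con 8) ⊆ P.Λ := P.con_sub (by norm_num) (by norm_num)
  have hz : {z | lvl P.l P.r z < P.s 8} ⊆ P.Λ := P.lt_sub (by norm_num)
  refine DifferentiableOn.const_mul (differentiableOn_contourInt (isOpen_lvl_lt _ _ _)
    (P.isLoop_con (by norm_num)).pwC1 (f := fun w u => D.L u * cauchyKer D.b u w) ?_ ?_) _
  · refine ContinuousOn.mul ((D.L_continuousOn_con (k := 8) (by norm_num) (by norm_num)).comp
      continuousOn_snd fun p hp => hp.2) ?_
    exact (D.conf.continuousOn_cauchyKer hs hz hdis).comp (f := fun p : ℂ × ℂ => (p.2, p.1))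
      (Continuous.continuousOn (by fun_prop)) fun p hp => ⟨hp.2, hp.1⟩
  · intro u hu
    refine (differentiableOn_const _).mul ((D.conf.cauchyKer_holo_right (hs hu)).mono ?_)
    exact fun w hw => ⟨hz hw, fun h => disjoint_left.1 hdis hu (h ▸ hw)⟩

/-- The Laurent splitting of `ln 𝓑`. -/
theorem L_eq {w : ℂ} (h1 : P.s 1 < lvl P.l P.r w) (h8 : lvl P.l P.r w < P.s 8) :
    D.L w = D.Lin w - D.ld w := by
  set V : Set ℂ := {z | lvl P.l P.r z < P.s 9} ∩ {z | P.s 0 < lvl P.l P.r z} with hV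
  have hVo : IsOpen V := (isOpen_lvl_lt _ _ _).inter (isOpen_lt_lvl _ _ _)
  have hVΛ : V ⊆ P.Λ := fun z hz => P.lt_sub (by norm_num) hz.1
  have ht : ∀ k : ℝ, 0 < k → k < 9 → trace (P.con k) ⊆ V := fun k hk hk' w hw =>
    ⟨P.con_sub_lt hk hk' hw, by rw [mem_ofPred_eq, P.lvl_con hk hw]; exact P.s_lt hk⟩
  have key := D.conf.cauchy_pair hVo hVΛ (P.isLoop_con (k := 8) (by norm_num))
    (P.isLoop_con (k := 1) (by norm_num)) (ht 8 (by norm_num) (by norm_num))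
    (ht 1 (by norm_num) (by norm_num)) (fun a ha => ?_)
    (D.branch.1.mono fun z hz => ⟨hVΛ hz, P.notMem_seg le_rfl hz.2⟩)
    (z := w) ⟨h8.trans (P.s_lt (by norm_num)), (P.s_lt one_pos).trans h1⟩
    (fun hw => h8.ne (P.lvl_con (by norm_num) hw)) (fun hw => h1.ne' (P.lvl_con (by norm_num) hw))
  · rw [P.winding_con_in (by norm_num) h8, P.winding_con_out (by norm_num) h1] at key
    unfold Lin ld
    rw [← mul_sub, key, sub_zero, mul_one, inv_mul_cancel_left₀ two_pi_I_ne_zero]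
  · by_cases h : lvl P.l P.r a < P.s 9
    · have h' : lvl P.l P.r a ≤ P.s 0 := not_lt.1 fun h' => ha ⟨h, h'⟩
      rw [P.winding_con_in (by norm_num) (h'.trans_lt (P.s_lt (by norm_num))),
        P.winding_con_in (by norm_num) (h'.trans_lt (P.s_lt (by norm_num)))]
    · have h' := not_lt.1 h
      rw [P.winding_con_out (by norm_num) ((P.s_lt (by norm_num)).trans_le h'),
        P.winding_con_out (by norm_num) ((P.s_lt (by norm_num)).trans_le h')]

theorem mem_of_level {k : ℝ} (hk : 0 ≤ k) {w : ℂ} (hw : w ∈ P.Λ) (h : P.s k < lvl P.l P.r w) :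
    w ∈ P.Λ \ seg P.l P.r := ⟨hw, P.notMem_seg hk h⟩

theorem add_h_mem {w : ℂ} (h : lvl P.l P.r w < P.s 9) : w + D.h ∈ P.Λ := by
  refine P.mem_Λ le_rfl ?_
  have h1 := lvl_le_add P.l P.r (w + D.h) w
  rw [add_sub_cancel_left, Complex.norm_real, Real.norm_of_nonneg D.h_pos.le] at h1
  have := D.h_le
  simp only [Setting.s] at h ⊢
  linarith [P.g_pos]

/-- The solution of the loop equation for the expectation of the observable. -/
theorem master {k : ℝ} (hk : 1 < k) (hk' : k < 8) {R : (Fin D.n → Fin 2) → ℂ}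
    {Q : (Fin D.n → Fin 2) → ℂ → ℂ} {j : ℝ} (hj : k < j) (hj8 : j ≤ 8)
    (hPQ : D.Insert {z | lvl P.l P.r z < P.s j} R Q)
    {z : ℂ} (hz : z ∈ P.Λ) (hzk : P.s k < lvl P.l P.r z) :
    D.E (fun e => R e * D.obs e z) * Complex.exp (-D.ld z) = D.E R +
      (2 * Real.pi * Complex.I)⁻¹ * contourInt (P.con k) (fun w =>
        D.φp w * Complex.exp (-D.ld w) / D.Bf w *
          D.E (fun e => D.sobs e w * Q e w - D.Gf w * (D.obs e w * R e)) *
            cauchyKer D.b w z) := by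
  have hk0 : 0 < k := by linarith
  set U : Set ℂ := {z | lvl P.l P.r z < P.s j} with hU
  have hUΛ : U ⊆ P.Λ := P.lt_sub (by linarith)
  obtain ⟨q, hq, hqf⟩ := D.loop_equation (isOpen_lvl_lt P.l P.r (P.s j)) hUΛ
    (fun w hw => D.add_h_mem (lt_trans hw (P.s_lt (by linarith))))
    (fun i => P.lvl_seg_lt (by linarith) (D.a_mem i)) hPQ
  set V : Set ℂ := U ∩ {w | lvl P.l P.r w < lvl P.l P.r z} with hV
  have hVo : IsOpen V := (isOpen_lvl_lt _ _ _).inter (isOpen_lvl_lt _ _ _)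
  have htV : trace (P.con k) ⊆ V := fun w hw => ⟨P.con_sub_lt hk0 hj hw, by
    rw [mem_ofPred_eq, P.lvl_con hk0 hw]; exact hzk⟩
  have hzV : z ∉ V := fun h => lt_irrefl (lvl P.l P.r z) h.2
  have hVΛ : V ⊆ P.Λ := fun w hw => hUΛ hw.1
  have hkerV : DifferentiableOn ℂ (fun w => cauchyKer D.b w z) V :=
    (D.conf.cauchyKer_holo_left hz).mono fun w hw => ⟨hVΛ hw, fun h => hzV (h ▸ hw)⟩
  set f₀ : ℂ → ℂ := fun w => Complex.exp (-D.Lin w) * q w * cauchyKer D.b w z with hf₀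
  have hLinV : DifferentiableOn ℂ D.Lin V :=
    D.Lin_holo.mono fun w hw => lt_of_lt_of_le hw.1 (P.s_le hj8)
  have hf₀d : DifferentiableOn ℂ f₀ V :=
    (hLinV.neg.cexp.mul (hq.mono inter_subset_left)).mul hkerV
  have I0 : contourInt (P.con k) f₀ = 0 := by
    refine contourInt_eq_zero hVo (P.isLoop_con hk0) htV (fun a ha => ?_) hf₀d
    by_cases h : lvl P.l P.r a < P.s j
    · exact P.winding_con_out hk0 (hzk.trans_le (not_lt.1 fun h' => ha ⟨h, h'⟩))
    · exact P.winding_con_out hk0 ((P.s_lt hj).trans_le (not_lt.1 h))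
  set f₁ : ℂ → ℂ := fun w => D.E (fun e => R e * D.obs e w) * Complex.exp (-D.ld w) with hf₁
  have hout : IsOuter P.Λ D.b P.core f₁ (D.E R) := by
    have h1 : IsOuter P.Λ D.b P.core (fun w => ∑ e, D.pr e * (R e * D.obs e w))
        (∑ e, D.pr e * (R e * 1)) := IsOuter.sum _ fun e _ =>
      (IsOuter.const _ _ _ _).mul ((IsOuter.const _ _ _ _).mul (D.obs_outer e))
    have h2 := h1.mul D.ld_outer.neg.exp
    simp only [mul_one, neg_zero, Complex.exp_zero] at h2
    exact h2
  have htc : trace (P.con k) ⊆ P.Λ \ P.core := fun w hw => ⟨hVΛ (htV hw),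
    P.notMem_core le_rfl (by rw [P.lvl_con hk0 hw]; exact P.s_lt hk)⟩
  have hzc : z ∈ P.Λ \ P.core := ⟨hz, P.notMem_core hk.le hzk⟩
  have I1 := hout.cauchy D.conf P.isCompact_core P.core_sub (P.isLoop_con hk0) htc
    (fun a ha => P.winding_con_in hk0 (lt_of_le_of_lt ha (P.s_lt hk)))
    (P.winding_con_off hk0 (by linarith)) hzc (fun h => hzk.ne' (P.lvl_con hk0 h))
    (P.winding_con_out hk0 hzk)
  have hf₁c : ContinuousOn (fun w => f₁ w * cauchyKer D.b w z) (trace (P.con k)) :=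
    ((hout.differentiableOn D.conf P.core_sub).continuousOn.mono htc).mul
      (hkerV.continuousOn.mono htV)
  have e1 : contourInt (P.con k) (fun w =>
        D.φp w * Complex.exp (-D.ld w) / D.Bf w *
          D.E (fun e => D.sobs e w * Q e w - D.Gf w * (D.obs e w * R e)) *
            cauchyKer D.b w z) =
      contourInt (P.con k) (fun w => f₀ w - f₁ w * cauchyKer D.b w z) := by
    refine contourInt_congr fun w hw => ?_
    have hlw := P.lvl_con hk0 hw
    have hwL := D.L_eq (w := w) (by rw [hlw]; exact P.s_lt hk) (by rw [hlw]; exact P.s_lt hk')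
    have hws : w ∈ P.Λ \ seg P.l P.r := ⟨hVΛ (htV hw), fun h => (htc hw).2 (P.seg_sub_core h)⟩
    have hq := hqf w (htV hw).1 fun i h => hws.2 (h ▸ D.a_mem i)
    have hB := D.Bf_ne hws
    have e2 : Complex.exp (-D.Lin w) = Complex.exp (-D.ld w) / D.Bf w := by
      rw [← D.exp_L hws, hwL, ← Complex.exp_sub]
      congr 1; ring
    simp only [hf₀, hf₁, e2, hq]
    have e3 : D.E (fun e => R e * D.obs e w) = D.E (fun e => D.obs e w * R e) := by
      simp only [mul_comm]
    rw [E_sub, E_mul_left, e3]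
    have hB2 := D.Bf_eq w
    field_simp
    rw [hB2]
    ring
  rw [e1, contourInt_sub (P.isLoop_con hk0).pwC1 (hf₀d.continuousOn.mono htV) hf₁c, I0, I1]
  rw [zero_sub, mul_neg, inv_mul_cancel_left₀ two_pi_I_ne_zero]
  ring

end Step

end

section

open Conf

theorem eq_mul_exp_integral {I : Set ℝ} (hI : IsOpen I) {u ψ : ℝ → ℂ}
    (hu : ∀ t ∈ I, HasDerivAt u (ψ t * u t) t) (hψ : ContinuousOn ψ I) {h : ℝ} (h0 : 0 ≤ h)
    (hhI : Icc 0 h ⊆ I) : u h = u 0 * Complex.exp (∫ s in (0 : ℝ)..h, ψ s) := by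
  set Φ : ℝ → ℂ := fun t => ∫ s in (0 : ℝ)..t, ψ s with hΦ
  have hd : ∀ t ∈ Icc 0 h, HasDerivAt (fun t => u t * Complex.exp (-Φ t)) 0 t := by
    intro t ht
    have h1 : HasDerivAt Φ (ψ t) t := by
      refine intervalIntegral.integral_hasDerivAt_right ?_
        (hψ.stronglyMeasurableAtFilter hI _ (hhI ht)) (hψ.continuousAt (hI.mem_nhds (hhI ht)))
      refine ContinuousOn.intervalIntegrable (hψ.mono ?_)
      rw [uIcc_of_le ht.1]
      exact (Icc_subset_Icc_right ht.2).trans hhI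
    refine ((hu t (hhI ht)).mul h1.neg.cexp).congr_deriv ?_
    ring
  have hc := constant_of_has_deriv_right_zero (f := fun t => u t * Complex.exp (-Φ t))
    (fun t ht => (hd t ht).continuousAt.continuousWithinAt)
    (fun t ht => (hd t ⟨ht.1, ht.2.le⟩).hasDerivWithinAt) h (right_mem_Icc.2 h0)
  simp only [hΦ, intervalIntegral.integral_same, neg_zero, Complex.exp_zero, mul_one] at hc
  rw [← hc, mul_assoc, ← Complex.exp_add, neg_add_cancel, Complex.exp_zero, mul_one]

namespace Step

variable {P : Setting} (D : Step P)

theorem intervalIntegral_shift (f : ℝ → ℂ) (a h : ℝ) :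
    ∫ s in a..a + h, f s = ∫ s in (0 : ℝ)..h, f (a + s) := by
  rw [intervalIntegral.integral_comp_add_left (fun s => f s) a, add_zero]

/-- Integration against the density `ρ`. -/
theorem integral_mul_rho {y : Fin D.n → ℝ} {f : ℝ → ℂ}
    (hf : ∀ j, ContinuousOn f (Icc (D.ε * y j) (D.ε * y j + D.h))) :
    Integrable (fun s => f s * (rho P.θ D.ε y s : ℂ)) ∧
    ∫ s : ℝ, f s * (rho P.θ D.ε y s : ℂ) =
      (P.θ : ℂ)⁻¹ * ∑ j, ∫ s in (0 : ℝ)..D.h, f ((D.ε * y j : ℝ) + s) := by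
  have h1 : ∀ s, f s * (rho P.θ D.ε y s : ℂ) = (P.θ : ℂ)⁻¹ *
      ∑ j, (Icc (D.ε * y j) (D.ε * y j + D.h)).indicator f s := by
    intro s
    unfold rho
    push_cast
    rw [mul_left_comm, Finset.mul_sum]
    congr 1
    refine Finset.sum_congr rfl fun j _ => ?_
    unfold indicator
    split_ifs with h2 h3 h3
    · simp
    · exact absurd h2 h3
    · exact absurd h3 h2
    · simp
  have h2 : ∀ j, Integrable ((Icc (D.ε * y j) (D.ε * y j + D.h)).indicator f) := fun j =>
    (integrable_indicator_iff measurableSet_Icc).2 ((hf j).integrableOn_Icc)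
  simp only [h1]
  refine ⟨(integrable_finsetSum _ fun j _ => h2 j).const_mul _, ?_⟩
  rw [integral_const_mul, integral_finsetSum _ fun j _ => h2 j]
  congr 1
  refine Finset.sum_congr rfl fun j _ => ?_
  rw [integral_indicator measurableSet_Icc, integral_Icc_eq_integral_Ioc,
    ← intervalIntegral.integral_of_le (by linarith [D.h_pos]), intervalIntegral_shift]

theorem rho_eq_zero {s : ℝ} (hs : s ∉ Icc P.l P.r) : rho P.θ D.ε D.x s = 0 := by
  unfold rho
  rw [Finset.sum_eq_zero fun i _ => ?_, mul_zero]
  refine indicator_of_notMem (fun hi => hs ?_) _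
  have h1 := D.l_le_a i
  have h2 := D.a_add_h_le i
  unfold a at h1 h2
  unfold h at h2
  exact ⟨h1.trans hi.1, hi.2.trans h2⟩

theorem intervalIntegral_mul_rho {f : ℝ → ℂ} (hf : ContinuousOn f (Icc P.l P.r)) :
    ∫ s in P.l..P.r, f s * (rho P.θ D.ε D.x s : ℂ) =
      (P.θ : ℂ)⁻¹ * ∑ j, ∫ s in (0 : ℝ)..D.h, f (D.a j + s) := by
  have := (D.integral_mul_rho (y := D.x) (f := f) fun j => hf.mono
    (Icc_subset_Icc (D.l_le_a j) (D.a_add_h_le j))).2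
  rw [show (∑ j, ∫ s in (0 : ℝ)..D.h, f (D.a j + s)) =
    ∑ j, ∫ s in (0 : ℝ)..D.h, f ((D.ε * D.x j : ℝ) + s) from rfl, ← this,
    intervalIntegral.integral_of_le P.lr.le, ← integral_Icc_eq_integral_Ioc]
  refine setIntegral_eq_integral_of_forall_compl_eq_zero fun s hs => ?_
  rw [D.rho_eq_zero hs]; simp

/-- The exponent of `𝒢`. -/
noncomputable def Γ (w : ℂ) : ℂ := ∑ j, ∫ s in (0 : ℝ)..D.h, cauchyKer D.b w (D.a j + s)

theorem a_add_mem (j : Fin D.n) {s : ℝ} (hs : s ∈ Icc 0 D.h) :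
    ((D.a j : ℂ) + s) ∈ seg P.l P.r := by
  rw [← Complex.ofReal_add]
  exact mem_seg (by linarith [D.l_le_a j, hs.1]) (by linarith [D.a_add_h_le j, hs.2])

theorem continuousOn_cauchyKer_seg {w : ℂ} (hw : w ∈ P.Λ \ seg P.l P.r) :
    ContinuousOn (fun s : ℝ => cauchyKer D.b w s) (Icc P.l P.r) := by
  refine ((D.conf.cauchyKer_holo_right hw.1).continuousOn).comp (f := fun s : ℝ => (s : ℂ))
    Complex.continuous_ofReal.continuousOn fun s hs => ⟨P.seg_sub (mem_seg hs.1 hs.2), fun h => ?_⟩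
  exact hw.2 (by rw [← mem_singleton_iff.1 h]; exact mem_seg hs.1 hs.2)

theorem Gf_eq {w : ℂ} (hw : w ∈ P.Λ \ seg P.l P.r) : D.Gf w = Complex.exp (D.Γ w) := by
  have h1 : ∀ s : ℝ, deriv D.b w * (rho P.θ D.ε D.x s : ℂ) / (D.b w - D.b s) =
      cauchyKer D.b w s * (rho P.θ D.ε D.x s : ℂ) := fun s => by unfold cauchyKer; ring
  unfold Gf G Γ
  simp only [h1]
  rw [D.intervalIntegral_mul_rho (D.continuousOn_cauchyKer_seg hw), mul_inv_cancel_left₀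
    (by exact_mod_cast P.θ_pos.ne')]
  push_cast
  rfl

/-- The logarithm of the factor `(b(a + h) - b(v)) / (b(a) - b(v))`. -/
noncomputable def hf (v a : ℂ) : ℂ := ∫ s in (0 : ℝ)..D.h, cauchyKer D.b (a + s) v

/-- The linear statistic `ln ∏ⱼ (b(v) - b(aⱼ + h eⱼ)) / (b(v) - b(aⱼ))`. -/
noncomputable def T (e : Fin D.n → Fin 2) (v : ℂ) : ℂ := ∑ j, (e j : ℕ) * D.hf v (D.a j)

theorem exp_integral_cauchyKer {v a : ℂ} {h : ℝ} (h0 : 0 ≤ h) (hv : v ∈ P.Λ)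
    (ha : ∀ s ∈ Icc 0 h, a + s ∈ P.Λ \ {v}) :
    Complex.exp (∫ s in (0 : ℝ)..h, cauchyKer D.b (a + s) v) =
      (D.b (a + h) - D.b v) / (D.b a - D.b v) := by
  set I : Set ℝ := (fun s : ℝ => a + s) ⁻¹' (P.Λ \ {v}) with hI
  have hIo : IsOpen I := (P.isOpen.sdiff isClosed_singleton).preimage (by fun_prop)
  have ha0 : a ∈ P.Λ \ {v} := by simpa using ha 0 (left_mem_Icc.2 h0)
  have hne : ∀ w ∈ P.Λ \ {v}, D.b w - D.b v ≠ 0 := fun w hw => D.conf.sub_ne hw.1 hv hw.2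
  have key := eq_mul_exp_integral hIo (u := fun s : ℝ => D.b (a + s) - D.b v)
    (ψ := fun s : ℝ => cauchyKer D.b (a + s) v) (fun t ht => ?_) ?_ h0 ha
  · simp only [Complex.ofReal_zero, add_zero] at key
    rw [eq_div_iff (hne a ha0), mul_comm]
    exact key.symm
  · have h1 : HasDerivAt (fun s : ℝ => a + (s : ℂ)) 1 t :=
      (Complex.ofRealCLM.hasDerivAt (x := t)).const_add a
    have h2 := ((D.conf.differentiableAt ht.1).hasDerivAt.comp_of_eq t h1 rfl).sub_const (D.b v)
    refine h2.congr_deriv ?_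
    simp only [cauchyKer]
    rw [div_mul_cancel₀ _ (hne _ ht), mul_one]
  · exact (D.conf.cauchyKer_holo_left hv).continuousOn.comp
      (Continuous.continuousOn (by fun_prop)) fun s hs => hs

theorem exp_hf {v a : ℂ} (hv : v ∈ P.Λ) (ha : ∀ s ∈ Icc 0 D.h, a + s ∈ P.Λ \ {v}) :
    Complex.exp (D.hf v a) = (D.b (a + D.h) - D.b v) / (D.b a - D.b v) :=
  D.exp_integral_cauchyKer D.h_pos.le hv ha

theorem a_add_off {v : ℂ} (hv : v ∉ seg P.l P.r) (j : Fin D.n) {s : ℝ} (hs : s ∈ Icc 0 D.h) :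
    (D.a j : ℂ) + s ∈ P.Λ \ {v} :=
  ⟨P.seg_sub (D.a_add_mem j hs), fun h => hv (by
    rw [← mem_singleton_iff.1 h]; exact D.a_add_mem j hs)⟩

theorem obs_eq (e : Fin D.n → Fin 2) {v : ℂ} (hv : v ∈ P.Λ \ seg P.l P.r) :
    D.obs e v = Complex.exp (D.T e v) := by
  unfold obs T
  rw [Complex.exp_sum]
  refine Finset.prod_congr rfl fun j _ => ?_
  have hne : D.b v - D.b (D.a j) ≠ 0 := D.conf.sub_ne hv.1 (P.seg_sub (D.a_mem j))
    fun h => hv.2 (h ▸ D.a_mem j)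
  rcases fin_two (e j) with h | h
  · rw [D.pt_zero h, h, div_self hne]; simp
  · rw [D.pt_one h, h]
    simp only [Fin.val_one, Nat.cast_one, one_mul]
    rw [D.exp_hf hv.1 fun s hs => D.a_add_off hv.2 j hs, ← neg_sub (D.b v), ← neg_sub (D.b v),
      neg_div_neg_eq]
    push_cast
    rfl

/-- The logarithm of the factor `(b(w + h) - b(aⱼ)) / (b(w) - b(aⱼ))`, summed over `j`. -/
noncomputable def Γs (w : ℂ) : ℂ := ∑ j, ∫ s in (0 : ℝ)..D.h, cauchyKer D.b (w + s) (D.a j)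

theorem sobs_eq (e : Fin D.n → Fin 2) {w : ℂ} (hw : ∀ s ∈ Icc 0 D.h, w + s ∈ P.Λ \ seg P.l P.r) :
    D.sobs e w = Complex.exp (D.Γs w) * D.obs e (w + D.h) := by
  have hoff : ∀ j, ∀ s ∈ Icc 0 D.h, w + s ∈ P.Λ \ {(D.a j : ℂ)} := fun j s hs =>
    ⟨(hw s hs).1, fun h => (hw s hs).2 (by rw [mem_singleton_iff.1 h]; exact D.a_mem j)⟩
  unfold sobs obs Γs
  rw [Complex.exp_sum, ← Finset.prod_mul_distrib]
  refine Finset.prod_congr rfl fun j _ => ?_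
  rw [D.exp_integral_cauchyKer D.h_pos.le (P.seg_sub (D.a_mem j)) (hoff j)]
  have h1 := hoff j D.h (right_mem_Icc.2 D.h_pos.le)
  have hne : D.b (w + D.h) - D.b (D.a j) ≠ 0 := D.conf.sub_ne h1.1 (P.seg_sub (D.a_mem j)) h1.2
  field_simp

end Step

end

section

open Conf

/-! ### Taylor estimates -/

theorem norm_sub_le_of_ball {f : ℂ → ℂ} {c : ℂ} {R M : ℝ} (hf : DifferentiableOn ℂ f (Metric.ball c R))
    (hM : ∀ z ∈ Metric.ball c R, ‖f z‖ ≤ M) {s : ℂ} (hs : ‖s‖ < R) :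
    ‖f (c + s) - f c‖ ≤ 2 * M / R * ‖s‖ := by
  have hR : 0 < R := (norm_nonneg s).trans_lt hs
  have h1 : MapsTo f (Metric.ball c R) (Metric.closedBall (f c) (2 * M)) := fun z hz => by
    rw [Metric.mem_closedBall, dist_eq_norm]
    have h1 := hM z hz
    have h2 := hM c (Metric.mem_ball_self hR)
    linarith [norm_sub_le (f z) (f c)]
  have := Complex.dist_le_div_mul_dist_of_mapsTo_ball hf h1 (z := c + s) (by simpa using hs)
  simpa [dist_eq_norm] using this

theorem norm_taylor_le_of_ball {f : ℂ → ℂ} {c : ℂ} {R M : ℝ}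
    (hf : DifferentiableOn ℂ f (Metric.ball c R)) (hM : ∀ z ∈ Metric.ball c R, ‖f z‖ ≤ M)
    {s : ℂ} (hs : ‖s‖ < R) :
    ‖f (c + s) - f c - s * deriv f c‖ ≤ 4 * M / R ^ 2 * ‖s‖ ^ 2 := by
  have hR : 0 < R := (norm_nonneg s).trans_lt hs
  have h1 : MapsTo f (Metric.ball c R) (Metric.closedBall (f c) (2 * M)) := fun z hz => by
    rw [Metric.mem_closedBall, dist_eq_norm]
    have h1 := hM z hz
    have h2 := hM c (Metric.mem_ball_self hR)
    linarith [norm_sub_le (f z) (f c)]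
  have h2 := norm_sub_le_of_ball (f := dslope f c) ((Complex.differentiableOn_dslope
    (Metric.ball_mem_nhds c hR)).2 hf)
    (fun z hz => Complex.norm_dslope_le_div_of_mapsTo_ball hf h1 hz) hs
  have h3 := sub_smul_dslope f c (c + s)
  rw [add_sub_cancel_left, smul_eq_mul] at h3
  rw [← h3, ← mul_sub, norm_mul]
  rw [dslope_same] at h2
  refine (mul_le_mul_of_nonneg_left h2 (norm_nonneg s)).trans (le_of_eq ?_)
  field_simp
  ring

theorem norm_deriv_le_of_ball {f : ℂ → ℂ} {c : ℂ} {R M : ℝ} (hR : 0 < R)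
    (hf : DifferentiableOn ℂ f (Metric.ball c R)) (hM : ∀ z ∈ Metric.ball c R, ‖f z‖ ≤ M) :
    ‖deriv f c‖ ≤ 2 * M / R := by
  have h1 : MapsTo f (Metric.ball c R) (Metric.closedBall (f c) (2 * M)) := fun z hz => by
    rw [Metric.mem_closedBall, dist_eq_norm]
    have h1 := hM z hz
    have h2 := hM c (Metric.mem_ball_self hR)
    linarith [norm_sub_le (f z) (f c)]
  have := Complex.norm_dslope_le_div_of_mapsTo_ball hf h1 (Metric.mem_ball_self hR)
  rwa [dslope_same] at this

namespace Setting

variable {P : Setting}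

theorem sep {j k : ℝ} {a w : ℂ} (ha : lvl P.l P.r a ≤ P.s j) (hw : P.s k ≤ lvl P.l P.r w) :
    (k - j) * P.g / 2 ≤ ‖w - a‖ := by
  have := lvl_le_add P.l P.r w a
  simp only [s] at ha hw
  linarith

theorem ball_lvl {k : ℝ} {c z : ℂ} {δ : ℝ} (hz : z ∈ Metric.ball c (δ * P.g)) :
    (lvl P.l P.r c ≤ P.s k → lvl P.l P.r z ≤ P.s (k + 2 * δ)) ∧
      (P.s k ≤ lvl P.l P.r c → P.s (k - 2 * δ) ≤ lvl P.l P.r z) := by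
  rw [Metric.mem_ball, dist_eq_norm] at hz
  have h1 := lvl_le_add P.l P.r z c
  have h2 := lvl_le_add P.l P.r c z
  rw [norm_sub_rev] at h2
  simp only [s]
  constructor <;> intro h <;> linarith

theorem ball_sub {k δ : ℝ} (hk : k + 2 * δ ≤ 10) {c : ℂ} (hc : lvl P.l P.r c ≤ P.s k) :
    Metric.ball c (δ * P.g) ⊆ P.Λ := fun _ hz => P.mem_Λ hk ((ball_lvl hz).1 hc)

theorem lvl_seg {a : ℂ} (ha : a ∈ seg P.l P.r) : lvl P.l P.r a ≤ P.s 0 := by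
  rw [lvl_of_mem_seg ha, s]; linarith [P.g_pos]

end Setting

variable {P : Setting}

/-! ### Uniform bounds for `b` -/

theorem exists_deriv_b_bound (P : Setting) : ∃ K : ℝ, 0 < K ∧ ∀ (D : Step P) (z : ℂ),
    (lvl P.l P.r z ≤ P.s 9.5 ∨ z ∈ P.F) → ‖deriv D.b z‖ ≤ K := by
  obtain ⟨δ, hδ, hF⟩ := P.F_compact.exists_cthickening_subset_open P.isOpen P.F_sub
  set R := min δ (1 / 4 * P.g) with hR
  have hR0 : 0 < R := lt_min hδ (by linarith [P.g_pos])
  refine ⟨2 * P.C / R, by have := P.C_pos; positivity, fun D z hz => ?_⟩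
  have hball : Metric.ball z R ⊆ P.Λ := by
    rcases hz with hz | hz
    · exact (Metric.ball_subset_ball (min_le_right _ _)).trans
        (P.ball_sub (k := 9.5) (by norm_num) hz)
    · refine ((Metric.ball_subset_ball (min_le_left _ _)).trans ?_).trans hF
      exact (Metric.ball_subset_thickening hz δ).trans (Metric.thickening_subset_cthickening _ _)
  exact norm_deriv_le_of_ball hR0 (D.conf.holo.mono hball)
    fun w hw => D.adm.asymp.b_bound w (hball hw)

theorem exists_b_sep (P : Setting) {δ : ℝ} (hδ : 0 < δ) : ∃ κ : ℝ, 0 < κ ∧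
    ∀ (D : Step P) (w z : ℂ), lvl P.l P.r w ≤ P.s 9.5 → z ∈ P.Λ → δ ≤ ‖z - w‖ →
      κ ≤ ‖D.b z - D.b w‖ := by
  have hg := P.g_pos
  have hC := P.C_pos
  set R := 1 / 4 * P.g with hR
  have hR0 : 0 < R := by positivity
  set M := 4 * P.C / R ^ 2 with hM
  have hM0 : 0 < M := by positivity
  set ρ := min (δ / 2) (min (R / 2) (1 / (2 * P.C * M))) with hρ
  have hρ0 : 0 < ρ := lt_min (by positivity) (lt_min (by positivity) (by positivity))
  have hρδ : ρ < δ := (min_le_left _ _).trans_lt (by linarith)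
  have hρR : ρ < R := ((min_le_right _ _).trans (min_le_left _ _)).trans_lt (by linarith)
  have hρM : ρ ≤ 1 / (2 * P.C * M) := (min_le_right _ _).trans (min_le_right _ _)
  refine ⟨ρ / (2 * P.C) / 2, by positivity, fun D w z hw hz hzw => ?_⟩
  have hball : Metric.ball w R ⊆ P.Λ := P.ball_sub (k := 9.5) (by norm_num) hw
  have hwΛ : w ∈ P.Λ := hball (Metric.mem_ball_self hR0)
  have hlow : ∀ v ∈ Metric.sphere w ρ, ρ / (2 * P.C) ≤ ‖D.b v - D.b w‖ := by
    intro v hv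
    have hvn : ‖v - w‖ = ρ := by rw [← dist_eq_norm]; exact hv
    have h1 := norm_taylor_le_of_ball (D.conf.holo.mono hball)
      (fun u hu => D.adm.asymp.b_bound u (hball hu)) (s := v - w) (by rw [hvn]; exact hρR)
    rw [add_sub_cancel, hvn] at h1
    have h2 := D.adm.asymp.deriv_b_bound w hwΛ
    have h3 : ρ * (1 / P.C) ≤ ‖(v - w) * deriv D.b w‖ := by
      rw [norm_mul, hvn]; exact mul_le_mul_of_nonneg_left h2 hρ0.le
    have h4 : ‖(v - w) * deriv D.b w‖ ≤ ‖D.b v - D.b w‖ +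
        ‖D.b v - D.b w - (v - w) * deriv D.b w‖ := by
      have := norm_sub_le (D.b v - D.b w) (D.b v - D.b w - (v - w) * deriv D.b w)
      rwa [sub_sub_cancel] at this
    have h5 : M * ρ ^ 2 ≤ ρ / (2 * P.C) := by
      have : M * ρ ≤ M * (1 / (2 * P.C * M)) := mul_le_mul_of_nonneg_left hρM hM0.le
      have e : M * (1 / (2 * P.C * M)) = 1 / (2 * P.C) := by field_simp
      rw [e] at this
      calc M * ρ ^ 2 = (M * ρ) * ρ := by ring
        _ ≤ 1 / (2 * P.C) * ρ := mul_le_mul_of_nonneg_right this hρ0.le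
        _ = ρ / (2 * P.C) := by ring
    have h6 : ρ * (1 / P.C) = 2 * (ρ / (2 * P.C)) := by field_simp
    linarith
  by_contra! hlt
  have hsub := DiffContOnCl.ball_subset_image_closedBall (f := D.b) (z₀ := w) (r := ρ)
    (DifferentiableOn.diffContOnCl (by
      rw [closure_ball _ hρ0.ne']
      exact D.conf.holo.mono ((Metric.closedBall_subset_ball hρR).trans hball))) hρ0 hlow (by
      have : ∀ᶠ u in 𝓝[≠] w, D.b u ≠ D.b w := by
        filter_upwards [self_mem_nhdsWithin, mem_nhdsWithin_of_mem_nhds (P.isOpen.mem_nhds hwΛ)]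
          with u hu hu' h
        exact hu (D.conf.inj hu' hwΛ h)
      exact this.frequently.filter_mono nhdsWithin_le_nhds)
  obtain ⟨v, hv, hvz⟩ := hsub (show D.b z ∈ _ by rw [Metric.mem_ball, dist_eq_norm]; exact hlt)
  have : v = z := D.conf.inj (hball (Metric.closedBall_subset_ball hρR hv)) hz hvz
  subst this
  rw [Metric.mem_closedBall, dist_eq_norm] at hv
  linarith

/-- Uniform bound for the Cauchy kernel. -/
theorem exists_cauchyKer_bound (P : Setting) {δ : ℝ} (hδ : 0 < δ) : ∃ K : ℝ, 0 < K ∧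
    ∀ (D : Step P) (w a : ℂ), lvl P.l P.r w ≤ P.s 9.5 → lvl P.l P.r a ≤ P.s 9.5 →
      δ ≤ ‖w - a‖ → ‖cauchyKer D.b w a‖ ≤ K := by
  obtain ⟨κ, hκ, h1⟩ := exists_b_sep P hδ
  obtain ⟨K, hK, h2⟩ := exists_deriv_b_bound P
  refine ⟨K / κ, by positivity, fun D w a hw ha hwa => ?_⟩
  unfold cauchyKer
  rw [norm_div]
  exact div_le_div₀ hK.le (h2 D w (Or.inl hw)) hκ (h1 D a w ha (P.mem_Λ (by norm_num) hw) hwa)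

/-- The closed region between two levels. -/
def Setting.ann (P : Setting) (j k : ℝ) : Set ℂ :=
  {z | P.s j ≤ lvl P.l P.r z ∧ lvl P.l P.r z ≤ P.s k}

theorem Setting.isCompact_ann (j k : ℝ) : IsCompact (P.ann j k) :=
  (isCompact_lvl_le P.l P.r (P.s k)).inter_left (isClosed_le continuous_const (continuous_lvl _ _))

theorem Setting.ann_sub {j k : ℝ} (hj : 0 < j) (hk : k ≤ 10) :
    P.ann j k ⊆ P.Λ \ seg P.l P.r := fun _ hz =>
  ⟨P.mem_Λ hk hz.2, P.notMem_seg (k := 0) le_rfl ((P.s_lt hj).trans_le hz.1)⟩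

theorem Setting.con_sub_ann {i j k : ℝ} (hi : 0 < i) (hj : j ≤ i) (hk : i ≤ k) :
    trace (P.con i) ⊆ P.ann j k := fun w hw => by
  rw [Setting.ann, mem_ofPred_eq, P.lvl_con hi hw]; exact ⟨P.s_le hj, P.s_le hk⟩

theorem Setting.ann_mono {j k j' k' : ℝ} (hj : j' ≤ j) (hk : k ≤ k') :
    P.ann j k ⊆ P.ann j' k' := fun _ hz => ⟨(P.s_le hj).trans hz.1, hz.2.trans (P.s_le hk)⟩

theorem Setting.ball_sub_ann {j k δ : ℝ} {c : ℂ} (hc : c ∈ P.ann j k) :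
    Metric.ball c (δ * P.g) ⊆ P.ann (j - 2 * δ) (k + 2 * δ) := fun _ hz =>
  ⟨(P.ball_lvl hz).2 hc.1, (P.ball_lvl hz).1 hc.2⟩

/-- Sums over the particles of quantities of order `ε`. -/
theorem Step.norm_sum_le (D : Step P) {f : Fin D.n → ℂ} {K : ℝ} (hf : ∀ j, ‖f j‖ ≤ K * D.ε) :
    ‖∑ j, f j‖ ≤ K * P.N := by
  refine (norm_sum_le_of_le _ fun j _ => hf j).trans (le_of_eq ?_)
  rw [Finset.sum_const, Finset.card_univ, Fintype.card_fin, nsmul_eq_mul, ← D.n_mul_ε]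
  ring

theorem Step.norm_sum_mul_le (D : Step P) (e : Fin D.n → Fin 2) {f : Fin D.n → ℂ} {K : ℝ}
    (hf : ∀ j, ‖f j‖ ≤ K * D.ε) : ‖∑ j, (e j : ℕ) * f j‖ ≤ K * P.N := by
  refine D.norm_sum_le fun j => ?_
  rw [norm_mul, Complex.norm_natCast]
  refine le_trans (mul_le_of_le_one_left (norm_nonneg _) ?_) (hf j)
  exact_mod_cast Fin.is_le (e j)

theorem Step.norm_integral_h_le (D : Step P) {f : ℝ → ℂ} {K : ℝ} (hf : ∀ s ∈ Icc 0 D.h, ‖f s‖ ≤ K) :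
    ‖∫ s in (0 : ℝ)..D.h, f s‖ ≤ K * D.h := by
  have := intervalIntegral.norm_integral_le_of_norm_le_const (a := 0) (b := D.h) (C := K)
    (f := f) fun s hs => hf s (by
      rw [uIoc_of_le D.h_pos.le] at hs; exact ⟨hs.1.le, hs.2⟩)
  rwa [sub_zero, abs_of_pos D.h_pos] at this

/-- The Cauchy kernel between the segment and points away from it. -/
theorem exists_cauchyKer_seg_bound (P : Setting) {j : ℝ} (hj : 0 < j) : ∃ K : ℝ, 0 < K ∧
    ∀ (D : Step P) (w a : ℂ), w ∈ P.ann j 9.5 → a ∈ seg P.l P.r →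
      ‖cauchyKer D.b w a‖ ≤ K ∧ ‖cauchyKer D.b a w‖ ≤ K := by
  obtain ⟨K, hK, h⟩ := exists_cauchyKer_bound P (δ := j * P.g / 2)
    (by have := P.g_pos; positivity)
  refine ⟨K, hK, fun D w a hw ha => ?_⟩
  have h1 := P.sep (P.lvl_seg ha) hw.1
  rw [sub_zero] at h1
  have h2 : lvl P.l P.r a ≤ P.s 9.5 := (P.lvl_seg ha).trans (P.s_le (by norm_num))
  exact ⟨h D w a hw.2 h2 h1, h D a w h2 hw.2 (by rwa [norm_sub_rev])⟩

theorem exists_Γ_T_bound (P : Setting) {j : ℝ} (hj : 0 < j) : ∃ K : ℝ, 0 < K ∧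
    ∀ (D : Step P) (w : ℂ), w ∈ P.ann j 9.5 → ‖D.Γ w‖ ≤ K ∧ ∀ e, ‖D.T e w‖ ≤ K := by
  obtain ⟨K, hK, h⟩ := exists_cauchyKer_seg_bound P hj
  have hθ := P.θ_pos
  have hN := P.N_pos
  refine ⟨K * P.θ * P.N, by positivity, fun D w hw => ⟨?_, fun e => ?_⟩⟩
  · refine D.norm_sum_le fun i => ?_
    refine (D.norm_integral_h_le fun s hs => (h D w _ hw (D.a_add_mem i hs)).1).trans (le_of_eq ?_)
    unfold Conf.h; ring
  · refine D.norm_sum_mul_le e fun i => ?_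
    refine (D.norm_integral_h_le fun s hs => (h D w _ hw (D.a_add_mem i hs)).2).trans (le_of_eq ?_)
    unfold Conf.h; ring

theorem norm_exp_le {z : ℂ} {K : ℝ} (h : ‖z‖ ≤ K) : ‖Complex.exp z‖ ≤ Real.exp K := by
  rw [Complex.norm_exp]
  exact Real.exp_le_exp.2 ((Complex.re_le_norm z).trans h)

theorem exists_B_bound (P : Setting) {j : ℝ} (hj : 0 < j) : ∃ K : ℝ, 0 < K ∧
    ∀ (D : Step P) (w : ℂ), w ∈ P.ann j 9.5 → ‖D.Bf w‖ ≤ K ∧ ‖(D.Bf w)⁻¹‖ ≤ K := by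
  have hS := P.ann_sub hj (k := 9.5) (by norm_num)
  have hc := P.c_pos _ (P.isCompact_ann j 9.5) hS
  refine ⟨(P.c (P.ann j 9.5))⁻¹, inv_pos.2 hc, fun D w hw => ?_⟩
  have := D.adm.stable.bounds _ (P.isCompact_ann j 9.5) hS w hw
  refine ⟨this.2.le, ?_⟩
  rw [norm_inv]
  exact inv_anti₀ hc this.1.le

end

section

open Conf

/-- The oscillation of a holomorphic function along a curve. -/
theorem norm_sub_le_curveLength {γ : ℝ → ℂ} (h : PwC1 γ) {V : Set ℂ} (hV : IsOpen V)
    (hγ : trace γ ⊆ V) {F : ℂ → ℂ} (hF : DifferentiableOn ℂ F V) {M : ℝ}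
    (hM : ∀ w ∈ trace γ, ‖deriv F w‖ ≤ M) {w : ℂ} (hw : w ∈ trace γ) :
    ‖F w - F (γ 0)‖ ≤ M * curveLength γ := by
  obtain ⟨u, hu, rfl⟩ := hw
  obtain ⟨P, hP⟩ := h.exists_finset_hasDerivAt
  have hc : ContinuousOn (deriv F) V := (hF.deriv hV).continuousOn
  have hi := h.integrable (hc.mono hγ)
  have hsub : uIcc 0 u ⊆ uIcc (0 : ℝ) 1 := by
    rw [uIcc_of_le hu.1, uIcc_of_le zero_le_one]; exact Icc_subset_Icc_right hu.2
  have hi' : IntervalIntegrable (fun t => deriv F (γ t) * deriv γ t) volume 0 u := hi.mono_set hsub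
  have key : ∫ t in (0 : ℝ)..u, deriv F (γ t) * deriv γ t = F (γ u) - F (γ 0) := by
    refine integral_eq_of_hasDerivAt_off_countable_of_le (fun t => F (γ t)) _ hu.1
      P.countable_toSet ((continuousOn_comp_trace h.1 (hF.continuousOn.mono hγ)).mono
        (Icc_subset_Icc_right hu.2)) (fun t ht => ?_) hi'
    have ht1 : t ∈ Ioo (0 : ℝ) 1 := ⟨ht.1.1, ht.1.2.trans_le hu.2⟩
    have h1 := hP t ht1 ht.2
    have h2 := (hF.differentiableAt
      (hV.mem_nhds (hγ (mem_trace (Ioo_subset_Icc_self ht1))))).hasDerivAt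
    exact h2.comp_of_eq t h1 rfl
  have hd := h.intervalIntegrable_deriv.norm.const_mul M
  rw [← key, curveLength, ← intervalIntegral.integral_const_mul]
  refine (intervalIntegral.norm_integral_le_of_norm_le hu.1 (Eventually.of_forall fun t ht => ?_)
    (hd.mono_set hsub)).trans ?_
  · rw [norm_mul]
    exact mul_le_mul_of_nonneg_right (hM _ (mem_trace ⟨ht.1.le, ht.2.trans hu.2⟩)) (norm_nonneg _)
  · refine intervalIntegral.integral_mono_interval le_rfl hu.1 hu.2
      (Eventually.of_forall fun t => ?_) hd
    have : 0 ≤ M := (norm_nonneg _).trans (hM _ (mem_trace hu))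
    exact mul_nonneg this (norm_nonneg _)

variable {P : Setting}

theorem Setting.isOpen_off : IsOpen (P.Λ \ seg P.l P.r) :=
  P.isOpen.sdiff ((isCompact_Icc.image Complex.continuous_ofReal).isClosed)

/-- Exterior Cauchy integrals are bounded by the integrand. -/
theorem exists_cauchy_bound (P : Setting) {i j : ℝ} (hi : 0 < i) (hij : i < j) (hi' : i ≤ 9.5) :
    ∃ K : ℝ, 0 < K ∧ ∀ (D : Step P) (f : ℂ → ℂ) (M : ℝ) (z : ℂ), z ∈ P.ann j 9.5 →
      (∀ w ∈ trace (P.con i), ‖f w‖ ≤ M) →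
      ‖(2 * Real.pi * Complex.I)⁻¹ * contourInt (P.con i) (fun w => f w * cauchyKer D.b w z)‖
        ≤ K * M := by
  obtain ⟨K, hK, h⟩ := exists_cauchyKer_bound P (δ := (j - i) * P.g / 2)
    (by have := P.g_pos; have := sub_pos.2 hij; positivity)
  have h2 : 0 < ‖(2 * Real.pi * Complex.I : ℂ)⁻¹‖ := norm_pos_iff.2 (inv_ne_zero two_pi_I_ne_zero)
  refine ⟨‖(2 * Real.pi * Complex.I : ℂ)⁻¹‖ * (K * (curveLength (P.con i) + 1)),
    mul_pos h2 (mul_pos hK (by linarith [curveLength_nonneg (P.con i)])),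
    fun D f M z hz hf => ?_⟩
  have hM : 0 ≤ M := (norm_nonneg _).trans (hf _ (mem_trace (t := 0) (by simp)))
  rw [norm_mul, mul_assoc ‖_‖]
  refine mul_le_mul_of_nonneg_left ?_ h2.le
  refine (norm_contourInt_le (P.isLoop_con hi).pwC1 (M := M * K) fun w hw => ?_).trans ?_
  · rw [norm_mul]
    have hl := P.lvl_con hi hw
    exact mul_le_mul (hf w hw) (h D w z (by rw [hl]; exact P.s_le hi') hz.2
      (by rw [norm_sub_rev]; exact P.sep hl.le hz.1)) (norm_nonneg _) hM
  · nlinarith [mul_nonneg hM hK.le]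

theorem Step.contourInt_cauchyKer_eq_zero (D : Step P) {i : ℝ} (hi : 0 < i) {z : ℂ}
    (hz : z ∈ P.Λ) (hz' : P.s i < lvl P.l P.r z) (hi' : i ≤ 10) :
    contourInt (P.con i) (fun w => cauchyKer D.b w z) = 0 := by
  refine contourInt_eq_zero (V := P.Λ \ {z}) (P.isOpen.sdiff isClosed_singleton)
    (P.isLoop_con hi) (fun w hw => ⟨P.con_sub hi hi' hw, fun h => ?_⟩) (fun a ha => ?_)
    (D.conf.cauchyKer_holo_left hz)
  · rw [mem_singleton_iff.1 h] at hw
    exact hz'.ne' (P.lvl_con hi hw)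
  · by_cases h : a ∈ P.Λ
    · have : a = z := by by_contra h'; exact ha ⟨h, h'⟩
      rw [this]; exact P.winding_con_out hi hz'
    · exact P.winding_con_off hi hi' a h

/-- Exterior Cauchy integrals are bounded by the derivative of the integrand. -/
theorem exists_cauchy_deriv_bound (P : Setting) {i j : ℝ} (hi : 0 < i) (hij : i < j)
    (hi' : i ≤ 9.5) :
    ∃ K : ℝ, 0 < K ∧ ∀ (D : Step P) (f : ℂ → ℂ) (M : ℝ) (z : ℂ), z ∈ P.ann j 9.5 →
      ∀ V : Set ℂ, IsOpen V → trace (P.con i) ⊆ V → DifferentiableOn ℂ f V →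
      (∀ w ∈ trace (P.con i), ‖deriv f w‖ ≤ M) →
      ‖(2 * Real.pi * Complex.I)⁻¹ * contourInt (P.con i) (fun w => f w * cauchyKer D.b w z)‖
        ≤ K * M := by
  obtain ⟨K, hK, h⟩ := exists_cauchy_bound P hi hij hi'
  refine ⟨K * (curveLength (P.con i) + 1),
    mul_pos hK (by linarith [curveLength_nonneg (P.con i)]), fun D f M z hz V hV hγ hf hM => ?_⟩
  have hM0 : 0 ≤ M := (norm_nonneg _).trans (hM _ (mem_trace (t := 0) (by simp)))
  have hp := (P.isLoop_con hi).pwC1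
  have hzΛ : z ∈ P.Λ := P.mem_Λ (by norm_num) hz.2
  have hlt : P.s i < lvl P.l P.r z := (P.s_lt hij).trans_le hz.1
  have hc : ContinuousOn (fun w => cauchyKer D.b w z) (trace (P.con i)) :=
    (D.conf.cauchyKer_holo_left hzΛ).continuousOn.mono fun w hw =>
      ⟨P.con_sub hi (by linarith) hw, fun h => by
        rw [mem_singleton_iff.1 h] at hw; exact hlt.ne' (P.lvl_con hi hw)⟩
  have e : contourInt (P.con i) (fun w => f w * cauchyKer D.b w z) =
      contourInt (P.con i) (fun w => (f w - f (P.con i 0)) * cauchyKer D.b w z) := by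
    have h1 := contourInt_sub hp (f := fun w => f w * cauchyKer D.b w z)
      (g := fun w => f (P.con i 0) * cauchyKer D.b w z)
      ((hf.continuousOn.mono hγ).mul hc) (continuousOn_const.mul hc)
    rw [contourInt_const_mul, D.contourInt_cauchyKer_eq_zero hi hzΛ hlt (by linarith), mul_zero,
      sub_zero] at h1
    rw [← h1]
    exact contourInt_congr fun w _ => by ring
  rw [e]
  refine (h D _ _ z hz fun w hw => norm_sub_le_curveLength hp hV hγ hf hM hw).trans ?_
  nlinarith [mul_nonneg hK.le hM0]

namespace Step

variable (D : Step P)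

theorem Bf_holo : DifferentiableOn ℂ D.Bf (P.Λ \ seg P.l P.r) :=
  (D.branch.1.cexp).congr fun _ hw => (D.exp_L hw).symm

theorem deriv_L {w : ℂ} (hw : w ∈ P.Λ \ seg P.l P.r) : deriv D.L w = deriv D.Bf w / D.Bf w := by
  have h1 : D.Bf =ᶠ[𝓝 w] fun w => Complex.exp (D.L w) := by
    filter_upwards [P.isOpen_off.mem_nhds hw] with u hu using (D.exp_L hu).symm
  have h2 := (D.branch.1.differentiableAt (P.isOpen_off.mem_nhds hw)).hasDerivAt.cexp
  rw [h1.deriv_eq, h2.deriv, D.exp_L hw, mul_div_cancel_left₀ _ (D.Bf_ne hw)]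

theorem T_outer (e : Fin D.n → Fin 2) : IsOuter P.Λ D.b P.core (D.T e) 0 := by
  have h1 : ∀ j ∈ Finset.univ, IsOuter P.Λ D.b P.core
      (fun v => ((e j : ℕ) : ℂ) * D.hf v (D.a j)) 0 := fun j _ => by
    have hseg : ∀ t ∈ Icc 0 D.h, (D.a j : ℂ) + (t : ℝ) ∈ P.core := fun t ht =>
      P.seg_sub_core (D.a_add_mem j ht)
    have hcont : ContinuousOn (fun t : ℝ => (D.a j : ℂ) + t) (Icc 0 D.h) := by fun_prop
    have hsub : MapsTo (fun t : ℝ => (D.a j : ℂ) + t) (Icc 0 D.h) P.Λ := fun t ht =>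
      P.core_sub (hseg t ht)
    have h1 : IsOuter P.Λ D.b P.core _ 0 := IsOuter.intervalIntegral (Λ := P.Λ) (b := D.b)
      (S := P.core) (y := fun t => D.b (D.a j + t)) (g := fun t => -deriv D.b (D.a j + t))
      D.h_pos.le (D.conf.holo.continuousOn.comp hcont hsub)
      (fun t ht => mem_image_of_mem _ (hseg t ht)) D.isCompact_image_core
      (((D.conf.deriv_holo.continuousOn.comp hcont hsub).neg).intervalIntegrable_of_Icc D.h_pos.le)
    have h2 := (IsOuter.const P.Λ D.b P.core ((e j : ℕ) : ℂ)).mul h1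
    rw [mul_zero] at h2
    refine h2.congr fun w hw => ?_
    unfold hf
    congr 1
    refine intervalIntegral.integral_congr fun t ht => ?_
    rw [uIcc_of_le D.h_pos.le] at ht
    simp only [cauchyKer]
    rw [← neg_sub (D.b w), div_neg, div_eq_mul_inv]
    ring
  have := IsOuter.sum Finset.univ h1
  rwa [Finset.sum_const_zero] at this

/-- The fluctuation of the logarithm of the observable. -/
noncomputable def τ (e : Fin D.n → Fin 2) (v : ℂ) : ℂ := D.T e v - D.ld v

/-- The relative fluctuation of the observable. -/
noncomputable def η (e : Fin D.n → Fin 2) (v : ℂ) : ℂ := Complex.exp (D.τ e v) - 1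

/-- The deterministic part of the discretization error. -/
noncomputable def ν (w : ℂ) : ℂ := D.Γs w - D.Γ w

/-- The discretization error. -/
noncomputable def ξ (e : Fin D.n → Fin 2) (w : ℂ) : ℂ := D.ν w + (D.T e (w + D.h) - D.T e w)

/-- The weight `𝒢 φ⁺ / 𝓑`. -/
noncomputable def A (w : ℂ) : ℂ := D.Gf w * D.φp w / D.Bf w

theorem τ_outer (e : Fin D.n → Fin 2) : IsOuter P.Λ D.b P.core (D.τ e) 0 := by
  have := (D.T_outer e).sub D.ld_outer
  rwa [sub_zero] at this

theorem η_outer (e : Fin D.n → Fin 2) : IsOuter P.Λ D.b P.core (D.η e) 0 := by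
  have := (D.τ_outer e).exp.sub (IsOuter.const P.Λ D.b P.core 1)
  rwa [Complex.exp_zero, sub_self] at this

theorem exp_τ (e : Fin D.n → Fin 2) {v : ℂ} (hv : v ∈ P.Λ \ seg P.l P.r) :
    Complex.exp (D.τ e v) = D.obs e v * Complex.exp (-D.ld v) := by
  rw [D.obs_eq e hv, ← Complex.exp_add, τ, sub_eq_add_neg]

theorem ann_add {j k t : ℝ} {w : ℂ} (hw : w ∈ P.ann j k) (h0 : 0 ≤ t) (ht : t ≤ P.g / 8) :
    w + t ∈ P.ann (j - 1 / 4) (k + 1 / 4) := by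
  have h1 := lvl_le_add P.l P.r (w + t) w
  have h2 := lvl_le_add P.l P.r w (w + t)
  rw [add_sub_cancel_left, Complex.norm_real, Real.norm_of_nonneg h0] at h1
  rw [sub_add_cancel_left, norm_neg, Complex.norm_real, Real.norm_of_nonneg h0] at h2
  have := hw.1
  have := hw.2
  simp only [Setting.s] at *
  refine ⟨?_, ?_⟩ <;> simp only [Setting.s] <;> nlinarith

theorem sobs_eq_exp (e : Fin D.n → Fin 2) {w : ℂ} (hw : w ∈ P.ann 1 9) :
    D.sobs e w * Complex.exp (-D.ld w) =
      D.Gf w * (Complex.exp (D.τ e w) * Complex.exp (D.ξ e w)) := by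
  have h1 : ∀ s ∈ Icc 0 D.h, w + (s : ℝ) ∈ P.Λ \ seg P.l P.r := fun s hs =>
    P.ann_sub (by norm_num) (by norm_num) (ann_add hw hs.1 (hs.2.trans D.h_le))
  have h0 : w ∈ P.Λ \ seg P.l P.r := P.ann_sub (by norm_num) (by norm_num) hw
  rw [D.sobs_eq e h1, D.obs_eq e (h1 _ (right_mem_Icc.2 D.h_pos.le)), D.Gf_eq h0]
  simp only [← Complex.exp_add]
  congr 1
  unfold τ ξ ν
  ring

/-- The solved loop equation in terms of fluctuations. -/
theorem master_fluct {k : ℝ} (hk : 1 < k) (hk' : k < 8) {R : (Fin D.n → Fin 2) → ℂ}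
    {Q : (Fin D.n → Fin 2) → ℂ → ℂ} {j : ℝ} (hj : k < j) (hj8 : j ≤ 8)
    (hPQ : D.Insert {z | lvl P.l P.r z < P.s j} R Q)
    {z : ℂ} (hz : z ∈ P.Λ) (hzk : P.s k < lvl P.l P.r z) :
    D.E (fun e => R e * D.η e z) = (2 * Real.pi * Complex.I)⁻¹ * contourInt (P.con k) (fun w =>
        D.A w * D.E (fun e => Complex.exp (D.τ e w) * (Complex.exp (D.ξ e w) * Q e w - R e)) *
          cauchyKer D.b w z) := by
  have hk0 : 0 < k := by linarith
  have h1 := D.master hk hk' hj hj8 hPQ hz hzk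
  have hz' := mem_of_level hk0.le hz hzk
  have h2 : D.E (fun e => R e * D.η e z) =
      D.E (fun e => R e * D.obs e z) * Complex.exp (-D.ld z) - D.E R := by
    rw [← D.E_mul_right, ← D.E_sub]
    congr 1; funext e
    rw [η, D.exp_τ e hz']; ring
  rw [h2, h1, add_sub_cancel_left]
  congr 1
  refine contourInt_congr fun w hw => ?_
  have hw9 : w ∈ P.ann 1 9 := P.con_sub_ann hk0 hk.le (by linarith) hw
  have hw0 : w ∈ P.Λ \ seg P.l P.r := P.ann_sub (by norm_num) (by norm_num) hw9
  congr 1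
  unfold A
  have h3 : (fun e => D.sobs e w * Q e w - D.Gf w * (D.obs e w * R e)) = fun e =>
      D.Gf w * Complex.exp (D.ld w) *
        (Complex.exp (D.τ e w) * (Complex.exp (D.ξ e w) * Q e w - R e)) := by
    funext e
    have h4 := D.sobs_eq_exp e hw9
    have h5 := D.exp_τ e hw0
    have h6 : Complex.exp (-D.ld w) * Complex.exp (D.ld w) = 1 := by
      rw [← Complex.exp_add, neg_add_cancel, Complex.exp_zero]
    have h7 : D.sobs e w = D.Gf w * (Complex.exp (D.τ e w) * Complex.exp (D.ξ e w)) *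
        Complex.exp (D.ld w) := by rw [← h4, mul_assoc, h6, mul_one]
    have h8 : D.obs e w = Complex.exp (D.τ e w) * Complex.exp (D.ld w) := by
      rw [h5, mul_assoc, h6, mul_one]
    rw [h7, h8]; ring
  rw [h3, D.E_mul_left, Complex.exp_neg]
  have := Complex.exp_ne_zero (D.ld w)
  field_simp

end Step

theorem exists_ld_bound (P : Setting) : ∃ K : ℝ, 0 < K ∧
    ∀ (D : Step P) (w : ℂ), w ∈ P.ann 1.5 9.5 → ‖D.ld w‖ ≤ K := by
  obtain ⟨K, hK, h⟩ := exists_cauchy_deriv_bound P (i := 1) (j := 1.5) one_pos (by norm_num)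
    (by norm_num)
  obtain ⟨KB, hKB, hB⟩ := exists_B_bound P (j := 0.5) (by norm_num)
  have hg := P.g_pos
  refine ⟨K * (2 * KB / (1 / 4 * P.g) * KB), by positivity, fun D w hw => ?_⟩
  refine h D D.L _ w hw _ P.isOpen_off (fun u hu => Step.mem_of_level (k := 0.5) (by norm_num)
    (P.con_sub one_pos (by norm_num) hu) (by rw [P.lvl_con one_pos hu]; exact P.s_lt (by norm_num)))
    D.branch.1 fun u hu => ?_
  have hu1 : u ∈ P.ann 1 1 := P.con_sub_ann one_pos le_rfl le_rfl hu
  have hball : Metric.ball u (1 / 4 * P.g) ⊆ P.ann 0.5 9.5 :=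
    (P.ball_sub_ann hu1).trans (P.ann_mono (by norm_num) (by norm_num))
  rw [D.deriv_L (P.ann_sub (by norm_num) (by norm_num) hu1), div_eq_mul_inv, norm_mul]
  refine mul_le_mul ?_ (hB D u (P.ann_mono (by norm_num) (by norm_num) hu1)).2 (norm_nonneg _)
    (by positivity)
  exact norm_deriv_le_of_ball (by positivity)
    (D.Bf_holo.mono (hball.trans (P.ann_sub (by norm_num) (by norm_num))))
    fun v hv => (hB D v (hball hv)).1

theorem exists_A_bound (P : Setting) {j : ℝ} (hj : 0 < j) : ∃ K : ℝ, 0 < K ∧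
    ∀ (D : Step P) (w : ℂ), w ∈ P.ann j 9.5 → ‖D.A w‖ ≤ K := by
  obtain ⟨KB, hKB, hB⟩ := exists_B_bound P hj
  obtain ⟨KΓ, hKΓ, hΓ⟩ := exists_Γ_T_bound P hj
  have := P.C_pos
  refine ⟨Real.exp KΓ * P.C * KB, by positivity, fun D w hw => ?_⟩
  have h0 := P.ann_sub hj (by norm_num) hw
  unfold Step.A
  rw [div_eq_mul_inv, norm_mul, norm_mul, D.Gf_eq h0]
  gcongr
  · exact norm_exp_le (hΓ D w hw).1
  · exact D.adm.asymp.φp_bound w h0.1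
  · exact (hB D w hw).2

theorem exists_τ_bound (P : Setting) : ∃ K : ℝ, 0 < K ∧
    ∀ (D : Step P) (w : ℂ), w ∈ P.ann 1.5 9.5 → ∀ e, ‖D.τ e w‖ ≤ K := by
  obtain ⟨K1, hK1, h1⟩ := exists_ld_bound P
  obtain ⟨K2, hK2, h2⟩ := exists_Γ_T_bound P (j := 1.5) (by norm_num)
  exact ⟨K2 + K1, by positivity, fun D w hw e =>
    (norm_sub_le _ _).trans (add_le_add ((h2 D w hw).2 e) (h1 D w hw))⟩

end

section

open Conf

/-- The kernel of the discretization error. -/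
noncomputable def skewKer (b : ℂ → ℂ) (w a : ℂ) : ℂ :=
  (deriv (deriv b) w * (b w - b a) - deriv b w ^ 2 - deriv b w * deriv b a) / (b w - b a) ^ 2

namespace Conformal

variable {Λ : Set ℂ} {b : ℂ → ℂ} (h : Conformal Λ b) {w a : ℂ}

include h in
theorem hasDerivAt (hw : w ∈ Λ) : HasDerivAt b (deriv b w) w := (h.differentiableAt hw).hasDerivAt

include h in
theorem hasDerivAt_cauchyKer_right (hw : w ∈ Λ) (ha : a ∈ Λ) (hwa : w ≠ a) :
    HasDerivAt (fun a => cauchyKer b w a) (ker b w a) a := by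
  have h1 := (hasDerivAt_const a (deriv b w)).fun_div ((h.hasDerivAt ha).const_sub (b w))
    (h.sub_ne hw ha hwa)
  refine h1.congr_deriv ?_
  unfold ker
  ring

include h in
theorem hasDerivAt_cauchyKer_left (hw : w ∈ Λ) (ha : a ∈ Λ) (hwa : w ≠ a) :
    HasDerivAt (fun w => cauchyKer b w a) (skewKer b w a + ker b w a) w := by
  have h1 := ((h.deriv_holo.differentiableAt (h.isOpen.mem_nhds hw)).hasDerivAt).fun_div
    ((h.hasDerivAt hw).sub_const (b a)) (h.sub_ne hw ha hwa)
  refine h1.congr_deriv ?_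
  unfold ker skewKer
  ring

end Conformal

variable {P : Setting}

theorem exists_deriv2_b_bound (P : Setting) : ∃ K : ℝ, 0 < K ∧ ∀ (D : Step P) (z : ℂ),
    lvl P.l P.r z ≤ P.s 9 → ‖deriv (deriv D.b) z‖ ≤ K := by
  obtain ⟨K, hK, h⟩ := exists_deriv_b_bound P
  have hg := P.g_pos
  refine ⟨2 * K / (1 / 4 * P.g), by positivity, fun D z hz => ?_⟩
  exact norm_deriv_le_of_ball (by positivity)
    (D.conf.deriv_holo.mono (P.ball_sub (k := 9) (by norm_num) hz)) fun w hw => h D w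
      (Or.inl (((P.ball_lvl hw).1 hz).trans (P.s_le (by norm_num))))

theorem exists_cauchyKer_taylor (P : Setting) : ∃ K : ℝ, 0 < K ∧ ∀ (D : Step P) (w a s : ℂ),
    lvl P.l P.r w ≤ P.s 9 → lvl P.l P.r a ≤ P.s 9 → P.g / 2 ≤ ‖w - a‖ → ‖s‖ < 1 / 4 * P.g →
    ‖cauchyKer D.b (w + s) a - cauchyKer D.b w a - s * (skewKer D.b w a + ker D.b w a)‖
        ≤ K * ‖s‖ ^ 2 ∧
      ‖cauchyKer D.b w (a + s) - cauchyKer D.b w a - s * ker D.b w a‖ ≤ K * ‖s‖ ^ 2 := by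
  have hg := P.g_pos
  obtain ⟨K, hK, h⟩ := exists_cauchyKer_bound P (δ := P.g / 4) (by positivity)
  refine ⟨4 * K / (1 / 4 * P.g) ^ 2, by positivity, fun D w a s hw ha hwa hs => ?_⟩
  have hne : w ≠ a := fun h0 => by rw [h0, sub_self, norm_zero] at hwa; linarith
  have hwΛ : w ∈ P.Λ := P.mem_Λ (by norm_num) hw
  have haΛ : a ∈ P.Λ := P.mem_Λ (by norm_num) ha
  have hsep : ∀ u v : ℂ, P.g / 2 ≤ ‖u - v‖ → ∀ z ∈ Metric.ball u (1 / 4 * P.g),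
      P.g / 4 ≤ ‖z - v‖ := by
    intro u v huv z hz
    rw [Metric.mem_ball, dist_eq_norm, norm_sub_rev] at hz
    have := norm_sub_le_norm_sub_add_norm_sub u z v
    linarith
  have hwa' : P.g / 2 ≤ ‖a - w‖ := by rwa [norm_sub_rev]
  constructor
  · have h1 := norm_taylor_le_of_ball (f := fun w => cauchyKer D.b w a) (c := w)
      ((D.conf.cauchyKer_holo_left haΛ).mono fun z hz => ⟨P.ball_sub (k := 9) (by norm_num) hw hz,
        fun h0 => by
          have := hsep w a hwa z hz
          rw [mem_singleton_iff.1 h0, sub_self, norm_zero] at this; linarith⟩)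
      (M := K) (fun z hz => h D z a (((P.ball_lvl hz).1 hw).trans (P.s_le (by norm_num)))
        (ha.trans (P.s_le (by norm_num))) (hsep w a hwa z hz)) hs
    rwa [(D.conf.hasDerivAt_cauchyKer_left hwΛ haΛ hne).deriv] at h1
  · have h1 := norm_taylor_le_of_ball (f := fun a => cauchyKer D.b w a) (c := a)
      ((D.conf.cauchyKer_holo_right hwΛ).mono fun z hz => ⟨P.ball_sub (k := 9) (by norm_num) ha hz,
        fun h0 => by
          have := hsep a w hwa' z hz
          rw [mem_singleton_iff.1 h0, sub_self, norm_zero] at this; linarith⟩)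
      (M := K) (fun z hz => h D w z (hw.trans (P.s_le (by norm_num)))
        (((P.ball_lvl hz).1 ha).trans (P.s_le (by norm_num)))
        (by rw [norm_sub_rev]; exact hsep a w hwa' z hz)) hs
    rwa [(D.conf.hasDerivAt_cauchyKer_right hwΛ haΛ hne).deriv] at h1

theorem exists_skewKer_bound (P : Setting) : ∃ K : ℝ, 0 < K ∧ ∀ (D : Step P) (w a : ℂ),
    w ∈ P.ann 2 9 → lvl P.l P.r a ≤ P.s 1 → ‖skewKer D.b w a‖ ≤ K := by
  have hg := P.g_pos
  have hC := P.C_pos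
  obtain ⟨K1, hK1, h1⟩ := exists_deriv_b_bound P
  obtain ⟨K2, hK2, h2⟩ := exists_deriv2_b_bound P
  obtain ⟨κ, hκ, h3⟩ := exists_b_sep P (δ := P.g / 2) (by positivity)
  refine ⟨(K2 * (P.C + P.C) + K1 ^ 2 + K1 * K1) / κ ^ 2, by positivity, fun D w a hw ha => ?_⟩
  have hwΛ : w ∈ P.Λ := P.mem_Λ (by norm_num) hw.2
  have haΛ : a ∈ P.Λ := P.mem_Λ (by norm_num) ha
  have hw1 := h1 D w (Or.inl (hw.2.trans (P.s_le (by norm_num))))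
  have ha1 := h1 D a (Or.inl (ha.trans (P.s_le (by norm_num))))
  have hsep := P.sep ha hw.1
  have := h3 D a w (ha.trans (P.s_le (by norm_num))) hwΛ (by linarith)
  unfold skewKer
  rw [norm_div, norm_pow]
  refine div_le_div₀ (by positivity) ?_ (by positivity) (by gcongr)
  refine (norm_sub_le _ _).trans (add_le_add ((norm_sub_le _ _).trans (add_le_add ?_ ?_)) ?_)
  · rw [norm_mul]
    exact mul_le_mul (h2 D w hw.2) ((norm_sub_le _ _).trans
      (add_le_add (D.adm.asymp.b_bound w hwΛ) (D.adm.asymp.b_bound a haΛ))) (norm_nonneg _) hK2.le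
  · rw [norm_pow]; gcongr
  · rw [norm_mul]; gcongr

theorem Conformal.skewKer_holo_right {Λ : Set ℂ} {b : ℂ → ℂ} (h : Conformal Λ b) {w : ℂ}
    (hw : w ∈ Λ) : DifferentiableOn ℂ (fun a => skewKer b w a) (Λ \ {w}) := by
  have h1 : DifferentiableOn ℂ b (Λ \ {w}) := h.holo.mono sdiff_subset
  have h2 : DifferentiableOn ℂ (deriv b) (Λ \ {w}) := h.deriv_holo.mono sdiff_subset
  unfold skewKer
  exact ((((h1.const_sub _).const_mul _).sub (differentiableOn_const _)).sub
    (h2.const_mul _)).fun_div ((h1.const_sub _).fun_pow 2)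
    fun a ha => pow_ne_zero _ (h.sub_ne hw ha.1 fun h0 => ha.2 h0.symm)

namespace Step

variable (D : Step P)

/-- The third term of the correction. -/
noncomputable def A3 (w : ℂ) : ℂ :=
  (P.θ : ℂ) ^ 2 / 2 * ∫ s in P.l..P.r, skewKer D.b w s * (rho P.θ D.ε D.x s : ℂ)

theorem A3_eq {w : ℂ} (hw : w ∈ P.Λ \ seg P.l P.r) :
    D.A3 w = P.θ / 2 * ∑ j, ∫ s in (0 : ℝ)..D.h, skewKer D.b w (D.a j + s) := by
  have hc : ContinuousOn (fun s : ℝ => skewKer D.b w s) (Icc P.l P.r) :=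
    (D.conf.skewKer_holo_right hw.1).continuousOn.comp Complex.continuous_ofReal.continuousOn
      fun s hs => ⟨P.seg_sub (mem_seg hs.1 hs.2), fun h0 =>
        hw.2 (mem_singleton_iff.1 h0 ▸ mem_seg hs.1 hs.2)⟩
  have := D.intervalIntegral_mul_rho hc
  unfold A3
  rw [this]
  have hθ : (P.θ : ℂ) ≠ 0 := by exact_mod_cast P.θ_pos.ne'
  push_cast
  field_simp

end Step

theorem Step.norm_shift_le (D : Step P) {s : ℝ} (hs : s ∈ Icc 0 D.h) :
    ‖(s : ℂ)‖ < 1 / 4 * P.g ∧ ‖(s : ℂ)‖ ≤ D.h := by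
  rw [Complex.norm_real, Real.norm_of_nonneg hs.1]
  exact ⟨by linarith [hs.2, D.h_le, P.g_pos], hs.2⟩

theorem exists_A3_bound (P : Setting) : ∃ K : ℝ, 0 < K ∧ ∀ (D : Step P) (w : ℂ),
    w ∈ P.ann 2 9 → ‖D.A3 w‖ ≤ K := by
  obtain ⟨K, hK, h⟩ := exists_skewKer_bound P
  have hθ := P.θ_pos
  have hN := P.N_pos
  refine ⟨P.θ / 2 * (K * P.θ * P.N), by positivity, fun D w hw => ?_⟩
  rw [D.A3_eq (P.ann_sub (by norm_num) (by norm_num) hw), norm_mul]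
  have : ‖(P.θ : ℂ) / 2‖ = P.θ / 2 := by simp [abs_of_pos hθ]
  rw [this]
  refine mul_le_mul_of_nonneg_left (D.norm_sum_le fun j => ?_) (by positivity)
  refine (D.norm_integral_h_le fun s hs => h D w _ hw
    ((P.lvl_seg (D.a_add_mem j hs)).trans (P.s_le (by norm_num)))).trans (le_of_eq ?_)
  unfold Conf.h; ring

theorem exists_ν_expansion (P : Setting) : ∃ K : ℝ, 0 < K ∧ ∀ (D : Step P) (w : ℂ),
    w ∈ P.ann 2 9 → ‖D.ν w - D.ε * D.A3 w‖ ≤ K * D.ε ^ 2 := by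
  obtain ⟨K1, hK1, h1⟩ := exists_cauchyKer_taylor P
  obtain ⟨K2, hK2, h2⟩ := exists_skewKer_bound P
  have hθ := P.θ_pos
  have hN := P.N_pos
  have hg := P.g_pos
  refine ⟨(2 * K1 + 2 * K2 / (1 / 4 * P.g)) * P.θ ^ 3 * P.N +
    P.θ / 2 * (2 * K2 / (1 / 4 * P.g)) * P.θ ^ 2 * P.N, by positivity, fun D w hw => ?_⟩
  have hw0 := P.ann_sub (by norm_num) (by norm_num) hw
  have hε := D.ε_pos
  have hh := D.h_pos
  set K3 := 2 * K2 / (1 / 4 * P.g) with hK3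
  have hsep : ∀ j, P.g / 2 ≤ ‖w - D.a j‖ := fun j => by
    have := P.sep (P.lvl_seg (D.a_mem j)) hw.1
    linarith
  have hne : ∀ j, w ≠ D.a j := fun j h0 => hw0.2 (h0 ▸ D.a_mem j)
  -- continuity of the integrands
  have c1 : ∀ j, ContinuousOn (fun s : ℝ => cauchyKer D.b (w + s) (D.a j)) (Icc 0 D.h) := fun j =>
    (D.conf.cauchyKer_holo_left (P.seg_sub (D.a_mem j))).continuousOn.comp (by fun_prop)
      fun s hs => by
        have h3 := P.ann_sub (by norm_num) (by norm_num)
          (Step.ann_add hw hs.1 (hs.2.trans D.h_le))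
        exact ⟨h3.1, fun h0 => h3.2 (mem_singleton_iff.1 h0 ▸ D.a_mem j)⟩
  have c2 : ∀ j, ContinuousOn (fun s : ℝ => cauchyKer D.b w (D.a j + s)) (Icc 0 D.h) := fun j =>
    (D.conf.cauchyKer_holo_right hw0.1).continuousOn.comp (by fun_prop)
      fun s hs => ⟨P.seg_sub (D.a_add_mem j hs), fun h0 => hw0.2
        (mem_singleton_iff.1 h0 ▸ D.a_add_mem j hs)⟩
  have c3 : ∀ j, ContinuousOn (fun s : ℝ => skewKer D.b w (D.a j + s)) (Icc 0 D.h) := fun j =>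
    (D.conf.skewKer_holo_right hw0.1).continuousOn.comp (by fun_prop)
      fun s hs => ⟨P.seg_sub (D.a_add_mem j hs), fun h0 => hw0.2
        (mem_singleton_iff.1 h0 ▸ D.a_add_mem j hs)⟩
  have i1 := fun j => (c1 j).intervalIntegrable_of_Icc (μ := volume) hh.le
  have i2 := fun j => (c2 j).intervalIntegrable_of_Icc (μ := volume) hh.le
  have i3 := fun j => (c3 j).intervalIntegrable_of_Icc (μ := volume) hh.le
  have i4 : ∀ j, IntervalIntegrable (fun s : ℝ => (s : ℂ) * skewKer D.b w (D.a j)) volume 0 D.h :=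
    fun j => (by fun_prop : Continuous _).intervalIntegrable _ _
  have e4 : ∀ j, ∫ s in (0 : ℝ)..D.h, (s : ℂ) * skewKer D.b w (D.a j) =
      (D.h : ℂ) ^ 2 / 2 * skewKer D.b w (D.a j) := fun j => by
    rw [intervalIntegral.integral_mul_const, intervalIntegral.integral_ofReal, integral_id]
    push_cast; ring
  have hΦ : ∀ j, ∀ s ∈ Icc 0 D.h,
      ‖skewKer D.b w (D.a j + s) - skewKer D.b w (D.a j)‖ ≤ K3 * D.h := by
    intro j s hs
    have hb : ∀ z ∈ Metric.ball (D.a j : ℂ) (1 / 4 * P.g), lvl P.l P.r z ≤ P.s 1 := fun z hz =>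
      ((P.ball_lvl hz).1 (P.lvl_seg (D.a_mem j))).trans (P.s_le (by norm_num))
    have h3 := norm_sub_le_of_ball (f := fun a => skewKer D.b w a) (c := D.a j)
      ((D.conf.skewKer_holo_right hw0.1).mono fun z hz => ⟨P.mem_Λ (by norm_num) (hb z hz),
        fun h0 => by
          have h4 := hb z hz
          rw [mem_singleton_iff.1 h0] at h4
          have h5 := P.s_lt (show (1 : ℝ) < 2 by norm_num)
          linarith [hw.1]⟩)
      (fun z hz => h2 D w z hw (hb z hz)) (D.norm_shift_le hs).1
    exact h3.trans (mul_le_mul_of_nonneg_left (D.norm_shift_le hs).2 (by positivity))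
  have key : D.ν w - D.ε * D.A3 w = (∑ j, ∫ s in (0 : ℝ)..D.h, (cauchyKer D.b (w + s) (D.a j) -
      cauchyKer D.b w (D.a j + s) - s * skewKer D.b w (D.a j))) -
      D.h / 2 * ∑ j, ∫ s in (0 : ℝ)..D.h,
        (skewKer D.b w (D.a j + s) - skewKer D.b w (D.a j)) := by
    rw [D.A3_eq hw0, Step.ν, Step.Γs, Step.Γ]
    have e1 : ∀ j, ∫ s in (0 : ℝ)..D.h, (cauchyKer D.b (w + s) (D.a j) -
        cauchyKer D.b w (D.a j + s) - s * skewKer D.b w (D.a j)) =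
        (∫ s in (0 : ℝ)..D.h, cauchyKer D.b (w + s) (D.a j)) -
        (∫ s in (0 : ℝ)..D.h, cauchyKer D.b w (D.a j + s)) -
          (D.h : ℂ) ^ 2 / 2 * skewKer D.b w (D.a j) := fun j => by
      rw [intervalIntegral.integral_sub ((i1 j).sub (i2 j)) (i4 j),
        intervalIntegral.integral_sub (i1 j) (i2 j), e4]
    have e2 : ∀ j, ∫ s in (0 : ℝ)..D.h,
        (skewKer D.b w (D.a j + s) - skewKer D.b w (D.a j)) =
        (∫ s in (0 : ℝ)..D.h, skewKer D.b w (D.a j + s)) - D.h * skewKer D.b w (D.a j) :=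
      fun j => by
        rw [intervalIntegral.integral_sub (i3 j) (by simp), intervalIntegral.integral_const]
        simp
    simp only [e1, e2, Finset.sum_sub_distrib, ← Finset.mul_sum]
    have : (D.h : ℂ) = D.ε * P.θ := by unfold Conf.h; push_cast; ring
    rw [this]; ring
  rw [key]
  have b1 : ‖∑ j, ∫ s in (0 : ℝ)..D.h, (cauchyKer D.b (w + s) (D.a j) -
      cauchyKer D.b w (D.a j + s) - s * skewKer D.b w (D.a j))‖ ≤
      (2 * K1 * P.θ ^ 3 * D.ε ^ 2) * P.N := by
    refine D.norm_sum_le fun j => ?_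
    refine (D.norm_integral_h_le (K := 2 * K1 * D.h ^ 2) fun s hs => ?_).trans (le_of_eq ?_)
    · obtain ⟨h5, h6⟩ := h1 D w (D.a j) s hw.2
        ((P.lvl_seg (D.a_mem j)).trans (P.s_le (by norm_num))) (hsep j) (D.norm_shift_le hs).1
      have h7 : ‖(s : ℂ)‖ ^ 2 ≤ D.h ^ 2 := by
        have := (D.norm_shift_le hs).2; gcongr
      rw [show cauchyKer D.b (w + s) (D.a j) - cauchyKer D.b w (D.a j + s) -
        s * skewKer D.b w (D.a j) = (cauchyKer D.b (w + s) (D.a j) - cauchyKer D.b w (D.a j) -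
          s * (skewKer D.b w (D.a j) + ker D.b w (D.a j))) -
          (cauchyKer D.b w (D.a j + s) - cauchyKer D.b w (D.a j) - s * ker D.b w (D.a j)) by ring]
      refine (norm_sub_le _ _).trans ?_
      nlinarith [mul_le_mul_of_nonneg_left h7 hK1.le]
    · unfold Conf.h; ring
  have b2 : ‖∑ j, ∫ s in (0 : ℝ)..D.h,
        (skewKer D.b w (D.a j + s) - skewKer D.b w (D.a j))‖ ≤ (K3 * P.θ ^ 2 * D.ε) * P.N := by
    refine D.norm_sum_le fun j => ?_
    refine (D.norm_integral_h_le (hΦ j)).trans (le_of_eq ?_)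
    unfold Conf.h; ring
  refine (norm_sub_le _ _).trans ((add_le_add b1
    (b := (2 * K1 * P.θ ^ 3 * D.ε ^ 2) * P.N) (d := D.h / 2 * ((K3 * P.θ ^ 2 * D.ε) * P.N))
    ?_).trans ?_)
  · rw [norm_mul]
    have : ‖(D.h : ℂ) / 2‖ = D.h / 2 := by simp [abs_of_pos hh]
    rw [this]
    exact mul_le_mul_of_nonneg_left b2 (by positivity)
  · unfold Conf.h
    have : 0 ≤ K3 * P.θ ^ 3 * P.N * D.ε ^ 2 := by positivity
    nlinarith

namespace Step

variable (D : Step P)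

theorem off_core_of_ann {w : ℂ} {j k : ℝ} (hj : 1 < j) (hk : k ≤ 10) (hw : w ∈ P.ann j k) :
    w ∈ P.Λ \ P.core :=
  ⟨P.mem_Λ hk hw.2, P.notMem_core le_rfl ((P.s_lt hj).trans_le hw.1)⟩

theorem deriv_ld {w : ℂ} (hw : w ∈ P.Λ) (hw1 : P.s 1 < lvl P.l P.r w) : deriv D.ld w =
    (2 * Real.pi * Complex.I)⁻¹ * contourInt (P.con 1) (fun u => D.L u * ker D.b u w) := by
  have hs : trace (P.con 1) ⊆ P.Λ := P.con_sub one_pos (by norm_num)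
  have hV : IsOpen (P.Λ ∩ {z | P.s 1 < lvl P.l P.r z}) :=
    P.isOpen.inter (isOpen_lt_lvl _ _ _)
  have hne : ∀ u ∈ trace (P.con 1), ∀ z ∈ P.Λ ∩ {z | P.s 1 < lvl P.l P.r z}, u ≠ z :=
    fun u hu z hz h0 => by
      have h1 := P.lvl_con one_pos hu
      rw [h0] at h1
      exact (ne_of_gt hz.2) h1
  have h1 := hasDerivAt_contourInt hV (P.isLoop_con one_pos).pwC1
    (f := fun z u => D.L u * cauchyKer D.b u z) ?_ ?_ ⟨hw, hw1⟩
  · have h2 := h1.const_mul (2 * Real.pi * Complex.I : ℂ)⁻¹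
    refine h2.deriv.trans ?_
    congr 1
    refine contourInt_congr fun u hu => ?_
    exact ((D.conf.hasDerivAt_cauchyKer_right (hs hu) hw (hne u hu w ⟨hw, hw1⟩)).const_mul _).deriv
  · refine ContinuousOn.mul ((D.L_continuousOn_con one_pos (by norm_num)).comp
      continuousOn_snd fun p hp => hp.2) ?_
    refine (D.conf.continuousOn_cauchyKer hs (inter_subset_left (s := P.Λ)) ?_).comp
      continuous_swap.continuousOn fun p hp => ⟨hp.2, hp.1⟩
    exact disjoint_left.2 fun u hu hz => hne u hu u hz rfl
  · intro u hu
    exact ((D.conf.cauchyKer_holo_right (hs hu)).mono fun z hz =>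
      ⟨hz.1, fun h0 => hne u hu z hz (mem_singleton_iff.1 h0).symm⟩).const_mul _

/-- The leading part of the discretization error. -/
noncomputable def κ (w : ℂ) : ℂ := P.θ * deriv D.ld w + D.A3 w

end Step

theorem exists_ξ_expansion (P : Setting) : ∃ K : ℝ, 0 < K ∧ ∀ (D : Step P) (w : ℂ),
    w ∈ P.ann 2 9 → ‖D.κ w‖ ≤ K ∧
      ∀ e, ‖D.ξ e w - D.ε * D.κ w - (D.τ e (w + D.h) - D.τ e w)‖ ≤ K * D.ε ^ 2 := by
  obtain ⟨K1, hK1, h1⟩ := exists_ν_expansion P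
  obtain ⟨K2, hK2, h2⟩ := exists_ld_bound P
  obtain ⟨K3, hK3, h3⟩ := exists_A3_bound P
  have hθ := P.θ_pos
  have hg := P.g_pos
  refine ⟨(P.θ * (2 * K2 / (1 / 4 * P.g)) + K3) + (K1 + 4 * K2 / (1 / 4 * P.g) ^ 2 * P.θ ^ 2),
    by positivity, fun D w hw => ?_⟩
  have hball : Metric.ball w (1 / 4 * P.g) ⊆ P.ann 1.5 9.5 :=
    (P.ball_sub_ann hw).trans (P.ann_mono (by norm_num) (by norm_num))
  have hd : DifferentiableOn ℂ D.ld (Metric.ball w (1 / 4 * P.g)) :=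
    (D.ld_outer.differentiableOn D.conf P.core_sub).mono fun z hz =>
      Step.off_core_of_ann (by norm_num) (by norm_num) (hball hz)
  have hε := D.ε_pos
  constructor
  · have h4 := norm_deriv_le_of_ball (by positivity) hd fun z hz => h2 D z (hball hz)
    unfold Step.κ
    refine (norm_add_le _ _).trans (le_trans (add_le_add ?_ (h3 D w hw))
      (le_add_of_nonneg_right (by positivity)))
    rw [norm_mul, Complex.norm_real, Real.norm_of_nonneg hθ.le]
    exact mul_le_mul_of_nonneg_left h4 hθ.le
  · intro e
    have hh := D.norm_shift_le (right_mem_Icc.2 D.h_pos.le)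
    have h4 := norm_taylor_le_of_ball hd (fun z hz => h2 D z (hball hz)) hh.1
    have h5 := h1 D w hw
    have e1 : D.ξ e w - D.ε * D.κ w - (D.τ e (w + D.h) - D.τ e w) = (D.ν w - D.ε * D.A3 w) +
        (D.ld (w + D.h) - D.ld w - D.h * deriv D.ld w) := by
      unfold Step.ξ Step.κ Step.τ Conf.h
      push_cast; ring
    rw [e1]
    refine (norm_add_le _ _).trans ((add_le_add h5 h4).trans ?_)
    rw [Complex.norm_real, Real.norm_of_nonneg D.h_pos.le, Conf.h]
    have : 0 ≤ (P.θ * (2 * K2 / (1 / 4 * P.g)) + K3) * D.ε ^ 2 := by positivity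
    nlinarith

theorem exists_τ_shift_bound (P : Setting) {i j k l : ℝ} (hi : 1.5 ≤ i)
    (hl : l ≤ 9.5) (hij' : i + 1 / 2 ≤ j) (hkl' : k + 1 / 2 ≤ l) :
    ∃ K : ℝ, 0 < K ∧ ∀ (D : Step P) (e : Fin D.n → Fin 2) (M : ℝ), (∀ w ∈ P.ann i l, ‖D.τ e w‖ ≤ M) →
      ∀ w ∈ P.ann j k, ‖D.τ e (w + D.h) - D.τ e w‖ ≤ K * (M * D.ε) := by
  have hθ := P.θ_pos
  have hg := P.g_pos
  refine ⟨2 / (1 / 4 * P.g) * P.θ, by positivity, fun D e M hM w hw => ?_⟩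
  have hball : Metric.ball w (1 / 4 * P.g) ⊆ P.ann i l :=
    (P.ball_sub_ann hw).trans (P.ann_mono (by linarith) (by linarith))
  have hd : DifferentiableOn ℂ (D.τ e) (Metric.ball w (1 / 4 * P.g)) :=
    ((D.τ_outer e).differentiableOn D.conf P.core_sub).mono fun z hz =>
      Step.off_core_of_ann (by linarith) (by linarith) (hball hz)
  have hh := D.norm_shift_le (right_mem_Icc.2 D.h_pos.le)
  have h4 := norm_sub_le_of_ball hd (fun z hz => hM z (hball hz)) hh.1
  rw [Complex.norm_real, Real.norm_of_nonneg D.h_pos.le, Conf.h] at h4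
  refine h4.trans (le_of_eq ?_)
  field_simp

theorem exists_ξ_bound (P : Setting) : ∃ K : ℝ, 0 < K ∧ ∀ (D : Step P) (w : ℂ),
    w ∈ P.ann 2 9 → ∀ e, ‖D.ξ e w‖ ≤ K * D.ε := by
  obtain ⟨K1, hK1, h1⟩ := exists_ξ_expansion P
  obtain ⟨K2, hK2, h2⟩ := exists_τ_bound P
  obtain ⟨K3, hK3, h3⟩ := exists_τ_shift_bound P (i := 1.5) (j := 2) (k := 9) (l := 9.5)
    (by norm_num) (by norm_num) (by norm_num) (by norm_num)
  have hg := P.g_pos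
  refine ⟨K1 * (P.g / 8) + K1 + K3 * K2, by positivity, fun D w hw e => ?_⟩
  obtain ⟨h4, h5⟩ := h1 D w hw
  have h6 := h3 D e K2 (fun z hz => h2 D z hz e) w hw
  have hε := D.ε_pos
  have e1 : D.ξ e w = (D.ξ e w - D.ε * D.κ w - (D.τ e (w + D.h) - D.τ e w)) + D.ε * D.κ w +
      (D.τ e (w + D.h) - D.τ e w) := by ring
  rw [e1]
  refine (norm_add_le _ _).trans ((add_le_add ((norm_add_le _ _).trans
    (add_le_add (h5 e) (le_of_eq (norm_mul _ _)))) h6).trans ?_)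
  rw [Complex.norm_real, Real.norm_of_nonneg hε.le]
  have h7 : K1 * D.ε ^ 2 ≤ K1 * (P.g / 8) * D.ε := by
    rw [sq, mul_assoc]
    exact mul_le_mul_of_nonneg_left (mul_le_mul_of_nonneg_right D.ε_le hε.le) hK1.le
  nlinarith [mul_le_mul_of_nonneg_left h4 hε.le]

end

section

open Conf

theorem norm_prod_add_le {ι : Type*} (s : Finset ι) {A δ : ι → ℂ} {y η : ℝ}
    (hA : ∀ i ∈ s, ‖A i‖ ≤ y) (hδ : ∀ i ∈ s, ‖δ i‖ ≤ η) :
    ‖∏ i ∈ s, (A i + δ i)‖ ≤ (y + η) ^ s.card := by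
  rw [norm_prod, ← Finset.prod_const]
  exact Finset.prod_le_prod (fun _ _ => norm_nonneg _) fun i hi =>
    (norm_add_le _ _).trans (add_le_add (hA i hi) (hδ i hi))

theorem norm_prod_add_sub_prod_le {ι : Type*} (s : Finset ι) {A δ : ι → ℂ} {y η : ℝ}
    (hy : 0 ≤ y) (hη : 0 ≤ η) (hA : ∀ i ∈ s, ‖A i‖ ≤ y) (hδ : ∀ i ∈ s, ‖δ i‖ ≤ η) :
    ‖∏ i ∈ s, (A i + δ i) - ∏ i ∈ s, A i‖ ≤ s.card * (η * (y + η) ^ (s.card - 1)) := by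
  classical
  induction s using Finset.induction_on with
  | empty => simp
  | insert a s ha ih =>
    rw [Finset.prod_insert ha, Finset.prod_insert ha, Finset.card_insert_of_notMem ha]
    have ih' := ih (fun i hi => hA i (Finset.mem_insert_of_mem hi))
      fun i hi => hδ i (Finset.mem_insert_of_mem hi)
    have h1 := norm_prod_add_le s (fun i hi => hA i (Finset.mem_insert_of_mem hi))
      fun i hi => hδ i (Finset.mem_insert_of_mem hi)
    rw [show (A a + δ a) * ∏ i ∈ s, (A i + δ i) - A a * ∏ i ∈ s, A i =
      δ a * ∏ i ∈ s, (A i + δ i) + A a * (∏ i ∈ s, (A i + δ i) - ∏ i ∈ s, A i) by ring]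
    have h2 : (s.card : ℝ) * (η * (y + η) ^ (s.card - 1)) * y ≤ s.card * (η * (y + η) ^ s.card) := by
      rcases Nat.eq_zero_or_pos s.card with h0 | h0
      · simp [h0]
      · obtain ⟨c, hc⟩ := Nat.exists_eq_succ_of_ne_zero h0.ne'
        rw [hc, Nat.succ_sub_one, mul_assoc, mul_assoc, pow_succ]
        gcongr
        linarith
    refine (norm_add_le _ _).trans ?_
    rw [norm_mul, norm_mul, Nat.add_sub_cancel]
    have h3 := mul_le_mul (hδ a (Finset.mem_insert_self _ _)) h1 (norm_nonneg _) hη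
    have h4 := mul_le_mul (hA a (Finset.mem_insert_self _ _)) ih' (norm_nonneg _) hy
    push_cast
    nlinarith

theorem norm_pow_mul_pow_sub_le {A B α β : ℂ} {y η : ℝ} (m n : ℕ) (hy : 0 ≤ y) (hη : 0 ≤ η)
    (hA : ‖A‖ ≤ y) (hB : ‖B‖ ≤ y) (hα : ‖α‖ ≤ η) (hβ : ‖β‖ ≤ η) :
    ‖(A + α) ^ m * (B + β) ^ n‖ ≤ (y + η) ^ (m + n) ∧
    ‖(A + α) ^ m * (B + β) ^ n - A ^ m * B ^ n‖ ≤ (m + n : ℕ) * (η * (y + η) ^ (m + n - 1)) := by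
  have h1 := norm_prod_add_le (Finset.univ : Finset (Fin m ⊕ Fin n))
    (A := Sum.elim (fun _ => A) fun _ => B) (δ := Sum.elim (fun _ => α) fun _ => β)
    (y := y) (η := η) (by rintro (i | i) - <;> assumption) (by rintro (i | i) - <;> assumption)
  have h2 := norm_prod_add_sub_prod_le (Finset.univ : Finset (Fin m ⊕ Fin n))
    (A := Sum.elim (fun _ => A) fun _ => B) (δ := Sum.elim (fun _ => α) fun _ => β)
    hy hη (by rintro (i | i) - <;> assumption) (by rintro (i | i) - <;> assumption)
  simpa using And.intro h1 h2

theorem norm_exp_sub_one_le (z : ℂ) : ‖Complex.exp z - 1‖ ≤ ‖z‖ * Real.exp ‖z‖ := by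
  simpa using Complex.norm_exp_sub_sum_le_norm_mul_exp z 1

variable {P : Setting}

theorem lvl_conj (l r : ℝ) (z : ℂ) : lvl l r (starRingEnd ℂ z) = lvl l r z := by
  have h : ∀ a : ℝ, ‖starRingEnd ℂ z - a‖ = ‖z - a‖ := fun a => by
    rw [← Complex.conj_ofReal a, ← map_sub, Complex.norm_conj, Complex.conj_ofReal]
  unfold lvl
  rw [h, h]

namespace Step

variable (D : Step P)

theorem conj_obs (e : Fin D.n → Fin 2) {v : ℂ} (hv : v ∈ P.Λ) :
    starRingEnd ℂ (D.obs e v) = D.obs e (starRingEnd ℂ v) := by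
  have hr : ∀ t : ℝ, (t : ℂ) ∈ P.Λ → starRingEnd ℂ (D.b t) = D.b t := fun t ht => by
    rw [← D.adm.asymp.b_real _ ht, Complex.conj_ofReal]
  unfold obs
  rw [map_prod]
  refine Finset.prod_congr rfl fun j _ => ?_
  rw [map_div₀, map_sub, map_sub, hr _ (P.seg_sub (D.pt_mem e j)), hr _ (P.seg_sub (D.a_mem j)),
    D.adm.asymp.b_real v hv]

/-- The relative change of the observable at `v` when a particle at `w` jumps. -/
noncomputable def jumpFactor (v w : ℂ) : ℂ := (D.b w - D.b (w + D.h)) / (D.b v - D.b w)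

theorem obs_update (e : Fin D.n → Fin 2) (i : Fin D.n) (he : e i = 0) {v : ℂ}
    (hv : v ∈ P.Λ \ seg P.l P.r) :
    D.obs (Function.update e i 1) v = D.obs e v * (1 + D.jumpFactor v (D.a i)) := by
  have hne : D.b v - D.b (D.a i) ≠ 0 := D.conf.sub_ne hv.1 (P.seg_sub (D.a_mem i))
    fun h => hv.2 (h ▸ D.a_mem i)
  unfold obs
  rw [← Finset.mul_prod_erase _ _ (Finset.mem_univ i),
    ← Finset.mul_prod_erase Finset.univ (fun j => (D.b v - D.b (D.pt e j)) / _)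
      (Finset.mem_univ i)]
  have h1 : ∀ j ∈ Finset.univ.erase i, (D.b v - D.b (D.pt (Function.update e i 1) j)) /
      (D.b v - D.b (D.a j)) = (D.b v - D.b (D.pt e j)) / (D.b v - D.b (D.a j)) := fun j hj => by
    rw [D.pt_update_ne e (Finset.ne_of_mem_erase hj)]
  rw [Finset.prod_congr rfl h1, D.pt_zero he, D.pt_one (Function.update_self i 1 e), div_self hne,
    jumpFactor]
  push_cast
  field_simp
  ring

theorem jumpFactor_holo {v : ℂ} {j k : ℝ} (hv : v ∈ P.ann k 9.5) (hj : j ≤ k) (hj' : j ≤ 9) :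
    DifferentiableOn ℂ (D.jumpFactor v) {z | lvl P.l P.r z < P.s j} := by
  have hs : {z | lvl P.l P.r z < P.s j} ⊆ P.Λ := P.lt_sub (by linarith)
  have h1 : DifferentiableOn ℂ (fun w => D.b (w + D.h)) {z | lvl P.l P.r z < P.s j} :=
    D.conf.holo.comp (by fun_prop) fun w hw => D.add_h_mem (lt_of_lt_of_le hw (P.s_le hj'))
  unfold jumpFactor
  refine ((D.conf.holo.mono hs).sub h1).fun_div ((D.conf.holo.mono hs).const_sub _) fun w hw => ?_
  refine D.conf.sub_ne (P.mem_Λ (by norm_num) hv.2) (hs hw) fun h0 => ?_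
  rw [← h0] at hw
  exact absurd (hv.1.trans_lt hw) (not_lt.2 (P.s_le hj))

theorem η_eq (e : Fin D.n → Fin 2) {v : ℂ} (hv : v ∈ P.Λ \ seg P.l P.r) :
    D.η e v = Complex.exp (-D.ld v) * D.obs e v - 1 := by
  rw [η, D.exp_τ e hv, mul_comm]

end Step

theorem exists_jumpFactor_bound (P : Setting) : ∃ K : ℝ, 0 < K ∧ ∀ (D : Step P) (v w : ℂ),
    v ∈ P.ann 3 9.5 → w ∈ P.ann 2 2 → ‖D.jumpFactor v w‖ ≤ K * D.ε := by
  have hg := P.g_pos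
  have hθ := P.θ_pos
  have hC := P.C_pos
  obtain ⟨κ, hκ, h3⟩ := exists_b_sep P (δ := P.g / 2) (by positivity)
  refine ⟨(2 * P.C / (1 / 4 * P.g) * P.θ) / κ, by positivity, fun D v w hv hw => ?_⟩
  have hb := P.ball_sub (k := 2) (δ := 1 / 4) (by norm_num) hw.2
  have h1 := norm_sub_le_of_ball (D.conf.holo.mono hb) (fun z hz => D.adm.asymp.b_bound z (hb hz))
    (D.norm_shift_le (right_mem_Icc.2 D.h_pos.le)).1
  have h2 := P.sep hw.2 hv.1
  have h4 := h3 D w v (hw.2.trans (P.s_le (by norm_num))) (P.mem_Λ (by norm_num) hv.2)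
    (by linarith)
  unfold Step.jumpFactor
  rw [norm_div, norm_sub_rev (D.b w), div_mul_eq_mul_div]
  refine div_le_div₀ (by have := D.ε_pos; positivity) (h1.trans (le_of_eq ?_)) hκ h4
  rw [Complex.norm_real, Real.norm_of_nonneg D.h_pos.le, Conf.h]
  ring

/-- The even moments of the fluctuation. -/
theorem exists_η_moment (P : Setting) (q : ℕ) : ∃ K : ℝ, 0 < K ∧ ∀ (D : Step P) (v : ℂ),
    v ∈ P.ann 3 3 → D.ER (fun e => ‖D.η e v‖ ^ (2 * q)) ≤ K * D.ε ^ q := by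
  induction q with
  | zero => exact ⟨1, one_pos, fun D v _ => by simp [D.ER_const]⟩
  | succ q ih =>
    obtain ⟨Kq, hKq, ih⟩ := ih
    obtain ⟨Kc, hKc, hc⟩ := exists_cauchy_bound P (i := 2) (j := 3) (by norm_num) (by norm_num)
      (by norm_num)
    obtain ⟨Kτ, hKτ, hτ⟩ := exists_τ_bound P
    obtain ⟨Kξ, hKξ, hξ⟩ := exists_ξ_bound P
    obtain ⟨KA, hKA, hA⟩ := exists_A_bound P (j := 2) (by norm_num)
    obtain ⟨KJ, hKJ, hJ⟩ := exists_jumpFactor_bound P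
    have hg := P.g_pos
    -- bounds for `η`, for the perturbation and for `exp ξ - 1`
    set Ky := Real.exp Kτ + 1 with hKy
    set Kδ := Real.exp Kτ * KJ with hKδ
    set Ke := Kξ * Real.exp (Kξ * (P.g / 8)) with hKe
    set M1 := Ke * (Ky + Kδ * (P.g / 8)) + (2 * q + 1 : ℕ) * Kδ with hM1
    set M2 := 2 ^ (2 * q - 1) * (Kq + Kδ ^ (2 * q) * (P.g / 8) ^ q) with hM2
    refine ⟨Kc * (KA * (Real.exp Kτ * (M1 * M2))), by positivity, fun D v hv => ?_⟩
    have hε := D.ε_pos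
    have hv3 : v ∈ P.ann 3 9.5 := P.ann_mono le_rfl (by norm_num) hv
    have hv0 : v ∈ P.Λ \ seg P.l P.r := P.ann_sub (by norm_num) (by norm_num) hv
    set u := starRingEnd ℂ v with hu
    have hu3 : u ∈ P.ann 3 9.5 := by
      rw [Setting.ann, mem_ofPred_eq, hu, lvl_conj]; exact hv3
    have hu0 : u ∈ P.Λ \ seg P.l P.r := P.ann_sub (by norm_num) (by norm_num) hu3
    set c := Complex.exp (-D.ld v) with hcdef
    set R : (Fin D.n → Fin 2) → ℂ := fun e =>
      (c * D.obs e v - 1) ^ q * (starRingEnd ℂ c * D.obs e u - 1) ^ (q + 1) with hR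
    set Q : (Fin D.n → Fin 2) → ℂ → ℂ := fun e w =>
      ((c * D.obs e v - 1) + c * D.obs e v * D.jumpFactor v w) ^ q *
        ((starRingEnd ℂ c * D.obs e u - 1) +
          starRingEnd ℂ c * D.obs e u * D.jumpFactor u w) ^ (q + 1) with hQ
    have hins : D.Insert {z | lvl P.l P.r z < P.s 2.5} R Q := by
      constructor
      · intro e
        have d1 := D.jumpFactor_holo hv3 (j := 2.5) (by norm_num) (by norm_num)
        have d2 := D.jumpFactor_holo hu3 (j := 2.5) (by norm_num) (by norm_num)
        exact (((d1.const_mul _).const_add _).fun_pow _).fun_mul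
          (((d2.const_mul _).const_add _).fun_pow _)
      · intro e i he
        simp only [hQ, hR, D.obs_update e i he hv0, D.obs_update e i he hu0]
        ring
    have hconj : ∀ e, starRingEnd ℂ c * D.obs e u - 1 = starRingEnd ℂ (D.η e v) := fun e => by
      rw [D.η_eq e hv0, map_sub, map_mul, map_one, D.conj_obs e hv0.1]
    have hη' : ∀ e, c * D.obs e v - 1 = D.η e v := fun e => (D.η_eq e hv0).symm
    have hcobs : ∀ e, ‖c * D.obs e v‖ ≤ Real.exp Kτ := fun e => by
      rw [mul_comm, ← D.exp_τ e hv0]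
      exact norm_exp_le (hτ D v (P.ann_mono (by norm_num) le_rfl hv3) e)
    have hcobs' : ∀ e, ‖starRingEnd ℂ c * D.obs e u‖ ≤ Real.exp Kτ := fun e => by
      rw [← D.conj_obs e hv0.1, ← map_mul, Complex.norm_conj]; exact hcobs e
    have hηb : ∀ e, ‖D.η e v‖ ≤ Ky := fun e => by
      rw [← hη']
      refine (norm_sub_le _ _).trans ?_
      rw [norm_one]; linarith [hcobs e]
    have hmaster := D.master_fluct (k := 2) (by norm_num) (by norm_num) (j := 2.5) (by norm_num)
      (by norm_num) hins hv0.1 ((P.s_lt (by norm_num)).trans_le hv.1)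
    -- the left side
    have hleft : D.E (fun e => R e * D.η e v) =
        ((D.ER fun e => ‖D.η e v‖ ^ (2 * (q + 1)) : ℝ) : ℂ) := by
      rw [← D.E_ofReal]
      congr 1; funext e
      simp only [hR, hconj, hη']
      rw [show D.η e v ^ q * starRingEnd ℂ (D.η e v) ^ (q + 1) * D.η e v =
        (D.η e v * starRingEnd ℂ (D.η e v)) ^ (q + 1) by ring, Complex.mul_conj,
        Complex.normSq_eq_norm_sq]
      push_cast
      ring
    -- the integrand
    have hpow : D.ER (fun e => (‖D.η e v‖ + Kδ * D.ε) ^ (2 * q)) ≤ M2 * D.ε ^ q := by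
      have h1 : ∀ e, (‖D.η e v‖ + Kδ * D.ε) ^ (2 * q) ≤
          2 ^ (2 * q - 1) * (‖D.η e v‖ ^ (2 * q) + (Kδ * D.ε) ^ (2 * q)) := fun e =>
        add_pow_le (norm_nonneg (D.η e v)) (show 0 ≤ Kδ * D.ε by positivity) (2 * q)
      refine (D.ER_mono h1).trans ?_
      rw [D.ER_mul_left, D.ER_add, D.ER_const]
      have h2 : M2 * D.ε ^ q = 2 ^ (2 * q - 1) *
          (Kq * D.ε ^ q + Kδ ^ (2 * q) * (P.g / 8) ^ q * D.ε ^ q) := by rw [hM2]; ring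
      rw [h2]
      refine mul_le_mul_of_nonneg_left ?_ (pow_nonneg zero_le_two _)
      refine add_le_add (ih D v hv) ?_
      rw [mul_pow, mul_assoc]
      refine mul_le_mul_of_nonneg_left ?_ (by positivity)
      rw [two_mul, pow_add]
      exact mul_le_mul_of_nonneg_right (pow_le_pow_left₀ hε.le D.ε_le _) (by positivity)
    have hbound : ∀ w ∈ trace (P.con 2), ‖D.A w * D.E (fun e =>
        Complex.exp (D.τ e w) * (Complex.exp (D.ξ e w) * Q e w - R e))‖ ≤
        KA * (Real.exp Kτ * (M1 * D.ε * (M2 * D.ε ^ q))) := by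
      intro w hw
      have hw2 : w ∈ P.ann 2 2 := P.con_sub_ann (by norm_num) le_rfl le_rfl hw
      rw [norm_mul]
      refine mul_le_mul (hA D w (P.ann_mono le_rfl (by norm_num) hw2)) ?_ (norm_nonneg _) hKA.le
      have h1 : ∀ e, ‖Complex.exp (D.τ e w) * (Complex.exp (D.ξ e w) * Q e w - R e)‖ ≤
          (Real.exp Kτ * (M1 * D.ε)) * (‖D.η e v‖ + Kδ * D.ε) ^ (2 * q) := by
        intro e
        have hy := norm_nonneg (D.η e v)
        have hδ1 : ‖c * D.obs e v * D.jumpFactor v w‖ ≤ Kδ * D.ε := by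
          rw [norm_mul, hKδ, mul_assoc]
          exact mul_le_mul (hcobs e) (hJ D v w hv3 hw2) (norm_nonneg _) (by positivity)
        have hδ2 : ‖starRingEnd ℂ c * D.obs e u * D.jumpFactor u w‖ ≤ Kδ * D.ε := by
          rw [norm_mul, hKδ, mul_assoc]
          exact mul_le_mul (hcobs' e) (hJ D u w hu3 hw2) (norm_nonneg _) (by positivity)
        obtain ⟨h2, h3⟩ := norm_pow_mul_pow_sub_le q (q + 1) hy (by positivity)
          (le_of_eq (congrArg norm (hη' e)))
          (le_of_eq ((congrArg norm (hconj e)).trans (Complex.norm_conj _))) hδ1 hδ2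
        have h4 : ‖Complex.exp (D.ξ e w) - 1‖ ≤ Ke * D.ε := by
          have h5 := hξ D w (P.ann_mono le_rfl (by norm_num) hw2) e
          refine (norm_exp_sub_one_le _).trans ?_
          have h6 : ‖D.ξ e w‖ ≤ Kξ * (P.g / 8) :=
            h5.trans (mul_le_mul_of_nonneg_left D.ε_le hKξ.le)
          calc _ ≤ (Kξ * D.ε) * Real.exp (Kξ * (P.g / 8)) :=
                mul_le_mul h5 (Real.exp_le_exp.2 h6) (Real.exp_nonneg _) (by positivity)
            _ = Ke * D.ε := by rw [hKe]; ring
        rw [norm_mul, mul_assoc]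
        refine mul_le_mul (norm_exp_le (hτ D w (P.ann_mono (by norm_num) (by norm_num) hw2) e)) ?_
          (norm_nonneg _) (by positivity)
        rw [show Complex.exp (D.ξ e w) * Q e w - R e =
          (Complex.exp (D.ξ e w) - 1) * Q e w + (Q e w - R e) by ring]
        have h7 : q + (q + 1) = 2 * q + 1 := by ring
        rw [h7] at h2 h3
        rw [Nat.add_sub_cancel] at h3
        have h8 : (‖D.η e v‖ + Kδ * D.ε) ^ (2 * q + 1) ≤
            (Ky + Kδ * (P.g / 8)) * (‖D.η e v‖ + Kδ * D.ε) ^ (2 * q) := by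
          rw [pow_succ']
          refine mul_le_mul_of_nonneg_right (add_le_add (hηb e) ?_) (by positivity)
          exact mul_le_mul_of_nonneg_left D.ε_le (by positivity)
        refine (norm_add_le _ _).trans ?_
        rw [norm_mul]
        have h9 := mul_le_mul h4 (h2.trans h8) (norm_nonneg _) (by positivity)
        refine (add_le_add h9 h3).trans (le_of_eq ?_)
        rw [hM1]; ring
      refine (D.norm_E_le_of_le h1).trans ?_
      rw [D.ER_mul_left, mul_assoc]
      refine mul_le_mul_of_nonneg_left ?_ (Real.exp_nonneg _)
      exact mul_le_mul_of_nonneg_left hpow (by positivity)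
    have hfin := hc D _ _ v hv3 hbound
    rw [← hmaster, hleft, Complex.norm_real] at hfin
    refine (le_abs_self _).trans (hfin.trans (le_of_eq ?_))
    ring

end

section

open Conf

theorem pow_integral_le {f : ℝ → ℝ} (hf : ContinuousOn f (Icc 0 1)) (q : ℕ) :
    (∫ t in (0 : ℝ)..1, f t) ^ (2 * q) ≤ ∫ t in (0 : ℝ)..1, f t ^ (2 * q) := by
  have : IsProbabilityMeasure (volume.restrict (Ioc (0 : ℝ) 1)) := ⟨by simp⟩
  have h1 := (even_two_mul q).convexOn_pow (𝕜 := ℝ)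
  have h2 := ConvexOn.map_integral_le (μ := volume.restrict (Ioc (0 : ℝ) 1)) (f := f) h1
    (by fun_prop) isClosed_univ (by simp)
    ((hf.integrableOn_Icc).mono_set Ioc_subset_Icc_self)
    (((hf.pow (2 * q)).integrableOn_Icc).mono_set Ioc_subset_Icc_self)
  rw [intervalIntegral.integral_of_le zero_le_one, intervalIntegral.integral_of_le zero_le_one]
  exact h2

theorem hasDerivAt_ell {l r s : ℝ} (hlr : l < r) (hs : r - l < s) (t : ℝ) :
    ‖deriv (ell l r s) t‖ ≤ (r - l) / 4 * (2 * (2 * Real.pi * ellRad l r s)) := by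
  have hρ := (ellRad_spec hlr hs).1
  set ρ := ellRad l r s with hρ'
  have hn : ‖circ ρ t‖ = ρ := by
    simp [circ, circleMap, Complex.norm_exp, abs_of_pos (zero_lt_one.trans hρ)]
  have h0 : circ ρ t ≠ 0 := norm_pos_iff.1 (by rw [hn]; linarith)
  have h1 : HasDerivAt (circ ρ) (circ ρ t * Complex.I * (2 * Real.pi)) t := by
    have h2 := (hasDerivAt_circleMap 0 ρ (2 * Real.pi * t)).scomp t
      ((hasDerivAt_id t).const_mul (2 * Real.pi))
    refine h2.congr_deriv ?_
    simp only [circ, Complex.real_smul]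
    simp [circleMap]
    ring
  have h3 : HasDerivAt (jouk l r) ((r - l) / 4 * (1 + -(circ ρ t ^ 2)⁻¹)) (circ ρ t) :=
    (((hasDerivAt_id _).add (hasDerivAt_inv h0)).const_mul _).const_add _
  have h4 : HasDerivAt (ell l r s) _ t := h3.comp_of_eq t h1 rfl
  rw [h4.deriv]
  have e1 : ‖((r : ℂ) - l) / 4‖ = (r - l) / 4 := by
    rw [← Complex.ofReal_sub, norm_div, Complex.norm_real, Real.norm_of_nonneg (by linarith)]
    simp
  have e2 : ‖(1 : ℂ) + -(circ ρ t ^ 2)⁻¹‖ ≤ 2 := by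
    refine (norm_add_le _ _).trans ?_
    rw [norm_neg, norm_inv, norm_pow, hn, norm_one]
    have : (ρ ^ 2)⁻¹ ≤ 1 := inv_le_one_of_one_le₀ (one_le_pow₀ hρ.le)
    linarith
  have e3 : ‖circ ρ t * Complex.I * (2 * Real.pi)‖ = 2 * Real.pi * ρ := by
    rw [norm_mul, norm_mul, hn, Complex.norm_I, norm_mul, Complex.norm_real,
      Real.norm_of_nonneg Real.pi_pos.le]
    simp; ring
  rw [norm_mul, norm_mul, e1, e3, mul_assoc]
  have : 0 ≤ (r - l) / 4 := by linarith
  have := Real.pi_pos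
  gcongr

variable {P : Setting}

namespace Step

variable (D : Step P)

/-- The mean fluctuation along a contour. -/
noncomputable def Y (e : Fin D.n → Fin 2) : ℝ := ∫ t in (0 : ℝ)..1, ‖D.η e (P.con 3 t)‖

/-- The scale of the fluctuations. -/
noncomputable def σ : ℝ := √D.ε

/-- A random variable of order `√ε` which dominates all the fluctuations. -/
noncomputable def W (e : Fin D.n → Fin 2) : ℝ := D.Y e + D.σ

theorem η_continuousOn (e : Fin D.n → Fin 2) {k : ℝ} (hk : 1 < k) (hk' : k ≤ 10) :
    ContinuousOn (D.η e) (trace (P.con k)) :=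
  ((D.η_outer e).differentiableOn D.conf P.core_sub).continuousOn.mono fun _ hw =>
    off_core_of_ann hk hk' (P.con_sub_ann (by linarith) le_rfl le_rfl hw)

theorem τ_continuousOn (e : Fin D.n → Fin 2) {k : ℝ} (hk : 1 < k) (hk' : k ≤ 10) :
    ContinuousOn (D.τ e) (trace (P.con k)) :=
  ((D.τ_outer e).differentiableOn D.conf P.core_sub).continuousOn.mono fun _ hw =>
    off_core_of_ann hk hk' (P.con_sub_ann (by linarith) le_rfl le_rfl hw)

theorem norm_η_continuousOn (e : Fin D.n → Fin 2) :
    ContinuousOn (fun t => ‖D.η e (P.con 3 t)‖) (Icc 0 1) :=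
  (continuousOn_comp_trace (P.isLoop_con (by norm_num)).1
    (D.η_continuousOn e (by norm_num) (by norm_num))).norm

theorem Y_nonneg (e : Fin D.n → Fin 2) : 0 ≤ D.Y e :=
  intervalIntegral.integral_nonneg zero_le_one fun _ _ => norm_nonneg _

theorem σ_pos : 0 < D.σ := Real.sqrt_pos.2 D.ε_pos

theorem σ_sq : D.σ ^ 2 = D.ε := Real.sq_sqrt D.ε_pos.le

theorem W_pos (e : Fin D.n → Fin 2) : 0 < D.W e := add_pos_of_nonneg_of_pos (D.Y_nonneg e) D.σ_pos

theorem σ_le_W (e : Fin D.n → Fin 2) : D.σ ≤ D.W e := le_add_of_nonneg_left (D.Y_nonneg e)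

theorem Y_le_W (e : Fin D.n → Fin 2) : D.Y e ≤ D.W e := le_add_of_nonneg_right D.σ_pos.le

theorem ε_le_W (e : Fin D.n → Fin 2) : D.ε ≤ D.W e ^ 2 := by
  rw [← D.σ_sq]; exact pow_le_pow_left₀ D.σ_pos.le (D.σ_le_W e) 2

theorem ER_integral {f : (Fin D.n → Fin 2) → ℝ → ℝ} (hf : ∀ e, ContinuousOn (f e) (Icc 0 1)) :
    D.ER (fun e => ∫ t in (0 : ℝ)..1, f e t) = ∫ t in (0 : ℝ)..1, D.ER (fun e => f e t) := by
  unfold ER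
  rw [intervalIntegral.integral_finsetSum (f := fun e t => D.p e * f e t) fun e _ =>
    ((hf e).const_smul (D.p e)).intervalIntegrable_of_Icc zero_le_one]
  exact Finset.sum_congr rfl fun e _ => (intervalIntegral.integral_const_mul _ _).symm

end Step

theorem exists_Y_moment (P : Setting) (q : ℕ) : ∃ K : ℝ, 0 < K ∧ ∀ D : Step P,
    D.ER (fun e => D.Y e ^ (2 * q)) ≤ K * D.σ ^ (2 * q) := by
  obtain ⟨K, hK, h⟩ := exists_η_moment P q
  refine ⟨K, hK, fun D => ?_⟩
  rw [pow_mul, D.σ_sq]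
  refine (D.ER_mono fun e => pow_integral_le (D.norm_η_continuousOn e) q).trans ?_
  rw [D.ER_integral (f := fun e t => ‖D.η e (P.con 3 t)‖ ^ (2 * q))
    fun e => (D.norm_η_continuousOn e).pow _]
  have hc : ContinuousOn (fun t => D.ER (fun e => ‖D.η e (P.con 3 t)‖ ^ (2 * q))) (Icc 0 1) :=
    continuousOn_finsetSum _ fun e _ => ((D.norm_η_continuousOn e).pow _).const_smul (D.p e)
  have := intervalIntegral.integral_mono_on zero_le_one
    (hc.intervalIntegrable_of_Icc (μ := volume) zero_le_one)
    (intervalIntegrable_const (c := K * D.ε ^ q))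
    fun t ht => h D _ (P.con_sub_ann (by norm_num) le_rfl le_rfl (mem_trace ht))
  simpa using this

theorem exists_W_moment (P : Setting) (m : ℕ) : ∃ K : ℝ, 0 < K ∧ ∀ D : Step P,
    D.ER (fun e => D.W e ^ m) ≤ K * D.σ ^ m := by
  have heven : ∀ q : ℕ, ∃ K : ℝ, 0 < K ∧ ∀ D : Step P,
      D.ER (fun e => D.W e ^ (2 * q)) ≤ K * D.σ ^ (2 * q) := fun q => by
    obtain ⟨K, hK, h⟩ := exists_Y_moment P q
    refine ⟨2 ^ (2 * q - 1) * (K + 1), by positivity, fun D => ?_⟩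
    refine (D.ER_mono fun e => add_pow_le (D.Y_nonneg e) D.σ_pos.le (2 * q)).trans ?_
    rw [D.ER_mul_left, D.ER_add, D.ER_const, mul_assoc]
    refine mul_le_mul_of_nonneg_left ?_ (by positivity)
    linarith [h D]
  rcases Nat.even_or_odd' m with ⟨q, rfl | rfl⟩
  · exact heven q
  · obtain ⟨K, hK, h⟩ := heven (q + 1)
    refine ⟨K, hK, fun D => ?_⟩
    have hσ := D.σ_pos
    have h1 : ∀ e, D.W e ^ (2 * q + 1) ≤ D.σ⁻¹ * D.W e ^ (2 * (q + 1)) := fun e => by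
      rw [inv_mul_eq_div, le_div_iff₀ hσ, show 2 * (q + 1) = 2 * q + 1 + 1 by ring,
        pow_succ (D.W e) (2 * q + 1)]
      exact mul_le_mul_of_nonneg_left (D.σ_le_W e) (pow_nonneg (D.W_pos e).le _)
    refine (D.ER_mono h1).trans ?_
    rw [D.ER_mul_left]
    refine (mul_le_mul_of_nonneg_left (h D) (inv_nonneg.2 hσ.le)).trans (le_of_eq ?_)
    rw [show 2 * (q + 1) = 2 * q + 1 + 1 by ring, pow_succ D.σ (2 * q + 1)]
    field_simp

/-- Expectations of quantities dominated by powers of `W`. -/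
theorem exists_E_bound (P : Setting) (m : ℕ) : ∃ K : ℝ, 0 < K ∧ ∀ (D : Step P)
    (f : (Fin D.n → Fin 2) → ℂ) (M : ℝ), 0 ≤ M → (∀ e, ‖f e‖ ≤ M * D.W e ^ m) →
    ‖D.E f‖ ≤ K * (M * D.σ ^ m) := by
  obtain ⟨K, hK, h⟩ := exists_W_moment P m
  refine ⟨K, hK, fun D f M hM hf => (D.norm_E_le_of_le hf).trans ?_⟩
  rw [D.ER_mul_left]
  nlinarith [mul_le_mul_of_nonneg_left (h D) hM]

theorem exists_η_le_Y (P : Setting) : ∃ K : ℝ, 0 < K ∧ ∀ (D : Step P) (e : Fin D.n → Fin 2) (v : ℂ),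
    v ∈ P.ann 4 9.5 → ‖D.η e v‖ ≤ K * D.Y e := by
  have hg := P.g_pos
  obtain ⟨K, hK, h⟩ := exists_cauchyKer_bound P (δ := P.g / 2) (by positivity)
  set M := (P.r - P.l) / 4 * (2 * (2 * Real.pi * ellRad P.l P.r (P.s 3))) with hM
  have hM' : ∀ t, ‖deriv (P.con 3) t‖ ≤ M := fun t =>
    hasDerivAt_ell P.lr (P.lt_s (by norm_num)) t
  have hM0 : 0 ≤ M := (norm_nonneg _).trans (hM' 0)
  have h2 : 0 < ‖(2 * Real.pi * Complex.I : ℂ)⁻¹‖ := norm_pos_iff.2 (inv_ne_zero two_pi_I_ne_zero)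
  refine ⟨‖(2 * Real.pi * Complex.I : ℂ)⁻¹‖ * (K * (M + 1)), by positivity, fun D e v hv => ?_⟩
  have h0 : (0 : ℝ) < 3 := by norm_num
  have hvl : P.s 3 < lvl P.l P.r v := (P.s_lt (by norm_num)).trans_le hv.1
  have hc := (D.η_outer e).cauchy D.conf P.isCompact_core P.core_sub (P.isLoop_con h0)
    (fun w hw => Step.off_core_of_ann (by norm_num) (by norm_num)
      (P.con_sub_ann h0 le_rfl le_rfl hw))
    (fun a ha => P.winding_con_in h0 (lt_of_le_of_lt ha (P.s_lt (by norm_num))))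
    (P.winding_con_off h0 (by norm_num)) (Step.off_core_of_ann (by norm_num) (by norm_num) hv)
    (fun hw => hvl.ne' (P.lvl_con h0 hw)) (P.winding_con_out h0 hvl)
  have e1 : D.η e v = -((2 * Real.pi * Complex.I)⁻¹ *
      contourInt (P.con 3) (fun w => D.η e w * cauchyKer D.b w v)) := by
    rw [hc, inv_mul_cancel_left₀ two_pi_I_ne_zero]; ring
  rw [e1, norm_neg, norm_mul, mul_assoc ‖_‖]
  refine mul_le_mul_of_nonneg_left ?_ h2.le
  unfold contourInt Step.Y
  rw [← intervalIntegral.integral_const_mul]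
  refine intervalIntegral.norm_integral_le_of_norm_le zero_le_one
    (Eventually.of_forall fun t ht => ?_)
    ((continuousOn_const.mul (D.norm_η_continuousOn e)).intervalIntegrable_of_Icc zero_le_one)
  have hw := P.lvl_con h0 (mem_trace (γ := P.con 3) (Ioc_subset_Icc_self ht))
  have h3 := h D (P.con 3 t) v (by rw [hw]; exact P.s_le (by norm_num)) hv.2
    (by rw [norm_sub_rev]; have := P.sep hw.le hv.1; linarith)
  rw [norm_mul, norm_mul, mul_assoc, mul_comm (K * _)]
  refine mul_le_mul_of_nonneg_left (mul_le_mul h3 ((hM' t).trans (by linarith)) (norm_nonneg _)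
    hK.le) (norm_nonneg _)

theorem exists_τ_le_W (P : Setting) : ∃ K : ℝ, 0 < K ∧ ∀ (D : Step P) (e : Fin D.n → Fin 2) (v : ℂ),
    v ∈ P.ann 5 9.5 → ‖D.τ e v‖ ≤ K * D.W e := by
  have hg := P.g_pos
  obtain ⟨K1, hK1, h1⟩ := exists_η_le_Y P
  obtain ⟨K2, hK2, h2⟩ := exists_τ_bound P
  have hi : (0 : ℝ) < 4.75 := by norm_num
  obtain ⟨K3, hK3, h3⟩ := exists_cauchy_deriv_bound P (i := 4.75) (j := 5) hi (by norm_num)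
    (by norm_num)
  refine ⟨2 * K1 * K2 + K3 * (2 * (2 * K1 / (1 / 4 * P.g))), by positivity, fun D e v hv => ?_⟩
  have hY := D.Y_nonneg e
  have hW := D.Y_le_W e
  have hg1 : 0 ≤ K3 * (2 * (2 * K1 / (1 / 4 * P.g))) * D.Y e := by positivity
  have hg2 : 0 ≤ 2 * K1 * K2 * D.Y e := by positivity
  suffices hs : ‖D.τ e v‖ ≤ (2 * K1 * K2 + K3 * (2 * (2 * K1 / (1 / 4 * P.g)))) * D.Y e from
    hs.trans (mul_le_mul_of_nonneg_left hW (by positivity))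
  rw [add_mul]
  by_cases hsmall : K1 * D.Y e ≤ 1 / 2
  · have hvl : P.s 4.75 < lvl P.l P.r v := (P.s_lt (by norm_num)).trans_le hv.1
    have hc := (D.τ_outer e).cauchy D.conf P.isCompact_core P.core_sub (P.isLoop_con hi)
      (fun w hw => Step.off_core_of_ann (by norm_num) (by norm_num)
        (P.con_sub_ann hi le_rfl le_rfl hw))
      (fun a ha => P.winding_con_in hi (lt_of_le_of_lt ha (P.s_lt (by norm_num))))
      (P.winding_con_off hi (by norm_num)) (Step.off_core_of_ann (by norm_num) (by norm_num) hv)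
      (fun hw => hvl.ne' (P.lvl_con hi hw)) (P.winding_con_out hi hvl)
    have e1 : D.τ e v = -((2 * Real.pi * Complex.I)⁻¹ *
        contourInt (P.con 4.75) (fun w => D.τ e w * cauchyKer D.b w v)) := by
      rw [hc, inv_mul_cancel_left₀ two_pi_I_ne_zero]; ring
    rw [e1, norm_neg]
    refine le_trans ?_ (le_add_of_nonneg_left hg2)
    rw [mul_assoc K3]
    have hdτ := (D.τ_outer e).differentiableOn D.conf P.core_sub
    have hVo : IsOpen (P.Λ \ P.core) := P.isOpen.sdiff P.isCompact_core.isClosed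
    have hoff : ∀ w ∈ trace (P.con 4.75), w ∈ P.Λ \ P.core := fun w hw =>
      Step.off_core_of_ann (by norm_num) (by norm_num) (P.con_sub_ann hi le_rfl le_rfl hw)
    refine h3 D (D.τ e) _ v hv _ hVo hoff hdτ fun w hw => ?_
    have hw1 : w ∈ P.ann 4.75 4.75 := P.con_sub_ann hi le_rfl le_rfl hw
    have hball : Metric.ball w (1 / 4 * P.g) ⊆ P.ann 4 9.5 :=
      (P.ball_sub_ann hw1).trans (P.ann_mono (by norm_num) (by norm_num))
    have hdη : deriv (D.η e) w = Complex.exp (D.τ e w) * deriv (D.τ e) w :=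
      ((hdτ.differentiableAt (hVo.mem_nhds (hoff w hw))).hasDerivAt.cexp.sub_const 1).deriv
    have h4 := norm_deriv_le_of_ball (by positivity)
      (((D.η_outer e).differentiableOn D.conf P.core_sub).mono fun z hz =>
        Step.off_core_of_ann (by norm_num) (by norm_num) (hball hz))
      fun z hz => h1 D e z (hball hz)
    rw [hdη, norm_mul] at h4
    have h5 : 1 / 2 ≤ ‖Complex.exp (D.τ e w)‖ := by
      have h6 := h1 D e w (P.ann_mono (by norm_num) (by norm_num) hw1)
      have h7 : Complex.exp (D.τ e w) = 1 - (-(D.η e w)) := by unfold Step.η; ring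
      have h8 := norm_sub_norm_le (1 : ℂ) (-(D.η e w))
      rw [← h7, norm_one, norm_neg] at h8
      linarith
    have h9 : 2 * (2 * K1 / (1 / 4 * P.g)) * D.Y e = 2 * (2 * (K1 * D.Y e) / (1 / 4 * P.g)) := by
      ring
    rw [h9]
    nlinarith [norm_nonneg (deriv (D.τ e) w)]
  · refine le_trans ?_ (le_add_of_nonneg_right hg1)
    refine (h2 D v (P.ann_mono (by norm_num) le_rfl hv) e).trans ?_
    push Not at hsmall
    nlinarith

theorem exists_W_bound (P : Setting) : ∃ K : ℝ, 0 < K ∧ ∀ (D : Step P) (e : Fin D.n → Fin 2),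
    D.W e ≤ K := by
  obtain ⟨K, hK, h⟩ := exists_τ_bound P
  refine ⟨Real.exp K + 1 + √(P.g / 8), by positivity, fun D e => ?_⟩
  unfold Step.W
  refine add_le_add ?_ (Real.sqrt_le_sqrt D.ε_le)
  have h1 : ∀ t ∈ Icc (0 : ℝ) 1, ‖D.η e (P.con 3 t)‖ ≤ Real.exp K + 1 := fun t ht => by
    refine (norm_sub_le _ _).trans ?_
    rw [norm_one]
    have := norm_exp_le (h D _ (P.con_sub_ann (by norm_num) (by norm_num) (by norm_num)
      (mem_trace (γ := P.con 3) ht)) e)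
    linarith
  have := intervalIntegral.integral_mono_on zero_le_one
    ((D.norm_η_continuousOn e).intervalIntegrable_of_Icc (μ := volume) zero_le_one)
    (intervalIntegrable_const (c := Real.exp K + 1)) h1
  rw [intervalIntegral.integral_const, sub_zero, one_smul] at this
  exact this

end

section

open Conf

theorem intervalIntegrable_rho (θ ε : ℝ) {n : ℕ} (x : Fin n → ℝ) (l r : ℝ) :
    IntervalIntegrable (fun s => (rho θ ε x s : ℂ)) volume l r := by
  have h : Integrable (fun s => rho θ ε x s) := by
    unfold rho
    refine (integrable_finsetSum _ fun i _ => ?_).const_mul _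
    exact (integrableOn_const (by simp) (by simp)).integrable_indicator measurableSet_Icc
  exact h.ofReal.intervalIntegrable

theorem Conformal.G_holo {Λ : Set ℂ} {b : ℂ → ℂ} (hb : Conformal Λ b) {l r : ℝ} (hlr : l ≤ r)
    (hseg : seg l r ⊆ Λ) (θ ε : ℝ) {n : ℕ} (x : Fin n → ℝ) :
    DifferentiableOn ℂ (G θ ε l r b x) (Λ \ seg l r) := by
  have hV : IsOpen (Λ \ seg l r) :=
    hb.isOpen.sdiff ((isCompact_Icc.image Complex.continuous_ofReal).isClosed)
  have hm : ∀ t ∈ Icc l r, (t : ℂ) ∈ seg l r := fun t ht => ⟨t, ht, rfl⟩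
  have h1 : DifferentiableOn ℂ
      (fun z => ∫ s in l..r, cauchyKer b z s * (rho θ ε x s : ℂ)) (Λ \ seg l r) := fun z hz =>
    (hasDerivAt_intervalIntegral hV hlr (f := fun z (t : ℝ) => cauchyKer b z t)
      ((hb.continuousOn_cauchyKer sdiff_subset hseg disjoint_sdiff_left).comp
        (f := fun p : ℂ × ℝ => (p.1, (p.2 : ℂ))) (by fun_prop) fun p hp => ⟨hp.1, hm _ hp.2⟩)
      (fun t ht => (hb.cauchyKer_holo_left (hseg (hm t ht))).mono fun w hw =>
        ⟨hw.1, fun h0 => hw.2 (mem_singleton_iff.1 h0 ▸ hm t ht)⟩)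
      (intervalIntegrable_rho θ ε x l r) hz).differentiableAt.differentiableWithinAt
  have h2 : G θ ε l r b x = fun z => Complex.exp (θ * ∫ s in l..r, cauchyKer b z s *
      (rho θ ε x s : ℂ)) := by
    funext z
    unfold G cauchyKer
    congr 2
    exact intervalIntegral.integral_congr fun s _ => (div_mul_eq_mul_div _ _ _).symm
  rw [h2]
  exact (h1.const_mul _).cexp

/-- Second order expansion of a product of small quantities. -/
theorem norm_prod_expansion {ι : Type*} [DecidableEq ι] (s : Finset ι) {A δ : ι → ℂ} {y W K : ℝ}
    (hy : 0 ≤ y) (hW : 0 ≤ W) (hWK : W ≤ K) (hA : ∀ i ∈ s, ‖A i‖ ≤ y * W)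
    (hδ : ∀ i ∈ s, ‖δ i‖ ≤ y * W ^ 2) :
    ‖∏ i ∈ s, A i‖ ≤ (y + y * K) ^ s.card * W ^ s.card ∧
    ‖∏ i ∈ s, (A i + δ i)‖ ≤ (y + y * K) ^ s.card * W ^ s.card ∧
    ‖∏ i ∈ s, (A i + δ i) - ∏ i ∈ s, A i‖ ≤ s.card * (y + y * K) ^ s.card * W ^ (s.card + 1) ∧
    ‖∏ i ∈ s, (A i + δ i) - ∏ i ∈ s, A i - ∑ k ∈ s, δ k * ∏ i ∈ s.erase k, A i‖ ≤
      s.card ^ 2 * (y + y * K) ^ s.card * W ^ (s.card + 2) := by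
  set y' := y + y * K with hy'
  have hK : 0 ≤ K := hW.trans hWK
  have hyy : y ≤ y' := le_add_of_nonneg_right (by positivity)
  have hy0 : 0 ≤ y' := hy.trans hyy
  induction s using Finset.induction_on with
  | empty => simp
  | insert a s ha ih =>
    obtain ⟨h0, h1, h2, h3⟩ := ih (fun i hi => hA i (Finset.mem_insert_of_mem hi))
      fun i hi => hδ i (Finset.mem_insert_of_mem hi)
    have ha1 := hA a (Finset.mem_insert_self _ _)
    have ha2 := hδ a (Finset.mem_insert_self _ _)
    have hyW : y * W ≤ y' * W := mul_le_mul_of_nonneg_right hyy hW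
    have hyW2 : y * W ^ 2 ≤ y' * W ^ 2 := mul_le_mul_of_nonneg_right hyy (by positivity)
    have ha3 : ‖A a + δ a‖ ≤ y' * W := by
      refine (norm_add_le _ _).trans ((add_le_add ha1 ha2).trans ?_)
      rw [hy']
      nlinarith [mul_le_mul_of_nonneg_left hWK (mul_nonneg hy hW)]
    have hsum : ∑ k ∈ insert a s, δ k * ∏ i ∈ (insert a s).erase k, A i =
        δ a * ∏ i ∈ s, A i + A a * ∑ k ∈ s, δ k * ∏ i ∈ s.erase k, A i := by
      rw [Finset.sum_insert ha, Finset.erase_insert ha, Finset.mul_sum]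
      congr 1
      refine Finset.sum_congr rfl fun k hk => ?_
      have hka : a ≠ k := fun h => ha (h ▸ hk)
      rw [Finset.erase_insert_of_ne hka, Finset.prod_insert fun h =>
        ha (Finset.mem_of_mem_erase h)]
      ring
    rw [Finset.prod_insert ha, Finset.prod_insert ha, Finset.card_insert_of_notMem ha, hsum]
    set c := s.card
    have hp : 0 ≤ y' ^ c * W ^ c := by positivity
    refine ⟨?_, ?_, ?_, ?_⟩
    · rw [norm_mul]
      refine (mul_le_mul (ha1.trans hyW) h0 (norm_nonneg _) (by positivity)).trans (le_of_eq ?_)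
      ring
    · rw [norm_mul]
      refine (mul_le_mul ha3 h1 (norm_nonneg _) (by positivity)).trans (le_of_eq ?_)
      ring
    · rw [show (A a + δ a) * ∏ i ∈ s, (A i + δ i) - A a * ∏ i ∈ s, A i =
        δ a * ∏ i ∈ s, (A i + δ i) + A a * (∏ i ∈ s, (A i + δ i) - ∏ i ∈ s, A i) by ring]
      refine (norm_add_le _ _).trans ?_
      rw [norm_mul, norm_mul]
      refine (add_le_add (mul_le_mul (ha2.trans hyW2) h1 (norm_nonneg _) (by positivity))
        (mul_le_mul (ha1.trans hyW) h2 (norm_nonneg _) (by positivity))).trans (le_of_eq ?_)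
      push_cast; ring
    · rw [show (A a + δ a) * ∏ i ∈ s, (A i + δ i) - A a * ∏ i ∈ s, A i -
        (δ a * ∏ i ∈ s, A i + A a * ∑ k ∈ s, δ k * ∏ i ∈ s.erase k, A i) =
        δ a * (∏ i ∈ s, (A i + δ i) - ∏ i ∈ s, A i) + A a * (∏ i ∈ s, (A i + δ i) -
          ∏ i ∈ s, A i - ∑ k ∈ s, δ k * ∏ i ∈ s.erase k, A i) by ring]
      refine (norm_add_le _ _).trans ?_
      rw [norm_mul, norm_mul]
      refine (add_le_add (mul_le_mul (ha2.trans hyW2) h2 (norm_nonneg _) (by positivity))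
        (mul_le_mul (ha1.trans hyW) h3 (norm_nonneg _) (by positivity))).trans ?_
      have hz : 0 ≤ y' ^ (c + 1) * W ^ (c + 3) := by positivity
      push_cast
      have e : y' * W ^ 2 * (c * y' ^ c * W ^ (c + 1)) + y' * W * (c ^ 2 * y' ^ c * W ^ (c + 2)) =
        (c + c ^ 2) * (y' ^ (c + 1) * W ^ (c + 3)) := by ring
      rw [e, show ((c : ℝ) + 1) ^ 2 * y' ^ (c + 1) * W ^ (c + 1 + 2) =
        ((c : ℝ) + 1) ^ 2 * (y' ^ (c + 1) * W ^ (c + 3)) by ring]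
      refine mul_le_mul_of_nonneg_right ?_ hz
      have : (0 : ℝ) ≤ c := Nat.cast_nonneg c
      nlinarith

variable {P : Setting}

namespace Step

variable (D : Step P)

theorem Gf_holo : DifferentiableOn ℂ D.Gf (P.Λ \ seg P.l P.r) :=
  D.conf.G_holo P.lr.le P.seg_sub _ _ _

theorem A_holo : DifferentiableOn ℂ D.A (P.Λ \ seg P.l P.r) :=
  (D.Gf_holo.mul (D.adm.asymp.φp_holo.mono sdiff_subset)).fun_div D.Bf_holo fun _ hw => D.Bf_ne hw

/-- The linear statistic of the jump. -/
noncomputable def val (f : ℂ → ℂ) (e : Fin D.n → Fin 2) : ℂ := ∑ j, (e j : ℕ) * f (D.a j)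

/-- The centred linear statistic. -/
noncomputable def cen (f : ℂ → ℂ) (e : Fin D.n → Fin 2) : ℂ := D.val f e - D.E (D.val f)

theorem E_cen (f : ℂ → ℂ) : D.E (D.cen f) = 0 := by
  have : D.E (D.cen f) = D.E (D.val f) - D.E (fun _ => D.E (D.val f)) := D.E_sub _ _
  rw [this, D.E_const, sub_self]

theorem val_update (f : ℂ → ℂ) (e : Fin D.n → Fin 2) (i : Fin D.n) (he : e i = 0) :
    D.val f (Function.update e i 1) = D.val f e + f (D.a i) := by
  unfold val
  rw [← Finset.add_sum_erase _ _ (Finset.mem_univ i),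
    ← Finset.add_sum_erase Finset.univ (fun j => ((e j : ℕ) : ℂ) * f (D.a j)) (Finset.mem_univ i)]
  have h1 : ∀ j ∈ Finset.univ.erase i, ((Function.update e i 1 j : ℕ) : ℂ) * f (D.a j) =
      ((e j : ℕ) : ℂ) * f (D.a j) := fun j hj => by
    rw [Function.update_of_ne (Finset.ne_of_mem_erase hj)]
  rw [Finset.sum_congr rfl h1, Function.update_self, he]
  simp [add_comm]

theorem cen_update (f : ℂ → ℂ) (e : Fin D.n → Fin 2) (i : Fin D.n) (he : e i = 0) :
    D.cen f (Function.update e i 1) = D.cen f e + f (D.a i) := by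
  unfold cen; rw [D.val_update f e i he]; ring

theorem insert_prod {ι : Type*} (s : Finset ι) {f : ι → ℂ → ℂ} {U : Set ℂ}
    (hf : ∀ k, DifferentiableOn ℂ (f k) U) :
    D.Insert U (fun e => ∏ k ∈ s, D.cen (f k) e) (fun e w => ∏ k ∈ s, (D.cen (f k) e + f k w)) :=
  ⟨fun _ => DifferentiableOn.fun_finsetProd fun k _ => (hf k).const_add _, fun e i he =>
    Finset.prod_congr rfl fun k _ => (D.cen_update (f k) e i he).symm⟩

/-- The response of `ln ∏` at `z` to the insertion of `f`. -/
noncomputable def resp (f : ℂ → ℂ) (z : ℂ) : ℂ :=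
  (2 * Real.pi * Complex.I)⁻¹ * contourInt (P.con 6) (fun w => D.A w * f w * cauchyKer D.b w z)

theorem expτξ_continuousOn (e : Fin D.n → Fin 2) :
    ContinuousOn (fun w => Complex.exp (D.τ e w) * Complex.exp (D.ξ e w)) (trace (P.con 6)) := by
  have h6 : (0 : ℝ) < 6 := by norm_num
  have hw9 : ∀ w ∈ trace (P.con 6), w ∈ P.ann 1 9 := fun w hw =>
    P.con_sub_ann h6 (by norm_num) (by norm_num) hw
  have hoff : trace (P.con 6) ⊆ P.Λ \ seg P.l P.r := fun w hw =>
    P.ann_sub (by norm_num) (by norm_num) (hw9 w hw)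
  have hG : ∀ w ∈ trace (P.con 6), D.Gf w ≠ 0 := fun w hw => by
    rw [D.Gf_eq (hoff hw)]; exact Complex.exp_ne_zero _
  have h1 : ContinuousOn (fun w => (D.sobs e w * Complex.exp (-D.ld w)) / D.Gf w)
      (trace (P.con 6)) := by
    refine ContinuousOn.div (ContinuousOn.mul ?_ (ContinuousOn.cexp ?_))
      (D.Gf_holo.continuousOn.mono hoff) hG
    · unfold sobs
      refine continuousOn_finsetProd _ fun j _ => ContinuousOn.div ?_ ?_ fun w hw => ?_
      · refine (D.conf.holo.continuousOn.comp (f := fun w : ℂ => w + D.h) (by fun_prop)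
          fun w hw => ?_).sub continuousOn_const
        exact D.add_h_mem (by rw [P.lvl_con h6 hw]; exact P.s_lt (by norm_num))
      · exact (D.conf.holo.continuousOn.mono (hoff.trans sdiff_subset)).sub continuousOn_const
      · exact D.conf.sub_ne (hoff hw).1 (P.seg_sub (D.a_mem j)) fun h0 =>
          (hoff hw).2 (h0 ▸ D.a_mem j)
    · exact ((D.ld_outer.differentiableOn D.conf P.core_sub).continuousOn.mono fun w hw =>
        off_core_of_ann (by norm_num) (by norm_num)
          (P.con_sub_ann h6 (le_refl 6) le_rfl hw)).neg
  refine h1.congr fun w hw => ?_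
  simp only [D.sobs_eq_exp e (hw9 w hw)]
  rw [mul_div_cancel_left₀ _ (hG w hw)]

theorem E_continuousOn {f : (Fin D.n → Fin 2) → ℂ → ℂ} {S : Set ℂ}
    (hf : ∀ e, ContinuousOn (f e) S) : ContinuousOn (fun w => D.E (fun e => f e w)) S :=
  continuousOn_finsetSum _ fun e _ => continuousOn_const.mul (hf e)

theorem cauchyKer_continuousOn_con {i : ℝ} (hi : 0 < i) (hi' : i ≤ 10) {z : ℂ} (hz : z ∈ P.Λ)
    (hz' : lvl P.l P.r z ≠ P.s i) :
    ContinuousOn (fun w => cauchyKer D.b w z) (trace (P.con i)) :=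
  (D.conf.cauchyKer_holo_left hz).continuousOn.mono fun w hw =>
    ⟨P.con_sub hi hi' hw, fun h => by
      rw [mem_singleton_iff.1 h] at hw; exact hz' (P.lvl_con hi hw)⟩

end Step

theorem exists_η_sub_τ_bound (P : Setting) : ∃ K : ℝ, 0 < K ∧ ∀ (D : Step P) (e : Fin D.n → Fin 2)
    (v : ℂ), v ∈ P.ann 5 9.5 → ‖D.η e v‖ ≤ K * D.W e ∧ ‖D.η e v - D.τ e v‖ ≤ K * D.W e ^ 2 := by
  obtain ⟨K1, hK1, h1⟩ := exists_τ_le_W P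
  obtain ⟨K2, hK2, h2⟩ := exists_W_bound P
  refine ⟨(K1 + K1 ^ 2) * Real.exp (K1 * K2), by positivity, fun D e v hv => ?_⟩
  have hW := D.W_pos e
  have h3 := h1 D e v hv
  have h4 : Real.exp ‖D.τ e v‖ ≤ Real.exp (K1 * K2) :=
    Real.exp_le_exp.2 (h3.trans (mul_le_mul_of_nonneg_left (h2 D e) hK1.le))
  constructor
  · refine (norm_exp_sub_one_le _).trans ?_
    refine (mul_le_mul h3 h4 (Real.exp_nonneg _) (by positivity)).trans ?_
    have : 0 ≤ K1 ^ 2 * Real.exp (K1 * K2) * D.W e := by positivity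
    nlinarith
  · have h5 := Complex.norm_exp_sub_sum_le_norm_mul_exp (D.τ e v) 2
    simp only [Finset.sum_range_succ, Finset.sum_range_zero, zero_add, pow_zero, Nat.factorial,
      Nat.cast_one, div_one, pow_one, mul_one] at h5
    rw [Step.η, sub_sub]
    refine h5.trans ((mul_le_mul (pow_le_pow_left₀ (norm_nonneg _) h3 2) h4 (Real.exp_nonneg _)
      (by positivity)).trans ?_)
    have : 0 ≤ K1 * Real.exp (K1 * K2) * D.W e ^ 2 := by positivity
    nlinarith

theorem exists_expξ_bound (P : Setting) : ∃ K : ℝ, 0 < K ∧ ∀ (D : Step P) (w : ℂ),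
    w ∈ P.ann 2 9 → ∀ e, ‖Complex.exp (D.ξ e w) - 1‖ ≤ K * D.ε := by
  obtain ⟨Kξ, hKξ, hξ⟩ := exists_ξ_bound P
  have hg := P.g_pos
  refine ⟨Kξ * Real.exp (Kξ * (P.g / 8)), by positivity, fun D w hw e => ?_⟩
  have h5 := hξ D w hw e
  refine (norm_exp_sub_one_le _).trans ?_
  have h6 : ‖D.ξ e w‖ ≤ Kξ * (P.g / 8) := h5.trans (mul_le_mul_of_nonneg_left D.ε_le hKξ.le)
  calc _ ≤ (Kξ * D.ε) * Real.exp (Kξ * (P.g / 8)) :=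
        mul_le_mul h5 (Real.exp_le_exp.2 h6) (Real.exp_nonneg _)
          (mul_nonneg hKξ.le D.ε_pos.le)
    _ = _ := by ring

/-- Linear statistics with uniform bounds. -/
structure Step.Good (D : Step P) (K : ℝ) (f : ℂ → ℂ) : Prop where
  holo : DifferentiableOn ℂ f {z | lvl P.l P.r z < P.s 6.5}
  le : ∀ z, lvl P.l P.r z < P.s 6.5 → ‖f z‖ ≤ K * D.ε
  cen_le : ∀ e, ‖D.cen f e‖ ≤ K * D.W e

/-- The linear response formula. -/
theorem exists_response (P : Setting) (p : ℕ) {K : ℝ} (hK : 0 ≤ K) : ∃ K' : ℝ, 0 < K' ∧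
    ∀ (D : Step P) (f : Fin p → ℂ → ℂ), (∀ k, D.Good K (f k)) → ∀ s : Finset (Fin p),
    ∀ z ∈ P.ann 6.75 9.5,
    ‖D.E (fun e => (∏ k ∈ s, D.cen (f k) e) * D.τ e z) -
      ∑ k ∈ s, D.E (fun e => ∏ i ∈ s.erase k, D.cen (f i) e) * D.resp (f k) z‖ ≤
        K' * D.σ ^ (s.card + 2) := by
  obtain ⟨Kc, hKc, hc⟩ := exists_cauchy_bound P (i := 6) (j := 6.75) (by norm_num) (by norm_num)
    (by norm_num)
  obtain ⟨Kτ, hKτ, hτ⟩ := exists_τ_bound P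
  obtain ⟨Kη, hKη, hη⟩ := exists_η_sub_τ_bound P
  obtain ⟨Kξ, hKξ, hξ⟩ := exists_expξ_bound P
  obtain ⟨KA, hKA, hA⟩ := exists_A_bound P (j := 6) (by norm_num)
  obtain ⟨KW, hKW, hW⟩ := exists_W_bound P
  choose KE hKE hE using exists_E_bound P
  set K1 := K + K * KW with hK1
  have hK10 : 0 ≤ K1 := by positivity
  set C : ℕ → ℝ := fun c => Real.exp Kτ * Kξ * K1 ^ c + Kη * (c * K1 ^ c) + c ^ 2 * K1 ^ c with hC
  have hC0 : ∀ c, 0 ≤ C c := fun c => by positivity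
  set M : ℕ → ℝ := fun c => KE (c + 2) * (Kη * K1 ^ c) + Kc * (KA * (KE (c + 2) * C c)) with hM
  have hM0 : ∀ c, 0 ≤ M c := fun c => by
    have := (hKE (c + 2)).le
    have := hC0 c
    positivity
  refine ⟨(∑ c ∈ Finset.range (p + 1), M c) + 1,
    add_pos_of_nonneg_of_pos (Finset.sum_nonneg fun c _ => hM0 c) one_pos,
    fun D f hf s z hz => ?_⟩
  set c := s.card with hcdef
  have hσ := D.σ_pos
  have hε := D.ε_pos
  suffices hs : ‖D.E (fun e => (∏ k ∈ s, D.cen (f k) e) * D.τ e z) -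
      ∑ k ∈ s, D.E (fun e => ∏ i ∈ s.erase k, D.cen (f i) e) * D.resp (f k) z‖ ≤
        M c * D.σ ^ (c + 2) by
    refine hs.trans (mul_le_mul_of_nonneg_right ?_ (by positivity))
    have hcp : c ∈ Finset.range (p + 1) :=
      Finset.mem_range_succ_iff.2 ((Finset.card_le_univ s).trans (by simp))
    linarith [Finset.single_le_sum (fun c _ => hM0 c) hcp]
  have h6 : (0 : ℝ) < 6 := by norm_num
  have hzΛ : z ∈ P.Λ := P.mem_Λ (by norm_num) hz.2
  have hzl : P.s 6 < lvl P.l P.r z := (P.s_lt (by norm_num)).trans_le hz.1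
  have hw6 : ∀ w ∈ trace (P.con 6), w ∈ P.ann 6 6 := fun w hw =>
    P.con_sub_ann h6 le_rfl le_rfl hw
  have hlt : ∀ w ∈ trace (P.con 6), lvl P.l P.r w < P.s 6.5 := fun w hw => by
    rw [P.lvl_con h6 hw]; exact P.s_lt (by norm_num)
  have hoff : trace (P.con 6) ⊆ P.Λ \ seg P.l P.r := fun w hw =>
    P.ann_sub (by norm_num) (by norm_num) (hw6 w hw)
  have hmaster := D.master_fluct (k := 6) (by norm_num) (by norm_num) (j := 6.5) (by norm_num)
    (by norm_num) (D.insert_prod s fun k => (hf k).holo) hzΛ hzl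
  -- product estimates
  have hprod : ∀ e w, w ∈ trace (P.con 6) → _ := fun e w hw =>
    norm_prod_expansion s (A := fun k => D.cen (f k) e) (δ := fun k => f k w) hK (D.W_pos e).le
      (hW D e) (fun k _ => (hf k).cen_le e) fun k _ => ((hf k).le w (hlt w hw)).trans
        (mul_le_mul_of_nonneg_left (D.ε_le_W e) hK)
  have hw0 : P.con 6 0 ∈ trace (P.con 6) := mem_trace (by simp)
  -- replacing `τ` by `η`
  have hleft : ‖D.E (fun e => (∏ k ∈ s, D.cen (f k) e) * D.η e z) -
      D.E (fun e => (∏ k ∈ s, D.cen (f k) e) * D.τ e z)‖ ≤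
      KE (c + 2) * ((Kη * K1 ^ c) * D.σ ^ (c + 2)) := by
    rw [← D.E_sub]
    refine hE (c + 2) D _ _ (by positivity) fun e => ?_
    rw [← mul_sub, norm_mul]
    refine (mul_le_mul (hprod e _ hw0).1
      (hη D e z (P.ann_mono (by norm_num) le_rfl hz)).2 (norm_nonneg _)
      (by have := (D.W_pos e).le; positivity)).trans (le_of_eq ?_)
    ring
  -- the integrand
  set Fw : ℂ → ℂ := fun w => D.E (fun e => Complex.exp (D.τ e w) *
    (Complex.exp (D.ξ e w) * ∏ k ∈ s, (D.cen (f k) e + f k w) - ∏ k ∈ s, D.cen (f k) e)) with hFw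
  set Gw : ℂ → ℂ := fun w => ∑ k ∈ s, f k w * D.E (fun e => ∏ i ∈ s.erase k, D.cen (f i) e)
    with hGw
  have hFG : ∀ w ∈ trace (P.con 6), ‖Fw w - Gw w‖ ≤ KE (c + 2) * (C c * D.σ ^ (c + 2)) := by
    intro w hw
    have e1 : Gw w = D.E (fun e => ∑ k ∈ s, f k w * ∏ i ∈ s.erase k, D.cen (f i) e) := by
      rw [D.E_sum]
      exact Finset.sum_congr rfl fun k _ => (D.E_mul_left _ _).symm
    rw [e1, hFw, ← D.E_sub]
    refine hE (c + 2) D _ _ (hC0 c) fun e => ?_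
    obtain ⟨-, p1, p2, p3⟩ := hprod e w hw
    have hWe := (D.W_pos e).le
    have hw5 : w ∈ P.ann 5 9.5 := P.ann_mono (by norm_num) (by norm_num) (hw6 w hw)
    have b1 : ‖Complex.exp (D.τ e w)‖ ≤ Real.exp Kτ :=
      norm_exp_le (hτ D w (P.ann_mono (by norm_num) le_rfl hw5) e)
    have b2 : ‖Complex.exp (D.ξ e w) - 1‖ ≤ Kξ * D.W e ^ 2 :=
      (hξ D w (P.ann_mono (by norm_num) (by norm_num) (hw6 w hw)) e).trans
        (mul_le_mul_of_nonneg_left (D.ε_le_W e) hKξ.le)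
    have b3 : ‖Complex.exp (D.τ e w) - 1‖ ≤ Kη * D.W e := (hη D e w hw5).1
    rw [show Complex.exp (D.τ e w) * (Complex.exp (D.ξ e w) * ∏ k ∈ s, (D.cen (f k) e + f k w) -
        ∏ k ∈ s, D.cen (f k) e) - ∑ k ∈ s, f k w * ∏ i ∈ s.erase k, D.cen (f i) e =
      Complex.exp (D.τ e w) * (Complex.exp (D.ξ e w) - 1) * ∏ k ∈ s, (D.cen (f k) e + f k w) +
      (Complex.exp (D.τ e w) - 1) * (∏ k ∈ s, (D.cen (f k) e + f k w) - ∏ k ∈ s, D.cen (f k) e) +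
      (∏ k ∈ s, (D.cen (f k) e + f k w) - ∏ k ∈ s, D.cen (f k) e -
        ∑ k ∈ s, f k w * ∏ i ∈ s.erase k, D.cen (f i) e) by ring]
    refine (norm_add₃_le).trans ?_
    rw [norm_mul, norm_mul, norm_mul]
    refine (add_le_add (add_le_add (mul_le_mul (mul_le_mul b1 b2 (norm_nonneg _) (by positivity))
      p1 (norm_nonneg _) (by positivity)) (mul_le_mul b3 p2 (norm_nonneg _) (by positivity)))
      p3).trans (le_of_eq ?_)
    simp only [hC]
    ring
  have hcont : ContinuousOn (fun w => cauchyKer D.b w z) (trace (P.con 6)) :=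
    D.cauchyKer_continuousOn_con h6 (by norm_num) hzΛ hzl.ne'
  have hAc : ContinuousOn D.A (trace (P.con 6)) := D.A_holo.continuousOn.mono hoff
  have hfc : ∀ k, ContinuousOn (f k) (trace (P.con 6)) := fun k =>
    (hf k).holo.continuousOn.mono fun w hw => hlt w hw
  have hFc : ContinuousOn Fw (trace (P.con 6)) := by
    refine D.E_continuousOn fun e => ?_
    have h1 : ContinuousOn (fun w => Complex.exp (D.τ e w) * Complex.exp (D.ξ e w) *
        ∏ k ∈ s, (D.cen (f k) e + f k w) - Complex.exp (D.τ e w) * ∏ k ∈ s, D.cen (f k) e)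
        (trace (P.con 6)) :=
      ((D.expτξ_continuousOn e).mul (continuousOn_finsetProd _ fun k _ =>
        continuousOn_const.add (hfc k))).sub
        ((D.τ_continuousOn e (by norm_num) (by norm_num)).cexp.mul continuousOn_const)
    exact h1.congr fun w _ => by ring
  have hGc : ContinuousOn Gw (trace (P.con 6)) :=
    continuousOn_finsetSum _ fun k _ => (hfc k).mul continuousOn_const
  have hp6 := (P.isLoop_con h6).pwC1
  have hsumresp : ∑ k ∈ s, D.E (fun e => ∏ i ∈ s.erase k, D.cen (f i) e) * D.resp (f k) z =
      (2 * Real.pi * Complex.I)⁻¹ * contourInt (P.con 6)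
        (fun w => D.A w * Gw w * cauchyKer D.b w z) := by
    have e2 : contourInt (P.con 6) (fun w => D.A w * Gw w * cauchyKer D.b w z) =
        contourInt (P.con 6) (fun w => ∑ k ∈ s,
          D.E (fun e => ∏ i ∈ s.erase k, D.cen (f i) e) * (D.A w * f k w * cauchyKer D.b w z)) :=
      contourInt_congr fun w _ => by
        simp only [hGw, Finset.mul_sum, Finset.sum_mul]
        exact Finset.sum_congr rfl fun k _ => by ring
    rw [e2, contourInt_finset_sum hp6 s (f := fun k w =>
      D.E (fun e => ∏ i ∈ s.erase k, D.cen (f i) e) * (D.A w * f k w * cauchyKer D.b w z))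
      fun k _ => continuousOn_const.mul ((hAc.mul (hfc k)).mul hcont), Finset.mul_sum]
    refine Finset.sum_congr rfl fun k _ => ?_
    rw [contourInt_const_mul, Step.resp]
    ring
  have hdiff : D.E (fun e => (∏ k ∈ s, D.cen (f k) e) * D.η e z) -
      ∑ k ∈ s, D.E (fun e => ∏ i ∈ s.erase k, D.cen (f i) e) * D.resp (f k) z =
      (2 * Real.pi * Complex.I)⁻¹ * contourInt (P.con 6)
        (fun w => D.A w * (Fw w - Gw w) * cauchyKer D.b w z) := by
    rw [hsumresp, hmaster, ← mul_sub, ← contourInt_sub hp6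
      (f := fun w => D.A w * Fw w * cauchyKer D.b w z)
      (g := fun w => D.A w * Gw w * cauchyKer D.b w z)
      ((hAc.mul hFc).mul hcont) ((hAc.mul hGc).mul hcont)]
    congr 1
    exact contourInt_congr fun w _ => by ring
  have hright := hc D (fun w => D.A w * (Fw w - Gw w)) _ z hz fun w hw => by
    rw [norm_mul]
    exact mul_le_mul (hA D w (P.ann_mono le_rfl (by norm_num) (hw6 w hw))) (hFG w hw)
      (norm_nonneg _) hKA.le
  rw [← hdiff] at hright
  have := norm_sub_le_norm_sub_add_norm_sub
    (D.E (fun e => (∏ k ∈ s, D.cen (f k) e) * D.τ e z))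
    (D.E (fun e => (∏ k ∈ s, D.cen (f k) e) * D.η e z))
    (∑ k ∈ s, D.E (fun e => ∏ i ∈ s.erase k, D.cen (f i) e) * D.resp (f k) z)
  rw [norm_sub_rev] at hleft
  refine this.trans ((add_le_add hleft hright).trans (le_of_eq ?_))
  simp only [hM]
  ring

end

section

open Conf

variable {P : Setting}

theorem Setting.lvl_add_le {w : ℂ} {j t : ℝ} (hw : lvl P.l P.r w ≤ P.s j) (h0 : 0 ≤ t)
    (ht : t ≤ P.g / 8) : lvl P.l P.r (w + t) ≤ P.s (j + 1 / 4) := by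
  have h1 := lvl_le_add P.l P.r (w + t) w
  rw [add_sub_cancel_left, Complex.norm_real, Real.norm_of_nonneg h0] at h1
  simp only [Setting.s] at *
  linarith

theorem Setting.lvl_add_lt {w : ℂ} {j t : ℝ} (hw : lvl P.l P.r w < P.s j) (h0 : 0 ≤ t)
    (ht : t ≤ P.g / 8) : lvl P.l P.r (w + t) < P.s (j + 1 / 4) := by
  have h1 := lvl_le_add P.l P.r (w + t) w
  rw [add_sub_cancel_left, Complex.norm_real, Real.norm_of_nonneg h0] at h1
  simp only [Setting.s] at *
  linarith

/-- The kernel of the increments away from the segment. -/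
theorem exists_outerKer_bound (P : Setting) : ∃ K : ℝ, 0 < K ∧ ∀ (D : Step P) (z u : ℂ),
    z ∈ P.F → lvl P.l P.r u ≤ P.s 9.5 → ‖cauchyKer D.b z u‖ ≤ K := by
  have hg := P.g_pos
  obtain ⟨κ, hκ, h1⟩ := exists_b_sep P (δ := P.g / 4) (by positivity)
  obtain ⟨K, hK, h2⟩ := exists_deriv_b_bound P
  refine ⟨K / κ, by positivity, fun D z u hz hu => ?_⟩
  unfold cauchyKer
  rw [norm_div]
  refine div_le_div₀ hK.le (h2 D z (Or.inr hz)) hκ (h1 D u z hu (P.F_sub hz) ?_)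
  have := P.sep (k := 10) hu (P.F_far z hz).le
  linarith

namespace Step

variable (D : Step P)

theorem outerKer_holo {z : ℂ} (hz : z ∈ P.F) :
    DifferentiableOn ℂ (fun u => cauchyKer D.b z u) {u | lvl P.l P.r u < P.s 10} :=
  (D.conf.cauchyKer_holo_right (P.F_sub hz)).mono fun u hu => ⟨P.lt_sub le_rfl hu, fun h0 => by
    rw [mem_singleton_iff.1 h0] at hu
    exact lt_asymm hu (P.F_far z hz)⟩

/-- The difference quotient of the kernel of the increments. -/
noncomputable def Kav (z w : ℂ) : ℂ :=
  (D.ε : ℂ)⁻¹ * (cauchyKer D.b z (w + D.ε) - cauchyKer D.b z w)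

theorem Kav_holo {z : ℂ} (hz : z ∈ P.F) :
    DifferentiableOn ℂ (D.Kav z) {w | lvl P.l P.r w < P.s 9} := by
  refine (DifferentiableOn.sub ?_ ?_).const_mul _
  · refine (D.outerKer_holo hz).comp (by fun_prop) fun w hw => ?_
    exact (P.lvl_add_lt hw D.ε_pos.le D.ε_le).trans_le (P.s_le (by norm_num))
  · exact (D.outerKer_holo hz).mono fun w hw => hw.trans_le (P.s_le (by norm_num))

theorem holo_integral_shift {g : ℂ → ℂ} {j : ℝ}
    (hg : DifferentiableOn ℂ g {w | lvl P.l P.r w < P.s (j + 1 / 4)}) :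
    DifferentiableOn ℂ (fun w => ∫ s in (0 : ℝ)..D.h, g (w + s)) {w | lvl P.l P.r w < P.s j} := by
  intro w hw
  have h1 := hasDerivAt_intervalIntegral (isOpen_lvl_lt P.l P.r (P.s j)) D.h_pos.le
    (f := fun w (s : ℝ) => g (w + s)) (g := fun _ => 1)
    (hg.continuousOn.comp (f := fun p : ℂ × ℝ => p.1 + (p.2 : ℂ)) (by fun_prop)
      fun p hp => P.lvl_add_lt hp.1 hp.2.1 (hp.2.2.trans D.h_le))
    (fun s hs => hg.comp (by fun_prop) fun w hw => P.lvl_add_lt hw hs.1 (hs.2.trans D.h_le))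
    (by simp) hw
  simp only [mul_one] at h1
  exact h1.differentiableAt.differentiableWithinAt

/-- The function whose linear statistic is the increment. -/
noncomputable def fX (z w : ℂ) : ℂ := (P.θ : ℂ)⁻¹ * ∫ s in (0 : ℝ)..D.h, D.Kav z (w + s)

theorem fX_holo {z : ℂ} (hz : z ∈ P.F) {j : ℝ} (hj : j ≤ 8.75) :
    DifferentiableOn ℂ (D.fX z) {w | lvl P.l P.r w < P.s j} :=
  (D.holo_integral_shift ((D.Kav_holo hz).mono fun _ hw =>
    hw.trans_le (P.s_le (by linarith)))).const_mul _

theorem eps_ne : (D.ε : ℂ) ≠ 0 := by exact_mod_cast D.ε_pos.ne'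

theorem increment_eq {z : ℂ} (hz : z ∈ P.F) (e : Fin D.n → Fin 2) :
    increment P.θ D.ε D.b D.x e z = D.val (D.fX z) e := by
  have hθ : (P.θ : ℂ) ≠ 0 := by exact_mod_cast P.θ_pos.ne'
  have hreal : ∀ t : ℝ, P.l ≤ t → t ≤ P.r + 2 * (P.g / 8) → lvl P.l P.r t < P.s 10 := by
    intro t h1 h2
    have e1 : ‖(t : ℂ) - P.l‖ = t - P.l := by
      rw [← Complex.ofReal_sub, Complex.norm_real, Real.norm_of_nonneg (by linarith)]
    have e2 : ‖(t : ℂ) - P.r‖ = |t - P.r| := by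
      rw [← Complex.ofReal_sub, Complex.norm_real, Real.norm_eq_abs]
    rw [lvl, e1, e2, Setting.s]
    have := P.g_pos
    have := P.lr
    rcases abs_cases (t - P.r) with h | h <;> linarith
  have hcont : ContinuousOn (fun t : ℝ => cauchyKer D.b z t) (Icc P.l (P.r + 2 * (P.g / 8))) :=
    (D.outerKer_holo hz).continuousOn.comp Complex.continuous_ofReal.continuousOn
      fun t ht => hreal t ht.1 ht.2
  have hjump : ∀ j, D.ε * jump D.x e j = D.a j + D.ε * (e j : ℕ) := fun j => by
    unfold jump a; ring
  have he : ∀ j, (0 : ℝ) ≤ (e j : ℕ) ∧ ((e j : ℕ) : ℝ) ≤ 1 := fun j =>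
    ⟨Nat.cast_nonneg _, by exact_mod_cast Fin.is_le (e j)⟩
  have hy := D.integral_mul_rho (y := jump D.x e) (f := fun t : ℝ => cauchyKer D.b z t) fun j =>
    hcont.mono fun t ht => by
      rw [hjump] at ht
      have h1 := D.l_le_a j
      have h2 := D.a_add_h_le j
      have h3 := D.ε_pos
      have h4 := D.ε_le
      have h5 := mul_le_mul_of_nonneg_left (he j).2 h3.le
      have h6 := mul_nonneg h3.le (he j).1
      have h7 := P.g_pos
      exact ⟨by linarith [ht.1], by linarith [ht.2]⟩
  have hx := D.integral_mul_rho (y := D.x) (f := fun t : ℝ => cauchyKer D.b z t) fun j =>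
    hcont.mono fun t ht => by
      have h1 := D.l_le_a j
      have h2 := D.a_add_h_le j
      have h7 := P.g_pos
      unfold a at h1 h2
      exact ⟨by linarith [ht.1], by linarith [ht.2]⟩
  have hint : ∀ s : ℝ, deriv D.b z * ((rho P.θ D.ε (jump D.x e) s - rho P.θ D.ε D.x s : ℝ) : ℂ) /
      (D.b z - D.b s) = cauchyKer D.b z s * (rho P.θ D.ε (jump D.x e) s : ℂ) -
        cauchyKer D.b z s * (rho P.θ D.ε D.x s : ℂ) := fun s => by
    unfold cauchyKer; push_cast; ring
  unfold increment
  simp only [hint]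
  rw [integral_sub hy.1 hx.1, hy.2, hx.2, ← mul_sub, ← Finset.sum_sub_distrib, val,
    ← mul_assoc, Finset.mul_sum]
  refine Finset.sum_congr rfl fun j _ => ?_
  rw [hjump]
  rcases fin_two (e j) with h | h
  · rw [h]; simp [a]
  · rw [h]
    have hi1 : IntervalIntegrable (fun s : ℝ => cauchyKer D.b z (D.a j + s + D.ε)) volume 0 D.h := by
      refine ContinuousOn.intervalIntegrable_of_Icc D.h_pos.le ?_
      refine ((D.outerKer_holo hz).continuousOn).comp (by fun_prop) fun s hs => ?_
      have := P.lvl_add_lt (P.lvl_add_lt (j := 1) (P.lvl_seg_lt one_pos (D.a_mem j)) hs.1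
        (hs.2.trans D.h_le)) D.ε_pos.le D.ε_le
      exact this.trans (P.s_lt (by norm_num))
    have hi2 : IntervalIntegrable (fun s : ℝ => cauchyKer D.b z (D.a j + s)) volume 0 D.h := by
      refine ContinuousOn.intervalIntegrable_of_Icc D.h_pos.le ?_
      refine ((D.outerKer_holo hz).continuousOn).comp (by fun_prop) fun s hs => ?_
      have := P.lvl_add_lt (j := 1) (P.lvl_seg_lt one_pos (D.a_mem j)) hs.1 (hs.2.trans D.h_le)
      exact this.trans (P.s_lt (by norm_num))
    unfold fX Kav
    rw [intervalIntegral.integral_const_mul, intervalIntegral.integral_sub hi1 hi2]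
    have e1 : ∀ s : ℝ, (((D.a j + D.ε * ((1 : Fin 2) : ℕ) : ℝ) + s : ℝ) : ℂ) =
        D.a j + s + D.ε := fun s => by push_cast; simp; ring
    have e2 : ∀ s : ℝ, (((D.ε * D.x j : ℝ) + s : ℝ) : ℂ) = D.a j + s := fun s => by
      unfold a; push_cast; ring
    simp only [e1, e2]
    simp only [Fin.isValue, Fin.val_one, Nat.cast_one, one_mul]
    ring

/-- The Cauchy formula in the second variable of the kernel. -/
theorem cauchy_right {i j : ℝ} (hi : 0 < i) (hij : i < j) (hj : j ≤ 10) {g : ℂ → ℂ}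
    (hg : DifferentiableOn ℂ g {w | lvl P.l P.r w < P.s j}) {w : ℂ} (hw : lvl P.l P.r w < P.s i) :
    contourInt (P.con i) (fun z => cauchyKer D.b w z * g z) =
      -(2 * Real.pi * Complex.I * g w) := by
  have hs : {w | lvl P.l P.r w < P.s j} ⊆ P.Λ := P.lt_sub hj
  have hwj : lvl P.l P.r w < P.s j := hw.trans (P.s_lt hij)
  have hf : DifferentiableOn ℂ (fun z => -(g z * deriv D.b w / deriv D.b z))
      {w | lvl P.l P.r w < P.s j} :=
    ((hg.mul_const _).fun_div (D.conf.deriv_holo.mono hs)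
      fun z hz => D.conf.deriv_ne z (hs hz)).neg
  have h1 := D.conf.cauchy (isOpen_lvl_lt P.l P.r (P.s j)) hs (P.isLoop_con hi)
    (P.con_sub_lt hi hij) (fun a ha => P.winding_con_out hi ((P.s_lt hij).trans_le (not_lt.1 ha)))
    hf hwj fun h0 => hw.ne (P.lvl_con hi h0)
  rw [P.winding_con_in hi hw, mul_one] at h1
  have h2 : contourInt (P.con i) (fun z => cauchyKer D.b w z * g z) = contourInt (P.con i)
      (fun z => -(g z * deriv D.b w / deriv D.b z) * cauchyKer D.b z w) := by
    refine contourInt_congr fun z hz => ?_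
    have hzΛ : z ∈ P.Λ := hs (P.con_sub_lt hi hij hz)
    have hne : z ≠ w := fun h0 => hw.ne (h0 ▸ P.lvl_con hi hz)
    have h3 := D.conf.sub_ne hzΛ (hs hwj) hne
    have h4 := D.conf.sub_ne (hs hwj) hzΛ hne.symm
    have h5 := D.conf.deriv_ne z hzΛ
    unfold cauchyKer
    rw [← neg_sub (D.b z), div_neg]
    field_simp
  have h6 := D.conf.deriv_ne w (hs hwj)
  rw [h2, h1]
  field_simp

/-- The functional which recovers the increment from the observable. -/
noncomputable def fun7 (z : ℂ) (u : ℂ → ℂ) : ℂ :=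
  -((P.θ : ℂ)⁻¹ * ((2 * Real.pi * Complex.I)⁻¹ *
    contourInt (P.con 7) (fun w => u w * D.Kav z w)))

theorem Kav_continuousOn {z : ℂ} (hz : z ∈ P.F) {k : ℝ} (hk : 0 < k) (hk' : k < 9) :
    ContinuousOn (D.Kav z) (trace (P.con k)) :=
  (D.Kav_holo hz).continuousOn.mono (P.con_sub_lt hk hk')

theorem val_fX {z : ℂ} (hz : z ∈ P.F) (e : Fin D.n → Fin 2) :
    D.val (D.fX z) e = D.fun7 z (D.T e) := by
  have h7 : (0 : ℝ) < 7 := by norm_num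
  have hp := (P.isLoop_con h7).pwC1
  have hs : trace (P.con 7) ⊆ P.Λ := P.con_sub h7 (by norm_num)
  have hsegc : ∀ j, ∀ s ∈ Icc 0 D.h, lvl P.l P.r (D.a j + s) < P.s 7 := fun j s hs =>
    P.lvl_seg_lt h7 (D.a_add_mem j hs)
  have hcont : ∀ j, ContinuousOn (Function.uncurry fun (w : ℂ) (s : ℝ) =>
      cauchyKer D.b (D.a j + s) w * D.Kav z w) (trace (P.con 7) ×ˢ Icc 0 D.h) := fun j => by
    refine ContinuousOn.mul ?_ ((D.Kav_continuousOn hz h7 (by norm_num)).comp continuousOn_fst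
      fun p hp => hp.1)
    refine (D.conf.continuousOn_cauchyKer P.seg_sub hs ?_).comp
      (f := fun p : ℂ × ℝ => ((D.a j : ℂ) + p.2, p.1)) (by fun_prop)
      fun p hp => ⟨D.a_add_mem j hp.2, hp.1⟩
    exact disjoint_left.2 fun u hu hu' => (P.lvl_seg_lt h7 hu).ne (P.lvl_con h7 hu')
  have h1 : ∀ j, contourInt (P.con 7) (fun w => D.hf w (D.a j) * D.Kav z w) =
      -(2 * Real.pi * Complex.I * ∫ s in (0 : ℝ)..D.h, D.Kav z (D.a j + s)) := fun j => by
    have h2 := contourInt_intervalIntegral_swap hp D.h_pos.le (hcont j)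
    have h3 : contourInt (P.con 7) (fun w => D.hf w (D.a j) * D.Kav z w) =
        contourInt (P.con 7) (fun w => ∫ s in (0 : ℝ)..D.h,
          cauchyKer D.b (D.a j + s) w * D.Kav z w) :=
      contourInt_congr fun w _ => (intervalIntegral.integral_mul_const _ _).symm
    rw [h3, h2, ← intervalIntegral.integral_const_mul, ← intervalIntegral.integral_neg]
    refine intervalIntegral.integral_congr fun s hs => ?_
    rw [uIcc_of_le D.h_pos.le] at hs
    exact D.cauchy_right h7 (j := 9) (by norm_num) (by norm_num) (D.Kav_holo hz) (hsegc j s hs)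
  have hc : ∀ j, ContinuousOn (fun w => ((e j : ℕ) : ℂ) * (D.hf w (D.a j) * D.Kav z w))
      (trace (P.con 7)) := fun j => by
    refine continuousOn_const.mul (ContinuousOn.mul ?_ (D.Kav_continuousOn hz h7 (by norm_num)))
    intro w hw
    have hV : IsOpen (P.Λ \ seg P.l P.r) := P.isOpen_off
    have hw0 : w ∈ P.Λ \ seg P.l P.r :=
      P.ann_sub h7 (by norm_num) (P.con_sub_ann h7 le_rfl le_rfl hw)
    have h1 := hasDerivAt_intervalIntegral hV D.h_pos.le
      (f := fun w (s : ℝ) => cauchyKer D.b (D.a j + s) w) (g := fun _ => 1)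
      ((D.conf.continuousOn_cauchyKer P.seg_sub sdiff_subset disjoint_sdiff_right).comp
        (f := fun p : ℂ × ℝ => ((D.a j : ℂ) + p.2, p.1)) (by fun_prop)
        fun p hp => ⟨D.a_add_mem j hp.2, hp.1⟩)
      (fun s hs => (D.conf.cauchyKer_holo_right (P.seg_sub (D.a_add_mem j hs))).mono fun u hu =>
        ⟨hu.1, fun h0 => hu.2 (mem_singleton_iff.1 h0 ▸ D.a_add_mem j hs)⟩)
      (by simp) hw0
    simp only [mul_one] at h1
    exact h1.continuousAt.continuousWithinAt
  have h4 : contourInt (P.con 7) (fun w => D.T e w * D.Kav z w) =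
      contourInt (P.con 7) (fun w => ∑ j, ((e j : ℕ) : ℂ) * (D.hf w (D.a j) * D.Kav z w)) :=
    contourInt_congr fun w _ => by
      unfold T; rw [Finset.sum_mul]; exact Finset.sum_congr rfl fun j _ => by ring
  unfold fun7 val
  rw [h4, contourInt_finset_sum hp _ fun j _ => hc j, Finset.mul_sum, Finset.mul_sum,
    ← Finset.sum_neg_distrib]
  refine Finset.sum_congr rfl fun j _ => ?_
  rw [contourInt_const_mul, h1, fX]
  have := two_pi_I_ne_zero
  field_simp

end Step

end

section

open Conf

theorem ker_comm (b : ℂ → ℂ) (w z : ℂ) : ker b w z = ker b z w := by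
  unfold ker
  rw [mul_comm, ← neg_sub, neg_sq]

variable {P : Setting}

theorem exists_Kav_bound (P : Setting) : ∃ K : ℝ, 0 < K ∧ ∀ (D : Step P) (z w : ℂ), z ∈ P.F →
    lvl P.l P.r w ≤ P.s 9 → ‖D.Kav z w‖ ≤ K ∧ ‖D.Kav z w - ker D.b w z‖ ≤ K * D.ε := by
  obtain ⟨K, hK, h⟩ := exists_outerKer_bound P
  have hg := P.g_pos
  refine ⟨2 * K / (1 / 4 * P.g) + 4 * K / (1 / 4 * P.g) ^ 2, by positivity,
    fun D z w hz hw => ?_⟩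
  have hε := D.ε_pos
  have hb : ∀ u ∈ Metric.ball w (1 / 4 * P.g), lvl P.l P.r u ≤ P.s 9.5 := fun u hu =>
    ((P.ball_lvl hu).1 hw).trans (P.s_le (by norm_num))
  have hd := (D.outerKer_holo hz).mono (s := Metric.ball w (1 / 4 * P.g)) fun u hu =>
    (hb u hu).trans_lt (P.s_lt (by norm_num))
  have hεn : ‖(D.ε : ℂ)‖ = D.ε := by rw [Complex.norm_real, Real.norm_of_nonneg hε.le]
  have hsm : ‖(D.ε : ℂ)‖ < 1 / 4 * P.g := by rw [hεn]; linarith [D.ε_le]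
  have h1 := norm_sub_le_of_ball hd (fun u hu => h D z u hz (hb u hu)) hsm
  have h2 := norm_taylor_le_of_ball hd (fun u hu => h D z u hz (hb u hu)) hsm
  rw [(D.conf.hasDerivAt_cauchyKer_right (P.F_sub hz) (P.mem_Λ (by norm_num) hw) (fun h0 => by
    rw [← h0] at hw; exact absurd (P.F_far z hz) (not_lt.2 (hw.trans (P.s_le (by norm_num)))))).deriv]
    at h2
  rw [hεn] at h1 h2
  constructor
  · unfold Step.Kav
    rw [norm_mul, norm_inv, hεn, inv_mul_le_iff₀ hε]
    have : 0 ≤ 4 * K / (1 / 4 * P.g) ^ 2 * D.ε := by positivity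
    nlinarith
  · have e : D.Kav z w - ker D.b w z = (D.ε : ℂ)⁻¹ * (cauchyKer D.b z (w + D.ε) -
        cauchyKer D.b z w - D.ε * ker D.b z w) := by
      rw [ker_comm, Step.Kav]
      have := D.eps_ne
      field_simp
    rw [e, norm_mul, norm_inv, hεn, inv_mul_le_iff₀ hε]
    have : 0 ≤ 2 * K / (1 / 4 * P.g) * D.ε ^ 2 := by positivity
    nlinarith

theorem exists_fX_bound (P : Setting) : ∃ K : ℝ, 0 < K ∧ ∀ (D : Step P) (z w : ℂ), z ∈ P.F →
    lvl P.l P.r w ≤ P.s 8.5 → ‖D.fX z w‖ ≤ K * D.ε ∧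
      ‖D.fX z w - D.ε * ker D.b w z‖ ≤ K * D.ε ^ 2 := by
  obtain ⟨K, hK, h⟩ := exists_Kav_bound P
  have hg := P.g_pos
  have hθ := P.θ_pos
  refine ⟨K + (2 * K / (1 / 4 * P.g) * P.θ), by positivity, fun D z w hz hw => ?_⟩
  have hε := D.ε_pos
  have hh := D.h_pos
  have hθn : ‖(P.θ : ℂ)⁻¹‖ = P.θ⁻¹ := by
    rw [norm_inv, Complex.norm_real, Real.norm_of_nonneg hθ.le]
  have hlev : ∀ s ∈ Icc 0 D.h, lvl P.l P.r (w + s) ≤ P.s 9 := fun s hs =>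
    (P.lvl_add_le hw hs.1 (hs.2.trans D.h_le)).trans (P.s_le (by norm_num))
  have hbase : ‖D.fX z w‖ ≤ K * D.ε := by
    unfold Step.fX
    rw [norm_mul, hθn, inv_mul_le_iff₀ hθ]
    refine (D.norm_integral_h_le fun s hs => (h D z _ hz (hlev s hs)).1).trans (le_of_eq ?_)
    unfold Conf.h; ring
  have hw9 : lvl P.l P.r w ≤ P.s 9 := hw.trans (P.s_le (by norm_num))
  refine ⟨hbase.trans ?_, ?_⟩
  · have : 0 ≤ 2 * K / (1 / 4 * P.g) * P.θ * D.ε := by positivity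
    nlinarith
  · have hb : ∀ u ∈ Metric.ball w (1 / 4 * P.g), lvl P.l P.r u < P.s 9 := fun u hu => by
      rw [Metric.mem_ball, dist_eq_norm] at hu
      have := lvl_le_add P.l P.r u w
      simp only [Setting.s] at *
      linarith
    have hi : IntervalIntegrable (fun s : ℝ => D.Kav z (w + s)) volume 0 D.h := by
      refine ContinuousOn.intervalIntegrable_of_Icc hh.le ?_
      refine (D.Kav_holo hz).continuousOn.comp (by fun_prop) fun s hs => hb _ ?_
      have := D.norm_shift_le hs
      simpa using this.1
    have e : D.fX z w - D.ε * ker D.b w z = (P.θ : ℂ)⁻¹ * ∫ s in (0 : ℝ)..D.h,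
        (D.Kav z (w + s) - ker D.b w z) := by
      rw [intervalIntegral.integral_sub hi (by simp), intervalIntegral.integral_const, Step.fX,
        mul_sub, sub_zero]
      congr 1
      have hθ0 : (P.θ : ℂ) ≠ 0 := by exact_mod_cast hθ.ne'
      rw [Complex.real_smul, Conf.h]
      push_cast
      field_simp
    rw [e, norm_mul, hθn, inv_mul_le_iff₀ hθ]
    refine (D.norm_integral_h_le (K := (K + (2 * K / (1 / 4 * P.g) * P.θ)) * D.ε)
      fun s hs => ?_).trans (le_of_eq ?_)
    · have h1 := norm_sub_le_of_ball ((D.Kav_holo hz).mono hb)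
        (fun u hu => (h D z u hz (hb u hu).le).1) (D.norm_shift_le hs).1
      have h2 := (h D z w hz hw9).2
      have h3 : 2 * K / (1 / 4 * P.g) * ‖(s : ℂ)‖ ≤ 2 * K / (1 / 4 * P.g) * D.h :=
        mul_le_mul_of_nonneg_left (D.norm_shift_le hs).2 (by positivity)
      have e1 : D.Kav z (w + s) - ker D.b w z = (D.Kav z (w + s) - D.Kav z w) +
        (D.Kav z w - ker D.b w z) := by ring
      rw [e1]
      refine (norm_add_le _ _).trans ((add_le_add (h1.trans h3) h2).trans (le_of_eq ?_))
      unfold Conf.h; ring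
    · unfold Conf.h; ring

namespace Step

variable (D : Step P)

theorem T_continuousOn (e : Fin D.n → Fin 2) {k : ℝ} (hk : 1 < k) (hk' : k ≤ 10) :
    ContinuousOn (D.T e) (trace (P.con k)) :=
  ((D.T_outer e).differentiableOn D.conf P.core_sub).continuousOn.mono fun _ hw =>
    off_core_of_ann hk hk' (P.con_sub_ann (by linarith) le_rfl le_rfl hw)

theorem fun7_sub {z : ℂ} (hz : z ∈ P.F) {u v : ℂ → ℂ} (hu : ContinuousOn u (trace (P.con 7)))
    (hv : ContinuousOn v (trace (P.con 7))) :
    D.fun7 z (fun w => u w - v w) = D.fun7 z u - D.fun7 z v := by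
  have h7 : (0 : ℝ) < 7 := by norm_num
  have hK := D.Kav_continuousOn hz h7 (by norm_num)
  have h1 := contourInt_sub (P.isLoop_con h7).pwC1 (f := fun w => u w * D.Kav z w)
    (g := fun w => v w * D.Kav z w) (hu.mul hK) (hv.mul hK)
  unfold fun7
  rw [show (fun w => (u w - v w) * D.Kav z w) = fun w => u w * D.Kav z w - v w * D.Kav z w by
    funext w; ring, h1]
  ring

theorem fun7_mul_left (z : ℂ) (k : ℂ) (u : ℂ → ℂ) :
    D.fun7 z (fun w => k * u w) = k * D.fun7 z u := by
  unfold fun7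
  rw [show (fun w => k * u w * D.Kav z w) = fun w => k * (u w * D.Kav z w) by
    funext w; ring, contourInt_const_mul]
  ring

theorem fun7_sum {z : ℂ} (hz : z ∈ P.F) {ι : Type*} (s : Finset ι) {u : ι → ℂ → ℂ}
    (hu : ∀ i ∈ s, ContinuousOn (u i) (trace (P.con 7))) :
    D.fun7 z (fun w => ∑ i ∈ s, u i w) = ∑ i ∈ s, D.fun7 z (u i) := by
  have h7 : (0 : ℝ) < 7 := by norm_num
  have hK := D.Kav_continuousOn hz h7 (by norm_num)
  have h1 := contourInt_finset_sum (P.isLoop_con h7).pwC1 s (f := fun i w => u i w * D.Kav z w)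
    fun i hi => (hu i hi).mul hK
  unfold fun7
  simp only [Finset.sum_mul]
  rw [h1, Finset.mul_sum, Finset.mul_sum, Finset.sum_neg_distrib]

theorem E_fun7 {z : ℂ} (hz : z ∈ P.F) {u : (Fin D.n → Fin 2) → ℂ → ℂ}
    (hu : ∀ e, ContinuousOn (u e) (trace (P.con 7))) :
    D.E (fun e => D.fun7 z (u e)) = D.fun7 z (fun w => D.E (fun e => u e w)) := by
  unfold E
  rw [D.fun7_sum hz Finset.univ (u := fun e w => D.pr e * u e w)
    fun e _ => continuousOn_const.mul (hu e)]
  exact Finset.sum_congr rfl fun e _ => (D.fun7_mul_left _ _ _).symm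

theorem fun7_congr (z : ℂ) {u v : ℂ → ℂ} (h : ∀ w ∈ trace (P.con 7), u w = v w) :
    D.fun7 z u = D.fun7 z v := by
  unfold fun7
  rw [contourInt_congr (f := fun w => u w * D.Kav z w) (g := fun w => v w * D.Kav z w)
    fun w hw => congrArg (· * D.Kav z w) (h w hw)]

theorem Eτ_continuousOn : ContinuousOn (fun w => D.E (fun e => D.τ e w)) (trace (P.con 7)) :=
  D.E_continuousOn fun e => D.τ_continuousOn e (by norm_num) (by norm_num)

theorem ld_continuousOn {k : ℝ} (hk : 1 < k) (hk' : k ≤ 10) :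
    ContinuousOn D.ld (trace (P.con k)) :=
  (D.ld_outer.differentiableOn D.conf P.core_sub).continuousOn.mono fun _ hw =>
    off_core_of_ann hk hk' (P.con_sub_ann (by linarith) le_rfl le_rfl hw)

theorem E_val_fX {z : ℂ} (hz : z ∈ P.F) :
    D.E (D.val (D.fX z)) = D.fun7 z (fun w => D.E (fun e => D.T e w)) := by
  rw [← D.E_fun7 hz fun e => D.T_continuousOn e (by norm_num) (by norm_num)]
  congr 1; funext e; exact D.val_fX hz e

theorem cen_fX {z : ℂ} (hz : z ∈ P.F) (e : Fin D.n → Fin 2) :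
    D.cen (D.fX z) e = D.fun7 z (fun w => D.τ e w - D.E (fun e => D.τ e w)) := by
  unfold cen
  rw [D.val_fX hz, D.E_val_fX hz, ← D.fun7_sub hz (D.T_continuousOn e (by norm_num) (by norm_num))
    (D.E_continuousOn fun e => D.T_continuousOn e (by norm_num) (by norm_num))]
  refine D.fun7_congr z fun w _ => ?_
  have h : D.E (fun e => D.τ e w) = D.E (fun e => D.T e w) - D.ld w := by
    have := D.E_sub (fun e => D.T e w) (fun _ => D.ld w)
    rwa [D.E_const] at this
  rw [h, τ]; ring

end Step

theorem exists_fun7_bound (P : Setting) : ∃ K : ℝ, 0 < K ∧ ∀ (D : Step P) (z : ℂ), z ∈ P.F →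
    ∀ (u : ℂ → ℂ) (M : ℝ), (∀ w ∈ trace (P.con 7), ‖u w‖ ≤ M) → ‖D.fun7 z u‖ ≤ K * M := by
  obtain ⟨K, hK, h⟩ := exists_Kav_bound P
  have hθ := P.θ_pos
  have h2 : 0 < ‖(2 * Real.pi * Complex.I : ℂ)⁻¹‖ := norm_pos_iff.2 (inv_ne_zero two_pi_I_ne_zero)
  have h7 : (0 : ℝ) < 7 := by norm_num
  have hL := curveLength_nonneg (P.con 7)
  refine ⟨P.θ⁻¹ * (‖(2 * Real.pi * Complex.I : ℂ)⁻¹‖ * (K * (curveLength (P.con 7) + 1))),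
    mul_pos (inv_pos.2 hθ) (mul_pos h2 (mul_pos hK (by linarith))), fun D z hz u M hM => ?_⟩
  have hM0 : 0 ≤ M := (norm_nonneg _).trans (hM _ (mem_trace (t := 0) (by simp)))
  unfold Step.fun7
  rw [norm_neg, norm_mul, norm_mul, norm_inv, Complex.norm_real, Real.norm_of_nonneg hθ.le,
    mul_assoc P.θ⁻¹, mul_assoc ‖_‖]
  refine mul_le_mul_of_nonneg_left (mul_le_mul_of_nonneg_left ?_ h2.le) (inv_nonneg.2 hθ.le)
  refine (norm_contourInt_le (P.isLoop_con h7).pwC1 (M := M * K) fun w hw => ?_).trans ?_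
  · rw [norm_mul]
    exact mul_le_mul (hM w hw) (h D z w hz (by rw [P.lvl_con h7 hw]; exact P.s_le (by norm_num))).1
      (norm_nonneg _) hM0
  · nlinarith [mul_nonneg hM0 hK.le]

theorem exists_Eτ_bound (P : Setting) : ∃ K : ℝ, 0 < K ∧ ∀ (D : Step P), ∀ z ∈ P.ann 6.75 9.5,
    ‖D.E (fun e => D.τ e z)‖ ≤ K * D.ε := by
  obtain ⟨K, hK, h⟩ := exists_response P 0 (K := 0) le_rfl
  refine ⟨K, hK, fun D z hz => ?_⟩
  have := h D (fun _ _ => 0) (fun k => k.elim0) ∅ z hz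
  simpa [D.σ_sq] using this

theorem exists_good_fX (P : Setting) : ∃ K : ℝ, 0 < K ∧ ∀ (D : Step P), ∀ z ∈ P.F,
    D.Good K (D.fX z) := by
  obtain ⟨K1, hK1, h1⟩ := exists_fX_bound P
  obtain ⟨K2, hK2, h2⟩ := exists_fun7_bound P
  obtain ⟨K3, hK3, h3⟩ := exists_τ_le_W P
  obtain ⟨K4, hK4, h4⟩ := exists_E_bound P 1
  refine ⟨K1 + K2 * (K3 + K4 * K3), by positivity, fun D z hz => ⟨D.fX_holo hz (by norm_num),
    fun w hw => ?_, fun e => ?_⟩⟩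
  · refine (h1 D z w hz (hw.le.trans (P.s_le (by norm_num)))).1.trans ?_
    have := D.ε_pos
    have : 0 ≤ K2 * (K3 + K4 * K3) * D.ε := by positivity
    nlinarith
  · rw [D.cen_fX hz]
    have hW := D.W_pos e
    refine (h2 D z hz _ ((K3 + K4 * K3) * D.W e) fun w hw => ?_).trans ?_
    · have hw5 : w ∈ P.ann 5 9.5 := P.con_sub_ann (by norm_num) (by norm_num) (by norm_num) hw
      have h5 := h4 D (fun e => D.τ e w) K3 hK3.le fun e => by rw [pow_one]; exact h3 D e w hw5
      rw [pow_one] at h5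
      refine (norm_sub_le _ _).trans ((add_le_add (h3 D e w hw5) h5).trans ?_)
      have := mul_le_mul_of_nonneg_left (D.σ_le_W e) (mul_pos hK4 hK3).le
      nlinarith
    · have : 0 ≤ K1 * D.W e := by positivity
      nlinarith

namespace Step

variable (D : Step P)

/-- The covariance of two linear statistics. -/
noncomputable def bil (f : ℂ → ℂ) (z : ℂ) : ℂ :=
  (P.θ : ℂ)⁻¹ * ((2 * Real.pi * Complex.I)⁻¹ *
    contourInt (P.con 6) (fun w => D.A w * f w * D.Kav z w))

theorem resp_continuousOn {f : ℂ → ℂ} (hf : ContinuousOn f (trace (P.con 6))) :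
    ContinuousOn (D.resp f) (trace (P.con 7)) := by
  have h6 : (0 : ℝ) < 6 := by norm_num
  have hV : IsOpen (P.Λ ∩ {z | P.s 6 < lvl P.l P.r z}) := P.isOpen.inter (isOpen_lt_lvl _ _ _)
  have hoff : trace (P.con 6) ⊆ P.Λ \ seg P.l P.r := fun w hw =>
    P.ann_sub h6 (by norm_num) (P.con_sub_ann h6 le_rfl le_rfl hw)
  have hdis : Disjoint (trace (P.con 6)) (P.Λ ∩ {z | P.s 6 < lvl P.l P.r z}) :=
    disjoint_left.2 fun w hw hw' => (ne_of_gt hw'.2) (P.lvl_con h6 hw)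
  have h1 := differentiableOn_contourInt hV (P.isLoop_con h6).pwC1
    (f := fun z w => D.A w * f w * cauchyKer D.b w z) ?_ ?_
  · refine continuousOn_const.mul (h1.continuousOn.mono fun z hz => ?_)
    refine ⟨P.con_sub (by norm_num) (by norm_num) hz, ?_⟩
    rw [mem_ofPred_eq, P.lvl_con (by norm_num) hz]; exact P.s_lt (by norm_num)
  · refine ContinuousOn.mul (((D.A_holo.continuousOn.mono hoff).mul hf).comp continuousOn_snd
      fun p hp => hp.2) ?_
    exact (D.conf.continuousOn_cauchyKer (hoff.trans sdiff_subset) inter_subset_left hdis).comp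
      continuous_swap.continuousOn fun p hp => ⟨hp.2, hp.1⟩
  · intro w hw
    exact ((D.conf.cauchyKer_holo_right (hoff hw).1).mono fun z hz => ⟨hz.1, fun h0 =>
      disjoint_left.1 hdis hw (mem_singleton_iff.1 h0 ▸ hz)⟩).const_mul _

theorem fun7_resp {f : ℂ → ℂ} (hf : ContinuousOn f (trace (P.con 6))) {z : ℂ} (hz : z ∈ P.F) :
    D.fun7 z (D.resp f) = D.bil f z := by
  have h6 : (0 : ℝ) < 6 := by norm_num
  have h7 : (0 : ℝ) < 7 := by norm_num
  have hoff : trace (P.con 6) ⊆ P.Λ \ seg P.l P.r := fun w hw =>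
    P.ann_sub h6 (by norm_num) (P.con_sub_ann h6 le_rfl le_rfl hw)
  have hdis : Disjoint (trace (P.con 6)) (trace (P.con 7)) :=
    disjoint_left.2 fun w hw hw' => by
      have h1 := P.lvl_con h6 hw
      rw [P.lvl_con h7 hw'] at h1
      exact (P.s_lt (show (6 : ℝ) < 7 by norm_num)).ne' h1
  have hsw := contourInt_swap (P.isLoop_con h7).pwC1 (P.isLoop_con h6).pwC1
    (f := fun u w => D.A w * f w * (cauchyKer D.b w u * D.Kav z u)) ?_
  · have e1 : contourInt (P.con 7) (fun u => D.resp f u * D.Kav z u) =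
        (2 * Real.pi * Complex.I)⁻¹ * contourInt (P.con 7) (fun u => contourInt (P.con 6)
          (fun w => D.A w * f w * (cauchyKer D.b w u * D.Kav z u))) := by
      rw [← contourInt_const_mul]
      refine contourInt_congr fun u _ => ?_
      rw [resp, mul_assoc, ← contourInt_mul_const]
      congr 2; funext w; ring
    have e2 : contourInt (P.con 6) (fun w => contourInt (P.con 7)
        (fun u => D.A w * f w * (cauchyKer D.b w u * D.Kav z u))) =
        -(2 * Real.pi * Complex.I) * contourInt (P.con 6) (fun w => D.A w * f w * D.Kav z w) := by
      rw [← contourInt_const_mul]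
      refine contourInt_congr fun w hw => ?_
      rw [contourInt_const_mul, D.cauchy_right h7 (j := 9) (by norm_num) (by norm_num)
        (D.Kav_holo hz) (by rw [P.lvl_con h6 hw]; exact P.s_lt (by norm_num))]
      ring
    unfold fun7 bil
    rw [e1, hsw, e2]
    have := two_pi_I_ne_zero
    field_simp
  · refine ContinuousOn.mul (((D.A_holo.continuousOn.mono hoff).mul hf).comp continuousOn_snd
      fun p hp => hp.2) (ContinuousOn.mul ?_ ((D.Kav_continuousOn hz h7 (by norm_num)).comp
        continuousOn_fst fun p hp => hp.1))
    exact (D.conf.continuousOn_cauchyKer (hoff.trans sdiff_subset) (P.con_sub h7 (by norm_num))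
      hdis).comp continuous_swap.continuousOn fun p hp => ⟨hp.2, hp.1⟩

theorem Good.continuousOn {D : Step P} {K : ℝ} {f : ℂ → ℂ} (h : D.Good K f) :
    ContinuousOn f (trace (P.con 6)) :=
  h.holo.continuousOn.mono (P.con_sub_lt (by norm_num) (by norm_num))

end Step

theorem exists_prod_bound (P : Setting) (p : ℕ) {K : ℝ} (hK : 0 ≤ K) : ∃ K' : ℝ, 0 < K' ∧
    ∀ (D : Step P) (f : Fin p → ℂ → ℂ), (∀ k, D.Good K (f k)) → ∀ s : Finset (Fin p),
    ‖D.E (fun e => ∏ k ∈ s, D.cen (f k) e)‖ ≤ K' * D.σ ^ s.card := by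
  choose KE hKE hE using exists_E_bound P
  refine ⟨(∑ c ∈ Finset.range (p + 1), KE c * K ^ c) + 1, add_pos_of_nonneg_of_pos
    (Finset.sum_nonneg fun c _ => mul_nonneg (hKE c).le (by positivity)) one_pos,
    fun D f hf s => ?_⟩
  have hσ := D.σ_pos
  have h1 := hE s.card D (fun e => ∏ k ∈ s, D.cen (f k) e) (K ^ s.card) (by positivity) fun e => by
    rw [← mul_pow, norm_prod, ← Finset.prod_const]
    exact Finset.prod_le_prod (fun _ _ => norm_nonneg _) fun k _ => (hf k).cen_le e
  refine h1.trans ?_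
  rw [← mul_assoc]
  refine mul_le_mul_of_nonneg_right ?_ (by positivity)
  have hcp : s.card ∈ Finset.range (p + 1) :=
    Finset.mem_range_succ_iff.2 ((Finset.card_le_univ s).trans (by simp))
  linarith [Finset.single_le_sum (f := fun c => KE c * K ^ c)
    (fun c _ => mul_nonneg (hKE c).le (by positivity)) hcp]

/-- The recursion for the joint moments. -/
theorem exists_recursion (P : Setting) (p : ℕ) {K : ℝ} (hK : 0 ≤ K) : ∃ K' : ℝ, 0 < K' ∧
    ∀ (D : Step P) (f : Fin p → ℂ → ℂ), (∀ k, D.Good K (f k)) → ∀ s : Finset (Fin p),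
    ∀ z ∈ P.F,
    ‖D.E (fun e => (∏ k ∈ s, D.cen (f k) e) * D.cen (D.fX z) e) -
      ∑ k ∈ s, D.E (fun e => ∏ i ∈ s.erase k, D.cen (f i) e) * D.bil (f k) z‖ ≤
        K' * D.σ ^ (s.card + 2) := by
  obtain ⟨K1, hK1, h1⟩ := exists_response P p hK
  obtain ⟨K2, hK2, h2⟩ := exists_fun7_bound P
  obtain ⟨K3, hK3, h3⟩ := exists_Eτ_bound P
  obtain ⟨K4, hK4, h4⟩ := exists_prod_bound P p hK
  refine ⟨K2 * (K1 + K4 * K3), by positivity, fun D f hf s z hz => ?_⟩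
  have hτc : ∀ e, ContinuousOn (D.τ e) (trace (P.con 7)) := fun e =>
    D.τ_continuousOn e (by norm_num) (by norm_num)
  set R : (Fin D.n → Fin 2) → ℂ := fun e => ∏ k ∈ s, D.cen (f k) e with hR
  have e1 : D.E (fun e => R e * D.cen (D.fX z) e) =
      D.fun7 z (fun w => D.E (fun e => R e * D.τ e w) - D.E R * D.E (fun e => D.τ e w)) := by
    have h5 : (fun e => R e * D.cen (D.fX z) e) =
        fun e => D.fun7 z (fun w => R e * (D.τ e w - D.E (fun e => D.τ e w))) := by
      funext e; rw [D.fun7_mul_left, D.cen_fX hz]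
    rw [h5, D.E_fun7 hz (u := fun e w => R e * (D.τ e w - D.E (fun e => D.τ e w))) fun e => continuousOn_const.mul ((hτc e).sub D.Eτ_continuousOn)]
    refine D.fun7_congr z fun w _ => ?_
    rw [← D.E_mul_right, ← D.E_sub]
    congr 1; funext e; ring
  have e2 : ∑ k ∈ s, D.E (fun e => ∏ i ∈ s.erase k, D.cen (f i) e) * D.bil (f k) z =
      D.fun7 z (fun w => ∑ k ∈ s, D.E (fun e => ∏ i ∈ s.erase k, D.cen (f i) e) *
        D.resp (f k) w) := by
    rw [D.fun7_sum hz s (u := fun k w => D.E (fun e => ∏ i ∈ s.erase k, D.cen (f i) e) *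
      D.resp (f k) w) fun k _ => continuousOn_const.mul (D.resp_continuousOn (hf k).continuousOn)]
    refine Finset.sum_congr rfl fun k _ => ?_
    rw [D.fun7_mul_left, D.fun7_resp (hf k).continuousOn hz]
  have c1 : ContinuousOn (fun w => D.E (fun e => R e * D.τ e w) - D.E R * D.E (fun e => D.τ e w))
      (trace (P.con 7)) :=
    (D.E_continuousOn fun e => continuousOn_const.mul (hτc e)).sub
      (continuousOn_const.mul D.Eτ_continuousOn)
  have c2 : ContinuousOn (fun w => ∑ k ∈ s, D.E (fun e => ∏ i ∈ s.erase k, D.cen (f i) e) *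
        D.resp (f k) w) (trace (P.con 7)) :=
    continuousOn_finsetSum _ fun k _ =>
      continuousOn_const.mul (D.resp_continuousOn (hf k).continuousOn)
  rw [e1, e2, ← D.fun7_sub hz c1 c2, mul_assoc]
  refine h2 D z hz _ _ fun w hw => ?_
  have hw7 : w ∈ P.ann 6.75 9.5 := P.con_sub_ann (by norm_num) (by norm_num) (by norm_num) hw
  have b1 := h1 D f hf s w hw7
  have b2 := mul_le_mul (h4 D f hf s) (h3 D w hw7) (norm_nonneg _)
    (by have := D.σ_pos; positivity)
  rw [← norm_mul, ← D.σ_sq] at b2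
  rw [show D.E (fun e => R e * D.τ e w) - D.E R * D.E (fun e => D.τ e w) -
      ∑ k ∈ s, D.E (fun e => ∏ i ∈ s.erase k, D.cen (f i) e) * D.resp (f k) w =
    (D.E (fun e => R e * D.τ e w) -
      ∑ k ∈ s, D.E (fun e => ∏ i ∈ s.erase k, D.cen (f i) e) * D.resp (f k) w) -
      D.E R * D.E (fun e => D.τ e w) by ring]
  refine (norm_sub_le _ _).trans ((add_le_add b1 b2).trans (le_of_eq ?_))
  ring

end

section

open Conf

/-! ### Pairings -/

/-- The pairings of a finite set of indices, as involutions which move exactly this set. -/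
def pairings {p : ℕ} (s : Finset (Fin p)) : Finset (Equiv.Perm (Fin p)) :=
  Finset.univ.filter fun σ => ∀ i, σ (σ i) = i ∧ (σ i ≠ i ↔ i ∈ s)

/-- The sum over pairings of a finite set of indices. -/
def wickSum {p : ℕ} (C : Fin p → Fin p → ℂ) (s : Finset (Fin p)) : ℂ :=
  ∑ σ ∈ pairings s, ∏ i ∈ Finset.univ.filter (fun i => i < σ i), C i (σ i)

theorem wickSum_univ {p : ℕ} (C : Fin p → Fin p → ℂ) :
    wickSum C Finset.univ = gaussianMoment C := by
  unfold wickSum gaussianMoment pairings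
  simp

theorem wickSum_empty {p : ℕ} (C : Fin p → Fin p → ℂ) : wickSum C ∅ = 1 := by
  have h : pairings (∅ : Finset (Fin p)) = {1} := by
    ext σ
    simp only [pairings, Finset.mem_filter, Finset.mem_univ, true_and, Finset.mem_singleton]
    constructor
    · intro h
      ext i
      have := (h i).2
      simp only [Finset.notMem_empty, iff_false, not_not] at this
      simp [this]
    · rintro rfl i; simp
  rw [wickSum, h, Finset.sum_singleton]
  simp

theorem mem_pairings_swap {p : ℕ} {s : Finset (Fin p)} {i k : Fin p} (hi : i ∉ s) (hk : k ∈ s)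
    {τ : Equiv.Perm (Fin p)} (hτ : τ ∈ pairings (s.erase k)) :
    τ i = i ∧ τ k = k ∧ Equiv.swap i k * τ ∈ pairings (insert i s) := by
  have hik : i ≠ k := fun h => hi (h ▸ hk)
  simp only [pairings, Finset.mem_filter, Finset.mem_univ, true_and] at hτ ⊢
  have h1 : τ i = i := by
    have := (hτ i).2
    by_contra h
    exact hi (Finset.mem_of_mem_erase (this.1 h))
  have h2 : τ k = k := by
    have := (hτ k).2
    by_contra h
    exact Finset.notMem_erase k s (this.1 h)
  refine ⟨h1, h2, fun j => ?_⟩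
  rw [Equiv.Perm.mul_apply, Equiv.Perm.mul_apply]
  by_cases hji : j = i
  · subst hji
    rw [h1, Equiv.swap_apply_left, h2, Equiv.swap_apply_right]
    simp [hik.symm]
  by_cases hjk : j = k
  · subst hjk
    rw [h2, Equiv.swap_apply_right, h1, Equiv.swap_apply_left]
    simp [hik, hk]
  · have h3 : τ j ≠ i := fun h => hji (by rw [← (hτ j).1, h, h1])
    have h4 : τ j ≠ k := fun h => hjk (by rw [← (hτ j).1, h, h2])
    rw [Equiv.swap_apply_of_ne_of_ne h3 h4, (hτ j).1, Equiv.swap_apply_of_ne_of_ne hji hjk]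
    refine ⟨rfl, (hτ j).2.trans ?_⟩
    simp [hji, hjk]

theorem mem_pairings_unswap {p : ℕ} {s : Finset (Fin p)} {i : Fin p} (hi : i ∉ s)
    {τ : Equiv.Perm (Fin p)} (hτ : τ ∈ pairings (insert i s)) :
    τ i ∈ s ∧ Equiv.swap i (τ i) * τ ∈ pairings (s.erase (τ i)) := by
  simp only [pairings, Finset.mem_filter, Finset.mem_univ, true_and] at hτ ⊢
  set k := τ i with hk
  have hki : τ k = i := (hτ i).1
  have h0 : k ≠ i := (hτ i).2.2 (Finset.mem_insert_self _ _)
  have hks : k ∈ s := by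
    have := (hτ k).2.1 (by rw [hki]; exact h0.symm)
    exact (Finset.mem_insert.1 this).resolve_left h0
  refine ⟨hks, fun j => ?_⟩
  rw [Equiv.Perm.mul_apply, Equiv.Perm.mul_apply]
  by_cases hji : j = i
  · subst hji
    rw [← hk, Equiv.swap_apply_right, ← hk, Equiv.swap_apply_right]
    simp [hi]
  by_cases hjk : j = k
  · rw [hjk, hki, Equiv.swap_apply_left, hki, Equiv.swap_apply_left]
    simp
  · have h3 : τ j ≠ i := fun h => hjk (by rw [← (hτ j).1, h])
    have h4 : τ j ≠ k := fun h => hji (by rw [← (hτ j).1, h, hki])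
    rw [Equiv.swap_apply_of_ne_of_ne h3 h4, (hτ j).1, Equiv.swap_apply_of_ne_of_ne hji hjk]
    refine ⟨rfl, (hτ j).2.trans ?_⟩
    simp [hji, hjk]

/-- Wick's recursion. -/
theorem wickSum_insert {p : ℕ} (C : Fin p → Fin p → ℂ) {s : Finset (Fin p)} {i : Fin p}
    (hi : ∀ k ∈ s, i < k) :
    wickSum C (insert i s) = ∑ k ∈ s, C i k * wickSum C (s.erase k) := by
  have his : i ∉ s := fun h => lt_irrefl i (hi i h)
  simp only [wickSum, Finset.mul_sum]
  rw [Finset.sum_sigma']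
  symm
  refine Finset.sum_bij' (fun x _ => Equiv.swap i x.1 * x.2)
    (fun τ _ => ⟨τ i, Equiv.swap i (τ i) * τ⟩) ?_ ?_ ?_ ?_ ?_
  · rintro ⟨k, τ⟩ h
    rw [Finset.mem_sigma] at h
    exact (mem_pairings_swap his h.1 h.2).2.2
  · intro τ h
    rw [Finset.mem_sigma]
    exact mem_pairings_unswap his h
  · rintro ⟨k, τ⟩ h
    rw [Finset.mem_sigma] at h
    obtain ⟨h1, -, -⟩ := mem_pairings_swap his h.1 h.2
    simp only at h1
    have h2 : (Equiv.swap i k * τ) i = k := by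
      rw [Equiv.Perm.mul_apply, h1, Equiv.swap_apply_left]
    simp only [h2]
    rw [← mul_assoc, Equiv.swap_mul_self, one_mul]
  · intro τ h
    simp only
    rw [← mul_assoc, Equiv.swap_mul_self, one_mul]
  · rintro ⟨k, τ⟩ h
    rw [Finset.mem_sigma] at h
    obtain ⟨hk, hτ⟩ := h
    simp only at hk hτ
    obtain ⟨h1, h2, -⟩ := mem_pairings_swap his hk hτ
    have hik := hi k hk
    have hinv : ∀ j, τ (τ j) = j := fun j => by
      simp only [pairings, Finset.mem_filter, Finset.mem_univ, true_and] at hτ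
      exact (hτ j).1
    have happ : ∀ j, j ≠ i → j ≠ k → (Equiv.swap i k * τ) j = τ j := fun j hji hjk => by
      rw [Equiv.Perm.mul_apply, Equiv.swap_apply_of_ne_of_ne]
      · exact fun h => hji (by rw [← hinv j, h, h1])
      · exact fun h => hjk (by rw [← hinv j, h, h2])
    have happi : (Equiv.swap i k * τ) i = k := by
      rw [Equiv.Perm.mul_apply, h1, Equiv.swap_apply_left]
    have happk : (Equiv.swap i k * τ) k = i := by
      rw [Equiv.Perm.mul_apply, h2, Equiv.swap_apply_right]
    have hset : Finset.univ.filter (fun j => j < (Equiv.swap i k * τ) j) =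
        insert i (Finset.univ.filter (fun j => j < τ j)) := by
      ext j
      simp only [Finset.mem_filter, Finset.mem_univ, true_and, Finset.mem_insert]
      by_cases hji : j = i
      · subst hji; simp [happi, hik]
      by_cases hjk : j = k
      · subst hjk; simp [happk, h2, hji, hik.le]
      · rw [happ j hji hjk]; simp [hji]
    simp only [hset]
    rw [Finset.prod_insert (by simp [h1]), happi]
    congr 1
    refine Finset.prod_congr rfl fun j hj => ?_
    simp only [Finset.mem_filter, Finset.mem_univ, true_and] at hj
    rw [happ j (fun h => by rw [h, h1] at hj; exact lt_irrefl _ hj)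
      (fun h => by rw [h, h2] at hj; exact lt_irrefl _ hj)]

variable {P : Setting}

namespace Step

variable (D : Step P)

/-- The limiting covariance on the reference contour. -/
noncomputable def covc (z₁ z₂ : ℂ) : ℂ :=
  (2 * Real.pi * Complex.I * P.θ)⁻¹ * contourInt (P.con 6) (fun w =>
    D.A w * ker D.b w z₁ * ker D.b w z₂)

theorem covc_comm (z₁ z₂ : ℂ) : D.covc z₁ z₂ = D.covc z₂ z₁ := by
  unfold covc
  simp only [mul_right_comm]

theorem ker_holo {z : ℂ} (hz : z ∈ P.F) :
    DifferentiableOn ℂ (fun w => ker D.b w z) {w | lvl P.l P.r w < P.s 10} :=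
  (D.conf.ker_holo (P.F_sub hz)).mono fun _ hw => ⟨P.lt_sub le_rfl hw, fun h0 =>
    lt_asymm hw (mem_singleton_iff.1 h0 ▸ P.F_far z hz)⟩

theorem ker_continuousOn {z : ℂ} (hz : z ∈ P.F) {k : ℝ} (hk : 0 < k) (hk' : k < 10) :
    ContinuousOn (fun w => ker D.b w z) (trace (P.con k)) :=
  (D.ker_holo hz).continuousOn.mono (P.con_sub_lt hk hk')

end Step

theorem exists_bil_bound (P : Setting) : ∃ K : ℝ, 0 < K ∧ ∀ (D : Step P), ∀ z₁ ∈ P.F, ∀ z₂ ∈ P.F,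
    ‖D.bil (D.fX z₁) z₂ - D.ε * D.covc z₁ z₂‖ ≤ K * D.ε ^ 2 ∧ ‖D.covc z₁ z₂‖ ≤ K := by
  obtain ⟨K1, hK1, h1⟩ := exists_fX_bound P
  obtain ⟨K2, hK2, h2⟩ := exists_Kav_bound P
  obtain ⟨KA, hKA, hA⟩ := exists_A_bound P (j := 6) (by norm_num)
  have hθ := P.θ_pos
  have hg := P.g_pos
  have h6 : (0 : ℝ) < 6 := by norm_num
  have hp := (P.isLoop_con h6).pwC1
  set K3 := K2 + K2 * (P.g / 8) with hK3
  set c := ‖((2 * Real.pi * Complex.I * P.θ : ℂ))⁻¹‖ with hc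
  have hL := curveLength_nonneg (P.con 6)
  have hc0 : 0 ≤ c := norm_nonneg _
  refine ⟨c * (KA * (K1 * K2 + K3 * K2) * curveLength (P.con 6)) +
    c * (KA * K3 * K3 * curveLength (P.con 6)) + 1, by positivity, fun D z₁ hz₁ z₂ hz₂ => ?_⟩
  have hε := D.ε_pos
  have hlev : ∀ w ∈ trace (P.con 6), lvl P.l P.r w = P.s 6 := fun w hw => P.lvl_con h6 hw
  have hann : ∀ w ∈ trace (P.con 6), w ∈ P.ann 6 9.5 := fun w hw =>
    P.con_sub_ann h6 le_rfl (by norm_num) hw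
  have hoff : trace (P.con 6) ⊆ P.Λ \ seg P.l P.r := fun w hw =>
    P.ann_sub h6 (by norm_num) (hann w hw)
  have hAc : ContinuousOn D.A (trace (P.con 6)) := D.A_holo.continuousOn.mono hoff
  have b2 : ∀ z ∈ P.F, ∀ w ∈ trace (P.con 6), ‖D.Kav z w‖ ≤ K2 ∧
      ‖D.Kav z w - ker D.b w z‖ ≤ K2 * D.ε := fun z hz w hw =>
    h2 D z w hz (by rw [hlev w hw]; exact P.s_le (by norm_num))
  have b3 : ∀ z ∈ P.F, ∀ w ∈ trace (P.con 6), ‖ker D.b w z‖ ≤ K3 := fun z hz w hw => by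
    obtain ⟨h3, h4⟩ := b2 z hz w hw
    have h5 : ker D.b w z = D.Kav z w - (D.Kav z w - ker D.b w z) := by ring
    rw [h5]
    refine (norm_sub_le _ _).trans (add_le_add h3 (h4.trans ?_))
    exact mul_le_mul_of_nonneg_left D.ε_le hK2.le
  constructor
  · have e : D.bil (D.fX z₁) z₂ - D.ε * D.covc z₁ z₂ = (2 * Real.pi * Complex.I * P.θ)⁻¹ *
        contourInt (P.con 6) (fun w => D.A w * ((D.fX z₁ w - D.ε * ker D.b w z₁) * D.Kav z₂ w +
          D.ε * (ker D.b w z₁ * (D.Kav z₂ w - ker D.b w z₂)))) := by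
      have h3 := contourInt_sub hp (f := fun w => D.A w * D.fX z₁ w * D.Kav z₂ w)
        (g := fun w => D.ε * (D.A w * ker D.b w z₁ * ker D.b w z₂))
        ((hAc.mul ((D.fX_holo hz₁ (j := 8) (by norm_num)).continuousOn.mono
          (P.con_sub_lt h6 (by norm_num)))).mul (D.Kav_continuousOn hz₂ h6 (by norm_num)))
        (continuousOn_const.mul ((hAc.mul (D.ker_continuousOn hz₁ h6 (by norm_num))).mul
          (D.ker_continuousOn hz₂ h6 (by norm_num))))
      rw [contourInt_const_mul] at h3
      have h4 : contourInt (P.con 6) (fun w => D.A w * ((D.fX z₁ w - D.ε * ker D.b w z₁) *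
          D.Kav z₂ w + D.ε * (ker D.b w z₁ * (D.Kav z₂ w - ker D.b w z₂)))) =
          contourInt (P.con 6) (fun w => D.A w * D.fX z₁ w * D.Kav z₂ w -
            D.ε * (D.A w * ker D.b w z₁ * ker D.b w z₂)) :=
        contourInt_congr fun w _ => by ring
      rw [h4, h3, Step.bil, Step.covc, mul_inv]
      ring
    rw [e, norm_mul]
    have h3 := norm_contourInt_le hp (M := KA * ((K1 * K2 + K3 * K2) * D.ε ^ 2)) (f := fun w =>
      D.A w * ((D.fX z₁ w - D.ε * ker D.b w z₁) * D.Kav z₂ w +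
          D.ε * (ker D.b w z₁ * (D.Kav z₂ w - ker D.b w z₂)))) fun w hw => by
      rw [norm_mul]
      refine mul_le_mul (hA D w (hann w hw)) ?_ (norm_nonneg _) hKA.le
      refine (norm_add_le _ _).trans ?_
      rw [norm_mul, norm_mul, norm_mul, Complex.norm_real, Real.norm_of_nonneg hε.le]
      have h4 := mul_le_mul (h1 D z₁ w hz₁ (by rw [hlev w hw]; exact P.s_le (by norm_num))).2
        (b2 z₂ hz₂ w hw).1 (norm_nonneg _) (by positivity)
      have h5 := mul_le_mul_of_nonneg_left (mul_le_mul (b3 z₁ hz₁ w hw) (b2 z₂ hz₂ w hw).2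
        (norm_nonneg _) (by positivity)) hε.le
      refine (add_le_add h4 h5).trans (le_of_eq ?_)
      ring
    refine (mul_le_mul_of_nonneg_left h3 hc0).trans ?_
    have : 0 ≤ (c * (KA * K3 * K3 * curveLength (P.con 6)) + 1) * D.ε ^ 2 := by positivity
    nlinarith
  · unfold Step.covc
    rw [norm_mul]
    have h3 := norm_contourInt_le hp (M := KA * K3 * K3) (f := fun w =>
      D.A w * ker D.b w z₁ * ker D.b w z₂) fun w hw => by
      rw [norm_mul, norm_mul]
      exact mul_le_mul (mul_le_mul (hA D w (hann w hw)) (b3 z₁ hz₁ w hw) (norm_nonneg _) hKA.le)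
        (b3 z₂ hz₂ w hw) (norm_nonneg _) (by positivity)
    refine (mul_le_mul_of_nonneg_left h3 hc0).trans ?_
    have : 0 ≤ c * (KA * (K1 * K2 + K3 * K2) * curveLength (P.con 6)) + 1 := by positivity
    linarith

theorem exists_wick_recursion (P : Setting) (p : ℕ) : ∃ K : ℝ, 0 < K ∧
    ∀ (D : Step P) (z : Fin p → ℂ), (∀ k, z k ∈ P.F) → ∀ (s : Finset (Fin p)) (i : Fin p), i ∉ s →
    ‖D.E (fun e => ∏ k ∈ insert i s, D.cen (D.fX (z k)) e) -
      D.ε * ∑ k ∈ s, D.covc (z i) (z k) *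
        D.E (fun e => ∏ j ∈ s.erase k, D.cen (D.fX (z j)) e)‖ ≤ K * D.σ ^ (s.card + 2) := by
  obtain ⟨Kg, hKg, hg⟩ := exists_good_fX P
  obtain ⟨K1, hK1, h1⟩ := exists_recursion P p hKg.le
  obtain ⟨K2, hK2, h2⟩ := exists_bil_bound P
  obtain ⟨K3, hK3, h3⟩ := exists_prod_bound P p hKg.le
  have hgp := P.g_pos
  refine ⟨K1 + p * (K3 * K2) * √(P.g / 8), by positivity, fun D z hz s i hi => ?_⟩
  have hσ := D.σ_pos
  have b1 := h1 D (fun k => D.fX (z k)) (fun k => hg D _ (hz k)) s (z i) (hz i)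
  have e1 : (fun e => ∏ k ∈ insert i s, D.cen (D.fX (z k)) e) =
      fun e => (∏ k ∈ s, D.cen (D.fX (z k)) e) * D.cen (D.fX (z i)) e := by
    funext e; rw [Finset.prod_insert hi, mul_comm]
  have b2 : ‖∑ k ∈ s, D.E (fun e => ∏ j ∈ s.erase k, D.cen (D.fX (z j)) e) *
      (D.bil (D.fX (z k)) (z i) - D.ε * D.covc (z i) (z k))‖ ≤
      p * (K3 * K2) * √(P.g / 8) * D.σ ^ (s.card + 2) := by
    refine (norm_sum_le_of_le s (f := _) (n := fun _ => K3 * K2 * √(P.g / 8) * D.σ ^ (s.card + 2))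
      fun k hk => ?_).trans ?_
    · rw [norm_mul, D.covc_comm]
      refine (mul_le_mul (h3 D _ (fun k => hg D _ (hz k)) (s.erase k)) (h2 D _ (hz k) _ (hz i)).1
        (norm_nonneg _) (by positivity)).trans ?_
      obtain ⟨c, hc⟩ : ∃ c, s.card = c + 1 :=
        ⟨s.card - 1, (Nat.succ_pred_eq_of_pos (Finset.card_pos.2 ⟨k, hk⟩)).symm⟩
      rw [Finset.card_erase_of_mem hk, hc, Nat.add_sub_cancel, ← D.σ_sq]
      have hs8 : D.σ ≤ √(P.g / 8) := Real.sqrt_le_sqrt D.ε_le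
      have e2 : K3 * D.σ ^ c * (K2 * (D.σ ^ 2) ^ 2) = K3 * K2 * D.σ * D.σ ^ (c + 1 + 2) := by ring
      rw [e2]
      gcongr
    · rw [Finset.sum_const, nsmul_eq_mul]
      have : (s.card : ℝ) ≤ p := by exact_mod_cast (Finset.card_le_univ s).trans (by simp)
      have h0 : 0 ≤ K3 * K2 * √(P.g / 8) * D.σ ^ (s.card + 2) := by positivity
      nlinarith
  rw [e1]
  have e3 : D.E (fun e => (∏ k ∈ s, D.cen (D.fX (z k)) e) * D.cen (D.fX (z i)) e) -
      D.ε * ∑ k ∈ s, D.covc (z i) (z k) * D.E (fun e => ∏ j ∈ s.erase k, D.cen (D.fX (z j)) e) =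
      (D.E (fun e => (∏ k ∈ s, D.cen (D.fX (z k)) e) * D.cen (D.fX (z i)) e) -
        ∑ k ∈ s, D.E (fun e => ∏ j ∈ s.erase k, D.cen (D.fX (z j)) e) *
          D.bil (D.fX (z k)) (z i)) +
      ∑ k ∈ s, D.E (fun e => ∏ j ∈ s.erase k, D.cen (D.fX (z j)) e) *
      (D.bil (D.fX (z k)) (z i) - D.ε * D.covc (z i) (z k)) := by
    simp only [mul_sub, Finset.sum_sub_distrib, Finset.mul_sum]
    rw [sub_add_sub_cancel]
    congr 1
    exact Finset.sum_congr rfl fun k _ => by ring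
  rw [e3]
  refine (norm_add_le _ _).trans ((add_le_add b1 b2).trans (le_of_eq ?_))
  ring

/-- Asymptotic normality in the sense of moments. -/
theorem exists_moments (P : Setting) (p N : ℕ) : ∃ K : ℝ, 0 < K ∧
    ∀ (D : Step P) (z : Fin p → ℂ), (∀ k, z k ∈ P.F) → ∀ s : Finset (Fin p), s.card = N →
    ‖D.E (fun e => ∏ k ∈ s, D.cen (D.fX (z k)) e) -
      D.σ ^ N * wickSum (fun i j => D.covc (z i) (z j)) s‖ ≤ K * D.σ ^ (N + 1) := by
  induction N using Nat.strong_induction_on with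
  | _ N ih =>
    rcases Nat.eq_zero_or_pos N with rfl | hN
    · refine ⟨1, one_pos, fun D z _ s hs => ?_⟩
      rw [Finset.card_eq_zero] at hs
      subst hs
      simp only [Finset.prod_empty, wickSum_empty, D.E_const]
      simp [D.σ_pos.le]
    · obtain ⟨K0, hK0, h0⟩ := ih (N - 2) (by omega)
      obtain ⟨K1, hK1, h1⟩ := exists_wick_recursion P p
      obtain ⟨K2, hK2, h2⟩ := exists_bil_bound P
      refine ⟨K1 + p * (K2 * K0), by positivity, fun D z hz s hs => ?_⟩
      have hσ := D.σ_pos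
      have hne : s.Nonempty := Finset.card_pos.1 (hs ▸ hN)
      set i := s.min' hne with hi
      set t := s.erase i with ht
      have hst : insert i t = s := Finset.insert_erase (s.min'_mem hne)
      have htc : t.card + 1 = N := by rw [← hs, Finset.card_erase_add_one (s.min'_mem hne)]
      have b1 := h1 D z hz t i (Finset.notMem_erase _ _)
      rw [hst, show t.card + 2 = N + 1 by omega] at b1
      have hlt : ∀ k ∈ t, i < k := fun k hk => s.min'_lt_of_mem_erase_min' hne hk
      have hw := wickSum_insert (fun i j => D.covc (z i) (z j)) hlt
      rw [hst] at hw
      have b2 : ‖D.ε * ∑ k ∈ t, D.covc (z i) (z k) *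
          D.E (fun e => ∏ j ∈ t.erase k, D.cen (D.fX (z j)) e) -
          D.σ ^ N * wickSum (fun i j => D.covc (z i) (z j)) s‖ ≤
          p * (K2 * K0) * D.σ ^ (N + 1) := by
        rw [hw, Finset.mul_sum, Finset.mul_sum, ← Finset.sum_sub_distrib]
        refine (norm_sum_le_of_le t (f := _) (n := fun _ => K2 * K0 * D.σ ^ (N + 1))
          fun k hk => ?_).trans ?_
        · have htk : (t.erase k).card = N - 2 := by rw [Finset.card_erase_of_mem hk]; omega
          have hN2 : 2 ≤ N := by have := Finset.card_pos.2 ⟨k, hk⟩; omega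
          obtain ⟨M, rfl⟩ : ∃ M, N = M + 2 := ⟨N - 2, by omega⟩
          have b3 := h0 D z hz (t.erase k) htk
          rw [Nat.add_sub_cancel] at b3
          have e1 : (D.ε : ℂ) = (D.σ : ℂ) ^ 2 := by rw [← D.σ_sq]; push_cast; ring
          have e2 : D.ε * (D.covc (z i) (z k) *
              D.E (fun e => ∏ j ∈ t.erase k, D.cen (D.fX (z j)) e)) - (D.σ : ℂ) ^ (M + 2) *
              (D.covc (z i) (z k) * wickSum (fun i j => D.covc (z i) (z j)) (t.erase k)) =
              (D.σ : ℂ) ^ 2 * (D.covc (z i) (z k) *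
                (D.E (fun e => ∏ j ∈ t.erase k, D.cen (D.fX (z j)) e) -
                  D.σ ^ M * wickSum (fun i j => D.covc (z i) (z j)) (t.erase k))) := by
            rw [e1]; ring
          rw [e2, norm_mul, norm_mul, norm_pow, Complex.norm_real, Real.norm_of_nonneg hσ.le]
          refine (mul_le_mul_of_nonneg_left (mul_le_mul (h2 D _ (hz i) _ (hz k)).2 b3
            (norm_nonneg _) hK2.le) (by positivity)).trans (le_of_eq ?_)
          ring
        · rw [Finset.sum_const, nsmul_eq_mul]
          have : (t.card : ℝ) ≤ p := by exact_mod_cast (Finset.card_le_univ t).trans (by simp)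
          have h0 : 0 ≤ K2 * K0 * D.σ ^ (N + 1) := by positivity
          nlinarith
      refine (norm_sub_le_norm_sub_add_norm_sub _ _ _).trans ((add_le_add b1 b2).trans
        (le_of_eq ?_))
      ring

end

section

open Conf

theorem Conformal.skewKer_holo_left {Λ : Set ℂ} {b : ℂ → ℂ} (h : Conformal Λ b) {a : ℂ}
    (ha : a ∈ Λ) : DifferentiableOn ℂ (fun w => skewKer b w a) (Λ \ {a}) := by
  have h1 : DifferentiableOn ℂ b (Λ \ {a}) := h.holo.mono sdiff_subset
  have h2 : DifferentiableOn ℂ (deriv b) (Λ \ {a}) := h.deriv_holo.mono sdiff_subset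
  have h3 : DifferentiableOn ℂ (deriv (deriv b)) (Λ \ {a}) :=
    (h.deriv_holo.deriv h.isOpen).mono sdiff_subset
  unfold skewKer
  exact (((h3.mul (h1.sub_const _)).sub (h2.fun_pow 2)).sub (h2.mul_const _)).fun_div
    ((h1.sub_const _).fun_pow 2) fun w hw => pow_ne_zero _ (h.sub_ne hw.1 ha hw.2)

theorem Conformal.continuousOn_skewKer {Λ : Set ℂ} {b : ℂ → ℂ} (h : Conformal Λ b) {S T : Set ℂ}
    (hS : S ⊆ Λ) (hT : T ⊆ Λ) (hST : Disjoint S T) :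
    ContinuousOn (Function.uncurry (skewKer b)) (S ×ˢ T) := by
  have h1 : ContinuousOn b Λ := h.holo.continuousOn
  have h2 : ContinuousOn (deriv b) Λ := h.deriv_holo.continuousOn
  have h3 : ContinuousOn (deriv (deriv b)) Λ := (h.deriv_holo.deriv h.isOpen).continuousOn
  have f1 := h1.comp (continuousOn_fst (s := S ×ˢ T)) fun p hp => hS hp.1
  have f2 := h2.comp (continuousOn_fst (s := S ×ˢ T)) fun p hp => hS hp.1
  have f3 := h3.comp (continuousOn_fst (s := S ×ˢ T)) fun p hp => hS hp.1
  have g1 := h1.comp (continuousOn_snd (s := S ×ˢ T)) fun p hp => hT hp.2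
  have g2 := h2.comp (continuousOn_snd (s := S ×ˢ T)) fun p hp => hT hp.2
  exact (((f3.mul (f1.sub g1)).sub (f2.pow 2)).sub (f2.mul g2)).div ((f1.sub g1).pow 2)
    fun p hp => pow_ne_zero _ (h.sub_ne (hS hp.1) (hT hp.2) fun h0 =>
      disjoint_left.1 hST hp.1 (h0 ▸ hp.2))

theorem Conformal.integral_skewKer_holo {Λ : Set ℂ} {b : ℂ → ℂ} (hb : Conformal Λ b) {l r : ℝ}
    (hlr : l ≤ r) (hseg : seg l r ⊆ Λ) (θ ε : ℝ) {n : ℕ} (x : Fin n → ℝ) :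
    DifferentiableOn ℂ (fun z => ∫ s in l..r, skewKer b z s * (rho θ ε x s : ℂ))
      (Λ \ seg l r) := by
  have hV : IsOpen (Λ \ seg l r) :=
    hb.isOpen.sdiff ((isCompact_Icc.image Complex.continuous_ofReal).isClosed)
  have hm : ∀ t ∈ Icc l r, (t : ℂ) ∈ seg l r := fun t ht => ⟨t, ht, rfl⟩
  exact fun z hz => (hasDerivAt_intervalIntegral hV hlr (f := fun z (t : ℝ) => skewKer b z t)
      ((hb.continuousOn_skewKer sdiff_subset hseg disjoint_sdiff_left).comp
        (f := fun p : ℂ × ℝ => (p.1, (p.2 : ℂ))) (by fun_prop) fun p hp => ⟨hp.1, hm _ hp.2⟩)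
      (fun t ht => (hb.skewKer_holo_left (hseg (hm t ht))).mono fun w hw =>
        ⟨hw.1, fun h0 => hw.2 (mem_singleton_iff.1 h0 ▸ hm t ht)⟩)
      (intervalIntegrable_rho θ ε x l r) hz).differentiableAt.differentiableWithinAt

variable {P : Setting}

namespace Step

variable (D : Step P)

theorem A3_holo : DifferentiableOn ℂ D.A3 (P.Λ \ seg P.l P.r) :=
  (D.conf.integral_skewKer_holo P.lr.le P.seg_sub _ _ _).const_mul _

theorem κ_holo : DifferentiableOn ℂ D.κ (P.Λ \ P.core) := by
  have h : IsOpen (P.Λ \ P.core) := P.isOpen.sdiff P.isCompact_core.isClosed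
  exact (((D.ld_outer.differentiableOn D.conf P.core_sub).deriv h).const_mul _).add
    (D.A3_holo.mono fun w hw => ⟨hw.1, fun h0 => hw.2 (P.seg_sub_core h0)⟩)

theorem κ_continuousOn {k : ℝ} (hk : 1 < k) (hk' : k ≤ 10) :
    ContinuousOn D.κ (trace (P.con k)) :=
  D.κ_holo.continuousOn.mono fun _ hw =>
    off_core_of_ann hk hk' (P.con_sub_ann (by linarith) le_rfl le_rfl hw)

end Step

/-- The solved loop equation with an approximate integrand. -/
theorem exists_master_resp (P : Setting) : ∃ K : ℝ, 0 < K ∧ ∀ (D : Step P)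
    (R : (Fin D.n → Fin 2) → ℂ) (Q : (Fin D.n → Fin 2) → ℂ → ℂ),
    D.Insert {z | lvl P.l P.r z < P.s 6.5} R Q →
    ∀ (f : ℂ → ℂ) (M : ℝ), ContinuousOn f (trace (P.con 6)) →
    (∀ w ∈ trace (P.con 6), ‖D.E (fun e => Complex.exp (D.τ e w) *
      (Complex.exp (D.ξ e w) * Q e w - R e)) - f w‖ ≤ M) →
    ∀ z ∈ P.ann 6.75 9.5, ‖D.E (fun e => R e * D.η e z) - D.resp f z‖ ≤ K * M := by
  obtain ⟨Kc, hKc, hc⟩ := exists_cauchy_bound P (i := 6) (j := 6.75) (by norm_num) (by norm_num)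
    (by norm_num)
  obtain ⟨KA, hKA, hA⟩ := exists_A_bound P (j := 6) (by norm_num)
  refine ⟨Kc * KA, by positivity, fun D R Q hPQ f M hf hM z hz => ?_⟩
  have h6 : (0 : ℝ) < 6 := by norm_num
  have hzΛ : z ∈ P.Λ := P.mem_Λ (by norm_num) hz.2
  have hzl : P.s 6 < lvl P.l P.r z := (P.s_lt (by norm_num)).trans_le hz.1
  have hoff : trace (P.con 6) ⊆ P.Λ \ seg P.l P.r := fun w hw =>
    P.ann_sub (by norm_num) (by norm_num) (P.con_sub_ann h6 le_rfl le_rfl hw)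
  have hcont : ContinuousOn (fun w => cauchyKer D.b w z) (trace (P.con 6)) :=
    D.cauchyKer_continuousOn_con h6 (by norm_num) hzΛ hzl.ne'
  have hAc : ContinuousOn D.A (trace (P.con 6)) := D.A_holo.continuousOn.mono hoff
  set Fw : ℂ → ℂ := fun w => D.E (fun e => Complex.exp (D.τ e w) *
    (Complex.exp (D.ξ e w) * Q e w - R e)) with hFw
  have hFc : ContinuousOn Fw (trace (P.con 6)) := by
    refine D.E_continuousOn fun e => ?_
    have h1 : ContinuousOn (fun w => Complex.exp (D.τ e w) * Complex.exp (D.ξ e w) *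
        Q e w - Complex.exp (D.τ e w) * R e) (trace (P.con 6)) :=
      ((D.expτξ_continuousOn e).mul ((hPQ.1 e).continuousOn.mono
        (P.con_sub_lt h6 (by norm_num)))).sub
        ((D.τ_continuousOn e (by norm_num) (by norm_num)).cexp.mul continuousOn_const)
    exact h1.congr fun w _ => by ring
  rw [D.master_fluct (k := 6) (by norm_num) (by norm_num) (j := 6.5) (by norm_num)
    (by norm_num) hPQ hzΛ hzl, Step.resp, ← mul_sub, ← contourInt_sub (P.isLoop_con h6).pwC1
      (f := fun w => D.A w * Fw w * cauchyKer D.b w z)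
      (g := fun w => D.A w * f w * cauchyKer D.b w z)
      ((hAc.mul hFc).mul hcont) ((hAc.mul hf).mul hcont)]
  rw [contourInt_congr (g := fun w => D.A w * (Fw w - f w) * cauchyKer D.b w z)
    fun w _ => by ring]
  refine (hc D _ (KA * M) z hz fun w hw => ?_).trans (le_of_eq (mul_assoc _ _ _).symm)
  rw [norm_mul]
  exact mul_le_mul (hA D w (P.con_sub_ann h6 le_rfl (by norm_num) hw)) (hM w hw)
      (norm_nonneg _) hKA.le

theorem Step.insert_one (D : Step P) (U : Set ℂ) : D.Insert U (fun _ => 1) (fun _ _ => 1) :=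
  ⟨fun _ => differentiableOn_const _, fun _ _ _ => rfl⟩

theorem Step.insert_cen (D : Step P) {f : ℂ → ℂ} {U : Set ℂ} (hf : DifferentiableOn ℂ f U) :
    D.Insert U (D.cen f) (fun e w => D.cen f e + f w) :=
  ⟨fun _ => hf.const_add _, fun e i he => (D.cen_update f e i he).symm⟩

theorem exists_mean_bound (P : Setting) : ∃ K : ℝ, 0 < K ∧ ∀ (D : Step P), ∀ z ∈ P.ann 5.25 9.5,
    ‖D.E (fun e => D.η e z)‖ ≤ K * D.ε ∧ ‖D.E (fun e => D.τ e z)‖ ≤ K * D.ε := by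
  obtain ⟨Kc, hKc, hc⟩ := exists_cauchy_bound P (i := 5) (j := 5.25) (by norm_num) (by norm_num)
    (by norm_num)
  obtain ⟨Kτ, hKτ, hτ⟩ := exists_τ_bound P
  obtain ⟨Kη, hKη, hη⟩ := exists_η_sub_τ_bound P
  obtain ⟨Kξ, hKξ, hξ⟩ := exists_expξ_bound P
  obtain ⟨KA, hKA, hA⟩ := exists_A_bound P (j := 5) (by norm_num)
  obtain ⟨KE0, hKE0, hE0⟩ := exists_E_bound P 0
  obtain ⟨KE, hKE, hE⟩ := exists_E_bound P 2
  refine ⟨Kc * (KA * (KE0 * (Real.exp Kτ * Kξ))) + KE * Kη, by positivity, fun D z hz => ?_⟩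
  have h5 : (0 : ℝ) < 5 := by norm_num
  have hε := D.ε_pos
  have h1 : ‖D.E (fun e => D.η e z)‖ ≤ Kc * (KA * (KE0 * (Real.exp Kτ * Kξ))) * D.ε := by
    have hm := D.master_fluct (k := 5) (by norm_num) (by norm_num) (j := 6) (by norm_num)
      (by norm_num) (D.insert_one _) (P.mem_Λ (by norm_num) hz.2)
      ((P.s_lt (by norm_num)).trans_le hz.1)
    simp only [one_mul, mul_one] at hm
    rw [hm]
    refine (hc D (fun w => D.A w * D.E (fun e => Complex.exp (D.τ e w) *
      (Complex.exp (D.ξ e w) - 1))) (KA * (KE0 * (Real.exp Kτ * Kξ * D.ε))) z hz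
      fun w hw => ?_).trans (le_of_eq (by ring))
    rw [norm_mul]
    refine mul_le_mul (hA D w (P.con_sub_ann h5 le_rfl (by norm_num) hw)) ?_ (norm_nonneg _) hKA.le
    have h2 := hE0 D (fun e => Complex.exp (D.τ e w) * (Complex.exp (D.ξ e w) - 1))
      (Real.exp Kτ * Kξ * D.ε) (by positivity) fun e => by
        rw [pow_zero, mul_one, norm_mul, mul_assoc]
        exact mul_le_mul
          (norm_exp_le (hτ D w (P.con_sub_ann h5 (by norm_num) (by norm_num) hw) e))
          (hξ D w (P.con_sub_ann h5 (by norm_num) (by norm_num) hw) e) (norm_nonneg _)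
          (Real.exp_nonneg _)
    rwa [pow_zero, mul_one] at h2
  have h2 : ‖D.E (fun e => D.η e z - D.τ e z)‖ ≤ KE * Kη * D.ε := by
    have := hE D (fun e => D.η e z - D.τ e z) Kη hKη.le fun e =>
      (hη D e z (P.ann_mono (by norm_num) le_rfl hz)).2
    rwa [D.σ_sq, ← mul_assoc] at this
  have h3 : 0 ≤ KE * Kη * D.ε := by positivity
  constructor
  · linarith
  · rw [D.E_sub] at h2
    have h4 : D.E (fun e => D.τ e z) = D.E (fun e => D.η e z) -
      (D.E (fun e => D.η e z) - D.E (fun e => D.τ e z)) := by ring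
    rw [h4]
    refine (norm_sub_le _ _).trans ((add_le_add h1 h2).trans (le_of_eq ?_))
    ring

theorem exists_mean_shift_bound (P : Setting) : ∃ K : ℝ, 0 < K ∧ ∀ (D : Step P),
    ∀ w ∈ P.ann 5.75 9, ‖D.E (fun e => D.τ e (w + D.h) - D.τ e w)‖ ≤ K * D.ε ^ 2 := by
  obtain ⟨K, hK, h⟩ := exists_mean_bound P
  have hθ := P.θ_pos
  have hg := P.g_pos
  refine ⟨2 * K / (1 / 4 * P.g) * P.θ, by positivity, fun D w hw => ?_⟩
  have hball : Metric.ball w (1 / 4 * P.g) ⊆ P.ann 5.25 9.5 :=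
    (P.ball_sub_ann hw).trans (P.ann_mono (by norm_num) (by norm_num))
  have hd : DifferentiableOn ℂ (fun w => D.E (fun e => D.τ e w)) (Metric.ball w (1 / 4 * P.g)) := by
    unfold Conf.E
    exact DifferentiableOn.fun_sum fun e _ =>
      (((D.τ_outer e).differentiableOn D.conf P.core_sub).mono fun z hz =>
      Step.off_core_of_ann (by norm_num) (by norm_num) (hball hz)).const_mul _
  have hh := D.norm_shift_le (right_mem_Icc.2 D.h_pos.le)
  have h4 := norm_sub_le_of_ball hd (fun z hz => (h D z (hball hz)).2) hh.1
  rw [Complex.norm_real, Real.norm_of_nonneg D.h_pos.le, Conf.h] at h4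
  rw [D.E_sub]
  refine h4.trans (le_of_eq ?_)
  ring

theorem hf_holo (D : Step P) {z : ℂ} (hz : z ∈ P.ann 7 9) :
    DifferentiableOn ℂ (D.hf z) {w | lvl P.l P.r w < P.s 6.5} := by
  refine D.holo_integral_shift (g := fun w => cauchyKer D.b w z) (j := 6.5) ?_
  refine (D.conf.cauchyKer_holo_left (P.mem_Λ (by norm_num) hz.2)).mono fun w hw => ?_
  refine ⟨P.lt_sub (by norm_num) hw, fun h0 => ?_⟩
  rw [mem_singleton_iff.1 h0] at hw
  exact lt_irrefl _ ((hw.trans (P.s_lt (by norm_num))).trans_le hz.1)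

theorem cen_hf (D : Step P) (z : ℂ) (e : Fin D.n → Fin 2) :
    D.cen (D.hf z) e = D.τ e z - D.E (fun e => D.τ e z) := by
  have h : D.E (fun e => D.τ e z) = D.E (fun e => D.T e z) - D.ld z := by
    have := D.E_sub (fun e => D.T e z) (fun _ => D.ld z)
    rwa [D.E_const] at this
  rw [h, Step.cen, Step.τ]
  change D.T e z - D.E (fun e => D.T e z) = _
  ring

theorem exists_good_hf (P : Setting) : ∃ K : ℝ, 0 < K ∧ ∀ (D : Step P), ∀ z ∈ P.ann 7 9,
    D.Good K (D.hf z) := by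
  have hg := P.g_pos
  have hθ := P.θ_pos
  obtain ⟨K1, hK1, h1⟩ := exists_cauchyKer_bound P (δ := 1 / 4 * P.g / 2) (by positivity)
  obtain ⟨K3, hK3, h3⟩ := exists_τ_le_W P
  obtain ⟨K4, hK4, h4⟩ := exists_E_bound P 1
  refine ⟨K1 * P.θ + (K3 + K4 * K3), by positivity, fun D z hz => ⟨hf_holo D hz,
    fun w hw => ?_, fun e => ?_⟩⟩
  · have h5 : ‖D.hf z w‖ ≤ K1 * D.h := D.norm_integral_h_le fun s hs => by
      have h6 := P.lvl_add_le hw.le hs.1 (hs.2.trans D.h_le)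
      refine h1 D _ _ (h6.trans (P.s_le (by norm_num))) (hz.2.trans (P.s_le (by norm_num))) ?_
      have := P.sep h6 hz.1
      rw [norm_sub_rev]
      refine le_trans (le_of_eq ?_) this
      ring
    refine h5.trans ?_
    unfold Conf.h
    have : 0 ≤ (K3 + K4 * K3) * D.ε := by have := D.ε_pos; positivity
    nlinarith
  · rw [cen_hf]
    have hz5 : z ∈ P.ann 5 9.5 := P.ann_mono (by norm_num) (by norm_num) hz
    have h5 := h4 D (fun e => D.τ e z) K3 hK3.le fun e => by rw [pow_one]; exact h3 D e z hz5
    rw [pow_one] at h5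
    have h6 := mul_le_mul_of_nonneg_left (D.σ_le_W e) (mul_pos hK4 hK3).le
    have h7 : 0 ≤ K1 * P.θ * D.W e := by have := D.W_pos e; positivity
    refine (norm_sub_le _ _).trans ((add_le_add (h3 D e z hz5) h5).trans ?_)
    nlinarith

end

section

open Conf

variable {P : Setting}

/-- Bounds with one common constant `a` for the fluctuations. -/
structure Step.Unif (D : Step P) (a : ℝ) : Prop where
  W_le : ∀ e, D.W e ≤ a
  τ_le : ∀ e, ∀ v ∈ P.ann 5 9.5, ‖D.τ e v‖ ≤ a * D.W e
  η_le : ∀ e, ∀ v ∈ P.ann 5 9.5, ‖D.η e v‖ ≤ a * D.W e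
  η_two : ∀ e, ∀ v ∈ P.ann 5 9.5, ‖D.η e v - D.τ e v - D.τ e v ^ 2 / 2‖ ≤ a * D.W e ^ 3
  η_three : ∀ e, ∀ v ∈ P.ann 5 9.5,
    ‖D.η e v - D.τ e v - D.τ e v ^ 2 / 2 - D.τ e v ^ 3 / 6‖ ≤ a * D.W e ^ 4
  ξ_le : ∀ e, ∀ v ∈ P.ann 5.75 9, ‖Complex.exp (D.ξ e v) - 1‖ ≤ a * D.ε
  ξ_one : ∀ e, ∀ v ∈ P.ann 5.75 9, ‖Complex.exp (D.ξ e v) - 1 - D.ε * D.κ v -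
    (D.τ e (v + D.h) - D.τ e v)‖ ≤ a * D.ε ^ 2
  shift_le : ∀ e, ∀ v ∈ P.ann 5.75 9, ‖D.τ e (v + D.h) - D.τ e v‖ ≤ a * (D.W e * D.ε)
  κ_le : ∀ v ∈ P.ann 5.75 9, ‖D.κ v‖ ≤ a
  E_shift : ∀ v ∈ P.ann 5.75 9, ‖D.E (fun e => D.τ e (v + D.h) - D.τ e v)‖ ≤ a * D.ε ^ 2
  E_η : ∀ v ∈ P.ann 5.25 9.5, ‖D.E (fun e => D.η e v)‖ ≤ a * D.ε
  E_τ : ∀ v ∈ P.ann 5.25 9.5, ‖D.E (fun e => D.τ e v)‖ ≤ a * D.ε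
  good : ∀ z ∈ P.ann 7 9, D.Good a (D.hf z)

theorem exists_unif (P : Setting) : ∃ a : ℝ, 1 ≤ a ∧ ∀ D : Step P, D.Unif a := by
  obtain ⟨K1, hK1, h1⟩ := exists_W_bound P
  obtain ⟨K2, hK2, h2⟩ := exists_τ_le_W P
  obtain ⟨K3, hK3, h3⟩ := exists_η_sub_τ_bound P
  obtain ⟨K4, hK4, h4⟩ := exists_expξ_bound P
  obtain ⟨K5, hK5, h5⟩ := exists_ξ_expansion P
  obtain ⟨K6, hK6, h6⟩ := exists_ξ_bound P
  obtain ⟨K7, hK7, h7⟩ := exists_τ_shift_bound P (i := 5) (j := 5.5) (k := 9) (l := 9.5)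
    (by norm_num) (by norm_num) (by norm_num) (by norm_num)
  obtain ⟨K8, hK8, h8⟩ := exists_mean_shift_bound P
  obtain ⟨K9, hK9, h9⟩ := exists_mean_bound P
  obtain ⟨K10, hK10, h10⟩ := exists_good_hf P
  have hg := P.g_pos
  set A3 := K2 ^ 3 * Real.exp (K2 * K1) with hA3
  set A4 := K2 ^ 4 * Real.exp (K2 * K1) with hA4
  set A5 := K5 + K6 ^ 2 * Real.exp (K6 * (P.g / 8)) with hA5
  have : 0 < A3 := by positivity
  have : 0 < A4 := by positivity
  have : 0 < A5 := by positivity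
  have : 0 < K7 * K2 := by positivity
  set a := 1 + K1 + K2 + K3 + K4 + K5 + K7 * K2 + K8 + K9 + K10 + A3 + A4 + A5 with ha
  refine ⟨a, by linarith, fun D => ?_⟩
  have hε := D.ε_pos
  have mono : ∀ {K x y : ℝ}, K ≤ a → 0 ≤ y → x ≤ K * y → x ≤ a * y := fun hK hy hx =>
    hx.trans (mul_le_mul_of_nonneg_right hK hy)
  have hexp : ∀ (n : ℕ) e, ∀ v ∈ P.ann 5 9.5, ‖Complex.exp (D.τ e v) - ∑ m ∈ Finset.range n,
      D.τ e v ^ m / m.factorial‖ ≤ K2 ^ n * Real.exp (K2 * K1) * D.W e ^ n := fun n e v hv => by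
    have hW := D.W_pos e
    have hτ := h2 D e v hv
    refine (Complex.norm_exp_sub_sum_le_norm_mul_exp (D.τ e v) n).trans ?_
    have h11 : Real.exp ‖D.τ e v‖ ≤ Real.exp (K2 * K1) :=
      Real.exp_le_exp.2 (hτ.trans (mul_le_mul_of_nonneg_left (h1 D e) hK2.le))
    refine (mul_le_mul (pow_le_pow_left₀ (norm_nonneg _) hτ n) h11 (Real.exp_nonneg _)
      (by positivity)).trans (le_of_eq (by ring))
  have hann : P.ann 5.75 9 ⊆ P.ann 2 9 := P.ann_mono (by norm_num) le_rfl
  refine ⟨fun e => (h1 D e).trans (by linarith),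
    fun e v hv => mono (by linarith) (D.W_pos e).le (h2 D e v hv),
    fun e v hv => mono (by linarith) (D.W_pos e).le (h3 D e v hv).1,
    fun e v hv => mono (K := A3) (by linarith) (pow_pos (D.W_pos e) _).le ?_,
    fun e v hv => mono (K := A4) (by linarith) (pow_pos (D.W_pos e) _).le ?_,
    fun e v hv => mono (by linarith) hε.le (h4 D v (hann hv) e),
    fun e v hv => mono (K := A5) (by linarith) (by positivity) ?_,
    fun e v hv => mono (K := K7 * K2) (by linarith)
      (mul_pos (D.W_pos e) hε).le ?_,
    fun v hv => (h5 D v (hann hv)).1.trans (by linarith),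
    fun v hv => mono (by linarith) (by positivity) (h8 D v hv),
    fun v hv => mono (by linarith) hε.le (h9 D v hv).1,
    fun v hv => mono (by linarith) hε.le (h9 D v hv).2,
    fun z hz => ⟨(h10 D z hz).holo, fun w hw => mono (by linarith) hε.le ((h10 D z hz).le w hw),
      fun e => mono (by linarith) (D.W_pos e).le ((h10 D z hz).cen_le e)⟩⟩
  · have := hexp 3 e v hv
    simp only [Finset.sum_range_succ, Finset.sum_range_zero, Nat.factorial] at this
    convert this using 2
    unfold Step.η; push_cast; ring
  · have := hexp 4 e v hv
    simp only [Finset.sum_range_succ, Finset.sum_range_zero, Nat.factorial] at this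
    convert this using 2
    unfold Step.η; push_cast; ring
  · have h11 := (h5 D v (hann hv)).2 e
    have h12 := h6 D v (hann hv) e
    have h13 := Complex.norm_exp_sub_sum_le_norm_mul_exp (D.ξ e v) 2
    have h14 : ‖D.ξ e v‖ ≤ K6 * (P.g / 8) := h12.trans (mul_le_mul_of_nonneg_left D.ε_le hK6.le)
    have h15 := h13.trans (mul_le_mul (pow_le_pow_left₀ (norm_nonneg _) h12 2)
      (Real.exp_le_exp.2 h14) (Real.exp_nonneg _) (by positivity))
    simp only [Finset.sum_range_succ, Finset.sum_range_zero, Nat.factorial] at h15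
    have e1 : Complex.exp (D.ξ e v) - 1 - D.ε * D.κ v - (D.τ e (v + D.h) - D.τ e v) =
      (D.ξ e v - D.ε * D.κ v - (D.τ e (v + D.h) - D.τ e v)) +
      (Complex.exp (D.ξ e v) - (0 + D.ξ e v ^ 0 / ((1 : ℕ) : ℂ) +
        D.ξ e v ^ 1 / (((0 + 1) * 1 : ℕ) : ℂ))) := by push_cast; ring
    rw [e1]
    refine (norm_add_le _ _).trans ((add_le_add h11 h15).trans (le_of_eq ?_))
    rw [hA5]; ring
  · have := h7 D e (K2 * D.W e) (fun w hw => h2 D e w hw) v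
      (P.ann_mono (by norm_num) le_rfl hv)
    refine this.trans (le_of_eq (by ring))

/-- Second and third moments of the fluctuation, to precision `ε²`. -/
theorem exists_second_moment (P : Setting) : ∃ K : ℝ, 0 < K ∧ ∀ (D : Step P), ∀ z ∈ P.ann 7 9,
    ‖D.E (fun e => D.cen (D.hf z) e ^ 2 * D.τ e z)‖ ≤ K * D.ε ^ 2 ∧
    ‖D.E (fun e => D.cen (D.hf z) e * D.τ e z) - D.resp (D.hf z) z‖ ≤ K * D.ε ^ 2 := by
  obtain ⟨a, ha1, hU⟩ := exists_unif P
  have ha : 0 < a := by linarith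
  obtain ⟨K1, hK1, h1⟩ := exists_response P 2 ha.le
  obtain ⟨K2, hK2, h2⟩ := exists_master_resp P
  obtain ⟨K3, hK3, h3⟩ := exists_E_bound P 4
  set M := (1 + a * a) * (a * a) + a * a + a * (a * a) + a * (a * a) with hM
  refine ⟨K1 + K2 * (a ^ 2 + K3 * M) + K3 * (2 * a ^ 3 + a ^ 2), by positivity,
    fun D z hz => ?_⟩
  have hε := D.ε_pos
  have hz6 : z ∈ P.ann 6.75 9.5 := P.ann_mono (by norm_num) (by norm_num) hz
  have hz5 : z ∈ P.ann 5 9.5 := P.ann_mono (by norm_num) (by norm_num) hz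
  have hg := (hU D).good z hz
  have hσ4 : D.σ ^ 4 = D.ε ^ 2 := by rw [← D.σ_sq]; ring
  set S := D.cen (D.hf z) with hS
  set m := D.E (fun e => D.τ e z) with hm
  have hmle : ‖m‖ ≤ a * D.ε := (hU D).E_τ z (P.ann_mono (by norm_num) (by norm_num) hz)
  have hτS : ∀ e, S e = D.τ e z - m := fun e => cen_hf D z e
  have b1 : ‖D.E (fun e => S e ^ 2 * D.τ e z)‖ ≤ K1 * D.ε ^ 2 := by
    have h4 := h1 D (fun _ => D.hf z) (fun _ => hg) Finset.univ z hz6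
    have h5 : (Finset.univ : Finset (Fin 2)).erase 0 = {1} := by decide
    have h6 : (Finset.univ : Finset (Fin 2)).erase 1 = {0} := by decide
    simp only [Fin.sum_univ_two, h5, h6, Finset.prod_singleton, Fin.prod_univ_two, D.E_cen,
      zero_mul, add_zero, sub_zero, Finset.card_univ, Fintype.card_fin] at h4
    rw [← hσ4]
    simpa [sq] using h4
  refine ⟨b1.trans ?_, ?_⟩
  · have : 0 ≤ (K2 * (a ^ 2 + K3 * M) + K3 * (2 * a ^ 3 + a ^ 2)) * D.ε ^ 2 := by positivity
    nlinarith
  have b2 : ‖D.E (fun e => S e * D.η e z) - D.resp (D.hf z) z‖ ≤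
      K2 * (a ^ 2 + K3 * M) * D.ε ^ 2 := by
    refine (h2 D S (fun e w => S e + D.hf z w) (D.insert_cen hg.holo) (D.hf z)
      ((a ^ 2 + K3 * M) * D.ε ^ 2) hg.continuousOn (fun w hw => ?_) z hz6).trans
        (le_of_eq (by ring))
    have hw5 : w ∈ P.ann 5.75 9 := P.con_sub_ann (by norm_num) (by norm_num) (by norm_num) hw
    have hw5' : w ∈ P.ann 5.25 9.5 := P.ann_mono (by norm_num) (by norm_num) hw5
    have hw5'' : w ∈ P.ann 5 9.5 := P.ann_mono (by norm_num) (by norm_num) hw5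
    have hfw : ‖D.hf z w‖ ≤ a * D.ε := hg.le w (P.con_sub_lt (by norm_num) (by norm_num) hw)
    have c1 : ‖D.E (fun e => Complex.exp (D.τ e w) * (Complex.exp (D.ξ e w) *
        (S e + D.hf z w) - S e) - (D.hf z w + D.η e w * D.hf z w + D.ε * D.κ w * S e))‖ ≤
        K3 * M * D.ε ^ 2 := by
      rw [mul_assoc, ← hσ4]
      refine h3 D _ M (by positivity) fun e => ?_
      have hW := D.W_pos e
      set X := Complex.exp (D.ξ e w) - 1 with hX
      set δ := D.τ e (w + D.h) - D.τ e w with hδ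
      have hXle : ‖X‖ ≤ a * D.W e ^ 2 := ((hU D).ξ_le e w hw5).trans
        (mul_le_mul_of_nonneg_left (D.ε_le_W e) ha.le)
      have hfle : ‖D.hf z w‖ ≤ a * D.W e ^ 2 := hfw.trans
        (mul_le_mul_of_nonneg_left (D.ε_le_W e) ha.le)
      have hη : ‖D.η e w‖ ≤ a * D.W e := (hU D).η_le e w hw5''
      have hη' : ‖D.η e w‖ ≤ a * a := hη.trans
        (mul_le_mul_of_nonneg_left ((hU D).W_le e) ha.le)
      have hS1 : ‖S e‖ ≤ a * D.W e := hg.cen_le e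
      have hS2 : ‖S e‖ ≤ a * a := hS1.trans (mul_le_mul_of_nonneg_left ((hU D).W_le e) ha.le)
      have hδle : ‖δ‖ ≤ a * (D.W e * D.W e ^ 2) := ((hU D).shift_le e w hw5).trans
        (mul_le_mul_of_nonneg_left (mul_le_mul_of_nonneg_left (D.ε_le_W e) hW.le) ha.le)
      have hr : ‖X - D.ε * D.κ w - δ‖ ≤ a * D.W e ^ 4 := by
        refine ((hU D).ξ_one e w hw5).trans (mul_le_mul_of_nonneg_left ?_ ha.le)
        calc D.ε ^ 2 ≤ (D.W e ^ 2) ^ 2 := pow_le_pow_left₀ hε.le (D.ε_le_W e) 2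
          _ = _ := by ring
      have e1 : Complex.exp (D.τ e w) * (Complex.exp (D.ξ e w) * (S e + D.hf z w) - S e) -
          (D.hf z w + D.η e w * D.hf z w + D.ε * D.κ w * S e) =
          (1 + D.η e w) * (X * D.hf z w) + δ * S e + (X - D.ε * D.κ w - δ) * S e +
          D.η e w * (X * S e) := by
        rw [hX, Step.η]; ring
      rw [e1]
      refine (norm_add_le _ _).trans ((add_le_add_left (norm_add₃_le) _).trans ?_)
      simp only [norm_mul]
      have h1η : ‖1 + D.η e w‖ ≤ 1 + a * a := (norm_add_le _ _).trans (by rw [norm_one]; gcongr)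
      calc _ ≤ (1 + a * a) * ((a * D.W e ^ 2) * (a * D.W e ^ 2)) +
            (a * (D.W e * D.W e ^ 2)) * (a * D.W e) + (a * D.W e ^ 4) * (a * a) +
            (a * D.W e) * ((a * D.W e ^ 2) * (a * D.W e)) := by gcongr
        _ = M * D.W e ^ 4 := by rw [hM]; ring
    rw [D.E_sub] at c1
    have c2 : D.E (fun e => D.hf z w + D.η e w * D.hf z w + D.ε * D.κ w * S e) =
        D.hf z w + D.E (fun e => D.η e w) * D.hf z w := by
      rw [D.E_add, D.E_add, D.E_const, D.E_mul_right, D.E_mul_left, hS, D.E_cen, mul_zero, add_zero]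
    rw [c2] at c1
    have c3 : ‖D.E (fun e => D.η e w) * D.hf z w‖ ≤ a ^ 2 * D.ε ^ 2 := by
      rw [norm_mul]
      refine (mul_le_mul ((hU D).E_η w hw5') hfw (norm_nonneg _) (by positivity)).trans
        (le_of_eq (by ring))
    have e2 : ∀ x y u : ℂ, x - y = (x - (y + u)) + u := fun x y u => by ring
    rw [e2 _ _ (D.E (fun e => D.η e w) * D.hf z w)]
    refine (norm_add_le _ _).trans ((add_le_add c1 c3).trans (le_of_eq (by ring)))
  have b3 : ‖D.E (fun e => S e * D.η e z - S e * D.τ e z - S e ^ 2 * D.τ e z / 2)‖ ≤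
      K3 * (2 * a ^ 3 + a ^ 2) * D.ε ^ 2 := by
    rw [mul_assoc, ← hσ4]
    refine h3 D _ _ (by positivity) fun e => ?_
    have hW := D.W_pos e
    have hS1 : ‖S e‖ ≤ a * D.W e := hg.cen_le e
    have hτ1 := (hU D).τ_le e z hz5
    have hr := (hU D).η_two e z hz5
    have hm1 : ‖m‖ ≤ a * D.W e ^ 2 := hmle.trans
        (mul_le_mul_of_nonneg_left (D.ε_le_W e) ha.le)
    have e1 : S e * D.η e z - S e * D.τ e z - S e ^ 2 * D.τ e z / 2 =
        S e * (D.η e z - D.τ e z - D.τ e z ^ 2 / 2) + S e * (D.τ e z * m) * (1 / 2) := by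
      rw [hτS e]; ring
    rw [e1]
    refine (norm_add_le _ _).trans ?_
    simp only [norm_mul]
    have hh : ‖(1 / 2 : ℂ)‖ ≤ 1 := by norm_num
    calc _ ≤ (a * D.W e) * (a * D.W e ^ 3) + (a * D.W e) * ((a * D.W e) * (a * D.W e ^ 2)) * 1 := by
          gcongr
      _ ≤ _ := by
          have : 0 ≤ a ^ 3 * D.W e ^ 4 := by positivity
          nlinarith
  have b4 : D.E (fun e => S e * D.η e z - S e * D.τ e z - S e ^ 2 * D.τ e z / 2) =
      D.E (fun e => S e * D.η e z) - D.E (fun e => S e * D.τ e z) -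
        D.E (fun e => S e ^ 2 * D.τ e z) / 2 := by
    rw [D.E_sub, D.E_sub]
    simp only [div_eq_mul_inv, D.E_mul_right]
  rw [b4] at b3
  have e3 : ∀ x y u v : ℂ, x - u = (y - u) - (y - x - v / 2) - v * (1 / 2) := fun x y u v => by ring
  rw [e3 _ (D.E (fun e => S e * D.η e z)) _ (D.E (fun e => S e ^ 2 * D.τ e z))]
  refine (norm_sub_le _ _).trans ((add_le_add ((norm_sub_le _ _).trans (add_le_add b2 b3))
    (le_of_eq (norm_mul _ _))).trans ?_)
  have hh : ‖(1 / 2 : ℂ)‖ ≤ 1 := by norm_num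
  have := mul_le_mul b1 hh (norm_nonneg _) (by positivity)
  nlinarith

end

section

open Conf

variable {P : Setting}

namespace Step

variable (D : Step P)

/-- The source of the mean fluctuation at `z`. -/
noncomputable def src (z w : ℂ) : ℂ := D.κ w - P.θ / 2 * cauchyKer D.b w z

theorem resp_sub {f g : ℂ → ℂ} (hf : ContinuousOn f (trace (P.con 6)))
    (hg : ContinuousOn g (trace (P.con 6))) {z : ℂ} (hz : z ∈ P.ann 6.75 9.5) :
    D.resp (fun w => f w - g w) z = D.resp f z - D.resp g z := by
  have h6 : (0 : ℝ) < 6 := by norm_num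
  have hcont : ContinuousOn (fun w => cauchyKer D.b w z) (trace (P.con 6)) :=
    D.cauchyKer_continuousOn_con h6 (by norm_num) (P.mem_Λ (by norm_num) hz.2)
      ((P.s_lt (by norm_num)).trans_le hz.1).ne'
  have hAc : ContinuousOn D.A (trace (P.con 6)) := D.A_holo.continuousOn.mono fun w hw =>
    P.ann_sub (by norm_num) (by norm_num) (P.con_sub_ann h6 le_rfl le_rfl hw)
  unfold resp
  rw [← mul_sub, ← contourInt_sub (P.isLoop_con h6).pwC1
    (f := fun w => D.A w * f w * cauchyKer D.b w z)
    (g := fun w => D.A w * g w * cauchyKer D.b w z)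
    ((hAc.mul hf).mul hcont) ((hAc.mul hg).mul hcont)]
  congr 1
  exact contourInt_congr fun w _ => by ring

theorem resp_mul_left (k : ℂ) (f : ℂ → ℂ) (z : ℂ) :
    D.resp (fun w => k * f w) z = k * D.resp f z := by
  unfold resp
  rw [contourInt_congr (g := fun w => k * (D.A w * f w * cauchyKer D.b w z)) fun w _ => by ring,
    contourInt_const_mul]
  ring

end Step

theorem exists_resp_bound (P : Setting) : ∃ K : ℝ, 0 < K ∧ ∀ (D : Step P) (f : ℂ → ℂ) (M : ℝ),
    (∀ w ∈ trace (P.con 6), ‖f w‖ ≤ M) → ∀ z ∈ P.ann 6.75 9.5, ‖D.resp f z‖ ≤ K * M := by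
  obtain ⟨Kc, hKc, hc⟩ := exists_cauchy_bound P (i := 6) (j := 6.75) (by norm_num) (by norm_num)
    (by norm_num)
  obtain ⟨KA, hKA, hA⟩ := exists_A_bound P (j := 6) (by norm_num)
  refine ⟨Kc * KA, by positivity, fun D f M hM z hz => ?_⟩
  refine (hc D _ (KA * M) z hz fun w hw => ?_).trans (le_of_eq (mul_assoc _ _ _).symm)
  rw [norm_mul]
  exact mul_le_mul (hA D w (P.con_sub_ann (by norm_num) le_rfl (by norm_num) hw)) (hM w hw)
      (norm_nonneg _) hKA.le

theorem exists_hf_bound (P : Setting) : ∃ K : ℝ, 0 < K ∧ ∀ (D : Step P), ∀ z ∈ P.ann 7 9,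
    ∀ w ∈ trace (P.con 6), ‖D.hf z w - D.h * cauchyKer D.b w z‖ ≤ K * D.ε ^ 2 := by
  have hg := P.g_pos
  have hθ := P.θ_pos
  obtain ⟨K, hK, h⟩ := exists_cauchyKer_bound P (δ := 1 / 4 * P.g) (by positivity)
  refine ⟨2 * K / (1 / 4 * P.g) * P.θ ^ 2, by positivity, fun D z hz w hw => ?_⟩
  have h6 : (0 : ℝ) < 6 := by norm_num
  have hlw := P.lvl_con h6 hw
  have hh := D.h_pos
  have hball : ∀ u ∈ Metric.ball w (1 / 4 * P.g), lvl P.l P.r u ≤ P.s 6.5 := fun u hu =>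
    ((P.ball_lvl hu).1 hlw.le).trans (P.s_le (by norm_num))
  have hne : ∀ u ∈ Metric.ball w (1 / 4 * P.g), u ∈ P.Λ \ {z} := fun u hu =>
    ⟨P.mem_Λ (by norm_num) (hball u hu), fun h0 => by
      rw [mem_singleton_iff.1 h0] at hu
      exact absurd hz.1 (not_le.2 ((hball z hu).trans_lt (P.s_lt (by norm_num))))⟩
  have hd := (D.conf.cauchyKer_holo_left (P.mem_Λ (by norm_num) hz.2)).mono hne
  have hi : IntervalIntegrable (fun s : ℝ => cauchyKer D.b (w + s) z) volume 0 D.h := by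
    refine ContinuousOn.intervalIntegrable_of_Icc hh.le ?_
    refine hd.continuousOn.comp (by fun_prop) fun s hs => ?_
    simpa using (D.norm_shift_le hs).1
  have e : D.hf z w - D.h * cauchyKer D.b w z = ∫ s in (0 : ℝ)..D.h,
      (cauchyKer D.b (w + s) z - cauchyKer D.b w z) := by
    rw [intervalIntegral.integral_sub hi (by simp), intervalIntegral.integral_const, Step.hf,
      sub_zero, Complex.real_smul]
  rw [e]
  refine (D.norm_integral_h_le (K := 2 * K / (1 / 4 * P.g) * D.h) fun s hs => ?_).trans
    (le_of_eq (by unfold Conf.h; ring))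
  refine (norm_sub_le_of_ball hd (fun u hu => h D u z ((hball u hu).trans (P.s_le (by norm_num)))
    (hz.2.trans (P.s_le (by norm_num))) ?_) (D.norm_shift_le hs).1).trans ?_
  · have := P.sep (hball u hu) hz.1
    rw [norm_sub_rev]
    exact le_trans (le_of_eq (by ring)) this
  · exact mul_le_mul_of_nonneg_left (D.norm_shift_le hs).2 (by positivity)

/-- The mean of the fluctuation to precision `ε²`. -/
theorem exists_mean_expansion (P : Setting) : ∃ K : ℝ, 0 < K ∧ ∀ (D : Step P), ∀ z ∈ P.ann 7 9,
    ‖D.E (fun e => D.τ e z) - D.ε * D.resp (D.src z) z‖ ≤ K * D.ε ^ 2 := by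
  obtain ⟨a, ha1, hU⟩ := exists_unif P
  have ha : 0 < a := by linarith
  obtain ⟨K1, hK1, h1⟩ := exists_second_moment P
  obtain ⟨K2, hK2, h2⟩ := exists_master_resp P
  obtain ⟨K3, hK3, h3⟩ := exists_E_bound P 4
  obtain ⟨K4, hK4, h4⟩ := exists_hf_bound P
  obtain ⟨K5, hK5, h5⟩ := exists_resp_bound P
  set M := a + a * (a + a) + a * a * a with hM
  refine ⟨K2 * (a + a ^ 2 + K3 * M) + K3 * (a + 2 * a ^ 3) + 2 * K1 + a ^ 2 + K5 * K4,
    by positivity, fun D z hz => ?_⟩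
  have hε := D.ε_pos
  have hz6 : z ∈ P.ann 6.75 9.5 := P.ann_mono (by norm_num) (by norm_num) hz
  have hz5 : z ∈ P.ann 5 9.5 := P.ann_mono (by norm_num) (by norm_num) hz
  have hg := (hU D).good z hz
  have hσ4 : D.σ ^ 4 = D.ε ^ 2 := by rw [← D.σ_sq]; ring
  set S := D.cen (D.hf z) with hS
  set m := D.E (fun e => D.τ e z) with hm
  have hmle : ‖m‖ ≤ a * D.ε := (hU D).E_τ z (P.ann_mono (by norm_num) (by norm_num) hz)
  have hτS : ∀ e, S e = D.τ e z - m := fun e => cen_hf D z e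
  have hκc : ContinuousOn D.κ (trace (P.con 6)) := D.κ_continuousOn (by norm_num) (by norm_num)
  obtain ⟨b1, b2⟩ := h1 D z hz
  -- the mean of `η`
  have b3 : ‖D.E (fun e => D.η e z) - D.resp (fun w => D.ε * D.κ w) z‖ ≤
      K2 * (a + a ^ 2 + K3 * M) * D.ε ^ 2 := by
    have := h2 D (fun _ => 1) (fun _ _ => 1) (D.insert_one _) (fun w => D.ε * D.κ w)
      ((a + a ^ 2 + K3 * M) * D.ε ^ 2) (continuousOn_const.mul hκc) (fun w hw => ?_) z hz6
    · simp only [one_mul] at this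
      exact this.trans (le_of_eq (by ring))
    have hw5 : w ∈ P.ann 5.75 9 := P.con_sub_ann (by norm_num) (by norm_num) (by norm_num) hw
    have hw5' : w ∈ P.ann 5.25 9.5 := P.ann_mono (by norm_num) (by norm_num) hw5
    have hw5'' : w ∈ P.ann 5 9.5 := P.ann_mono (by norm_num) (by norm_num) hw5
    have c1 : ‖D.E (fun e => Complex.exp (D.τ e w) * (Complex.exp (D.ξ e w) * 1 - 1) -
        (D.ε * D.κ w + (D.τ e (w + D.h) - D.τ e w) + D.ε * D.κ w * D.η e w))‖ ≤
        K3 * M * D.ε ^ 2 := by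
      rw [mul_assoc, ← hσ4]
      refine h3 D _ M (by positivity) fun e => ?_
      have hW := D.W_pos e
      set X := Complex.exp (D.ξ e w) - 1 with hX
      set δ := D.τ e (w + D.h) - D.τ e w with hδ
      have hη : ‖D.η e w‖ ≤ a * D.W e := (hU D).η_le e w hw5''
      have hη' : ‖D.η e w‖ ≤ a * a := hη.trans
        (mul_le_mul_of_nonneg_left ((hU D).W_le e) ha.le)
      have hδle : ‖δ‖ ≤ a * (D.W e * D.W e ^ 2) := ((hU D).shift_le e w hw5).trans
        (mul_le_mul_of_nonneg_left (mul_le_mul_of_nonneg_left (D.ε_le_W e) hW.le) ha.le)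
      have hr : ‖X - D.ε * D.κ w - δ‖ ≤ a * D.W e ^ 4 := by
        refine ((hU D).ξ_one e w hw5).trans (mul_le_mul_of_nonneg_left ?_ ha.le)
        calc D.ε ^ 2 ≤ (D.W e ^ 2) ^ 2 := pow_le_pow_left₀ hε.le (D.ε_le_W e) 2
          _ = _ := by ring
      have e1 : Complex.exp (D.τ e w) * (Complex.exp (D.ξ e w) * 1 - 1) -
          (D.ε * D.κ w + δ + D.ε * D.κ w * D.η e w) =
          (X - D.ε * D.κ w - δ) + D.η e w * δ + D.η e w * (X - D.ε * D.κ w - δ) := by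
        rw [hX, Step.η]; ring
      rw [e1]
      refine (norm_add₃_le).trans ?_
      simp only [norm_mul]
      calc _ ≤ a * D.W e ^ 4 + (a * D.W e) * (a * (D.W e * D.W e ^ 2)) +
            (a * a) * (a * D.W e ^ 4) := by gcongr
        _ ≤ M * D.W e ^ 4 := by
          have : 0 ≤ a * a * D.W e ^ 4 := by positivity
          rw [hM]; nlinarith
    rw [D.E_sub] at c1
    have c2 : D.E (fun e => D.ε * D.κ w + (D.τ e (w + D.h) - D.τ e w) + D.ε * D.κ w * D.η e w) =
        D.ε * D.κ w + (D.E (fun e => D.τ e (w + D.h) - D.τ e w) +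
          D.ε * D.κ w * D.E (fun e => D.η e w)) := by
      rw [D.E_add, D.E_add, D.E_const, D.E_mul_left]; ring
    rw [c2] at c1
    have c3 : ‖D.E (fun e => D.τ e (w + D.h) - D.τ e w) +
          D.ε * D.κ w * D.E (fun e => D.η e w)‖ ≤ (a + a ^ 2) * D.ε ^ 2 := by
      refine (norm_add_le _ _).trans ?_
      rw [norm_mul, norm_mul, Complex.norm_real, Real.norm_of_nonneg hε.le]
      have hE1 := (hU D).E_shift w hw5
      have hE2 := (hU D).E_η w hw5'
      have hE3 := (hU D).κ_le w hw5
      calc _ ≤ a * D.ε ^ 2 + D.ε * a * (a * D.ε) := by gcongr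
        _ = _ := by ring
    have e2 : ∀ x y u : ℂ, x - y = (x - (y + u)) + u := fun x y u => by ring
    rw [e2 _ _ (D.E (fun e => D.τ e (w + D.h) - D.τ e w) +
          D.ε * D.κ w * D.E (fun e => D.η e w))]
    refine (norm_add_le _ _).trans ((add_le_add c1 c3).trans (le_of_eq (by ring)))
  -- from `η` to `τ`
  have b4 : ‖D.E (fun e => D.η e z - (D.τ e z + S e * D.τ e z * (1 / 2) +
      S e ^ 2 * D.τ e z * (1 / 6) + m * D.τ e z * (1 / 2)))‖ ≤ K3 * (a + 2 * a ^ 3) * D.ε ^ 2 := by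
    rw [mul_assoc, ← hσ4]
    refine h3 D _ _ (by positivity) fun e => ?_
    have hW := D.W_pos e
    have hS1 : ‖S e‖ ≤ a * D.W e := hg.cen_le e
    have hτ1 := (hU D).τ_le e z hz5
    have hr := (hU D).η_three e z hz5
    have hm1 : ‖m‖ ≤ a * D.W e ^ 2 := hmle.trans
        (mul_le_mul_of_nonneg_left (D.ε_le_W e) ha.le)
    have e1 : D.η e z - (D.τ e z + S e * D.τ e z * (1 / 2) +
      S e ^ 2 * D.τ e z * (1 / 6) + m * D.τ e z * (1 / 2)) =
        (D.η e z - D.τ e z - D.τ e z ^ 2 / 2 - D.τ e z ^ 3 / 6) +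
          D.τ e z * m * (D.τ e z + S e) * (1 / 6) := by
      rw [hτS e]; ring
    rw [e1]
    refine (norm_add_le _ _).trans ?_
    simp only [norm_mul]
    have hh : ‖(1 / 6 : ℂ)‖ ≤ 1 := by norm_num
    have hsum : ‖D.τ e z + S e‖ ≤ a * D.W e + a * D.W e := (norm_add_le _ _).trans (by gcongr)
    calc _ ≤ a * D.W e ^ 4 + (a * D.W e) * (a * D.W e ^ 2) * (a * D.W e + a * D.W e) * 1 := by
          gcongr
      _ = _ := by ring
  have b5 : D.E (fun e => D.η e z - (D.τ e z + S e * D.τ e z * (1 / 2) +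
      S e ^ 2 * D.τ e z * (1 / 6) + m * D.τ e z * (1 / 2))) = D.E (fun e => D.η e z) -
      (m + D.E (fun e => S e * D.τ e z) * (1 / 2) + D.E (fun e => S e ^ 2 * D.τ e z) * (1 / 6) +
        m * m * (1 / 2)) := by
    rw [D.E_sub, D.E_add, D.E_add, D.E_add, D.E_mul_right, D.E_mul_right, D.E_mul_right,
      D.E_mul_left]
  rw [b5] at b4
  have hcc : ContinuousOn (fun w => cauchyKer D.b w z) (trace (P.con 6)) :=
    D.cauchyKer_continuousOn_con (by norm_num) (by norm_num) (P.mem_Λ (by norm_num) hz.2)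
      ((P.s_lt (by norm_num)).trans_le hz.1).ne'
  have b6 : ‖D.resp (D.hf z) z - D.resp (fun w => D.h * cauchyKer D.b w z) z‖ ≤
      K5 * K4 * D.ε ^ 2 := by
    rw [← D.resp_sub (g := fun w => D.h * cauchyKer D.b w z) hg.continuousOn
      (continuousOn_const.mul hcc) hz6, mul_assoc]
    exact h5 D _ _ (fun w hw => h4 D z hz w hw) z hz6
  have b7 : D.ε * D.resp (D.src z) z = D.resp (fun w => D.ε * D.κ w) z -
      D.resp (fun w => D.h * cauchyKer D.b w z) z * (1 / 2) := by
    have e1 : D.resp (fun w => D.ε * D.κ w - D.h / 2 * cauchyKer D.b w z) z = _ :=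
      D.resp_sub (f := fun w => D.ε * D.κ w) (g := fun w => D.h / 2 * cauchyKer D.b w z)
        (continuousOn_const.mul hκc) (continuousOn_const.mul hcc) hz6
    rw [D.resp_mul_left (D.h / 2)] at e1
    rw [D.resp_mul_left D.h]
    have e2 : (fun w => D.ε * D.κ w - D.h / 2 * cauchyKer D.b w z) =
        fun w => D.ε * D.src z w := by
      funext w; unfold Step.src Conf.h; push_cast; ring
    rw [e2, D.resp_mul_left] at e1
    rw [e1]; ring
  rw [b7]
  have e3 : ∀ u η r1 S1 S2 r2 r3 : ℂ, u - (r1 - r3 * (1 / 2)) =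
      (η - r1) - (η - (u + S1 * (1 / 2) + S2 * (1 / 6) + m * m * (1 / 2))) -
      (S1 - r2) * (1 / 2) - S2 * (1 / 6) - m * m * (1 / 2) - (r2 - r3) * (1 / 2) := by
    intros; ring
  rw [e3 m (D.E (fun e => D.η e z)) _ (D.E (fun e => S e * D.τ e z))
    (D.E (fun e => S e ^ 2 * D.τ e z)) (D.resp (D.hf z) z)]
  have hh : ‖(1 / 2 : ℂ)‖ ≤ 1 := by norm_num
  have hh6 : ‖(1 / 6 : ℂ)‖ ≤ 1 := by norm_num
  have hmm : ‖m * m * (1 / 2)‖ ≤ a ^ 2 * D.ε ^ 2 := by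
    rw [norm_mul, norm_mul]
    calc _ ≤ (a * D.ε) * (a * D.ε) * 1 := by gcongr
      _ = _ := by ring
  have half : ∀ {x c : ℂ} {y : ℝ}, ‖c‖ ≤ 1 → ‖x‖ ≤ y → ‖x * c‖ ≤ y := fun hc hx => by
    rw [norm_mul]
    exact (mul_le_of_le_one_right (norm_nonneg _) hc).trans hx
  refine (norm_sub_le _ _).trans ((add_le_add ((norm_sub_le _ _).trans (add_le_add
    ((norm_sub_le _ _).trans (add_le_add ((norm_sub_le _ _).trans (add_le_add
    ((norm_sub_le _ _).trans (add_le_add b3 b4)) (half hh b2))) (half hh6 b1))) hmm))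
    (half hh b6)).trans (le_of_eq ?_))
  ring

end

section

open Conf

variable {P : Setting}

namespace Step

variable (D : Step P)

theorem hasDerivAt_outerKer {z w : ℂ} (hz : z ∈ P.F) (hw : lvl P.l P.r w < P.s 10) :
    HasDerivAt (fun u => cauchyKer D.b z u) (ker D.b w z) w := by
  rw [ker_comm]
  refine D.conf.hasDerivAt_cauchyKer_right (P.F_sub hz) (P.mem_Λ le_rfl hw.le) fun h0 => ?_
  rw [← h0] at hw
  exact lt_asymm hw (P.F_far z hz)

end Step

theorem exists_ker_bound (P : Setting) : ∃ K : ℝ, 0 < K ∧ ∀ (D : Step P) (z w : ℂ), z ∈ P.F →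
    lvl P.l P.r w ≤ P.s 9 → ‖ker D.b w z‖ ≤ K := by
  obtain ⟨K, hK, h⟩ := exists_outerKer_bound P
  have hg := P.g_pos
  refine ⟨2 * K / (1 / 4 * P.g), by positivity, fun D z w hz hw => ?_⟩
  have hb : ∀ u ∈ Metric.ball w (1 / 4 * P.g), lvl P.l P.r u ≤ P.s 9.5 := fun u hu =>
    ((P.ball_lvl hu).1 hw).trans (P.s_le (by norm_num))
  rw [← (D.hasDerivAt_outerKer hz (hw.trans_lt (P.s_lt (by norm_num)))).deriv]
  exact norm_deriv_le_of_ball (by positivity) ((D.outerKer_holo hz).mono fun u hu =>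
    (hb u hu).trans_lt (P.s_lt (by norm_num))) fun u hu => h D z u hz (hb u hu)

theorem exists_Kav_expansion (P : Setting) : ∃ K : ℝ, 0 < K ∧ ∀ (D : Step P) (z w : ℂ), z ∈ P.F →
    lvl P.l P.r w ≤ P.s 8 → ‖D.Kav z w - ker D.b w z - D.ε / 2 * deriv (fun w => ker D.b w z) w‖ ≤
      K * D.ε ^ 2 := by
  obtain ⟨K, hK, h⟩ := exists_ker_bound P
  have hg := P.g_pos
  refine ⟨4 * K / (1 / 4 * P.g) ^ 2, by positivity, fun D z w hz hw => ?_⟩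
  have hε := D.ε_pos
  set k : ℂ → ℂ := fun w => ker D.b w z with hk
  have hb : ∀ u ∈ Metric.ball w (1 / 4 * P.g), lvl P.l P.r u ≤ P.s 9 := fun u hu =>
    ((P.ball_lvl hu).1 hw).trans (P.s_le (by norm_num))
  have hd : DifferentiableOn ℂ k (Metric.ball w (1 / 4 * P.g)) :=
    (D.ker_holo hz).mono fun u hu => (hb u hu).trans_lt (P.s_lt (by norm_num))
  have hmv := norm_image_sub_le_of_norm_deriv_le_segment' (a := 0) (b := D.ε)
    (f := fun t : ℝ => cauchyKer D.b z (w + t) - t * k w - (t : ℂ) ^ 2 / 2 * deriv k w)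
    (f' := fun t : ℝ => k (w + t) - k w - t * deriv k w)
    (C := 4 * K / (1 / 4 * P.g) ^ 2 * D.ε ^ 2) (fun t ht => ?_) (fun t ht => ?_) D.ε
    (right_mem_Icc.2 hε.le)
  · have e1 : D.Kav z w - k w - D.ε / 2 * deriv k w = (D.ε : ℂ)⁻¹ *
      ((cauchyKer D.b z (w + D.ε) - D.ε * k w - (D.ε : ℂ) ^ 2 / 2 * deriv k w) -
        (cauchyKer D.b z (w + (0 : ℝ)) - (0 : ℝ) * k w - ((0 : ℝ) : ℂ) ^ 2 / 2 * deriv k w)) := by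
      have := D.eps_ne
      rw [Step.Kav]
      push_cast
      field_simp
      ring_nf
    rw [e1, norm_mul, norm_inv, Complex.norm_real, Real.norm_of_nonneg hε.le, inv_mul_le_iff₀ hε]
    refine hmv.trans (le_of_eq ?_)
    ring
  · have hl : lvl P.l P.r (w + t) < P.s 10 :=
      (P.lvl_add_le hw ht.1 (ht.2.trans D.ε_le)).trans_lt (P.s_lt (by norm_num))
    have h1 : HasDerivAt (fun t : ℝ => w + (t : ℂ)) 1 t :=
      (Complex.ofRealCLM.hasDerivAt (x := t)).const_add w
    have h2 := (D.hasDerivAt_outerKer hz hl).comp t h1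
    have h3 : HasDerivAt (fun t : ℝ => (t : ℂ)) 1 t := Complex.ofRealCLM.hasDerivAt (x := t)
    have h4 := (h2.sub (h3.mul_const (k w))).sub (((h3.pow 2).div_const 2).mul_const (deriv k w))
    refine HasDerivAt.hasDerivWithinAt (h4.congr_deriv ?_)
    simp only [hk]
    push_cast
    ring
  · have htn : ‖(t : ℂ)‖ = t := by rw [Complex.norm_real, Real.norm_of_nonneg ht.1]
    refine (norm_taylor_le_of_ball hd (fun u hu => h D z u hz (hb u hu)) (s := (t : ℂ)) ?_).trans ?_
    · rw [htn]; linarith [ht.2, D.ε_le]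
    · rw [htn]
      exact mul_le_mul_of_nonneg_left (pow_le_pow_left₀ ht.1 ht.2.le 2) (by positivity)

namespace Step

variable (D : Step P)

/-- The limit of `fun7`. -/
noncomputable def funK (z : ℂ) (u : ℂ → ℂ) : ℂ :=
  -((P.θ : ℂ)⁻¹ * ((2 * Real.pi * Complex.I)⁻¹ *
    contourInt (P.con 7) (fun w => u w * ker D.b w z)))

/-- The quadratic term: a residue of order two. -/
theorem contourInt_cauchyKer_sq {z w : ℂ} (hz : z ∈ P.F) (hw : lvl P.l P.r w < P.s 7) :
    contourInt (P.con 7) (fun v => cauchyKer D.b w v ^ 2 * ker D.b v z) =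
      2 * Real.pi * Complex.I * (2 * (deriv D.b w / (D.b z - D.b w) * ker D.b w z)) := by
  have h7 : (0 : ℝ) < 7 := by norm_num
  set V : Set ℂ := {v | lvl P.l P.r v < P.s 9} with hVdef
  have hVΛ : V ⊆ P.Λ := P.lt_sub (by norm_num)
  have hVo : IsOpen V := isOpen_lvl_lt _ _ _
  have hVz : ∀ v ∈ V, D.b v - D.b z ≠ 0 := fun v hv =>
    D.conf.sub_ne (hVΛ hv) (P.F_sub hz) fun h0 => by
      rw [h0] at hv
      exact lt_asymm (lt_trans hv (P.s_lt (by norm_num : (9 : ℝ) < 10))) (P.F_far z hz)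
  have hwV : w ∈ V := hw.trans (P.s_lt (by norm_num))
  set q : ℂ → ℂ := fun v => deriv D.b w * deriv D.b z / (D.b v - D.b z) ^ 2 with hq
  have hqd : ∀ v ∈ V, HasDerivAt q (-2 * (deriv D.b w * deriv D.b z * deriv D.b v) /
      (D.b v - D.b z) ^ 3) v := fun v hv => by
    have h1 := ((D.conf.hasDerivAt (hVΛ hv)).sub_const (D.b z)).pow 2
    have h2 := (hasDerivAt_const v (deriv D.b w * deriv D.b z)).fun_div h1
      (pow_ne_zero 2 (hVz v hv))
    refine h2.congr_deriv ?_
    have := hVz v hv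
    simp only [Pi.pow_apply]
    field_simp
    push_cast; ring_nf
  have hqh : DifferentiableOn ℂ q V := fun v hv =>
    (hqd v hv).differentiableAt.differentiableWithinAt
  have htV : trace (P.con 7) ⊆ V \ {w} := fun v hv => ⟨P.con_sub_lt h7 (by norm_num) hv, fun h0 => by
    rw [mem_singleton_iff.1 h0] at hv; exact hw.ne (P.lvl_con h7 hv)⟩
  have hVw : IsOpen (V \ {w}) := hVo.sdiff isClosed_singleton
  have hc := (D.conf.cauchyKer_holo_right (hVΛ hwV)).mono
    (show V \ {w} ⊆ P.Λ \ {w} from fun v hv => ⟨hVΛ hv.1, hv.2⟩)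
  have h0 := (P.isLoop_con h7).contourInt_deriv hVw htV (hc.mul (hqh.mono sdiff_subset))
  have e1 : contourInt (P.con 7) (deriv ((fun v => cauchyKer D.b w v) * q)) =
      contourInt (P.con 7) (fun v => cauchyKer D.b w v ^ 2 * ker D.b v z +
        cauchyKer D.b w v * deriv q v) := by
    refine contourInt_congr fun v hv => ?_
    have hv1 := htV hv
    have hne : w ≠ v := fun h => hv1.2 h.symm
    have h1 := D.conf.hasDerivAt_cauchyKer_right (hVΛ hwV) (hVΛ hv1.1) hne
    rw [(h1.mul (hqd v hv1.1)).deriv, (hqd v hv1.1).deriv]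
    simp only [hq, ker, cauchyKer]
    have h2 := D.conf.sub_ne (hVΛ hwV) (hVΛ hv1.1) hne
    have h3 := hVz v hv1.1
    field_simp
  have hqc : ContinuousOn (deriv q) V := (hqh.deriv hVo).continuousOn
  have hcc : ContinuousOn (fun v => cauchyKer D.b w v) (trace (P.con 7)) :=
    hc.continuousOn.mono htV
  have htV' : trace (P.con 7) ⊆ V := htV.trans sdiff_subset
  rw [e1, contourInt_add (P.isLoop_con h7).pwC1
    (f := fun v => cauchyKer D.b w v ^ 2 * ker D.b v z)
    (g := fun v => cauchyKer D.b w v * deriv q v) ((hcc.pow 2).mul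
    (D.ker_continuousOn hz h7 (by norm_num))) (hcc.mul (hqc.mono htV')),
    D.cauchy_right h7 (j := 9) (by norm_num) (by norm_num) (hqh.deriv hVo) hw,
    (hqd w hwV).deriv] at h0
  rw [add_neg_eq_zero.1 h0]
  have h3 := hVz w hwV
  have h4 : D.b z - D.b w ≠ 0 := by rw [← neg_sub]; exact neg_ne_zero.2 h3
  have h5 : D.b z - D.b w = -(D.b w - D.b z) := by ring
  unfold ker
  rw [h5]
  field_simp

/-- The response on the diagonal. -/
noncomputable def diag (z : ℂ) : ℂ := D.resp (D.src z) z

theorem diag_kernel_continuousOn {V : Set ℂ} (hV : V ⊆ P.Λ)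
    (hdis : Disjoint (trace (P.con 6)) V) :
    ContinuousOn (Function.uncurry fun z w => D.A w * D.src z w * cauchyKer D.b w z)
      (V ×ˢ trace (P.con 6)) := by
  have h6 : (0 : ℝ) < 6 := by norm_num
  have hoff : trace (P.con 6) ⊆ P.Λ \ seg P.l P.r := fun w hw =>
    P.ann_sub h6 (by norm_num) (P.con_sub_ann h6 le_rfl le_rfl hw)
  have hck : ContinuousOn (fun p : ℂ × ℂ => cauchyKer D.b p.2 p.1) (V ×ˢ trace (P.con 6)) :=
    (D.conf.continuousOn_cauchyKer (hoff.trans sdiff_subset) hV hdis).comp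
      continuous_swap.continuousOn fun p hp => ⟨hp.2, hp.1⟩
  have hA : ContinuousOn (fun p : ℂ × ℂ => D.A p.2) (V ×ˢ trace (P.con 6)) :=
    (D.A_holo.continuousOn.mono hoff).comp continuousOn_snd fun p hp => hp.2
  have hκ : ContinuousOn (fun p : ℂ × ℂ => D.κ p.2) (V ×ˢ trace (P.con 6)) :=
    (D.κ_continuousOn (by norm_num) (by norm_num)).comp continuousOn_snd fun p hp => hp.2
  exact (hA.mul (hκ.sub (continuousOn_const.mul hck))).mul hck

theorem diag_continuousOn : ContinuousOn D.diag (trace (P.con 7)) := by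
  have h6 : (0 : ℝ) < 6 := by norm_num
  have hV : IsOpen (P.Λ ∩ {z | P.s 6 < lvl P.l P.r z}) := P.isOpen.inter (isOpen_lt_lvl _ _ _)
  have hoff : trace (P.con 6) ⊆ P.Λ := P.con_sub h6 (by norm_num)
  have hdis : Disjoint (trace (P.con 6)) (P.Λ ∩ {z | P.s 6 < lvl P.l P.r z}) :=
    disjoint_left.2 fun w hw hw' => (ne_of_gt hw'.2) (P.lvl_con h6 hw)
  have h1 := differentiableOn_contourInt hV (P.isLoop_con h6).pwC1
    (f := fun z w => D.A w * D.src z w * cauchyKer D.b w z)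
    (D.diag_kernel_continuousOn inter_subset_left hdis) fun w hw => ?_
  · refine continuousOn_const.mul (h1.continuousOn.mono fun z hz => ?_)
    refine ⟨P.con_sub (by norm_num) (by norm_num) hz, ?_⟩
    rw [mem_ofPred_eq, P.lvl_con (by norm_num) hz]; exact P.s_lt (by norm_num)
  · have hc : DifferentiableOn ℂ (fun z => cauchyKer D.b w z)
        (P.Λ ∩ {z | P.s 6 < lvl P.l P.r z}) :=
      (D.conf.cauchyKer_holo_right (hoff hw)).mono fun z hz => ⟨hz.1, fun h0 =>
        disjoint_left.1 hdis hw (mem_singleton_iff.1 h0 ▸ hz)⟩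
    exact (((differentiableOn_const _).sub (hc.const_mul _)).const_mul _).mul hc

theorem funK_diag {z : ℂ} (hz : z ∈ P.F) : D.funK z D.diag =
    (2 * Real.pi * Complex.I * P.θ)⁻¹ * contourInt (P.con 6) (fun w =>
      D.A w * (P.θ * deriv D.b w / (D.b z - D.b w) + D.κ w) * ker D.b w z) := by
  have h6 : (0 : ℝ) < 6 := by norm_num
  have h7 : (0 : ℝ) < 7 := by norm_num
  have hp6 := (P.isLoop_con h6).pwC1
  have hp7 := (P.isLoop_con h7).pwC1
  have hdis : Disjoint (trace (P.con 6)) (trace (P.con 7)) :=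
    disjoint_left.2 fun w hw hw' => by
      have h1 := P.lvl_con h6 hw
      rw [P.lvl_con h7 hw'] at h1
      exact (P.s_lt (show (6 : ℝ) < 7 by norm_num)).ne' h1
  have hk7 := D.ker_continuousOn hz h7 (by norm_num)
  have hsw := contourInt_swap hp7 hp6
    (f := fun u w => D.A w * D.src u w * cauchyKer D.b w u * ker D.b u z)
    ((D.diag_kernel_continuousOn (P.con_sub h7 (by norm_num)) hdis).mul
      (hk7.comp continuousOn_fst fun p hp => hp.1))
  have e1 : contourInt (P.con 7) (fun u => D.diag u * ker D.b u z) =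
      (2 * Real.pi * Complex.I)⁻¹ * contourInt (P.con 7) (fun u => contourInt (P.con 6)
        (fun w => D.A w * D.src u w * cauchyKer D.b w u * ker D.b u z)) := by
    rw [← contourInt_const_mul]
    refine contourInt_congr fun u _ => ?_
    rw [diag, resp, mul_assoc, ← contourInt_mul_const]
  have e2 : contourInt (P.con 6) (fun w => contourInt (P.con 7)
      (fun u => D.A w * D.src u w * cauchyKer D.b w u * ker D.b u z)) =
      -(2 * Real.pi * Complex.I) * contourInt (P.con 6) (fun w =>
      D.A w * (P.θ * deriv D.b w / (D.b z - D.b w) + D.κ w) * ker D.b w z) := by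
    rw [← contourInt_const_mul]
    refine contourInt_congr fun w hw => ?_
    have hlw : lvl P.l P.r w < P.s 7 := by rw [P.lvl_con h6 hw]; exact P.s_lt (by norm_num)
    have hck : ContinuousOn (fun u => cauchyKer D.b w u) (trace (P.con 7)) :=
      (D.conf.cauchyKer_holo_right (P.con_sub h6 (by norm_num) hw)).continuousOn.mono fun u hu =>
        ⟨P.con_sub h7 (by norm_num) hu, fun h0 =>
          disjoint_left.1 hdis hw (mem_singleton_iff.1 h0 ▸ hu)⟩
    have e3 : (fun u => D.A w * D.src u w * cauchyKer D.b w u * ker D.b u z) =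
        fun u => D.A w * D.κ w * (cauchyKer D.b w u * ker D.b u z) -
          D.A w * (P.θ / 2) * (cauchyKer D.b w u ^ 2 * ker D.b u z) := by
      funext u; unfold src; ring
    rw [e3, contourInt_sub hp7
      (f := fun u => D.A w * D.κ w * (cauchyKer D.b w u * ker D.b u z))
      (g := fun u => D.A w * (P.θ / 2) * (cauchyKer D.b w u ^ 2 * ker D.b u z)) (continuousOn_const.mul (hck.mul hk7))
      (continuousOn_const.mul ((hck.pow 2).mul hk7)), contourInt_const_mul, contourInt_const_mul,
      D.cauchy_right h7 (j := 9) (by norm_num) (by norm_num) ((D.ker_holo hz).mono fun u hu =>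
        lt_trans hu (P.s_lt (by norm_num))) hlw, D.contourInt_cauchyKer_sq hz hlw]
    ring
  unfold funK
  rw [e1, hsw, e2]
  have := two_pi_I_ne_zero
  rw [mul_inv]
  field_simp

theorem fun7_bound_sub {z : ℂ} (hz : z ∈ P.F) {u k : ℂ → ℂ} {M M' : ℝ}
    (hu : ContinuousOn u (trace (P.con 7))) (hk : ContinuousOn k (trace (P.con 7)))
    (hM : ∀ w ∈ trace (P.con 7), ‖u w‖ ≤ M)
    (hk' : ∀ w ∈ trace (P.con 7), ‖D.Kav z w - k w‖ ≤ M') :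
    ‖D.fun7 z u - -((P.θ : ℂ)⁻¹ * ((2 * Real.pi * Complex.I)⁻¹ *
      contourInt (P.con 7) (fun w => u w * k w)))‖ ≤
      ‖(P.θ : ℂ)⁻¹ * (2 * Real.pi * Complex.I)⁻¹‖ * (M * M' * curveLength (P.con 7)) := by
  have h7 : (0 : ℝ) < 7 := by norm_num
  have hM0 : 0 ≤ M := (norm_nonneg _).trans (hM _ (mem_trace (t := 0) (by simp)))
  have h1 := contourInt_sub (P.isLoop_con h7).pwC1 (f := fun w => u w * D.Kav z w)
    (g := fun w => u w * k w) (hu.mul (D.Kav_continuousOn hz h7 (by norm_num))) (hu.mul hk)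
  have e : D.fun7 z u - -((P.θ : ℂ)⁻¹ * ((2 * Real.pi * Complex.I)⁻¹ *
      contourInt (P.con 7) (fun w => u w * k w))) = -((P.θ : ℂ)⁻¹ * (2 * Real.pi * Complex.I)⁻¹ *
        contourInt (P.con 7) (fun w => u w * (D.Kav z w - k w))) := by
    simp only [mul_sub, h1]
    unfold fun7
    ring
  rw [e, norm_neg, norm_mul]
  refine mul_le_mul_of_nonneg_left (norm_contourInt_le (P.isLoop_con h7).pwC1 fun w hw => ?_)
    (norm_nonneg _)
  rw [norm_mul]
  exact mul_le_mul (hM w hw) (hk' w hw) (norm_nonneg _) hM0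

end Step

end

section

open Conf

variable {P : Setting}

namespace Step

variable (D : Step P)

/-- The expansion of the mean increment, on the reference contours. -/
noncomputable def meanX (z : ℂ) : ℂ :=
  (2 * Real.pi * Complex.I * P.θ)⁻¹ * contourInt (P.con 7) (fun w => D.L w * ker D.b w z) +
    D.ε * ((2 * Real.pi * Complex.I * P.θ)⁻¹ *
      (contourInt (P.con 6) (fun w =>
        D.A w * (P.θ * deriv D.b w / (D.b z - D.b w) + D.κ w) * ker D.b w z) -
      contourInt (P.con 7) (fun w => deriv D.Bf w / (2 * D.Bf w) * ker D.b w z)))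

theorem deriv_ker_continuousOn {z : ℂ} (hz : z ∈ P.F) {k : ℝ} (hk : 0 < k) (hk' : k < 10) :
    ContinuousOn (deriv fun w => ker D.b w z) (trace (P.con k)) :=
  ((D.ker_holo hz).deriv (isOpen_lvl_lt _ _ _)).continuousOn.mono (P.con_sub_lt hk hk')

/-- The leading term, by analyticity of the interior part and integration by parts. -/
theorem contourInt_ld_eq {z : ℂ} (hz : z ∈ P.F) :
    contourInt (P.con 7) (fun w => D.ld w * (ker D.b w z +
      D.ε / 2 * deriv (fun w => ker D.b w z) w)) =
    -contourInt (P.con 7) (fun w => D.L w * ker D.b w z) +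
      D.ε * contourInt (P.con 7) (fun w => deriv D.Bf w / (2 * D.Bf w) * ker D.b w z) := by
  have h7 : (0 : ℝ) < 7 := by norm_num
  have hp := (P.isLoop_con h7).pwC1
  set k : ℂ → ℂ := fun w => ker D.b w z with hk
  have hV10 : IsOpen {w | lvl P.l P.r w < P.s 10} := isOpen_lvl_lt _ _ _
  have hkh := D.ker_holo hz
  have hkc : ContinuousOn k (trace (P.con 7)) := D.ker_continuousOn hz h7 (by norm_num)
  have hk'c : ContinuousOn (deriv k) (trace (P.con 7)) :=
    D.deriv_ker_continuousOn hz h7 (by norm_num)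
  have hLc : ContinuousOn D.L (trace (P.con 7)) := D.L_continuousOn_con h7 (by norm_num)
  have hoff : trace (P.con 7) ⊆ P.Λ \ seg P.l P.r := fun w hw =>
    P.ann_sub h7 (by norm_num) (P.con_sub_ann h7 le_rfl le_rfl hw)
  have hBc : ContinuousOn (fun w => deriv D.Bf w / (2 * D.Bf w)) (trace (P.con 7)) :=
    ((D.Bf_holo.deriv P.isOpen_off).continuousOn.mono hoff).div
      (continuousOn_const.mul (D.Bf_holo.continuousOn.mono hoff)) fun w hw =>
        mul_ne_zero two_ne_zero (D.Bf_ne (hoff hw))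
  have h8 : {w | lvl P.l P.r w < P.s 8} ⊆ {w | lvl P.l P.r w < P.s 10} := fun w hw =>
    lt_trans hw (P.s_lt (by norm_num))
  have hin : contourInt (P.con 7) (fun w => D.Lin w * (k w + D.ε / 2 * deriv k w)) = 0 := by
    refine contourInt_eq_zero (isOpen_lvl_lt P.l P.r (P.s 8)) (P.isLoop_con h7)
      (P.con_sub_lt h7 (by norm_num)) (fun a ha => P.winding_con_out h7
        ((P.s_lt (by norm_num)).trans_le (not_lt.1 ha))) ?_
    exact D.Lin_holo.mul ((hkh.mono h8).add (((hkh.deriv hV10).mono h8).const_mul _))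
  have hparts : contourInt (P.con 7) (fun w => D.L w * deriv k w) =
      -(2 * contourInt (P.con 7) (fun w => deriv D.Bf w / (2 * D.Bf w) * k w)) := by
    have hVo : IsOpen ((P.Λ \ seg P.l P.r) ∩ {w | lvl P.l P.r w < P.s 10}) :=
      P.isOpen_off.inter hV10
    have ht : trace (P.con 7) ⊆ (P.Λ \ seg P.l P.r) ∩ {w | lvl P.l P.r w < P.s 10} := fun w hw =>
      ⟨hoff hw, P.con_sub_lt h7 (by norm_num) hw⟩
    have hL := D.branch.1.mono (inter_subset_left (t := {w | lvl P.l P.r w < P.s 10}))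
    have hkk := hkh.mono (inter_subset_right (s := P.Λ \ seg P.l P.r))
    have h0 := (P.isLoop_con h7).contourInt_deriv hVo ht (hL.mul hkk)
    have e1 : contourInt (P.con 7) (deriv (D.L * k)) = contourInt (P.con 7) (fun w =>
        2 * (deriv D.Bf w / (2 * D.Bf w) * k w) + D.L w * deriv k w) := by
      refine contourInt_congr fun w hw => ?_
      have hn := hVo.mem_nhds (ht hw)
      rw [((hL.differentiableAt hn).hasDerivAt.mul (hkk.differentiableAt hn).hasDerivAt).deriv,
        D.deriv_L (hoff hw)]
      have := D.Bf_ne (hoff hw)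
      field_simp
      simp only [hk]
    rw [e1, contourInt_add hp (f := fun w => 2 * (deriv D.Bf w / (2 * D.Bf w) * k w))
      (g := fun w => D.L w * deriv k w) (continuousOn_const.mul (hBc.mul hkc)) (hLc.mul hk'c),
      contourInt_const_mul] at h0
    exact eq_neg_of_add_eq_zero_right h0
  have hLk : contourInt (P.con 7) (fun w => D.L w * (k w + D.ε / 2 * deriv k w)) =
      contourInt (P.con 7) (fun w => D.L w * k w) +
        D.ε / 2 * contourInt (P.con 7) (fun w => D.L w * deriv k w) := by
    rw [← contourInt_const_mul, ← contourInt_add hp (f := fun w => D.L w * k w)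
      (g := fun w => D.ε / 2 * (D.L w * deriv k w)) (hLc.mul hkc)
      (continuousOn_const.mul (hLc.mul hk'c))]
    exact contourInt_congr fun w _ => by ring
  have hkk : ContinuousOn (fun w => k w + D.ε / 2 * deriv k w) (trace (P.con 7)) :=
    hkc.add (continuousOn_const.mul hk'c)
  have hLinc : ContinuousOn D.Lin (trace (P.con 7)) :=
    D.Lin_holo.continuousOn.mono (P.con_sub_lt h7 (by norm_num))
  have e2 : contourInt (P.con 7) (fun w => D.ld w * (k w + D.ε / 2 * deriv k w)) =
      contourInt (P.con 7) (fun w => D.Lin w * (k w + D.ε / 2 * deriv k w)) -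
      contourInt (P.con 7) (fun w => D.L w * (k w + D.ε / 2 * deriv k w)) := by
    rw [← contourInt_sub hp (f := fun w => D.Lin w * (k w + D.ε / 2 * deriv k w))
      (g := fun w => D.L w * (k w + D.ε / 2 * deriv k w)) (hLinc.mul hkk) (hLc.mul hkk)]
    refine contourInt_congr fun w hw => ?_
    have hlw := P.lvl_con h7 hw
    rw [D.L_eq (w := w) (by rw [hlw]; exact P.s_lt (by norm_num))
      (by rw [hlw]; exact P.s_lt (by norm_num))]
    ring
  rw [e2, hin, hLk, hparts]
  ring

end Step

/-- The mean of the increment. -/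
theorem exists_increment_mean (P : Setting) : ∃ K : ℝ, 0 < K ∧ ∀ (D : Step P), ∀ z ∈ P.F,
    ‖D.E (D.val (D.fX z)) - D.meanX z‖ ≤ K * D.ε ^ 2 := by
  obtain ⟨K1, hK1, h1⟩ := exists_mean_expansion P
  obtain ⟨K2, hK2, h2⟩ := exists_fun7_bound P
  obtain ⟨K3, hK3, h3⟩ := exists_Kav_bound P
  obtain ⟨K4, hK4, h4⟩ := exists_Kav_expansion P
  obtain ⟨K5, hK5, h5⟩ := exists_ld_bound P
  obtain ⟨K6, hK6, h6⟩ := exists_mean_bound P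
  have h7 : (0 : ℝ) < 7 := by norm_num
  have hg := P.g_pos
  set c := ‖(P.θ : ℂ)⁻¹ * (2 * Real.pi * Complex.I)⁻¹‖ with hc
  have hc0 : 0 ≤ c := norm_nonneg _
  have hl0 := curveLength_nonneg (P.con 7)
  refine ⟨K2 * K1 + c * ((K6 + K1 * (P.g / 8)) * K3 * curveLength (P.con 7)) +
    c * (K5 * K4 * curveLength (P.con 7)), by positivity, fun D z hz => ?_⟩
  have hε := D.ε_pos
  have hann : ∀ w ∈ trace (P.con 7), w ∈ P.ann 7 9 := fun w hw =>
    P.con_sub_ann h7 le_rfl (by norm_num) hw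
  have hlev : ∀ w ∈ trace (P.con 7), lvl P.l P.r w ≤ P.s 8 := fun w hw => by
    rw [P.lvl_con h7 hw]; exact P.s_le (by norm_num)
  have hkc := D.ker_continuousOn hz h7 (by norm_num)
  have hk'c := D.deriv_ker_continuousOn hz h7 (by norm_num)
  have hldc := D.ld_continuousOn (k := 7) (by norm_num) (by norm_num)
  have hdc := D.diag_continuousOn
  set m : ℂ → ℂ := fun w => D.E (fun e => D.τ e w) with hm
  have hmc : ContinuousOn m (trace (P.con 7)) := D.Eτ_continuousOn
  have e1 : D.E (D.val (D.fX z)) = D.fun7 z D.ld + D.fun7 z m := by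
    have e2 : D.fun7 z D.ld = D.fun7 z (fun w => D.E (fun e => D.T e w) - m w) :=
      D.fun7_congr z fun w _ => by
        have := D.E_sub (fun e => D.T e w) (fun _ => D.ld w)
        rw [D.E_const] at this
        simp only [hm, Step.τ]
        rw [this]; ring
    rw [e2, D.fun7_sub hz (D.E_continuousOn fun e =>
      D.T_continuousOn e (by norm_num) (by norm_num)) hmc, D.E_val_fX hz]
    ring
  have b1 : ‖D.fun7 z m - D.fun7 z (fun w => D.ε * D.diag w)‖ ≤ K2 * K1 * D.ε ^ 2 := by
    rw [← D.fun7_sub (v := fun w => D.ε * D.diag w) hz hmc (continuousOn_const.mul hdc),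
      mul_assoc]
    exact h2 D z hz _ _ fun w hw => h1 D w (hann w hw)
  have b2 : ‖D.fun7 z (fun w => D.ε * D.diag w) - D.ε * D.funK z D.diag‖ ≤
      c * ((K6 + K1 * (P.g / 8)) * K3 * curveLength (P.con 7)) * D.ε ^ 2 := by
    have hb := D.fun7_bound_sub hz (u := fun w => D.ε * D.diag w) (k := fun w => ker D.b w z)
      (M := (K6 + K1 * (P.g / 8)) * D.ε) (M' := K3 * D.ε) (continuousOn_const.mul hdc) hkc
      (fun w hw => ?_) fun w hw => (h3 D z w hz ((hlev w hw).trans (P.s_le (by norm_num)))).2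
    · have e3 : contourInt (P.con 7) (fun w => D.ε * D.diag w * ker D.b w z) =
        D.ε * contourInt (P.con 7) (fun w => D.diag w * ker D.b w z) := by
        rw [← contourInt_const_mul]; exact contourInt_congr fun w _ => by ring
      rw [e3] at hb
      have e4 : D.ε * D.funK z D.diag = -((P.θ : ℂ)⁻¹ * ((2 * Real.pi * Complex.I)⁻¹ *
        (D.ε * contourInt (P.con 7) (fun w => D.diag w * ker D.b w z)))) := by
        unfold Step.funK; ring
      rw [e4]
      refine hb.trans (le_of_eq ?_)
      ring
    · have h8 := h1 D w (hann w hw)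
      have h9 := (h6 D w (P.ann_mono (by norm_num) (by norm_num) (hann w hw))).2
      have e3 : D.ε * D.diag w = m w - (m w - D.ε * D.resp (D.src w) w) := by
        rw [Step.diag]; ring
      rw [e3]
      refine (norm_sub_le _ _).trans ((add_le_add h9 h8).trans ?_)
      have := mul_le_mul_of_nonneg_left (mul_le_mul_of_nonneg_right D.ε_le hε.le) hK1.le
      nlinarith
  have b3 : ‖D.fun7 z D.ld - -((P.θ : ℂ)⁻¹ * ((2 * Real.pi * Complex.I)⁻¹ *
      contourInt (P.con 7) (fun w => D.ld w * (ker D.b w z +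
        D.ε / 2 * deriv (fun w => ker D.b w z) w))))‖ ≤
      c * (K5 * K4 * curveLength (P.con 7)) * D.ε ^ 2 := by
    refine (D.fun7_bound_sub hz (u := D.ld) (k := fun w => ker D.b w z +
      D.ε / 2 * deriv (fun w => ker D.b w z) w) (M := K5) (M' := K4 * D.ε ^ 2) hldc
      (hkc.add (continuousOn_const.mul hk'c)) (fun w hw => h5 D w
        (P.ann_mono (by norm_num) (by norm_num) (hann w hw))) fun w hw => ?_).trans
        (le_of_eq (by ring))
    rw [← sub_sub]
    exact h4 D z w hz (hlev w hw)
  have e5 : D.meanX z = D.ε * D.funK z D.diag + -((P.θ : ℂ)⁻¹ * ((2 * Real.pi * Complex.I)⁻¹ *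
      contourInt (P.con 7) (fun w => D.ld w * (ker D.b w z +
        D.ε / 2 * deriv (fun w => ker D.b w z) w)))) := by
    rw [D.funK_diag hz, D.contourInt_ld_eq hz, Step.meanX, mul_inv]
    ring
  rw [e1, e5]
  have e6 : ∀ x y u v w : ℂ, x + y - (u + v) = (y - w) + (w - u) + (x - v) := by intros; ring
  rw [e6 _ _ _ _ (D.fun7 z (fun w => D.ε * D.diag w))]
  refine norm_add₃_le.trans ((add_le_add (add_le_add b1 b2) b3).trans (le_of_eq ?_))
  ring

end

section

section paths

variable {γ γ₁ γ₂ : ℝ → ℂ}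

theorem PwC1.rev (h : PwC1 γ) : PwC1 fun t => γ (1 - t) := by
  obtain ⟨h1, S, hS⟩ := h
  refine ⟨h1.comp (by fun_prop) fun t ht => ⟨by linarith [ht.2], by linarith [ht.1]⟩,
    S.image fun p => 1 - p, fun s t hs hst ht hp => ?_⟩
  refine (hS (1 - t) (1 - s) (by linarith) (by linarith) (by linarith) fun p hpS hpI =>
    hp _ (Finset.mem_image_of_mem _ hpS) ⟨by linarith [hpI.2], by linarith [hpI.1]⟩).comp
      (contDiff_const.sub contDiff_id).contDiffOn fun u hu => ?_
  exact ⟨by linarith [hu.2], by linarith [hu.1]⟩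

theorem trace_rev : trace (fun t => γ (1 - t)) ⊆ trace γ := by
  rintro _ ⟨t, ht, rfl⟩
  exact mem_trace ⟨by linarith [ht.2], by linarith [ht.1]⟩

theorem contourInt_rev (γ : ℝ → ℂ) (f : ℂ → ℂ) :
    contourInt (fun t => γ (1 - t)) f = -contourInt γ f := by
  unfold contourInt
  simp only [deriv_comp_const_sub, mul_neg, intervalIntegral.integral_neg]
  have := intervalIntegral.integral_comp_sub_left (a := 0) (b := 1)
    (fun t => f (γ t) * deriv γ t) 1
  rw [this]
  norm_num

/-- The concatenation of two curves. -/
noncomputable def join (γ₁ γ₂ : ℝ → ℂ) (t : ℝ) : ℂ :=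
  if t ≤ 1 / 2 then γ₁ (2 * t) else γ₂ (2 * t - 1)

theorem join_left {t : ℝ} (ht : t ≤ 1 / 2) : join γ₁ γ₂ t = γ₁ (2 * t) := if_pos ht

theorem join_right (h : γ₁ 1 = γ₂ 0) {t : ℝ} (ht : 1 / 2 ≤ t) : join γ₁ γ₂ t = γ₂ (2 * t - 1) := by
  rcases ht.eq_or_lt with rfl | ht
  · rw [join_left le_rfl]; norm_num [h]
  · exact if_neg (not_le.2 ht)

theorem trace_join (h : γ₁ 1 = γ₂ 0) : trace (join γ₁ γ₂) ⊆ trace γ₁ ∪ trace γ₂ := by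
  rintro _ ⟨t, ht, rfl⟩
  rcases le_total t (1 / 2) with h' | h'
  · rw [join_left h']; exact Or.inl (mem_trace ⟨by linarith [ht.1], by linarith⟩)
  · rw [join_right h h']; exact Or.inr (mem_trace ⟨by linarith, by linarith [ht.2]⟩)

theorem PwC1.join (h₁ : PwC1 γ₁) (h₂ : PwC1 γ₂) (h : γ₁ 1 = γ₂ 0) : PwC1 (join γ₁ γ₂) := by
  obtain ⟨c₁, S₁, d₁⟩ := h₁
  obtain ⟨c₂, S₂, d₂⟩ := h₂
  refine ⟨?_, S₁.image (fun p => p / 2) ∪ S₂.image (fun p => (p + 1) / 2) ∪ {1 / 2},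
    fun s t hs hst ht hp => ?_⟩
  · rw [← Icc_union_Icc_eq_Icc (a := (0 : ℝ)) (b := 1 / 2) (by norm_num) (by norm_num)]
    refine ContinuousOn.union_of_isClosed ?_ ?_ isClosed_Icc isClosed_Icc
    · exact (c₁.comp (f := fun t => 2 * t) (by fun_prop) fun t ht =>
        ⟨by linarith [ht.1], by linarith [ht.2]⟩).congr fun t ht => join_left ht.2
    · exact (c₂.comp (f := fun t => 2 * t - 1) (by fun_prop) fun t ht =>
        ⟨by linarith [ht.1], by linarith [ht.2]⟩).congr fun t ht => join_right h ht.1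
  · have hh : t ≤ 1 / 2 ∨ 1 / 2 ≤ s := by
      by_contra! hc
      exact hp (1 / 2) (by simp) ⟨hc.2, hc.1⟩
    rcases hh with hh | hh
    · refine ((d₁ (2 * s) (2 * t) (by linarith) (by linarith) (by linarith) fun p hpS hpI =>
        hp (p / 2) (Finset.mem_union_left _ (Finset.mem_union_left _
          (Finset.mem_image_of_mem _ hpS))) ⟨by linarith [hpI.1], by linarith [hpI.2]⟩).comp
        (f := fun t => 2 * t) (by fun_prop) fun u hu =>
          ⟨by linarith [hu.1], by linarith [hu.2]⟩).congr fun u hu => join_left (hu.2.trans hh)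
    · refine ((d₂ (2 * s - 1) (2 * t - 1) (by linarith) (by linarith) (by linarith) fun p hpS hpI =>
        hp ((p + 1) / 2) (Finset.mem_union_left _ (Finset.mem_union_right _
          (Finset.mem_image_of_mem _ hpS))) ⟨by linarith [hpI.1], by linarith [hpI.2]⟩).comp
        (f := fun t => 2 * t - 1) (by fun_prop) fun u hu =>
          ⟨by linarith [hu.1], by linarith [hu.2]⟩).congr fun u hu => join_right h (hh.trans hu.1)

theorem contourInt_join (h₁ : PwC1 γ₁) (h₂ : PwC1 γ₂) (h : γ₁ 1 = γ₂ 0) {f : ℂ → ℂ}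
    (hf : ContinuousOn f (trace γ₁ ∪ trace γ₂)) :
    contourInt (join γ₁ γ₂) f = contourInt γ₁ f + contourInt γ₂ f := by
  have hi := (h₁.join h₂ h).integrable (hf.mono (trace_join h))
  unfold contourInt
  rw [← intervalIntegral.integral_add_adjacent_intervals (b := 1 / 2)
    (hi.mono_set (uIcc_subset_uIcc (by simp) (by norm_num [uIcc_of_le])))
    (hi.mono_set (uIcc_subset_uIcc (by norm_num [uIcc_of_le]) (by simp)))]
  congr 1
  · have e := intervalIntegral.smul_integral_comp_mul_left (a := 0) (b := 1 / 2)
      (fun t => f (γ₁ t) * deriv γ₁ t) 2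
    norm_num at e
    rw [← e, ← intervalIntegral.integral_const_mul]
    refine intervalIntegral.integral_congr_ae' ?_ (by norm_num)
    filter_upwards [compl_mem_ae_iff.2 (measure_singleton (1 / 2 : ℝ))] with t ht1 ht
    have ht2 : t < 1 / 2 := lt_of_le_of_ne ht.2 ht1
    have e1 : join γ₁ γ₂ =ᶠ[𝓝 t] fun t => γ₁ (2 * t) := by
      filter_upwards [Iio_mem_nhds ht2] with u hu using join_left (le_of_lt hu)
    rw [e1.deriv_eq, join_left ht2.le, deriv_comp_mul_left]
    simp; ring
  · have e := intervalIntegral.smul_integral_comp_mul_sub (a := 1 / 2) (b := 1)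
      (fun t => f (γ₂ t) * deriv γ₂ t) 2 1
    norm_num at e
    rw [← e, ← intervalIntegral.integral_const_mul]
    refine intervalIntegral.integral_congr_ae' ?_ (by norm_num)
    refine Eventually.of_forall fun t ht => ?_
    have e1 : join γ₁ γ₂ =ᶠ[𝓝 t] fun t => γ₂ (2 * t - 1) := by
      filter_upwards [Ioi_mem_nhds ht.1] with u hu using join_right h (le_of_lt hu)
    rw [e1.deriv_eq, join_right h ht.1.le,
      deriv_comp_mul_left 2 (fun u => γ₂ (u - 1)) t, deriv_comp_sub_const]
    simp; ring

theorem pwC1_line (a b : ℂ) : PwC1 fun t : ℝ => a + t * (b - a) :=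
  ⟨by fun_prop, ∅, fun _ _ _ _ _ _ => by
    have : ContDiff ℝ 1 (fun t : ℝ => (t : ℂ)) := Complex.ofRealCLM.contDiff
    fun_prop⟩

end paths

/-- A nonvanishing holomorphic function without winding has a logarithm. -/
theorem exists_isLogBranch {U : Set ℂ} (hU : IsOpen U) {f : ℂ → ℂ} (hf : DifferentiableOn ℂ f U)
    (h0 : ∀ z ∈ U, f z ≠ 0)
    (hw : ∀ γ, IsLoop γ → trace γ ⊆ U → contourInt γ (fun w => deriv f w / f w) = 0) :
    ∃ L, IsLogBranch U f L := by
  set q : ℂ → ℂ := fun w => deriv f w / f w with hq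
  have hqh : DifferentiableOn ℂ q U := (hf.deriv hU).fun_div hf h0
  let J : ℂ → ℂ → (ℝ → ℂ) → Prop := fun z w γ => PwC1 γ ∧ γ 0 = z ∧ γ 1 = w ∧ trace γ ⊆ U
  have Jtrans : ∀ {z w u γ γ'}, J z w γ → J w u γ' → J z u (join γ γ') ∧
      contourInt (join γ γ') q = contourInt γ q + contourInt γ' q := by
    rintro z w u γ γ' ⟨a1, a2, a3, a4⟩ ⟨b1, b2, b3, b4⟩
    have h : γ 1 = γ' 0 := a3.trans b2.symm
    refine ⟨⟨a1.join b1 h, ?_, ?_, (trace_join h).trans (union_subset a4 b4)⟩,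
      contourInt_join a1 b1 h (hqh.continuousOn.mono (union_subset a4 b4))⟩
    · rw [join_left (by norm_num), mul_zero, a2]
    · rw [join_right h (by norm_num), ← b3]; norm_num
  have Jrev : ∀ {z w γ}, J z w γ → J w z (fun t => γ (1 - t)) := by
    rintro z w γ ⟨a1, a2, a3, a4⟩
    exact ⟨a1.rev, by simpa using a3, by simpa using a2, trace_rev.trans a4⟩
  have Juniq : ∀ {z w γ γ'}, J z w γ → J z w γ' → contourInt γ q = contourInt γ' q := by
    intro z w γ γ' h h'
    obtain ⟨⟨c1, c2, c3, c4⟩, e⟩ := Jtrans h (Jrev h')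
    rw [hw _ (c1.isLoop (c2.trans c3.symm)) c4, contourInt_rev] at e
    linear_combination -e
  have Jrefl : ∀ {z}, z ∈ U → J z z (fun _ => z) := fun {z} hz =>
    ⟨(isLoop_const z).pwC1, rfl, rfl, by rintro _ ⟨t, -, rfl⟩; exact hz⟩
  let β : ℂ → ℂ := fun w => Classical.epsilon fun z => ∃ γ, J z w γ
  have hβ : ∀ w, w ∈ U → ∃ γ, J (β w) w γ := fun w hw' =>
    Classical.epsilon_spec (p := fun z => ∃ γ, J z w γ) ⟨w, _, Jrefl hw'⟩
  have hβeq : ∀ {w w' γ}, J w w' γ → β w = β w' := by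
    intro w w' γ h
    have : (fun z => ∃ γ, J z w γ) = fun z => ∃ γ, J z w' γ := by
      funext z
      exact propext ⟨fun ⟨_, h1⟩ => ⟨_, (Jtrans h1 h).1⟩, fun ⟨_, h1⟩ => ⟨_, (Jtrans h1 (Jrev h)).1⟩⟩
    simp only [β, this]
  choose! Γ hΓ using hβ
  let L : ℂ → ℂ := fun w => Complex.log (f (β w)) + contourInt (Γ w) q
  have hL : ∀ w ∈ U, HasDerivAt L (q w) w := by
    intro w hwU
    obtain ⟨ρ, hρ, hb⟩ := Metric.isOpen_iff.1 hU w hwU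
    obtain ⟨Q, hQ⟩ := (hqh.mono hb).isExactOn_ball
    have e : L =ᶠ[𝓝 w] fun u => L w + (Q u - Q w) := by
      filter_upwards [Metric.ball_mem_nhds w hρ] with u hu
      have ht : trace (fun t : ℝ => w + t * (u - w)) ⊆ Metric.ball w ρ := by
        rintro _ ⟨t, ht, rfl⟩
        rw [mem_ball_iff_norm] at hu ⊢
        rw [add_sub_cancel_left, norm_mul, Complex.norm_real, Real.norm_of_nonneg ht.1]
        exact (mul_le_of_le_one_left (norm_nonneg _) ht.2).trans_lt hu
      have hj : J w u (fun t : ℝ => w + t * (u - w)) :=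
        ⟨pwC1_line w u, by simp, by simp, ht.trans hb⟩
      have e1 := (Jtrans (hΓ w hwU) hj)
      have e2 := Juniq (hβeq hj ▸ e1.1) (hΓ u (hb hu))
      have e3 := (pwC1_line w u).contourInt_deriv Metric.isOpen_ball ht (F := Q)
        fun v hv => (hQ v hv).differentiableAt.differentiableWithinAt
      rw [contourInt_congr fun v hv => (hQ v (ht hv)).deriv] at e3
      simp only [L]
      rw [← hβeq hj, ← e2, e1.2, e3]
      simp; ring
    exact (((hQ w (Metric.mem_ball_self hρ)).sub_const (Q w)).const_add (L w)).congr_of_eventuallyEq e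
  refine ⟨L, fun w hw' => (hL w hw').differentiableAt.differentiableWithinAt, fun w hwU => ?_⟩
  have hd : ∀ u ∈ U, HasDerivAt (fun u => f u * Complex.exp (-L u)) 0 u := fun u hu => by
    refine ((hf.differentiableAt (hU.mem_nhds hu)).hasDerivAt.mul
      (hL u hu).neg.cexp).congr_deriv ?_
    have := h0 u hu
    simp only [hq]
    field_simp
    ring
  obtain ⟨a1, a2, a3, a4⟩ := hΓ w hwU
  have e := a1.contourInt_deriv hU a4 (F := fun u => f u * Complex.exp (-L u)) fun u hu =>
    (hd u hu).differentiableAt.differentiableWithinAt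
  rw [contourInt_congr fun v hv => (hd v (a4 hv)).deriv, a2, a3] at e
  have hβU : β w ∈ U := a2 ▸ a4 (mem_trace (by simp))
  have hLβ : L (β w) = Complex.log (f (β w)) := by
    have h1 := hΓ (β w) hβU
    rw [hβeq (hΓ w hwU)] at h1
    simp only [L]
    rw [hβeq (hΓ w hwU), Juniq h1 (Jrefl hβU), contourInt_const, add_zero]
  have e2 : f (β w) * Complex.exp (-L (β w)) = 1 := by
    rw [hLβ, Complex.exp_neg, Complex.exp_log (h0 _ hβU), mul_inv_cancel₀ (h0 _ hβU)]
  have e3 : contourInt (Γ w) (fun _ => 0) = 0 := by simp [contourInt]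
  rw [e2, e3, Complex.exp_neg, eq_comm, sub_eq_zero, ← div_eq_mul_inv,
    div_eq_one_iff_eq (Complex.exp_ne_zero _)] at e
  exact e.symm

/-- The logarithm of `𝓑` exists. -/
theorem Conf.exists_branch {P : Setting} (D : Conf P) : ∃ L, IsLogBranch (P.Λ \ seg P.l P.r)
    (B P.θ (P.N / D.n) P.l P.r D.b D.φp D.φm D.x) L := by
  have hne : ∀ z ∈ P.Λ \ seg P.l P.r, B P.θ (P.N / D.n) P.l P.r D.b D.φp D.φm D.x z ≠ 0 :=
    fun z hz h0 => by
      have hS : ({z} : Set ℂ) ⊆ P.Λ \ seg P.l P.r := singleton_subset_iff.2 hz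
      have h1 := (D.adm.stable.bounds {z} isCompact_singleton hS z rfl).1
      have h2 := P.c_pos {z} isCompact_singleton hS
      rw [h0, norm_zero] at h1
      exact h1.not_gt h2
  refine exists_isLogBranch P.isOpen_off (((D.conf.G_holo P.lr.le P.seg_sub _ _ _).mul
    (D.adm.asymp.φp_holo.mono sdiff_subset)).add (D.adm.asymp.φm_holo.mono sdiff_subset))
    hne fun γ hγ ht => ?_
  have := D.adm.stable.no_winding γ hγ ht
  exact (mul_eq_zero.1 this).resolve_left (inv_ne_zero two_pi_I_ne_zero)

end

section

open Conf

variable {P : Setting}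

theorem Encloses.contourInt_eq {E : Set ℂ} (hE : IsClosed E) {ω₁ ω₂ : ℝ → ℂ}
    (h₁ : Encloses P.Λ P.l P.r E ω₁) (h₂ : Encloses P.Λ P.l P.r E ω₂) {f : ℂ → ℂ}
    (hf : DifferentiableOn ℂ f ((P.Λ \ seg P.l P.r) \ E)) :
    contourInt ω₁ f = contourInt ω₂ f := by
  refine DynLoop.contourInt_eq (P.isOpen_off.sdiff hE) h₁.isLoop h₂.isLoop
    (fun w hw => ⟨h₁.trace_subset hw, disjoint_left.1 h₁.disjoint hw⟩)
    (fun w hw => ⟨h₂.trace_subset hw, disjoint_left.1 h₂.disjoint hw⟩) (fun a ha => ?_) hf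
  by_cases h1 : a ∈ P.Λ
  · by_cases h2 : a ∈ seg P.l P.r
    · rw [h₁.winding_seg a h2, h₂.winding_seg a h2]
    · have h3 : a ∈ E := by
        by_contra h3
        exact ha ⟨⟨h1, h2⟩, h3⟩
      rw [h₁.winding_excluded a h3, h₂.winding_excluded a h3]
  · rw [h₁.winding_outside a h1, h₂.winding_outside a h1]

theorem Setting.encloses_con {k : ℝ} (hk : 0 < k) (hk' : k ≤ 10) {E : Set ℂ}
    (hE : ∀ a ∈ E, P.s k < lvl P.l P.r a) : Encloses P.Λ P.l P.r E (P.con k) where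
  isLoop := P.isLoop_con hk
  trace_subset := (P.con_sub_ann hk le_rfl le_rfl).trans (P.ann_sub hk hk')
  disjoint := disjoint_left.2 fun _ hw hE' => (hE _ hE').ne' (P.lvl_con hk hw)
  winding_seg _ ha := P.winding_con_in hk (P.lvl_seg_lt hk ha)
  winding_excluded _ ha := P.winding_con_out hk (hE _ ha)
  winding_outside := P.winding_con_off hk hk'

/-- A contour around `[l, r]` can be replaced by a reference contour. -/
theorem Encloses.contourInt_eq_con {E : Set ℂ} (hE : IsClosed E) (hEF : E ⊆ P.F) {ω : ℝ → ℂ}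
    (h : Encloses P.Λ P.l P.r E ω) {k : ℝ} (hk : 0 < k) (hk' : k ≤ 10) {f : ℂ → ℂ}
    (hf : DifferentiableOn ℂ f ((P.Λ \ seg P.l P.r) \ E)) :
    contourInt ω f = contourInt (P.con k) f :=
  h.contourInt_eq hE (P.encloses_con hk hk' fun a ha =>
    (P.s_le hk').trans_lt (P.F_far a (hEF ha))) hf

theorem Conformal.continuousOn_ker {Λ : Set ℂ} {b : ℂ → ℂ} (h : Conformal Λ b) {S T : Set ℂ}
    (hS : S ⊆ Λ) (hT : T ⊆ Λ) (hST : Disjoint S T) :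
    ContinuousOn (fun p : ℂ × ℂ => ker b p.2 p.1) (S ×ˢ T) := by
  have m1 : MapsTo Prod.fst (S ×ˢ T) Λ := fun p hp => hS hp.1
  have m2 : MapsTo Prod.snd (S ×ˢ T) Λ := fun p hp => hT hp.2
  have hd := h.deriv_holo.continuousOn
  have hb := h.holo.continuousOn
  exact ((hd.comp continuousOn_snd m2).mul (hd.comp continuousOn_fst m1)).div
    (((hb.comp continuousOn_snd m2).sub (hb.comp continuousOn_fst m1)).pow 2) fun p hp =>
      pow_ne_zero _ (h.sub_ne (m2 hp) (m1 hp) fun h0 => disjoint_left.1 hST hp.1 (h0 ▸ hp.2))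

/-- The index of a reference contour which does not enclose `w`. -/
noncomputable def Setting.lev (P : Setting) (w : ℂ) : ℝ :=
  min 1 ((lvl P.l P.r w - (P.r - P.l)) / (2 * P.g))

theorem Setting.lev_spec {w : ℂ} (hw : w ∉ seg P.l P.r) :
    0 < P.lev w ∧ P.lev w ≤ 1 ∧ P.s (P.lev w) < lvl P.l P.r w := by
  have h1 := lt_lvl_of_notMem_seg P.lr hw
  have hg := P.g_pos
  refine ⟨lt_min one_pos (div_pos (by linarith) (by linarith)), min_le_left _ _, ?_⟩
  have h2 : P.lev w ≤ (lvl P.l P.r w - (P.r - P.l)) / (2 * P.g) := min_le_right _ _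
  rw [le_div_iff₀ (by linarith)] at h2
  unfold Setting.s
  linarith

namespace Step

variable (D : Step P)

/-- The inner integral of the correction. -/
noncomputable def inner (w : ℂ) : ℂ :=
  contourInt (P.con (P.lev w)) (fun u => D.L u * ker D.b u w)

theorem inner_eq {w : ℂ} (hw : w ∈ P.Λ \ seg P.l P.r) {ω : ℝ → ℂ}
    (h : Encloses P.Λ P.l P.r {w} ω) :
    contourInt ω (fun u => D.L u * ker D.b u w) = D.inner w := by
  obtain ⟨h1, h2, h3⟩ := P.lev_spec hw.2
  refine h.contourInt_eq isClosed_singleton (P.encloses_con h1 (by linarith) fun a ha => by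
    rwa [mem_singleton_iff.1 ha]) ?_
  exact (D.branch.1.mono sdiff_subset).mul
    ((D.conf.ker_holo hw.1).mono fun u hu => ⟨hu.1.1, hu.2⟩)

theorem inner_eq_con {w : ℂ} {k : ℝ} (hk : 0 < k) (hk' : k ≤ 10) (hw : w ∈ P.Λ)
    (h : P.s k < lvl P.l P.r w) :
    D.inner w = contourInt (P.con k) (fun u => D.L u * ker D.b u w) :=
  (D.inner_eq (mem_of_level hk.le hw h) (P.encloses_con hk hk' fun a ha => by
    rwa [mem_singleton_iff.1 ha])).symm

theorem inner_holo : DifferentiableOn ℂ D.inner (P.Λ \ seg P.l P.r) := by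
  intro w hw
  obtain ⟨h1, h2, h3⟩ := P.lev_spec hw.2
  set k := P.lev w
  have h10 : k ≤ 10 := by linarith
  have hV : IsOpen (P.Λ ∩ {z | P.s k < lvl P.l P.r z}) := P.isOpen.inter (isOpen_lt_lvl _ _ _)
  have hs := P.con_sub h1 h10
  have hne : Disjoint (P.Λ ∩ {z | P.s k < lvl P.l P.r z}) (trace (P.con k)) :=
    disjoint_left.2 fun z hz hz' => hz.2.ne' (P.lvl_con h1 hz')
  have hd := differentiableOn_contourInt hV (P.isLoop_con h1).pwC1
    (f := fun z u => D.L u * ker D.b u z) (((D.L_continuousOn_con h1 h10).comp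
      continuousOn_snd fun p hp => hp.2).mul (D.conf.continuousOn_ker inter_subset_left hs hne))
    fun u hu => ?_
  · refine ((hd.congr fun z hz => ?_).differentiableAt
      (hV.mem_nhds ⟨hw.1, h3⟩)).differentiableWithinAt
    exact D.inner_eq_con h1 h10 hz.1 hz.2
  · simp only [ker_comm D.b u]
    exact ((D.conf.ker_holo (hs hu)).mono fun z hz =>
      ⟨hz.1, fun h0 => disjoint_left.1 hne hz (mem_singleton_iff.1 h0 ▸ hu)⟩).const_mul _

/-- The expansion of the mean does not depend on the contours. -/
theorem leading_add_correction {z : ℂ} (hz : z ∈ P.F) {ω : ℝ → ℂ}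
    (hω : Encloses P.Λ P.l P.r {z} ω) {ω' : ℂ → ℝ → ℂ}
    (hω' : ∀ w ∈ trace ω, Encloses P.Λ P.l P.r {w} (ω' w)) :
    leading P.θ D.b D.L ω z +
      correction P.θ D.ε P.l P.r D.b D.φp D.φm D.x D.L ω ω' z = D.meanX z := by
  have hzΛ := P.F_sub hz
  have hzF : ({z} : Set ℂ) ⊆ P.F := singleton_subset_iff.2 hz
  set V := (P.Λ \ seg P.l P.r) \ {z} with hV
  have hVo : V ⊆ P.Λ \ seg P.l P.r := sdiff_subset
  have hVΛ : V ⊆ P.Λ := hVo.trans sdiff_subset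
  have hk : DifferentiableOn ℂ (fun w => ker D.b w z) V :=
    (D.conf.ker_holo hzΛ).mono fun u hu => ⟨hu.1.1, hu.2⟩
  have htr : trace ω ⊆ V := fun w hw => ⟨hω.trace_subset hw, disjoint_left.1 hω.disjoint hw⟩
  have hf1 : DifferentiableOn ℂ (fun w => D.A w * (P.θ * deriv D.b w / (D.b z - D.b w) +
      (P.θ * (2 * Real.pi * Complex.I)⁻¹ * D.inner w + D.A3 w)) * ker D.b w z) V := by
    refine ((D.A_holo.mono hVo).fun_mul ((((D.conf.deriv_holo.mono hVΛ).const_mul _).fun_div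
      ((D.conf.holo.mono hVΛ).const_sub _) fun w hw => D.conf.sub_ne hzΛ (hVΛ hw)
        (Ne.symm hw.2)).fun_add (((D.inner_holo.mono hVo).const_mul _).fun_add
          (D.A3_holo.mono hVo)))).fun_mul hk
  have hf2 : DifferentiableOn ℂ (fun w => deriv D.Bf w / (2 * D.Bf w) * ker D.b w z) V :=
    (((D.Bf_holo.deriv P.isOpen_off).fun_div (D.Bf_holo.const_mul 2) fun w hw =>
      mul_ne_zero two_ne_zero (D.Bf_ne hw)).mono hVo).fun_mul hk
  have e0 := hω.contourInt_eq_con isClosed_singleton hzF (k := 7) (by norm_num) (by norm_num)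
    (f := fun w => D.L w * ker D.b w z) ((D.branch.1.mono hVo).fun_mul hk)
  have e1 := hω.contourInt_eq_con isClosed_singleton hzF (k := 6) (by norm_num) (by norm_num) hf1
  have e2 := hω.contourInt_eq_con isClosed_singleton hzF (k := 7) (by norm_num) (by norm_num) hf2
  have e3 : contourInt (P.con 6) (fun w => D.A w * (P.θ * deriv D.b w / (D.b z - D.b w) +
      (P.θ * (2 * Real.pi * Complex.I)⁻¹ * D.inner w + D.A3 w)) * ker D.b w z) =
      contourInt (P.con 6) (fun w =>
        D.A w * (P.θ * deriv D.b w / (D.b z - D.b w) + D.κ w) * ker D.b w z) := by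
    refine contourInt_congr fun w hw => ?_
    have hwΛ : w ∈ P.Λ := P.con_sub (by norm_num) (by norm_num) hw
    have h1 : P.s 1 < lvl P.l P.r w := by
      rw [P.lvl_con (by norm_num) hw]; exact P.s_lt (by norm_num)
    rw [κ, D.deriv_ld hwΛ h1, D.inner_eq_con one_pos (by norm_num) hwΛ h1]
    ring
  have e4 : contourInt ω (fun w =>
      E2 P.θ D.ε P.l P.r D.b D.φp D.φm D.x D.L (ω' w) w z * ker D.b w z) =
      contourInt ω (fun w => D.A w * (P.θ * deriv D.b w / (D.b z - D.b w) +
      (P.θ * (2 * Real.pi * Complex.I)⁻¹ * D.inner w + D.A3 w)) * ker D.b w z) -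
      contourInt ω (fun w => deriv D.Bf w / (2 * D.Bf w) * ker D.b w z) := by
    rw [← contourInt_sub hω.isLoop.pwC1 (hf1.continuousOn.mono htr) (hf2.continuousOn.mono htr)]
    refine contourInt_congr fun w hw => ?_
    have h1 : E2 P.θ D.ε P.l P.r D.b D.φp D.φm D.x D.L (ω' w) w z =
        D.φp w * D.Gf w / D.Bf w * (P.θ * deriv D.b w / (D.b z - D.b w) +
          P.θ / (2 * Real.pi * Complex.I) *
            contourInt (ω' w) (fun u => D.L u * ker D.b u w) + D.A3 w) -
          deriv D.Bf w / (2 * D.Bf w) := rfl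
    rw [h1, D.inner_eq (hVo (htr hw)) (hω' w hw), A]
    ring
  rw [leading, correction, e4, e0, e1, e2, e3, meanX]
  ring

theorem cov_eq {z₁ z₂ : ℂ} {E : Set ℂ} (hE : IsClosed E) (hEF : E ⊆ P.F) (h₁ : z₁ ∈ E)
    (h₂ : z₂ ∈ E) {ω : ℝ → ℂ} (hω : Encloses P.Λ P.l P.r E ω) :
    cov P.θ D.ε P.l P.r D.b D.φp D.φm D.x ω z₁ z₂ = D.covc z₁ z₂ := by
  have hk : ∀ z ∈ E, DifferentiableOn ℂ (fun w => ker D.b w z) ((P.Λ \ seg P.l P.r) \ E) :=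
    fun z hz => (D.conf.ker_holo (P.F_sub (hEF hz))).mono fun u hu =>
      ⟨hu.1.1, fun h => hu.2 (mem_singleton_iff.1 h ▸ hz)⟩
  have h := hω.contourInt_eq_con hE hEF (k := 6) (by norm_num) (by norm_num)
    (((D.A_holo.mono sdiff_subset).fun_mul (hk _ h₁)).fun_mul (hk _ h₂))
  rw [covc, ← h]
  rfl

theorem deltaM_eq {z : ℂ} (hz : z ∈ P.F) (e : Fin D.n → Fin 2) :
    deltaM P.θ D.ε D.b D.φp D.φm D.x e z = D.cen (D.fX z) e := by
  have h : (fun e => increment P.θ D.ε D.b D.x e z) = D.val (D.fX z) :=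
    funext fun e => D.increment_eq hz e
  rw [deltaM, D.increment_eq hz, h]
  rfl

end Step

end

section

open Conf

/-- There is room for ellipses between the segment and a compact set off the segment. -/
theorem exists_margin {l r : ℝ} (hlr : l < r) {Λ F : Set ℂ} (hΛ : IsOpen Λ) (hseg : seg l r ⊆ Λ)
    (hF : IsCompact F) (hFΛ : F ⊆ Λ \ seg l r) : ∃ g : ℝ, 0 < g ∧
    {z | lvl l r z ≤ r - l + 10 * g} ⊆ Λ ∧ ∀ z ∈ F, r - l + 10 * g < lvl l r z := by
  have hK : IsCompact ({z | lvl l r z ≤ r - l + 1} ∩ Λᶜ ∪ F) :=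
    ((isCompact_lvl_le l r _).inter_right hΛ.isClosed_compl).union hF
  obtain ⟨m, hm, h⟩ := hK.exists_forall_le' (continuous_lvl l r).continuousOn (a := r - l)
    fun z hz => lt_lvl_of_notMem_seg hlr (hz.elim (fun h h' => h.2 (hseg h')) fun h => (hFΛ h).2)
  have h1 : min 1 (m - (r - l)) ≤ 1 := min_le_left _ _
  have h2 : min 1 (m - (r - l)) ≤ m - (r - l) := min_le_right _ _
  have h0 : 0 < min 1 (m - (r - l)) := lt_min one_pos (by linarith)
  refine ⟨min 1 (m - (r - l)) / 20, by positivity, fun z hz => ?_, fun z hz => ?_⟩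
  · rw [mem_ofPred_eq] at hz
    by_contra hzΛ
    have := h z (Or.inl ⟨by rw [mem_ofPred_eq]; linarith, hzΛ⟩)
    linarith
  · have := h z (Or.inr hz)
    linarith

theorem Admissible.lt {θ N l r C : ℝ} {Λ : Set ℂ} {c : Set ℂ → ℝ} {n : ℕ} {x : Fin n → ℝ}
    {b φp φm : ℂ → ℂ} (hN : 0 < N) (h : Admissible θ N l r C Λ c n x b φp φm) : l < r := by
  have hn := h.asymp.n_pos
  have h1 := h.asymp.lower ⟨0, hn⟩
  have h2 := h.asymp.upper ⟨0, hn⟩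
  have : 0 < N / n := by positivity
  linarith

theorem Conf.expect_deltaM {P : Setting} (D : Conf P) (z : ℂ) :
    expect P.θ D.ε D.b D.φp D.φm D.x (fun e => deltaM P.θ D.ε D.b D.φp D.φm D.x e z) = 0 := by
  have := D.E_sub (fun e => increment P.θ D.ε D.b D.x e z)
    fun _ => D.E fun e => increment P.θ D.ε D.b D.x e z
  rw [D.E_const, sub_self] at this
  exact this

/-- The joint moments of the rescaled fluctuations. -/
theorem exists_normalized_moments (P : Setting) (p : ℕ) : ∃ K : ℝ, 0 < K ∧
    ∀ (D : Step P) (z : Fin p → ℂ), (∀ k, z k ∈ P.F) →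
    ‖expect P.θ D.ε D.b D.φp D.φm D.x (fun e =>
      ∏ k, deltaM P.θ D.ε D.b D.φp D.φm D.x e (z k) / (√D.ε : ℝ)) -
      gaussianMoment (fun i j => D.covc (z i) (z j))‖ ≤ K * √D.ε := by
  obtain ⟨K, hK, h⟩ := exists_moments P p p
  refine ⟨K, hK, fun D z hz => ?_⟩
  have h1 := h D z hz Finset.univ (Finset.card_fin p)
  have hσ := D.σ_pos
  have hσ' : (D.σ : ℂ) ≠ 0 := by exact_mod_cast hσ.ne'
  have e1 : expect P.θ D.ε D.b D.φp D.φm D.x (fun e =>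
      ∏ k, deltaM P.θ D.ε D.b D.φp D.φm D.x e (z k) / (√D.ε : ℝ)) =
      (D.σ : ℂ)⁻¹ ^ p * D.E (fun e => ∏ k, D.cen (D.fX (z k)) e) := by
    rw [D.expect_eq, ← D.E_mul_left]
    congr 1
    funext e
    simp only [D.deltaM_eq (hz _), div_eq_mul_inv, Finset.prod_mul_distrib, Finset.prod_const,
      Finset.card_univ, Fintype.card_fin]
    exact mul_comm _ _
  rw [wickSum_univ] at h1
  rw [e1, show gaussianMoment (fun i j => D.covc (z i) (z j)) = (D.σ : ℂ)⁻¹ ^ p *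
    (D.σ ^ p * gaussianMoment (fun i j => D.covc (z i) (z j))) by
      rw [← mul_assoc, ← mul_pow, inv_mul_cancel₀ hσ', one_pow, one_mul], ← mul_sub, norm_mul,
    norm_pow, norm_inv, Complex.norm_real, Real.norm_of_nonneg hσ.le]
  refine (mul_le_mul_of_nonneg_left h1 (by positivity)).trans (le_of_eq ?_)
  change _ = K * D.σ
  rw [mul_left_comm, pow_succ, ← mul_assoc (D.σ⁻¹ ^ p), ← mul_pow, inv_mul_cancel₀ hσ.ne', one_pow,
    one_mul]

theorem gaussianMoment_two (K : Fin 2 → Fin 2 → ℂ) : gaussianMoment K = K 0 1 := by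
  have h1 : ((Finset.univ : Finset (Equiv.Perm (Fin 2))).filter
      fun σ => ∀ i, σ (σ i) = i ∧ σ i ≠ i) = {Equiv.swap 0 1} := by decide
  have h2 : (Finset.univ.filter fun i : Fin 2 => i < Equiv.swap 0 1 i) = {0} := by decide
  rw [gaussianMoment, h1, Finset.sum_singleton, h2, Finset.prod_singleton, Equiv.swap_apply_left]

/-- An error of order `√ε` is eventually small. -/
theorem exists_threshold {K δ a : ℝ} (hK : 0 < K) (hδ : 0 < δ) (ha : 0 < a) :
    ∃ ε₀ : ℝ, 0 < ε₀ ∧ ∀ ε : ℝ, ε < ε₀ → ε < a ∧ K * √ε ≤ δ := by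
  refine ⟨min a ((δ / K) ^ 2), by positivity, fun ε hε => ⟨hε.trans_le (min_le_left _ _), ?_⟩⟩
  have := (Real.sqrt_lt' (by positivity)).2 (hε.trans_le (min_le_right _ _))
  rw [lt_div_iff₀ hK] at this
  linarith

end

end DynLoop

theorem theoremt (θ N l r C : ℝ) (Λ : Set ℂ) (c : Set ℂ → ℝ)
    (hθ : 0 < θ) (hN : 0 < N) (hC : 0 < C) (hΛ : IsOpen Λ) (hseg : DynLoop.seg l r ⊆ Λ)
    (hc : ∀ S : Set ℂ, IsCompact S → S ⊆ Λ \ DynLoop.seg l r → 0 < c S) :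
    -- the transition weights form a probability distribution, `ln 𝓑` exists, `Δℳ` has mean zero
    (∀ (n : ℕ) (x : Fin n → ℝ) (b φp φm : ℂ → ℂ),
      DynLoop.Admissible θ N l r C Λ c n x b φp φm →
        (∀ e, 0 ≤ (DynLoop.prob θ (N / n) b φp φm x e).re ∧
          (DynLoop.prob θ (N / n) b φp φm x e).im = 0) ∧
        ∑ e, DynLoop.prob θ (N / n) b φp φm x e = 1 ∧
        (∃ L : ℂ → ℂ,
          DynLoop.IsLogBranch (Λ \ DynLoop.seg l r) (DynLoop.B θ (N / n) l r b φp φm x) L) ∧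
        ∀ z ∈ Λ \ DynLoop.seg l r, DynLoop.expect θ (N / n) b φp φm x
          (fun e => DynLoop.deltaM θ (N / n) b φp φm x e z) = 0) ∧
    ∀ F : Set ℂ, IsCompact F → F ⊆ Λ \ DynLoop.seg l r →
      -- the expansion, with an error `O(ε²)`
      (∃ K ε₀ : ℝ, 0 < ε₀ ∧ ∀ (n : ℕ) (x : Fin n → ℝ) (b φp φm : ℂ → ℂ),
        N / n < ε₀ → DynLoop.Admissible θ N l r C Λ c n x b φp φm →
        ∀ L : ℂ → ℂ,
          DynLoop.IsLogBranch (Λ \ DynLoop.seg l r) (DynLoop.B θ (N / n) l r b φp φm x) L →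
        ∀ z ∈ F, ∀ ω : ℝ → ℂ, DynLoop.Encloses Λ l r {z} ω →
        ∀ ω' : ℂ → ℝ → ℂ, (∀ w ∈ DynLoop.trace ω, DynLoop.Encloses Λ l r {w} (ω' w)) →
        ∀ e : Fin n → Fin 2,
          ‖DynLoop.increment θ (N / n) b x e z -
            (DynLoop.leading θ b L ω z
              + DynLoop.correction θ (N / n) l r b φp φm x L ω ω' z
              + DynLoop.deltaM θ (N / n) b φp φm x e z)‖ ≤ K * (N / n) ^ 2) ∧
      -- the covariance, with an error `o(1)`
      (∀ δ : ℝ, 0 < δ → ∃ ε₀ : ℝ, 0 < ε₀ ∧ ∀ (n : ℕ) (x : Fin n → ℝ) (b φp φm : ℂ → ℂ),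
        N / n < ε₀ → DynLoop.Admissible θ N l r C Λ c n x b φp φm →
        ∀ z₁ ∈ F, ∀ z₂ ∈ F, ∀ ω : ℝ → ℂ, DynLoop.Encloses Λ l r {z₁, z₂} ω →
          ‖DynLoop.expect θ (N / n) b φp φm x (fun e =>
              DynLoop.deltaM θ (N / n) b φp φm x e z₁ / (√(N / n) : ℝ) *
                (DynLoop.deltaM θ (N / n) b φp φm x e z₂ / (√(N / n) : ℝ))) -
            DynLoop.cov θ (N / n) l r b φp φm x ω z₁ z₂‖ ≤ δ) ∧
      -- all joint moments are asymptotically those of the centred Gaussian field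
      (∀ (p : ℕ) (δ : ℝ), 0 < δ → ∃ ε₀ : ℝ, 0 < ε₀ ∧
        ∀ (n : ℕ) (x : Fin n → ℝ) (b φp φm : ℂ → ℂ),
        N / n < ε₀ → DynLoop.Admissible θ N l r C Λ c n x b φp φm →
        ∀ z : Fin p → ℂ, (∀ k, z k ∈ F) →
        ∀ ω : ℝ → ℂ, DynLoop.Encloses Λ l r (Set.range z) ω →
          ‖DynLoop.expect θ (N / n) b φp φm x (fun e =>
              ∏ k, DynLoop.deltaM θ (N / n) b φp φm x e (z k) / (√(N / n) : ℝ)) -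
            DynLoop.gaussianMoment (fun i j =>
              DynLoop.cov θ (N / n) l r b φp φm x ω (z i) (z j))‖ ≤ δ) := by

  open DynLoop in
  refine ⟨fun n x b φp φm hD => ?_, fun F hF hFΛ => ?_⟩
  · have hlr := hD.lt hN
    obtain ⟨g, hg, h1, h2⟩ := exists_margin hlr hΛ hseg isCompact_empty (Set.empty_subset _)
    let P : Setting := ⟨θ, N, l, r, C, g, Λ, c, ∅, hθ, hN, hC, hlr, hg, hΛ, hc, h1,
      isCompact_empty, Set.empty_subset _, h2⟩
    let D : Conf P := ⟨n, x, b, φp, φm, hD⟩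
    refine ⟨fun e => ?_, D.sum_pr, D.exists_branch, fun z _ => D.expect_deltaM z⟩
    obtain ⟨p, hp, he⟩ := D.exists_pr e
    change 0 ≤ (D.pr e).re ∧ (D.pr e).im = 0
    rw [← he]
    exact ⟨by simpa using hp, by simp⟩
  rcases le_or_gt r l with hlr | hlr
  · exact ⟨⟨0, 1, one_pos, fun n x b φp φm _ hD => absurd (hD.lt hN) hlr.not_gt⟩,
      fun δ _ => ⟨1, one_pos, fun n x b φp φm _ hD => absurd (hD.lt hN) hlr.not_gt⟩,
      fun p δ _ => ⟨1, one_pos, fun n x b φp φm _ hD => absurd (hD.lt hN) hlr.not_gt⟩⟩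
  obtain ⟨g, hg, h1, h2⟩ := exists_margin hlr hΛ hseg hF hFΛ
  let P : Setting := ⟨θ, N, l, r, C, g, Λ, c, F, hθ, hN, hC, hlr, hg, hΛ, hc, h1,
    hF, hFΛ.trans Set.sdiff_subset, h2⟩
  have ha : 0 < g / (8 * (1 + θ)) := by positivity
  have hsmall : ∀ ε : ℝ, ε < g / (8 * (1 + θ)) → (1 + θ) * ε ≤ g / 8 := fun ε hε => by
    rw [lt_div_iff₀ (by positivity)] at hε
    linarith
  have hmom : ∀ (p : ℕ) (δ : ℝ), 0 < δ → ∃ ε₀ : ℝ, 0 < ε₀ ∧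
      ∀ (n : ℕ) (x : Fin n → ℝ) (b φp φm : ℂ → ℂ),
      N / n < ε₀ → Admissible θ N l r C Λ c n x b φp φm →
      ∀ z : Fin p → ℂ, (∀ k, z k ∈ F) →
      ∀ ω : ℝ → ℂ, Encloses Λ l r (Set.range z) ω →
        ‖expect θ (N / n) b φp φm x (fun e =>
            ∏ k, deltaM θ (N / n) b φp φm x e (z k) / (√(N / n) : ℝ)) -
          gaussianMoment (fun i j =>
            cov θ (N / n) l r b φp φm x ω (z i) (z j))‖ ≤ δ := by
    intro p δ hδ
    obtain ⟨K, hK, h⟩ := exists_normalized_moments P p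
    obtain ⟨ε₀, h0, hε₀⟩ := exists_threshold hK hδ ha
    refine ⟨ε₀, h0, fun n x b φp φm hn hD z hz ω hω => ?_⟩
    let D₀ : Conf P := ⟨n, x, b, φp, φm, hD⟩
    obtain ⟨L, hL⟩ := D₀.exists_branch
    let D : Step P := ⟨D₀, L, hL, hsmall _ (hε₀ _ hn).1⟩
    have hcov : (fun i j => cov θ (N / n) l r b φp φm x ω (z i) (z j)) =
        fun i j => D.covc (z i) (z j) := by
      funext i j
      exact D.cov_eq (Set.finite_range z).isClosed (Set.range_subset_iff.2 hz)
        (Set.mem_range_self i) (Set.mem_range_self j) hω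
    rw [hcov]
    exact (h D z hz).trans (hε₀ _ hn).2
  refine ⟨?_, fun δ hδ => ?_, hmom⟩
  · obtain ⟨K, hK, h⟩ := exists_increment_mean P
    refine ⟨K, _, ha, fun n x b φp φm hn hD L hL z hz ω hω ω' hω' e => ?_⟩
    let D : Step P := ⟨⟨n, x, b, φp, φm, hD⟩, L, hL, hsmall _ hn⟩
    have e1 : leading θ b L ω z + correction θ (N / n) l r b φp φm x L ω ω' z = D.meanX z :=
      D.leading_add_correction hz hω hω'
    have e2 : deltaM θ (N / n) b φp φm x e z = D.cen (D.fX z) e := D.deltaM_eq hz e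
    have e3 : increment θ (N / n) b x e z = D.val (D.fX z) e := D.increment_eq hz e
    rw [e1, e2, e3, Step.cen, sub_add_eq_sub_sub_swap, sub_sub_cancel]
    exact h D z hz
  · obtain ⟨ε₀, h0, h⟩ := hmom 2 δ hδ
    refine ⟨ε₀, h0, fun n x b φp φm hn hD z₁ hz₁ z₂ hz₂ ω hω => ?_⟩
    have := h n x b φp φm hn hD ![z₁, z₂] (by simp [Fin.forall_fin_two, hz₁, hz₂]) ω
      (by simpa [Matrix.range_cons, Matrix.range_empty, Set.pair_comm] using hω)
    rw [gaussianMoment_two] at this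
    simp only [Fin.prod_univ_two] at this
    exact this
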